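/- Let $N\ge 0$ be an integer and let $q,c_0,c_1,c_2,c_3,c_4$ be nonzero complex numbers with $q^{2N+3}c_0c_1c_2c_3c_4=1$. Half-integer powers are understood as follows: fix square roots $r$ of $q$ and $s_i$ of $c_i$ with $r^{2N+3}s_0s_1s_2s_3s_4=1$, and for every monomial $m$ in $q^{\pm1},c_0^{\pm1},\dots,c_4^{\pm1}$ and every integer $n$ let $m^{n/2}$ be the $n$-th power of the corresponding monomial in $r,s_0,\dots,s_4$. Put $(a;q)_n=\prod_{\ell=0}^{n-1}(1-aq^\ell)$, $\left[{N\atop n}\right]_q=\frac{(q;q)_N}{(q;q)_n(q;q)_{N-n}}$ for $0\le n\le N$, $$\omega_n(c)=(-1)^n c^{n/2}q^{\binom{n+1}{2}},\qquad \xi_n(c,c')=\frac{(qc;q)_n}{(qc';q)_n}\Big(\frac{c'}{c}\Big)^{n/2}.$$ For integers $K\ge0$ and $0\le n,x\le K$ let (for parameters $b_1,b_2,b_3$) $$\Omega(n;b_1,b_2,b_3;K)=\left[{K\atop n}\right]_q\frac{(1-b_2b_3q^{2n+1})(qb_2;q)_n(b_1b_2b_3q^{K+2};q)_n(qb_1;q)_{K-n}}{(qb_2)^{n-K/2}(b_2b_3q^{n+1};q)_{K+1}(qb_3;q)_n},$$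 where the common factor $1-b_2b_3q^{2n+1}$ of numerator and denominator is cancelled, and $$\mathsf p_n(x;b_1,b_2,b_3;K)=\Omega(n;b_1,b_2,b_3;K)\sum_{k=0}^{n}\frac{(q^{-n};q)_k(b_2b_3q^{n+1};q)_k(q^{-x};q)_k(b_1b_2q^{x+1};q)_k}{(qb_2;q)_k(b_1b_2b_3q^{K+2};q)_k(q^{-K};q)_k(q;q)_k}\,q^k ;$$ put $\mathsf p_n(x;b_1,b_2,b_3;K)=0$ if $n>K$ or $x>K$. The Griffiths polynomials of $q$-Racah type are $$\mathcal G_{i,j}(x,y;c_1,c_2,c_3,c_4;N)=\sum_{a=0}^{\min(N-j,N-y)}\omega_a\Big(\frac{c_1c_2c_3}{c_4}\Big)\,\mathsf p_i(a;c_1,c_2,c_3;N-j)\,\mathsf p_j(y;c_3,c_0,c_4;N-a)\,\mathsf p_a(x;c_4,c_2,c_1;N-y),$$ where $c_0$ (with its square root) is determined by $c_1,\dots,c_4$ through the constraint above; in particular, for $\mathcal G_{y,x}(k,\ell;c_1,c_3,c_0,c_2;N)$ the role of $c_0$ is played by $c_4$. Assume that $q,q^2,\dots,q^N\ne1$, that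 $$c_0,c_1,c_2,c_3,c_4\notin\{q^{-1},\dots,q^{-N}\},$$ $$c_1c_2,\ c_2c_3,\ c_0c_3,\ c_0c_4,\ c_2c_4,\ qc_1c_2c_3,\ qc_0c_3c_4,\ qc_1c_2c_4\notin\{q^{-2},q^{-3},\dots,q^{-2N}\},$$ and that the same conditions hold with $(c_0,c_1,c_2,c_3,c_4)$ replaced by $(c_4,c_1,c_3,c_0,c_2)$. Then for all nonnegative integers $i,j,k,\ell$ with $i+j\le N$ and $k+\ell\le N$, $$\sum_{\substack{x,y\ge0\\x+y\le N}}\Big(\frac{c_1}{c_0}\Big)^{\frac x2}\Big(\frac{c_4}{c_1}\Big)^{\frac y2}\xi_x(c_2,c_4)\,\xi_y(c_0,c_3)\,\mathcal G_{i,j}(x,y;c_1,c_2,c_3,c_4;N)\,\mathcal G_{y,x}(k,\ell;c_1,c_3,c_0,c_2;N)$$ $$=\delta_{i,k}\,\delta_{j,\ell}\;\omega_N(qc_1c_2c_3)\,\frac{\omega_j\big(\frac{c_3c_0c_4}{c_2}\big)}{\omega_i(c_2c_3)}\,\xi_i(c_2,c_3)\,\xi_j(c_0,c_4).$$ -/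

import Mathlib

/-!
Univariate `q`-Racah functions and bivariate Griffiths functions of `q`-Racah type.

The formulas contain the half-integer powers of `q` and of the parameters. They are read with one
square root fixed for each quantity: `r` with `r ^ 2 = q` and `sᵢ` with `sᵢ ^ 2 = cᵢ`. Functions
in which half-integer powers occur take these square roots as arguments.
-/

namespace GriffithsQRacah

open Finset

noncomputable section

/-- The `q`-Pochhammer symbol `(a; q)_n`. -/
def qPoch (a q : ℂ) (n : ℕ) : ℂ := ∏ l ∈ range n, (1 - a * q ^ l)

/-- The `q`-binomial coefficient, zero for `n > N`. -/
def qBinom (q : ℂ) (N n : ℕ) : ℂ :=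
  if n ≤ N then qPoch q q N / (qPoch q q n * qPoch q q (N - n)) else 0

/-- The terminating series `₄φ₃(q ^ (-n), a₂, a₃, a₄; b₁, b₂, b₃ | q; q)`, whose terms vanish
for `k > n`. -/
def phi43 (q : ℂ) (n : ℕ) (a₂ a₃ a₄ b₁ b₂ b₃ : ℂ) : ℂ :=
  ∑ k ∈ range (n + 1),
    (qPoch (q ^ (-(n : ℤ))) q k * qPoch a₂ q k * qPoch a₃ q k * qPoch a₄ q k) /
      (qPoch b₁ q k * qPoch b₂ q k * qPoch b₃ q k) * (q ^ k / qPoch q q k)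

/-- The quotient `(c q ^ (n + 1); q)_(N + 1) / (1 - c q ^ (2 n + 1))` for `n ≤ N`, with the factor
in the denominator (the one with `l = n`) cancelled, so that the apparent pole is removed. -/
def reducedPoch (c q : ℂ) (n N : ℕ) : ℂ :=
  ∏ l ∈ (range (N + 1)).erase n, (1 - c * q ^ (n + 1) * q ^ l)

/-- The normalization `Ω(n; c₁, c₂, c₃; N)` with `q = r ^ 2`, `cᵢ = sᵢ ^ 2`; the power
`(q c₂) ^ (n - N / 2)` is `(r s₂) ^ (2 n - N)`. -/
def Omega (r : ℂ) (n : ℕ) (s₁ s₂ s₃ : ℂ) (N : ℕ) : ℂ :=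
  let q := r ^ 2
  let c₁ := s₁ ^ 2
  let c₂ := s₂ ^ 2
  let c₃ := s₃ ^ 2
  qBinom q N n *
    (qPoch (q * c₂) q n * qPoch (c₁ * c₂ * c₃ * q ^ (N + 2)) q n * qPoch (q * c₁) q (N - n)) /
    ((r * s₂) ^ (2 * (n : ℤ) - N) * reducedPoch (c₂ * c₃) q n N * qPoch (q * c₃) q n)

/-- The normalized `q`-Racah function `𝗉_n(x; c₁, c₂, c₃; N)`, zero for `n > N` or `x > N`. -/
def racah (r : ℂ) (n x : ℕ) (s₁ s₂ s₃ : ℂ) (N : ℕ) : ℂ :=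
  let q := r ^ 2
  let c₁ := s₁ ^ 2
  let c₂ := s₂ ^ 2
  let c₃ := s₃ ^ 2
  if n ≤ N ∧ x ≤ N then
    Omega r n s₁ s₂ s₃ N *
      phi43 q n (c₂ * c₃ * q ^ (n + 1)) (q ^ (-(x : ℤ))) (c₁ * c₂ * q ^ (x + 1))
        (q * c₂) (c₁ * c₂ * c₃ * q ^ (N + 2)) (q ^ (-(N : ℤ)))
  else 0

/-- `ω_n(c) = (-1) ^ n c ^ (n / 2) q ^ (n (n + 1) / 2)` with `q = r ^ 2`, `c = s ^ 2`. -/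
def omega (r : ℂ) (n : ℕ) (s : ℂ) : ℂ := (-1) ^ n * s ^ n * (r ^ 2) ^ ((n + 1).choose 2)

/-- `ξ_n(c, c') = (q c; q)_n / (q c'; q)_n (c' / c) ^ (n / 2)` with `q = r ^ 2`, `c = s ^ 2`,
`c' = t ^ 2`. -/
def xi (r : ℂ) (n : ℕ) (s t : ℂ) : ℂ :=
  qPoch (r ^ 2 * s ^ 2) (r ^ 2) n / qPoch (r ^ 2 * t ^ 2) (r ^ 2) n * (t / s) ^ n

/-- The square root of the fifth parameter, fixed by `r ^ (2 N + 3) s₀ s₁ s₂ s₃ s₄ = 1`; its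
square `c₀` satisfies `q ^ (2 N + 3) c₀ c₁ c₂ c₃ c₄ = 1`. -/
def fifthRoot (r s₁ s₂ s₃ s₄ : ℂ) (N : ℕ) : ℂ := (r ^ (2 * N + 3) * s₁ * s₂ * s₃ * s₄)⁻¹

/-- The Griffiths function of `q`-Racah type `𝒢_{i,j}(x, y; c₁, c₂, c₃, c₄; N)` with `q = r ^ 2`
and `cᵢ = sᵢ ^ 2`. -/
def griffiths (r : ℂ) (i j x y : ℕ) (s₁ s₂ s₃ s₄ : ℂ) (N : ℕ) : ℂ :=
  ∑ a ∈ range (min (N - j) (N - y) + 1),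
    omega r a (s₁ * s₂ * s₃ / s₄) *
      racah r i a s₁ s₂ s₃ (N - j) *
      racah r j y s₃ (fifthRoot r s₁ s₂ s₃ s₄ N) s₄ (N - a) *
      racah r a x s₄ s₂ s₁ (N - y)

/-- The conditions on `q` and the parameters under which all the univariate functions in the
definition of `𝒢_{i,j}(x, y; c₁, c₂, c₃, c₄; N)` are admissible `q`-Racah functions. -/
structure Admissible (q c₀ c₁ c₂ c₃ c₄ : ℂ) (N : ℕ) : Prop where
  q_ne_zero : q ≠ 0
  c_ne_zero : ∀ c ∈ ({c₀, c₁, c₂, c₃, c₄} : Set ℂ), c ≠ 0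
  q_pow_ne_one : ∀ m ∈ Icc 1 N, q ^ m ≠ 1
  prod_ne : ∀ c ∈ ({c₁ * c₂, c₂ * c₃, c₀ * c₃, c₀ * c₄, c₂ * c₄,
      q * c₁ * c₂ * c₃, q * c₀ * c₃ * c₄, q * c₁ * c₂ * c₄} : Set ℂ),
    ∀ m ∈ Icc 2 (2 * N), c ≠ q ^ (-(m : ℤ))
  c_ne : ∀ c ∈ ({c₀, c₁, c₂, c₃, c₄} : Set ℂ), ∀ m ∈ Icc 1 N, c ≠ q ^ (-(m : ℤ))

/-- Away from the apparent pole, `reducedPoch` is the quotient it replaces, so that `Omega` is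
given by the usual formula. -/
theorem inv_reducedPoch (c q : ℂ) (n N : ℕ) (hn : n ≤ N) (h : 1 - c * q ^ (2 * n + 1) ≠ 0) :
    (reducedPoch c q n N)⁻¹ =
      (1 - c * q ^ (2 * n + 1)) / qPoch (c * q ^ (n + 1)) q (N + 1) := by
  have h1 : qPoch (c * q ^ (n + 1)) q (N + 1) =
      (1 - c * q ^ (2 * n + 1)) * reducedPoch c q n N := by
    unfold qPoch reducedPoch
    rw [← mul_prod_erase _ _ (mem_range.2 (Nat.lt_succ_of_le hn))]
    congr 2
    ring
  rw [h1, div_mul_eq_div_div, div_self h, one_div]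

end

end GriffithsQRacah

namespace GriffithsQRacah

open Finset

noncomputable section

/-! Write both Griffiths functions as sums over auxiliary indices a and b. The left side becomes a
sum over x, y, a, b of six univariate q-Racah functions. Exactly three of them, with index pairs
(a,x), (y,b), (x,l), contain x. The pentagon relation `racah_pentagon` sums their product over x and
leaves two functions, with index pairs (y,l) and (a,b). After that y occurs only in p_j(y; c₃,c₀,c₄;
N-a) and p_y(l; c₄,c₀,c₃; N-a), and orthogonality (`sum_racah_mul_racah`) gives δ_{jl}. The sum over
a is then a product of two functions of the same size whose parameters are permuted. The Racah
relation `sum_omega_mul_racah_mul_racah` collapses it to the single function p_i(b; c₁,c₃,c₂; N-j),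
and orthogonality in b gives δ_{ik}. The remaining powers combine through `omega_add_mul_omega`.

These three univariate facts are proved here for the unnormalized polynomials `racahPhi`, each by
induction on the size. The tools are shift relations of balanced terminating series. Two of the
relations hold term by term (`serTerm_contiguous`, `serTerm_forward`). The other two hold only after
summation and come from telescoping (`sum_serTerm_backward`, `sum_serTerm_mixed`).

Orthogonality (`racahInner_eq`): summation by parts moves the backward shift off one polynomial, the
forward shift absorbs the resulting difference, and both degrees and the size drop by one. The total
mass follows from the orthogonality of degrees 1 and 0.

Racah relation (`racahKernel_eq`): the backward shift on one factor and the mixed relation on the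
other lower the size. The closed form obeys the same recursion.

Pentagon relation (`pentagon`): the five parameters are placed on a cycle d₁,…,d₅ = c₁,c₂,c₄,c₀,c₃,
and raising two adjacent ones by q compensates for lowering N in the constraint. For b > 0 each side
splits into four instances of smaller size whose coefficients agree one by one. A reflection handles
b = 0 < y. For y = b = 0 both sides satisfy one first-order recursion in a, and by reflection one in
l. The corner a = l = y = b = 0 is the total mass of a q-Racah weight.

The inductions divide by many factors, so they assume generic parameters: q is not a root of unity
and the relevant monomials are not integral powers of q. For admissible parameters, all quantities
are moved along a curve in w that preserves the constraint and passes through the given point at w =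
1. Genericity fails for at most countably many w, both sides are continuous at w = 1, and so the
identity extends. -/

theorem qPoch_zero (a q : ℂ) : qPoch a q 0 = 1 := by simp [qPoch]

theorem qPoch_succ (a q : ℂ) (n : ℕ) : qPoch a q (n + 1) = qPoch a q n * (1 - a * q ^ n) := by
  simp [qPoch, prod_range_succ]

theorem qPoch_succ' (a q : ℂ) (n : ℕ) : qPoch a q (n + 1) = (1 - a) * qPoch (q * a) q n := by
  simp only [qPoch, prod_range_succ', pow_zero, mul_one]
  rw [mul_comm]
  congr 1
  exact prod_congr rfl fun l _ => by ring

theorem one_sub_mul_qPoch (a q : ℂ) (n : ℕ) :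
    (1 - a) * qPoch (q * a) q n = qPoch a q n * (1 - a * q ^ n) := by
  rw [← qPoch_succ', qPoch_succ]

theorem qPoch_succ_mul_one (a q : ℂ) (n : ℕ) :
    qPoch a q (n + 1) * 1 = qPoch a q n * (1 - a * q ^ n) := by rw [mul_one, qPoch_succ]

theorem qPoch_succ_left_mul_one (a q : ℂ) (n : ℕ) :
    qPoch a q (n + 1) * 1 = qPoch (q * a) q n * (1 - a) := by rw [mul_one, qPoch_succ', mul_comm]

theorem qPoch_mul_one_sub (a q : ℂ) (n : ℕ) :
    qPoch a q n * (1 - a * q ^ n) = qPoch (q * a) q n * (1 - a) := by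
  rw [← one_sub_mul_qPoch, mul_comm]

theorem qPoch_ne_zero {a q : ℂ} {n : ℕ} (h : ∀ l < n, 1 - a * q ^ l ≠ 0) : qPoch a q n ≠ 0 :=
  prod_ne_zero_iff.2 fun l hl => h l (mem_range.1 hl)

theorem qPoch_mul_left {a q : ℂ} (h : 1 - a ≠ 0) (n : ℕ) :
    qPoch (q * a) q n = qPoch a q n * (1 - a * q ^ n) / (1 - a) := by
  rw [eq_div_iff h, mul_comm, one_sub_mul_qPoch]

theorem qPoch_inv_pow_eq_zero {q : ℂ} (hq : q ≠ 0) {n k : ℕ} (h : n < k) :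
    qPoch (q ^ n)⁻¹ q k = 0 :=
  prod_eq_zero (mem_range.2 h) (by rw [inv_mul_cancel₀ (pow_ne_zero _ hq), sub_self])

/-! ### Relations between shifted balanced hypergeometric series -/

/-- The general term of the balanced series `₄φ₃(A, B, C, D; E, G, H | q; q)`. -/
def serTerm (q A B C D E G H : ℂ) (k : ℕ) : ℂ :=
  (qPoch A q k * qPoch B q k * qPoch C q k * qPoch D q k) /
      (qPoch E q k * qPoch G q k * qPoch H q k) * (q ^ k / qPoch q q k)

theorem serTerm_zero (q A B C D E G H : ℂ) : serTerm q A B C D E G H 0 = 1 := by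
  simp [serTerm, qPoch_zero]

/-- Raising A or B, together with H, multiplies the k-th term by an explicit ratio. Once these are
divided out, what remains is (A-B)(1-Hq^k) = (A-H)(1-Bq^k) + (H-B)(1-Aq^k). The relation is termwise
and needs no balance condition. -/
theorem serTerm_contiguous {q A B C D E G H : ℂ} {k : ℕ} (hAB : A - B ≠ 0) (hH : 1 - H ≠ 0)
    (hk : 1 - H * q ^ k ≠ 0) :
    serTerm q A B C D E G H k =
      (1 - B) * (A - H) / ((A - B) * (1 - H)) * serTerm q A (q * B) C D E G (q * H) k +
      (1 - A) * (H - B) / ((A - B) * (1 - H)) * serTerm q (q * A) B C D E G (q * H) k := by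
  have eA := one_sub_mul_qPoch A q k
  have eB := one_sub_mul_qPoch B q k
  have eH : (qPoch (q * H) q k)⁻¹ = (1 - H) / (1 - H * q ^ k) * (qPoch H q k)⁻¹ := by
    rw [qPoch_mul_left hH, inv_div, div_eq_mul_inv, div_eq_mul_inv, mul_inv]
    ring
  have key : (A - B) * (1 - H * q ^ k) =
      (A - H) * (1 - B * q ^ k) + (H - B) * (1 - A * q ^ k) := by ring
  have e1 : (1 - B) * (A - H) / ((A - B) * (1 - H)) * serTerm q A (q * B) C D E G (q * H) k =
      serTerm q A B C D E G H k * ((A - H) * (1 - B * q ^ k) / ((A - B) * (1 - H * q ^ k))) := by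
    simp only [serTerm, div_eq_mul_inv, mul_inv, eH]
    linear_combination (A - H) * (A - B)⁻¹ * (1 - H)⁻¹ * (1 - H) * (1 - H * q ^ k)⁻¹ *
      (qPoch H q k)⁻¹ * qPoch A q k * qPoch C q k * qPoch D q k * (qPoch E q k)⁻¹ *
      (qPoch G q k)⁻¹ * q ^ k * (qPoch q q k)⁻¹ * eB +
      (A - H) * (A - B)⁻¹ * (1 - H * q ^ k)⁻¹ * qPoch B q k * (1 - B * q ^ k) *
      (qPoch H q k)⁻¹ * qPoch A q k * qPoch C q k * qPoch D q k * (qPoch E q k)⁻¹ *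
      (qPoch G q k)⁻¹ * q ^ k * (qPoch q q k)⁻¹ * (inv_mul_cancel₀ hH)
  have e2 : (1 - A) * (H - B) / ((A - B) * (1 - H)) * serTerm q (q * A) B C D E G (q * H) k =
      serTerm q A B C D E G H k * ((H - B) * (1 - A * q ^ k) / ((A - B) * (1 - H * q ^ k))) := by
    simp only [serTerm, div_eq_mul_inv, mul_inv, eH]
    linear_combination (H - B) * (A - B)⁻¹ * (1 - H)⁻¹ * (1 - H) * (1 - H * q ^ k)⁻¹ *
      (qPoch H q k)⁻¹ * qPoch B q k * qPoch C q k * qPoch D q k * (qPoch E q k)⁻¹ *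
      (qPoch G q k)⁻¹ * q ^ k * (qPoch q q k)⁻¹ * eA +
      (H - B) * (A - B)⁻¹ * (1 - H * q ^ k)⁻¹ * qPoch A q k * (1 - A * q ^ k) *
      (qPoch H q k)⁻¹ * qPoch B q k * qPoch C q k * qPoch D q k * (qPoch E q k)⁻¹ *
      (qPoch G q k)⁻¹ * q ^ k * (qPoch q q k)⁻¹ * (inv_mul_cancel₀ hH)
  rw [e1, e2, ← mul_add, ← add_div, ← key, div_self (mul_ne_zero hAB hk), mul_one]

/-- The two terms differ only through (1-A)(1-Bq^(j+1)) - (1-Aq^(j+1))(1-B) = (B-A)(1-q^(j+1)). The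
last factor cancels the top factor of (q;q)_(j+1), which leaves the j-th term of the series with
every parameter raised. -/
theorem serTerm_forward {q A B C D E G H : ℂ} {j : ℕ} (hq : 1 - q ^ (j + 1) ≠ 0) :
    serTerm q A (q * B) C D E G H (j + 1) - serTerm q (q * A) B C D E G H (j + 1) =
      q * (B - A) * (1 - C) * (1 - D) / ((1 - E) * (1 - G) * (1 - H)) *
        serTerm q (q * A) (q * B) (q * C) (q * D) (q * E) (q * G) (q * H) j := by
  have h1 : qPoch q q (j + 1) = qPoch q q j * (1 - q ^ (j + 1)) := by
    rw [qPoch_succ, pow_succ']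
  simp only [serTerm]
  rw [qPoch_succ' A, qPoch_succ (q * B), qPoch_succ (q * A), qPoch_succ' B, qPoch_succ' C,
    qPoch_succ' D, qPoch_succ' E, qPoch_succ' G, qPoch_succ' H, h1]
  simp only [div_eq_mul_inv, mul_inv]
  linear_combination q ^ (j + 1) * (B - A) * (1 - C) * (1 - D) * ((1 - E)⁻¹ * (1 - G)⁻¹ *
    (1 - H)⁻¹) * (qPoch (q * A) q j * qPoch (q * B) q j * qPoch (q * C) q j * qPoch (q * D) q j) *
    ((qPoch (q * E) q j)⁻¹ * (qPoch (q * G) q j)⁻¹ * (qPoch (q * H) q j)⁻¹ * (qPoch q q j)⁻¹) *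
    (mul_inv_cancel₀ hq)

theorem serTerm_succ (q A B C D E G H : ℂ) (j : ℕ) :
    serTerm q A B C D E G H (j + 1) = serTerm q A B C D E G H j *
      (q * (1 - A * q ^ j) * (1 - B * q ^ j) * (1 - C * q ^ j) * (1 - D * q ^ j) *
        ((1 - E * q ^ j)⁻¹ * (1 - G * q ^ j)⁻¹ * (1 - H * q ^ j)⁻¹ * (1 - q * q ^ j)⁻¹)) := by
  simp only [serTerm, qPoch_succ, div_eq_mul_inv, mul_inv]
  ring

theorem qPoch_mul_left_inv {a q : ℂ} (h : 1 - a ≠ 0) (n : ℕ) :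
    (qPoch (q * a) q n)⁻¹ = (qPoch a q n)⁻¹ * ((1 - a) * (1 - a * q ^ n)⁻¹) := by
  rw [qPoch_mul_left h, inv_div, div_eq_mul_inv, mul_inv]
  ring

theorem serTerm_shift {q A B C D E G H : ℂ} (hA : 1 - A ≠ 0) (hB : 1 - B ≠ 0)
    (hE : 1 - E ≠ 0) (hG : 1 - G ≠ 0) (hH : 1 - H ≠ 0) (j : ℕ) :
    (1 - D) * serTerm q (q * A) (q * B) C (q * D) (q * E) (q * G) (q * H) j =
      serTerm q A B C D E G H j *
        ((1 - A * q ^ j) * (1 - B * q ^ j) * (1 - D * q ^ j) *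
          ((1 - E * q ^ j)⁻¹ * (1 - G * q ^ j)⁻¹ * (1 - H * q ^ j)⁻¹)) *
        ((1 - E) * (1 - G) * (1 - H) * ((1 - A)⁻¹ * (1 - B)⁻¹)) := by
  have eD := one_sub_mul_qPoch D q j
  simp only [serTerm, div_eq_mul_inv, mul_inv]
  rw [qPoch_mul_left hA, qPoch_mul_left hB, qPoch_mul_left_inv hE, qPoch_mul_left_inv hG,
    qPoch_mul_left_inv hH]
  simp only [div_eq_mul_inv]
  linear_combination qPoch A q j * (1 - A * q ^ j) * (1 - A)⁻¹ *
    (qPoch B q j * (1 - B * q ^ j) * (1 - B)⁻¹) * qPoch C q j *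
    ((qPoch E q j)⁻¹ * ((1 - E) * (1 - E * q ^ j)⁻¹) * ((qPoch G q j)⁻¹ *
    ((1 - G) * (1 - G * q ^ j)⁻¹)) * ((qPoch H q j)⁻¹ * ((1 - H) * (1 - H * q ^ j)⁻¹))) *
    (q ^ j * (qPoch q q j)⁻¹) * eD

theorem serTerm_swap (q A B C D E G H : ℂ) (j : ℕ) :
    serTerm q A B C D E G H j = serTerm q A B D C E G H j := by
  simp only [serTerm]
  ring

theorem serTerm_swap₂ (q A B C D E G H : ℂ) (j : ℕ) :
    serTerm q A B C D E G H j = serTerm q C D A B E G H j := by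
  simp only [serTerm]
  ring

/-- The increment identity for `sum_serTerm_backward`, with z = q^m. Balance replaces EGH by qABCD.
Then (t-E)(t-G)(t-H) at t = C, D and (1-Ez)(1-Gz)(1-Hz) involve E, G, H only through two symmetric
functions, which can be treated as free variables. -/
theorem backward_aux {q A B C D E G H z : ℂ} (hz : z ≠ 0) (hqz : 1 - q * z ≠ 0) (hq : q ≠ 0)
    (hA : 1 - A ≠ 0) (hB : 1 - B ≠ 0) (hC : C ≠ 0) (hD : D ≠ 0) (hCD : C - D ≠ 0)
    (hb : E * G * H = q * A * B * C * D) :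
    q * (1 - C * z) * (1 - D * z) / (1 - q * z) -
        (C - E) * (C - G) * (C - H) / (C * (C - D)) * (1 - D * z) * ((1 - A)⁻¹ * (1 - B)⁻¹) -
        (D - E) * (D - G) * (D - H) / (D * (D - C)) * (1 - C * z) * ((1 - A)⁻¹ * (1 - B)⁻¹) =
      q * (1 - C * z) * (1 - D * z) / (1 - q * z) * ((1 - A * (q * z)) * (1 - B * (q * z)) /
          (q * z * ((1 - A) * (1 - B)))) -
        (1 - E * z) * (1 - G * z) * (1 - H * z) / (z * ((1 - A) * (1 - B))) := by
  have h1 : ∀ t : ℂ, (t - E) * (t - G) * (t - H) =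
      t ^ 3 - (E + G + H) * t ^ 2 + (E * G + E * H + G * H) * t - q * A * B * C * D := by
    intro t
    linear_combination -hb
  have h2 : (1 - E * z) * (1 - G * z) * (1 - H * z) =
      1 - (E + G + H) * z + (E * G + E * H + G * H) * z ^ 2 - q * A * B * C * D * z ^ 3 := by
    linear_combination -z ^ 3 * hb
  have hDC : D - C = -(C - D) := by ring
  rw [h1, h1, h2, hDC]
  generalize E + G + H = e₁
  generalize E * G + E * H + G * H = e₂
  field_simp
  ring

/-- This relation fails term by term. The partial sums satisfy it up to a closed boundary term, and
the proof is telescoping in m. The shifted sums stop one term earlier. The boundary term contains 1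
- Aq^m, so it disappears when A = q^(-m). -/
theorem sum_serTerm_backward {q A B C D E G H : ℂ} (hq : q ≠ 0)
    (hA : 1 - A ≠ 0) (hB : 1 - B ≠ 0) (hC : C ≠ 0) (hD : D ≠ 0) (hCD : C - D ≠ 0)
    (hE : 1 - E ≠ 0) (hG : 1 - G ≠ 0) (hH : 1 - H ≠ 0)
    (hb : E * G * H = q * A * B * C * D) (m : ℕ)
    (hEm : ∀ j < m, 1 - E * q ^ j ≠ 0) (hGm : ∀ j < m, 1 - G * q ^ j ≠ 0)
    (hHm : ∀ j < m, 1 - H * q ^ j ≠ 0) (hqm : ∀ j < m, 1 - q * q ^ j ≠ 0) :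
    ∑ j ∈ range (m + 1), serTerm q A B C D E G H j -
        (C - E) * (C - G) * (C - H) * (1 - D) / (C * (C - D) * (1 - E) * (1 - G) * (1 - H)) *
          ∑ j ∈ range m, serTerm q (q * A) (q * B) C (q * D) (q * E) (q * G) (q * H) j -
        (D - E) * (D - G) * (D - H) * (1 - C) / (D * (D - C) * (1 - E) * (1 - G) * (1 - H)) *
          ∑ j ∈ range m, serTerm q (q * A) (q * B) (q * C) D (q * E) (q * G) (q * H) j =
      serTerm q A B C D E G H m * ((1 - A * q ^ m) * (1 - B * q ^ m) /
        (q ^ m * ((1 - A) * (1 - B)))) := by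
  induction m with
  | zero => simp [serTerm_zero, hA, hB]
  | succ m ih =>
    have ih := ih (fun j hj => hEm j (by omega)) (fun j hj => hGm j (by omega))
      (fun j hj => hHm j (by omega)) (fun j hj => hqm j (by omega))
    have e1 := serTerm_shift (D := D) (C := C) hA hB hE hG hH m (q := q)
    have e2 := serTerm_shift (D := C) (C := D) hA hB hE hG hH m (q := q)
    rw [serTerm_swap, serTerm_swap q A B] at e2
    have aux := backward_aux (pow_ne_zero m hq) (hqm m (by omega)) hq hA hB hC hD hCD hb
    have hE' := hEm m (by omega)
    have hG' := hGm m (by omega)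
    have hH' := hHm m (by omega)
    rw [sum_range_succ, sum_range_succ (serTerm q (q * A) (q * B) C (q * D) _ _ _) m,
      sum_range_succ (serTerm q (q * A) (q * B) (q * C) D _ _ _) m]
    have e1' : (C - E) * (C - G) * (C - H) * (1 - D) /
        (C * (C - D) * (1 - E) * (1 - G) * (1 - H)) *
          serTerm q (q * A) (q * B) C (q * D) (q * E) (q * G) (q * H) m =
        serTerm q A B C D E G H m * ((1 - A * q ^ m) * (1 - B * q ^ m) *
          ((1 - E * q ^ m)⁻¹ * (1 - G * q ^ m)⁻¹ * (1 - H * q ^ m)⁻¹)) *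
          ((C - E) * (C - G) * (C - H) / (C * (C - D)) * (1 - D * q ^ m) *
            ((1 - A)⁻¹ * (1 - B)⁻¹)) := by
      have : (C - E) * (C - G) * (C - H) * (1 - D) /
        (C * (C - D) * (1 - E) * (1 - G) * (1 - H)) *
          serTerm q (q * A) (q * B) C (q * D) (q * E) (q * G) (q * H) m =
        (C - E) * (C - G) * (C - H) / (C * (C - D) * (1 - E) * (1 - G) * (1 - H)) *
          ((1 - D) * serTerm q (q * A) (q * B) C (q * D) (q * E) (q * G) (q * H) m) := by ring
      rw [this, e1]
      field_simp
    have hDC : D - C ≠ 0 := by rw [← neg_sub]; exact neg_ne_zero.2 hCD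
    have e2' : (D - E) * (D - G) * (D - H) * (1 - C) /
        (D * (D - C) * (1 - E) * (1 - G) * (1 - H)) *
          serTerm q (q * A) (q * B) (q * C) D (q * E) (q * G) (q * H) m =
        serTerm q A B C D E G H m * ((1 - A * q ^ m) * (1 - B * q ^ m) *
          ((1 - E * q ^ m)⁻¹ * (1 - G * q ^ m)⁻¹ * (1 - H * q ^ m)⁻¹)) *
          ((D - E) * (D - G) * (D - H) / (D * (D - C)) * (1 - C * q ^ m) *
            ((1 - A)⁻¹ * (1 - B)⁻¹)) := by
      have : (D - E) * (D - G) * (D - H) * (1 - C) /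
        (D * (D - C) * (1 - E) * (1 - G) * (1 - H)) *
          serTerm q (q * A) (q * B) (q * C) D (q * E) (q * G) (q * H) m =
        (D - E) * (D - G) * (D - H) / (D * (D - C) * (1 - E) * (1 - G) * (1 - H)) *
          ((1 - C) * serTerm q (q * A) (q * B) (q * C) D (q * E) (q * G) (q * H) m) := by ring
      rw [this, e2]
      field_simp
    have e3 : serTerm q A B C D E G H (m + 1) = serTerm q A B C D E G H m *
        ((1 - A * q ^ m) * (1 - B * q ^ m) *
          ((1 - E * q ^ m)⁻¹ * (1 - G * q ^ m)⁻¹ * (1 - H * q ^ m)⁻¹)) *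
        (q * (1 - C * q ^ m) * (1 - D * q ^ m) / (1 - q * q ^ m)) := by
      rw [serTerm_succ, div_eq_mul_inv]
      ring
    have e4 : serTerm q A B C D E G H m * ((1 - A * q ^ m) * (1 - B * q ^ m) /
        (q ^ m * ((1 - A) * (1 - B)))) = serTerm q A B C D E G H m *
        ((1 - A * q ^ m) * (1 - B * q ^ m) *
          ((1 - E * q ^ m)⁻¹ * (1 - G * q ^ m)⁻¹ * (1 - H * q ^ m)⁻¹)) *
        ((1 - E * q ^ m) * (1 - G * q ^ m) * (1 - H * q ^ m) /
          (q ^ m * ((1 - A) * (1 - B)))) := by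
      have hu : (1 - E * q ^ m)⁻¹ * (1 - G * q ^ m)⁻¹ * (1 - H * q ^ m)⁻¹ *
          ((1 - E * q ^ m) * (1 - G * q ^ m) * (1 - H * q ^ m)) = 1 := by
        rw [← mul_inv, ← mul_inv]
        exact inv_mul_cancel₀ (mul_ne_zero (mul_ne_zero hE' hG') hH')
      simp only [div_eq_mul_inv]
      linear_combination -serTerm q A B C D E G H m * ((1 - A * q ^ m) * (1 - B * q ^ m)) *
        (q ^ m * ((1 - A) * (1 - B)))⁻¹ * hu
    have e5 : q ^ (m + 1) = q * q ^ m := pow_succ' q m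
    rw [e5, mul_add, mul_add _ _ (serTerm q (q * A) (q * B) (q * C) D (q * E) (q * G) (q * H) m),
      e1', e2', e3]
    rw [e4] at ih
    linear_combination ih + serTerm q A B C D E G H m * ((1 - A * q ^ m) * (1 - B * q ^ m) *
          ((1 - E * q ^ m)⁻¹ * (1 - G * q ^ m)⁻¹ * (1 - H * q ^ m)⁻¹)) * aux

/-- The increment identity for `sum_serTerm_mixed`, with z = q^m. Eliminating E by balance in the
last bracket produces a multiple of (1-Gz)(1-Hz), which cancels the denominators. What is left no
longer contains A, B, G, H. -/
theorem mixed_aux {q A B C D E G H z : ℂ} (hq : q ≠ 0) (hC : C ≠ 0) (hD : D ≠ 0) (hG : G ≠ 0)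
    (hH : H ≠ 0) (hAB : A - B ≠ 0) (hCD : C - D ≠ 0) (hGz : 1 - G * z ≠ 0)
    (hHz : 1 - H * z ≠ 0) (hb : E * G * H = q ^ 2 * A * B * C * D) :
    -((q * D - E) / (q * D * (C - D))) * (1 - D) * (1 - C * z) +
        (q * C - E) / (q * C * (C - D)) * (1 - C) * (1 - D * z) +
        (1 - C * z) * (1 - D * z) * ((1 - G * z)⁻¹ * (1 - H * z)⁻¹) *
          (-(q * B * (G - A) * (H - A) / ((A - B) * (G * H))) * (1 - B * z) +
            q * A * (G - B) * (H - B) / ((A - B) * (G * H)) * (1 - A * z)) =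
      q * (1 - C * z) * (1 - A * z) * (1 - B * z) * (1 - D * z) *
        ((1 - G * z)⁻¹ * (1 - H * z)⁻¹) - (1 - E * z / q) * (1 - z) := by
  have h1 : -(q * B * (G - A) * (H - A) / ((A - B) * (G * H))) * (1 - B * z) +
      q * A * (G - B) * (H - B) / ((A - B) * (G * H)) * (1 - A * z) =
      q * (1 - A * z) * (1 - B * z) - E / (q * C * D) * ((1 - G * z) * (1 - H * z)) := by
    have : E = q ^ 2 * A * B * C * D / (G * H) := by
      rw [eq_div_iff (mul_ne_zero hG hH), ← hb]
      ring
    rw [this]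
    field_simp
    ring
  have h2 : (1 - G * z) * (1 - H * z) * ((1 - G * z)⁻¹ * (1 - H * z)⁻¹) = 1 := by
    rw [← mul_inv]
    exact mul_inv_cancel₀ (mul_ne_zero hGz hHz)
  have h3 : -((q * D - E) / (q * D * (C - D))) * (1 - D) * (1 - C * z) +
        (q * C - E) / (q * C * (C - D)) * (1 - C) * (1 - D * z) -
        (1 - C * z) * (1 - D * z) * (E / (q * C * D)) = -((1 - E * z / q) * (1 - z)) := by
    field_simp
    ring
  rw [h1]
  linear_combination h3 - (1 - C * z) * (1 - D * z) * (E / (q * C * D)) * h2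

theorem serTerm_shift_mixed {q A B C D E G H : ℂ} (hC1 : 1 - C ≠ 0) (hD1 : 1 - D ≠ 0)
    (hG1 : 1 - G ≠ 0) (hH1 : 1 - H ≠ 0) (m : ℕ) :
    (1 - B) * (1 - D) / ((1 - G) * (1 - H)) *
        serTerm q A (q * B) (q * C) (q * D) E (q * G) (q * H) m =
      serTerm q A B C D E G H m * ((1 - B * q ^ m) * (1 - C * q ^ m) * (1 - D * q ^ m) *
        ((1 - G * q ^ m)⁻¹ * (1 - H * q ^ m)⁻¹)) * (1 - C)⁻¹ := by
  have eB := one_sub_mul_qPoch B q m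
  simp only [serTerm, div_eq_mul_inv, mul_inv]
  rw [qPoch_mul_left hC1, qPoch_mul_left hD1, qPoch_mul_left_inv hG1, qPoch_mul_left_inv hH1]
  simp only [div_eq_mul_inv]
  have hD : (1 - D) * (1 - D)⁻¹ = 1 := mul_inv_cancel₀ hD1
  have hG : (1 - G) * (1 - G)⁻¹ = 1 := mul_inv_cancel₀ hG1
  have hH : (1 - H) * (1 - H)⁻¹ = 1 := mul_inv_cancel₀ hH1
  calc _ = ((1 - B) * qPoch (q * B) q m) * ((1 - D) * (1 - D)⁻¹) * ((1 - G) * (1 - G)⁻¹) *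
        ((1 - H) * (1 - H)⁻¹) * (qPoch A q m * qPoch C q m * (1 - C * q ^ m) * qPoch D q m *
          (1 - D * q ^ m) * (1 - C)⁻¹ * (qPoch E q m)⁻¹ * (qPoch G q m)⁻¹ * (qPoch H q m)⁻¹ *
          (1 - G * q ^ m)⁻¹ * (1 - H * q ^ m)⁻¹ * q ^ m * (qPoch q q m)⁻¹) := by ring
    _ = _ := by
      rw [eB, hD, hG, hH]
      ring

theorem serTerm_swap₁ (q A B C D E G H : ℂ) (j : ℕ) :
    serTerm q A B C D E G H j = serTerm q B A C D E G H j := by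
  simp only [serTerm]
  ring

theorem serTerm_swap₃ (q A B C D E G H : ℂ) (j : ℕ) :
    serTerm q A B C D E G H j = serTerm q A B C D E H G j := by
  simp only [serTerm]
  ring

theorem serTerm_succ_mixed {q A B C D E G H : ℂ} (hq : q ≠ 0) (m : ℕ) (hE' : 1 - E * q ^ m ≠ 0)
    (hq' : 1 - q * q ^ m ≠ 0) :
    serTerm q A B C D E G H (m + 1) * ((1 - E * q ^ (m + 1) / q) * (1 - q ^ (m + 1)) /
        (1 - C)) = serTerm q A B C D E G H m * (q * (1 - C * q ^ m) * (1 - A * q ^ m) *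
          (1 - B * q ^ m) * (1 - D * q ^ m) * ((1 - G * q ^ m)⁻¹ * (1 - H * q ^ m)⁻¹)) *
          (1 - C)⁻¹ := by
  have e5 : E * q ^ (m + 1) / q = E * q ^ m := by
    rw [pow_succ]
    field_simp
  have hu : (1 - E * q ^ m)⁻¹ * (1 - E * q ^ m) = 1 := inv_mul_cancel₀ hE'
  have hv : (1 - q * q ^ m)⁻¹ * (1 - q * q ^ m) = 1 := inv_mul_cancel₀ hq'
  rw [serTerm_succ, e5, pow_succ' q m, div_eq_mul_inv]
  generalize (1 - E * q ^ m)⁻¹ = u at *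
  generalize (1 - q * q ^ m)⁻¹ = v at *
  generalize (1 - G * q ^ m)⁻¹ = g' at *
  generalize (1 - H * q ^ m)⁻¹ = h' at *
  generalize (1 - C)⁻¹ = c at *
  generalize serTerm q A B C D E G H m = s at *
  linear_combination s * q * (1 - A * q ^ m) * (1 - B * q ^ m) * (1 - C * q ^ m) *
    (1 - D * q ^ m) * g' * h' * c * (u * (1 - E * q ^ m) * hv + hu)

/-- Also a telescoping identity. The balance condition carries q² because the unshifted series is
only a reference: each of the four series summed here is balanced in the usual sense. -/
theorem sum_serTerm_mixed {q A B C D E G H : ℂ} (hq : q ≠ 0) (hC : C ≠ 0) (hD : D ≠ 0)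
    (hG : G ≠ 0) (hH : H ≠ 0) (hAB : A - B ≠ 0) (hCD : C - D ≠ 0)
    (hC1 : 1 - C ≠ 0) (hD1 : 1 - D ≠ 0) (hG1 : 1 - G ≠ 0) (hH1 : 1 - H ≠ 0)
    (hb : E * G * H = q ^ 2 * A * B * C * D) (m : ℕ)
    (hEm : ∀ j < m, 1 - E * q ^ j ≠ 0) (hGm : ∀ j < m, 1 - G * q ^ j ≠ 0)
    (hHm : ∀ j < m, 1 - H * q ^ j ≠ 0) (hqm : ∀ j < m, 1 - q * q ^ j ≠ 0) :
    -((q * D - E) / (q * D * (C - D))) * (1 - D) *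
          ∑ j ∈ range m, serTerm q A B (q * C) D E G H j +
        (q * C - E) / (q * C * (C - D)) * (1 - D) *
          ∑ j ∈ range m, serTerm q A B C (q * D) E G H j -
        q * B * (G - A) * (H - A) / ((A - B) * (G * H)) *
          ((1 - B) * (1 - D) / ((1 - G) * (1 - H))) *
          ∑ j ∈ range m, serTerm q A (q * B) (q * C) (q * D) E (q * G) (q * H) j +
        q * A * (G - B) * (H - B) / ((A - B) * (G * H)) *
          ((1 - A) * (1 - D) / ((1 - G) * (1 - H))) *
          ∑ j ∈ range m, serTerm q (q * A) B (q * C) (q * D) E (q * G) (q * H) j =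
      serTerm q A B C D E G H m * ((1 - E * q ^ m / q) * (1 - q ^ m) / (1 - C)) := by
  induction m with
  | zero => simp
  | succ m ih =>
    have ih := ih (fun j hj => hEm j (by omega)) (fun j hj => hGm j (by omega))
      (fun j hj => hHm j (by omega)) (fun j hj => hqm j (by omega))
    have hE' := hEm m (by omega)
    have hG' := hGm m (by omega)
    have hH' := hHm m (by omega)
    have hq' := hqm m (by omega)
    have aux := mixed_aux hq hC hD hG hH hAB hCD hG' hH' hb
    simp only [sum_range_succ]
    have t1 : (1 - C) * serTerm q A B (q * C) D E G H m =
        serTerm q A B C D E G H m * (1 - C * q ^ m) := by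
      have eC := one_sub_mul_qPoch C q m
      simp only [serTerm, div_eq_mul_inv]
      linear_combination qPoch A q m * qPoch B q m * qPoch D q m *
        (qPoch E q m * qPoch G q m * qPoch H q m)⁻¹ * (q ^ m * (qPoch q q m)⁻¹) * eC
    have t2 : (1 - D) * serTerm q A B C (q * D) E G H m =
        serTerm q A B C D E G H m * (1 - D * q ^ m) := by
      have eD := one_sub_mul_qPoch D q m
      simp only [serTerm, div_eq_mul_inv]
      linear_combination qPoch A q m * qPoch B q m * qPoch C q m *
        (qPoch E q m * qPoch G q m * qPoch H q m)⁻¹ * (q ^ m * (qPoch q q m)⁻¹) * eD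
    have t3 := serTerm_shift_mixed (q := q) (A := A) (B := B) (E := E) hC1 hD1 hG1 hH1 m
    have t4 := serTerm_shift_mixed (q := q) (A := B) (B := A) (E := E) hC1 hD1 hG1 hH1 m
    rw [serTerm_swap₁, serTerm_swap₁ q B A] at t4
    have t5 := serTerm_succ_mixed (q := q) (A := A) (B := B) (C := C) (D := D) (G := G) (H := H)
      hq m hE' hq'
    have t1' : serTerm q A B (q * C) D E G H m =
        serTerm q A B C D E G H m * (1 - C * q ^ m) * (1 - C)⁻¹ := by
      rw [← t1]
      field_simp
    have hw : (1 - C) * (1 - C)⁻¹ = 1 := mul_inv_cancel₀ hC1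
    rw [t5]
    linear_combination ih - (q * D - E) / (q * D * (C - D)) * (1 - D) * t1' +
      (q * C - E) / (q * C * (C - D)) * t2 -
      q * B * (G - A) * (H - A) / ((A - B) * (G * H)) * t3 +
      q * A * (G - B) * (H - B) / ((A - B) * (G * H)) * t4 +
      serTerm q A B C D E G H m * (1 - C)⁻¹ * aux -
      (q * C - E) / (q * C * (C - D)) * serTerm q A B C D E G H m * (1 - D * q ^ m) * hw

/-! ### Genericity conditions -/

/-- A nonzero number that is not an integral power of `q`. -/
def Nz (q c : ℂ) : Prop := c ≠ 0 ∧ ∀ m : ℤ, c * q ^ m ≠ 1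

theorem Nz.mul_left {q c : ℂ} (hq : q ≠ 0) (h : Nz q c) : Nz q (q * c) :=
  ⟨mul_ne_zero hq h.1, fun m hm => h.2 (m + 1) (by rw [zpow_add_one₀ hq, ← hm]; ring)⟩

theorem Nz.mul_zpow {q c : ℂ} (hq : q ≠ 0) (h : Nz q c) (k : ℤ) : Nz q (c * q ^ k) :=
  ⟨mul_ne_zero h.1 (zpow_ne_zero _ hq), fun m => by
    rw [mul_assoc, ← zpow_add₀ hq]
    exact h.2 _⟩

theorem Nz.one_sub {q c : ℂ} (h : Nz q c) (m : ℕ) : 1 - c * q ^ m ≠ 0 := fun e =>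
  h.2 m (by rw [zpow_natCast]; exact (sub_eq_zero.1 e).symm)

theorem Nz.one_sub_of_eq {q c t : ℂ} (h : Nz q c) (m : ℤ) (e : t = c * q ^ m) : 1 - t ≠ 0 :=
  fun e' => h.2 m (by rw [← e]; exact (sub_eq_zero.1 e').symm)

theorem Nz.one_sub_sq {q c : ℂ} (h : Nz q c) (m : ℕ) : 1 - c * q * (q ^ m) ^ 2 ≠ 0 :=
  h.one_sub_of_eq (1 + m * 2 : ℕ) (by rw [zpow_natCast]; ring)

theorem Nz.one_sub' {q c : ℂ} (h : Nz q c) : 1 - c ≠ 0 :=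
  h.one_sub_of_eq 0 (by simp)

theorem Nz.qPoch_ne_zero {q c : ℂ} (h : Nz q c) (n : ℕ) : qPoch c q n ≠ 0 :=
  GriffithsQRacah.qPoch_ne_zero fun l _ => h.one_sub l

/-- Nonzero and not a root of unity. -/
def Nr (q : ℂ) : Prop := q ≠ 0 ∧ ∀ m : ℕ, q ^ (m + 1) ≠ 1

theorem Nr.one_sub {q : ℂ} (h : Nr q) (m : ℕ) : 1 - q * q ^ m ≠ 0 := fun e =>
  h.2 m (by rw [pow_succ']; exact (sub_eq_zero.1 e).symm)

theorem Nr.one_sub' {q : ℂ} (h : Nr q) : 1 - q ≠ 0 := by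
  simpa using h.one_sub 0

theorem Nr.one_sub_pow {q : ℂ} (h : Nr q) (m : ℕ) : 1 - q ^ (m + 1) ≠ 0 := fun e =>
  h.2 m (sub_eq_zero.1 e).symm

theorem Nr.qPoch_ne_zero {q : ℂ} (h : Nr q) (n : ℕ) : qPoch q q n ≠ 0 :=
  GriffithsQRacah.qPoch_ne_zero fun l _ => h.one_sub l

theorem Nr.pow_ne {q : ℂ} (h : Nr q) {m n : ℕ} (hmn : m < n) : q ^ n ≠ q ^ m := by
  obtain ⟨k, rfl⟩ := Nat.exists_eq_add_of_lt hmn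
  intro e
  refine h.2 k (mul_left_cancel₀ (pow_ne_zero m h.1) ?_)
  rw [mul_one, ← pow_add]
  exact e

theorem Nr.one_sub_inv_pow {q : ℂ} (h : Nr q) {m n : ℕ} (hmn : m < n) :
    1 - (q ^ n)⁻¹ * q ^ m ≠ 0 := by
  intro e
  refine h.pow_ne hmn ?_
  have h0 : q ^ n ≠ 0 := pow_ne_zero _ h.1
  field_simp at e
  exact sub_eq_zero.1 (by simpa using e)

/-- Genericity of the parameters of a `q`-Racah function. -/
structure Gen3 (q b₁ b₂ b₃ : ℂ) : Prop where
  nr : Nr q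
  n1 : Nz q b₁
  n2 : Nz q b₂
  n3 : Nz q b₃
  n12 : Nz q (b₁ * b₂)
  n23 : Nz q (b₂ * b₃)
  n123 : Nz q (b₁ * b₂ * b₃)

theorem Gen3.symm {q b₁ b₂ b₃ : ℂ} (h : Gen3 q b₁ b₂ b₃) : Gen3 q b₃ b₂ b₁ where
  nr := h.nr
  n1 := h.n3
  n2 := h.n2
  n3 := h.n1
  n12 := by simpa [mul_comm] using h.n23
  n23 := by simpa [mul_comm] using h.n12
  n123 := by
    rw [show b₃ * b₂ * b₁ = b₁ * b₂ * b₃ by ring]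
    exact h.n123

/-- `Nz` excludes all integral powers of q at once, so genericity survives multiplying a parameter
by q. This keeps the inductions on the size inside the generic class. -/
theorem Gen3.shift₃ {q b₁ b₂ b₃ : ℂ} (h : Gen3 q b₁ b₂ b₃) : Gen3 q b₁ b₂ (q * b₃) where
  nr := h.nr
  n1 := h.n1
  n2 := h.n2
  n3 := h.n3.mul_left h.nr.1
  n12 := h.n12
  n23 := by
    rw [show b₂ * (q * b₃) = q * (b₂ * b₃) by ring]
    exact h.n23.mul_left h.nr.1
  n123 := by
    rw [show b₁ * b₂ * (q * b₃) = q * (b₁ * b₂ * b₃) by ring]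
    exact h.n123.mul_left h.nr.1

theorem Gen3.shift₁ {q b₁ b₂ b₃ : ℂ} (h : Gen3 q b₁ b₂ b₃) : Gen3 q (q * b₁) b₂ b₃ :=
  h.symm.shift₃.symm

theorem Gen3.shift₂ {q b₁ b₂ b₃ : ℂ} (h : Gen3 q b₁ b₂ b₃) : Gen3 q b₁ (q * b₂) b₃ where
  nr := h.nr
  n1 := h.n1
  n2 := h.n2.mul_left h.nr.1
  n3 := h.n3
  n12 := by
    rw [show b₁ * (q * b₂) = q * (b₁ * b₂) by ring]
    exact h.n12.mul_left h.nr.1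
  n23 := by
    rw [show q * b₂ * b₃ = q * (b₂ * b₃) by ring]
    exact h.n23.mul_left h.nr.1
  n123 := by
    rw [show b₁ * (q * b₂) * b₃ = q * (b₁ * b₂ * b₃) by ring]
    exact h.n123.mul_left h.nr.1

theorem serTerm_eq_zero_left {q : ℂ} (hq : q ≠ 0) {n k : ℕ} (h : n < k) (B C D E G H : ℂ) :
    serTerm q (q ^ n)⁻¹ B C D E G H k = 0 := by
  simp [serTerm, qPoch_inv_pow_eq_zero hq h]

theorem serTerm_eq_zero_right {q : ℂ} (hq : q ≠ 0) {n k : ℕ} (h : n < k) (A B D E G H : ℂ) :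
    serTerm q A B (q ^ n)⁻¹ D E G H k = 0 := by
  simp [serTerm, qPoch_inv_pow_eq_zero hq h]

/-! ### Shift relations of the q-Racah polynomials -/

/-- The hypergeometric factor of the `q`-Racah function. -/
def racahPhi (q : ℂ) (n x : ℕ) (b₁ b₂ b₃ : ℂ) (K : ℕ) : ℂ :=
  ∑ k ∈ range (n + 1), serTerm q (q ^ n)⁻¹ (b₂ * b₃ * q ^ (n + 1)) (q ^ x)⁻¹
    (b₁ * b₂ * q ^ (x + 1)) (q * b₂) (b₁ * b₂ * b₃ * q ^ (K + 2)) (q ^ K)⁻¹ k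

theorem racahPhi_eq_sum_left {q : ℂ} (hq : q ≠ 0) {n x M : ℕ} (h : n < M) (b₁ b₂ b₃ : ℂ) (K : ℕ) :
    racahPhi q n x b₁ b₂ b₃ K =
      ∑ k ∈ range M, serTerm q (q ^ n)⁻¹ (b₂ * b₃ * q ^ (n + 1)) (q ^ x)⁻¹
        (b₁ * b₂ * q ^ (x + 1)) (q * b₂) (b₁ * b₂ * b₃ * q ^ (K + 2)) (q ^ K)⁻¹ k :=
  sum_subset (range_mono h) fun k _ hk =>
    serTerm_eq_zero_left hq (by simpa [Nat.lt_succ_iff] using hk) _ _ _ _ _ _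

/-- The factor (q^(-x);q)_k kills all terms with k > x, so the variable can serve as cut-off just as
well as the degree. -/
theorem racahPhi_eq_sum_right {q : ℂ} (hq : q ≠ 0) {n x M : ℕ} (h : x < M) (b₁ b₂ b₃ : ℂ)
    (K : ℕ) :
    racahPhi q n x b₁ b₂ b₃ K =
      ∑ k ∈ range M, serTerm q (q ^ n)⁻¹ (b₂ * b₃ * q ^ (n + 1)) (q ^ x)⁻¹
        (b₁ * b₂ * q ^ (x + 1)) (q * b₂) (b₁ * b₂ * b₃ * q ^ (K + 2)) (q ^ K)⁻¹ k := by
  rw [racahPhi_eq_sum_left hq (show n < max M (n + 1) from lt_max_of_lt_right (Nat.lt_succ_self n))]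
  refine (sum_subset (range_mono (le_max_left _ _)) fun k _ hk => ?_).symm
  have := not_lt.1 (mt mem_range.2 hk)
  exact serTerm_eq_zero_right hq (by omega) _ _ _ _ _ _

/-- Duality: exchanging the upper pairs (A,B) and (C,D) swaps degree and variable and reverses the
parameters. Every relation in the degree thus gives one in the variable. -/
theorem racahPhi_symm {q : ℂ} (hq : q ≠ 0) (n x : ℕ) (b₁ b₂ b₃ : ℂ) (K : ℕ) :
    racahPhi q n x b₁ b₂ b₃ K = racahPhi q x n b₃ b₂ b₁ K := by
  rw [racahPhi_eq_sum_right hq (Nat.lt_succ_self x), racahPhi]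
  refine sum_congr rfl fun k _ => ?_
  rw [serTerm_swap₂, mul_comm b₁ b₂, mul_comm b₃ b₂, show b₂ * b₁ * b₃ = b₂ * b₃ * b₁ by ring]

theorem racahPhi_zero_left (q : ℂ) (x : ℕ) (b₁ b₂ b₃ : ℂ) (K : ℕ) :
    racahPhi q 0 x b₁ b₂ b₃ K = 1 := by
  simp [racahPhi, serTerm_zero]

theorem racahPhi_zero_right {q : ℂ} (hq : q ≠ 0) (n : ℕ) (b₁ b₂ b₃ : ℂ) (K : ℕ) :
    racahPhi q n 0 b₁ b₂ b₃ K = 1 := by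
  rw [racahPhi_symm hq, racahPhi_zero_left]

theorem mul_inv_pow_succ {q : ℂ} (hq : q ≠ 0) (n : ℕ) : q * (q ^ (n + 1))⁻¹ = (q ^ n)⁻¹ := by
  have := pow_ne_zero n hq
  rw [pow_succ]
  field_simp

theorem inv_sub_ne_zero {Q t : ℂ} (hQ : Q ≠ 0) (h : 1 - t * Q ≠ 0) : Q⁻¹ - t ≠ 0 := by
  intro e
  refine h ?_
  rw [← sub_eq_zero.1 e, inv_mul_cancel₀ hQ, sub_self]

/-- `serTerm_contiguous` with H = q^(-K-1), so the size changes. The bound on x keeps the factors 1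
- q^(-K-1)q^k nonzero over the whole sum. -/
theorem racahPhi_contiguous_size {q b₁ b₂ b₃ : ℂ} (h : Gen3 q b₁ b₂ b₃) {n x K : ℕ}
    (hx : x ≤ K) :
    racahPhi q n x b₁ b₂ b₃ (K + 1) =
      (1 - b₂ * b₃ * q * q ^ n) * (q * q ^ K - q ^ n) /
          ((1 - b₂ * b₃ * q * (q ^ n) ^ 2) * (q * q ^ K - 1)) *
          racahPhi q n x b₁ b₂ (q * b₃) K +
        (q ^ n - 1) * (1 - b₂ * b₃ * q * q ^ n * (q * q ^ K)) /
          ((1 - b₂ * b₃ * q * (q ^ n) ^ 2) * (q * q ^ K - 1)) *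
          racahPhi q (n - 1) x b₁ b₂ (q * b₃) K := by
  have hq := h.nr.1
  have hQ : q ^ n ≠ 0 := pow_ne_zero _ hq
  have hκ : q ^ K ≠ 0 := pow_ne_zero _ hq
  have hH' : q * q ^ K - 1 ≠ 0 := sub_ne_zero.2 fun e => h.nr.one_sub K (by rw [e, sub_self])
  have hAB := h.n23.one_sub_sq n
  have hAB' : (q ^ n)⁻¹ - b₂ * b₃ * q ^ (n + 1) ≠ 0 :=
    inv_sub_ne_zero hQ (by convert hAB using 1; ring)
  have hH : 1 - (q ^ (K + 1))⁻¹ ≠ 0 := by simpa using h.nr.one_sub_inv_pow (Nat.succ_pos K)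
  have e1 : ∀ k, serTerm q (q ^ n)⁻¹ (b₂ * (q * b₃) * q ^ (n + 1)) (q ^ x)⁻¹
      (b₁ * b₂ * q ^ (x + 1)) (q * b₂) (b₁ * b₂ * (q * b₃) * q ^ (K + 2)) (q ^ K)⁻¹ k =
      serTerm q (q ^ n)⁻¹ (q * (b₂ * b₃ * q ^ (n + 1))) (q ^ x)⁻¹
      (b₁ * b₂ * q ^ (x + 1)) (q * b₂) (b₁ * b₂ * b₃ * q ^ (K + 1 + 2)) (q * (q ^ (K + 1))⁻¹) k := by
    intro k
    rw [mul_inv_pow_succ hq]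
    congr 1 <;> ring
  -- The factor q^n - 1 is kept so that the truncated degree n - 1 is harmless at n = 0. The same
  -- device is used for n - 1 and x - 1 in the later shift relations.
  have e2 : (q ^ n - 1) * racahPhi q (n - 1) x b₁ b₂ (q * b₃) K =
      (q ^ n - 1) * ∑ k ∈ range (x + 1), serTerm q (q * (q ^ n)⁻¹) (b₂ * b₃ * q ^ (n + 1)) (q ^ x)⁻¹
      (b₁ * b₂ * q ^ (x + 1)) (q * b₂) (b₁ * b₂ * b₃ * q ^ (K + 1 + 2))
      (q * (q ^ (K + 1))⁻¹) k := by
    cases n with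
    | zero => simp
    | succ n =>
      rw [racahPhi_eq_sum_right hq (Nat.lt_succ_self x)]
      congr 1
      refine sum_congr rfl fun k _ => ?_
      rw [mul_inv_pow_succ hq, mul_inv_pow_succ hq, Nat.add_sub_cancel]
      congr 1 <;> ring
  have e3 : ∀ k < x + 1, serTerm q (q ^ n)⁻¹ (b₂ * b₃ * q ^ (n + 1)) (q ^ x)⁻¹
      (b₁ * b₂ * q ^ (x + 1)) (q * b₂) (b₁ * b₂ * b₃ * q ^ (K + 1 + 2)) (q ^ (K + 1))⁻¹ k = _ :=
    fun k hk => serTerm_contiguous hAB' hH (h.nr.one_sub_inv_pow (by omega))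
  rw [racahPhi_eq_sum_right hq (Nat.lt_succ_self x), racahPhi_eq_sum_right hq (Nat.lt_succ_self x),
    sum_congr rfl fun k hk => e3 k (mem_range.1 hk), sum_add_distrib, ← mul_sum, ← mul_sum,
    sum_congr rfl fun k _ => e1 k, mul_div_assoc (q ^ n - 1), mul_right_comm (q ^ n - 1), e2,
    mul_right_comm (q ^ n - 1), ← mul_div_assoc (q ^ n - 1)]
  congr 2
  · rw [div_eq_div_iff (mul_ne_zero hAB' hH) (mul_ne_zero hAB hH')]
    field_simp
    ring
  · rw [div_eq_div_iff (mul_ne_zero hAB' hH) (mul_ne_zero hAB hH')]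
    field_simp
    ring

/-- Here the raised lower parameter is b₁b₂b₃q^(K+2) instead of q^(-K). Only b₃ changes and the size
stays. -/
theorem racahPhi_contiguous {q b₁ b₂ b₃ : ℂ} (h : Gen3 q b₁ b₂ b₃) (n x K : ℕ) :
    racahPhi q n x b₁ b₂ b₃ K =
      (1 - b₂ * b₃ * q * q ^ n) * (1 - b₁ * b₂ * b₃ * q ^ (K + 2) * q ^ n) /
          ((1 - b₂ * b₃ * q * (q ^ n) ^ 2) * (1 - b₁ * b₂ * b₃ * q ^ (K + 2))) *
          racahPhi q n x b₁ b₂ (q * b₃) K +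
        (q ^ n - 1) * (b₁ * b₂ * b₃ * q ^ (K + 2) - b₂ * b₃ * q * q ^ n) /
          ((1 - b₂ * b₃ * q * (q ^ n) ^ 2) * (1 - b₁ * b₂ * b₃ * q ^ (K + 2))) *
          racahPhi q (n - 1) x b₁ b₂ (q * b₃) K := by
  have hq := h.nr.1
  have hQ : q ^ n ≠ 0 := pow_ne_zero _ hq
  have hG : 1 - b₁ * b₂ * b₃ * q ^ (K + 2) ≠ 0 := h.n123.one_sub _
  have hAB := h.n23.one_sub_sq n
  have hAB' : (q ^ n)⁻¹ - b₂ * b₃ * q ^ (n + 1) ≠ 0 :=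
    inv_sub_ne_zero hQ (by convert hAB using 1; ring)
  have e1 : ∀ k, serTerm q (q ^ n)⁻¹ (b₂ * (q * b₃) * q ^ (n + 1)) (q ^ x)⁻¹
      (b₁ * b₂ * q ^ (x + 1)) (q * b₂) (b₁ * b₂ * (q * b₃) * q ^ (K + 2)) (q ^ K)⁻¹ k =
      serTerm q (q ^ n)⁻¹ (q * (b₂ * b₃ * q ^ (n + 1))) (q ^ x)⁻¹
      (b₁ * b₂ * q ^ (x + 1)) (q * b₂) (q ^ K)⁻¹ (q * (b₁ * b₂ * b₃ * q ^ (K + 2))) k := by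
    intro k
    rw [serTerm_swap₃]
    congr 1 <;> ring
  have e2 : (q ^ n - 1) * racahPhi q (n - 1) x b₁ b₂ (q * b₃) K =
      (q ^ n - 1) * ∑ k ∈ range (x + 1), serTerm q (q * (q ^ n)⁻¹) (b₂ * b₃ * q ^ (n + 1)) (q ^ x)⁻¹
      (b₁ * b₂ * q ^ (x + 1)) (q * b₂) (q ^ K)⁻¹ (q * (b₁ * b₂ * b₃ * q ^ (K + 2))) k := by
    cases n with
    | zero => simp
    | succ n =>
      rw [racahPhi_eq_sum_right hq (Nat.lt_succ_self x)]
      congr 1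
      refine sum_congr rfl fun k _ => ?_
      rw [mul_inv_pow_succ hq, Nat.add_sub_cancel, serTerm_swap₃]
      congr 1 <;> ring
  have e3 : ∀ k, serTerm q (q ^ n)⁻¹ (b₂ * b₃ * q ^ (n + 1)) (q ^ x)⁻¹
      (b₁ * b₂ * q ^ (x + 1)) (q * b₂) (b₁ * b₂ * b₃ * q ^ (K + 2)) (q ^ K)⁻¹ k = _ :=
    fun k => (serTerm_swap₃ _ _ _ _ _ _ _ _ _).trans
      (serTerm_contiguous (G := (q ^ K)⁻¹) hAB' hG (by
        rw [mul_assoc, ← pow_add]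
        exact h.n123.one_sub _))
  rw [racahPhi_eq_sum_right hq (Nat.lt_succ_self x), racahPhi_eq_sum_right hq (Nat.lt_succ_self x),
    sum_congr rfl fun k hk => e3 k, sum_add_distrib, ← mul_sum, ← mul_sum,
    sum_congr rfl fun k _ => e1 k, mul_div_assoc (q ^ n - 1), mul_right_comm (q ^ n - 1), e2,
    mul_right_comm (q ^ n - 1), ← mul_div_assoc (q ^ n - 1)]
  congr 2
  · rw [div_eq_div_iff (mul_ne_zero hAB' hG) (mul_ne_zero hAB hG)]
    field_simp
    ring
  · rw [div_eq_div_iff (mul_ne_zero hAB' hG) (mul_ne_zero hAB hG)]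
    field_simp
    ring

/-- Sum of `serTerm_forward`: the constant terms cancel and the summation index moves down by one.
Degree, variable and size drop together. -/
theorem racahPhi_forward {q b₁ b₂ b₃ : ℂ} (h : Gen3 q b₁ b₂ b₃) (n x K : ℕ) :
    racahPhi q (n + 1) (x + 1) b₁ b₂ b₃ (K + 1) - racahPhi q n (x + 1) b₁ b₂ b₃ (K + 1) =
      (b₂ * b₃ * (q * q ^ n) ^ 2 - 1) * (q * q ^ x - 1) * (1 - b₁ * b₂ * q * (q * q ^ x)) *
          (q * q ^ K) /
        (q ^ n * (q * q ^ x) * (1 - q * b₂) * (1 - b₁ * b₂ * b₃ * q ^ (K + 3)) * (q * q ^ K - 1)) *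
        racahPhi q n x (q * b₁) (q * b₂) b₃ K := by
  have hq := h.nr.1
  have hQ : q ^ n ≠ 0 := pow_ne_zero _ hq
  have hX : q ^ x ≠ 0 := pow_ne_zero _ hq
  have hG : 1 - b₁ * b₂ * b₃ * q ^ (K + 1 + 2) ≠ 0 := h.n123.one_sub _
  have hE : 1 - q * b₂ ≠ 0 := h.n2.one_sub_of_eq 1 (by rw [zpow_one, mul_comm])
  have hH' : q * q ^ K - 1 ≠ 0 := sub_ne_zero.2 fun e => h.nr.one_sub K (by rw [e, sub_self])
  have hH : 1 - (q ^ (K + 1))⁻¹ ≠ 0 := by simpa using h.nr.one_sub_inv_pow (Nat.succ_pos K)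
  have e0 : q * (b₂ * b₃ * q ^ (n + 1)) = b₂ * b₃ * q ^ (n + 1 + 1) := by ring
  have e1 := fun k => serTerm_forward (A := (q ^ (n + 1))⁻¹) (B := b₂ * b₃ * q ^ (n + 1))
    (C := (q ^ (x + 1))⁻¹) (D := b₁ * b₂ * q ^ (x + 1 + 1)) (E := q * b₂)
    (G := b₁ * b₂ * b₃ * q ^ (K + 1 + 2)) (H := (q ^ (K + 1))⁻¹) (h.nr.one_sub_pow k)
  simp only [mul_inv_pow_succ hq, e0] at e1
  rw [racahPhi_eq_sum_right hq (Nat.lt_succ_self _), racahPhi_eq_sum_right hq (Nat.lt_succ_self _),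
    racahPhi_eq_sum_right hq (Nat.lt_succ_self x), sum_range_succ', sum_range_succ' _ (x + 1),
    serTerm_zero, serTerm_zero, add_sub_add_right_eq_sub, ← sum_sub_distrib, sum_congr rfl fun k _ => e1 k,
    ← mul_sum]
  congr 1
  · rw [div_eq_div_iff (by simp only [mul_ne_zero_iff]; exact ⟨⟨hE, hG⟩, hH⟩) (by simp [*])]
    field_simp
    ring
  · refine sum_congr rfl fun k _ => ?_
    congr 1 <;> ring

/-- The inverse ladder, which combines the neighbouring points x and x - 1. It is
`sum_serTerm_backward` with A = q^(-n-1), C = q^(-x), D = b₁b₂q^(x+1): shifting D preserves x and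
shifting C lowers it. -/
theorem racahPhi_backward {q b₁ b₂ b₃ : ℂ} (h : Gen3 q b₁ b₂ b₃) {n K : ℕ} (x : ℕ)
    (hn : n ≤ K) :
    racahPhi q (n + 1) x b₁ b₂ b₃ (K + 1) =
      (1 - q * b₂ * q ^ x) * (1 - b₁ * b₂ * b₃ * q ^ (K + 3) * q ^ x) * (q * q ^ K - q ^ x) *
          (1 - b₁ * b₂ * q * q ^ x) /
        (q ^ x * (1 - b₁ * b₂ * q * (q ^ x) ^ 2) * (1 - q * b₂) *
          (1 - b₁ * b₂ * b₃ * q ^ (K + 3)) * (q * q ^ K - 1)) *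
        racahPhi q n x b₁ (q * b₂) (q * b₃) K -
      q * b₂ * (b₁ * q ^ x - 1) * (q ^ x - b₃ * q * (q * q ^ K)) *
          (b₁ * b₂ * q * q ^ x * (q * q ^ K) - 1) * (q ^ x - 1) /
        (q ^ x * (1 - b₁ * b₂ * q * (q ^ x) ^ 2) * (1 - q * b₂) *
          (1 - b₁ * b₂ * b₃ * q ^ (K + 3)) * (q * q ^ K - 1)) *
        racahPhi q n (x - 1) b₁ (q * b₂) (q * b₃) K := by
  have hq := h.nr.1
  have hQ : q ^ n ≠ 0 := pow_ne_zero _ hq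
  have hX : q ^ x ≠ 0 := pow_ne_zero _ hq
  have hκ : q ^ K ≠ 0 := pow_ne_zero _ hq
  have hb₁ := h.n1.1
  have hb₂ := h.n2.1
  have hb₃ := h.n3.1
  have hG : 1 - b₁ * b₂ * b₃ * q ^ (K + 3) ≠ 0 := h.n123.one_sub _
  have hE : 1 - q * b₂ ≠ 0 := h.n2.one_sub_of_eq 1 (by rw [zpow_one, mul_comm])
  have hH' : q * q ^ K - 1 ≠ 0 := sub_ne_zero.2 fun e => h.nr.one_sub K (by rw [e, sub_self])
  have hH : 1 - (q ^ (K + 1))⁻¹ ≠ 0 := by simpa using h.nr.one_sub_inv_pow (Nat.succ_pos K)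
  have hCD := h.n12.one_sub_sq x
  have hCD' : (q ^ x)⁻¹ - b₁ * b₂ * q ^ (x + 1) ≠ 0 :=
    inv_sub_ne_zero hX (by convert hCD using 1; ring)
  have hDC' : b₁ * b₂ * q ^ (x + 1) - (q ^ x)⁻¹ ≠ 0 := by
    rw [← neg_sub]
    exact neg_ne_zero.2 hCD'
  have key := sum_serTerm_backward (A := (q ^ (n + 1))⁻¹) (B := b₂ * b₃ * q ^ (n + 1 + 1))
    (C := (q ^ x)⁻¹) (D := b₁ * b₂ * q ^ (x + 1)) (E := q * b₂)
    (G := b₁ * b₂ * b₃ * q ^ (K + 3)) (H := (q ^ (K + 1))⁻¹) hq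
    (by simpa using h.nr.one_sub_inv_pow (Nat.succ_pos n)) (h.n23.one_sub _) (inv_ne_zero hX)
    (mul_ne_zero (mul_ne_zero hb₁ hb₂) (pow_ne_zero _ hq)) hCD' hE hG hH
    (by rw [pow_succ q K, pow_succ q n]; field_simp; ring) (n + 1)
    (fun j _ => by
      rw [mul_comm q, mul_assoc, ← pow_succ']
      exact h.n2.one_sub _)
    (fun j _ => by
      rw [mul_assoc, ← pow_add]
      exact h.n123.one_sub _)
    (fun j hj => h.nr.one_sub_inv_pow (by omega)) (fun j _ => h.nr.one_sub j)
  -- At m = n + 1 the boundary factor 1 - Aq^m is zero, and all partial sums are complete series.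
  rw [inv_mul_cancel₀ (pow_ne_zero _ hq), sub_self, zero_mul, zero_div, mul_zero] at key
  have e1 : ∑ j ∈ range (n + 1), serTerm q (q * (q ^ (n + 1))⁻¹) (q * (b₂ * b₃ * q ^ (n + 1 + 1)))
      (q ^ x)⁻¹ (q * (b₁ * b₂ * q ^ (x + 1))) (q * (q * b₂)) (q * (b₁ * b₂ * b₃ * q ^ (K + 3)))
      (q * (q ^ (K + 1))⁻¹) j = racahPhi q n x b₁ (q * b₂) (q * b₃) K := by
    refine sum_congr rfl fun j _ => ?_
    simp only [mul_inv_pow_succ hq]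
    congr 1 <;> ring
  have e2 : (q ^ x - 1) * ∑ j ∈ range (n + 1), serTerm q (q * (q ^ (n + 1))⁻¹)
      (q * (b₂ * b₃ * q ^ (n + 1 + 1))) (q * (q ^ x)⁻¹) (b₁ * b₂ * q ^ (x + 1)) (q * (q * b₂))
      (q * (b₁ * b₂ * b₃ * q ^ (K + 3))) (q * (q ^ (K + 1))⁻¹) j =
      (q ^ x - 1) * racahPhi q n (x - 1) b₁ (q * b₂) (q * b₃) K := by
    cases x with
    | zero => simp
    | succ x =>
      congr 1
      refine sum_congr rfl fun j _ => ?_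
      simp only [mul_inv_pow_succ hq, Nat.add_sub_cancel]
      congr 1 <;> ring
  rw [e1] at key
  rw [racahPhi]
  generalize ∑ j ∈ range (n + 1), serTerm q (q * (q ^ (n + 1))⁻¹)
      (q * (b₂ * b₃ * q ^ (n + 1 + 1))) (q * (q ^ x)⁻¹) (b₁ * b₂ * q ^ (x + 1)) (q * (q * b₂))
      (q * (b₁ * b₂ * b₃ * q ^ (K + 3))) (q * (q ^ (K + 1))⁻¹) j = S at key e2
  have c1 : ((q ^ x)⁻¹ - q * b₂) * ((q ^ x)⁻¹ - b₁ * b₂ * b₃ * q ^ (K + 3)) *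
      ((q ^ x)⁻¹ - (q ^ (K + 1))⁻¹) * (1 - b₁ * b₂ * q ^ (x + 1)) /
      ((q ^ x)⁻¹ * ((q ^ x)⁻¹ - b₁ * b₂ * q ^ (x + 1)) * (1 - q * b₂) *
        (1 - b₁ * b₂ * b₃ * q ^ (K + 3)) * (1 - (q ^ (K + 1))⁻¹)) =
      (1 - q * b₂ * q ^ x) * (1 - b₁ * b₂ * b₃ * q ^ (K + 3) * q ^ x) * (q * q ^ K - q ^ x) *
          (1 - b₁ * b₂ * q * q ^ x) /
        (q ^ x * (1 - b₁ * b₂ * q * (q ^ x) ^ 2) * (1 - q * b₂) *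
          (1 - b₁ * b₂ * b₃ * q ^ (K + 3)) * (q * q ^ K - 1)) := by
    rw [div_eq_div_iff (by simp only [mul_ne_zero_iff]; exact
      ⟨⟨⟨⟨inv_ne_zero hX, hCD'⟩, hE⟩, hG⟩, hH⟩) (by simp only [mul_ne_zero_iff]; exact
      ⟨⟨⟨⟨hX, hCD⟩, hE⟩, hG⟩, hH'⟩), pow_succ q K, pow_succ q x]
    generalize 1 - b₁ * b₂ * b₃ * q ^ (K + 3) = g
    field_simp
  have c2 : (b₁ * b₂ * q ^ (x + 1) - q * b₂) *
      (b₁ * b₂ * q ^ (x + 1) - b₁ * b₂ * b₃ * q ^ (K + 3)) *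
      (b₁ * b₂ * q ^ (x + 1) - (q ^ (K + 1))⁻¹) * (1 - (q ^ x)⁻¹) /
      (b₁ * b₂ * q ^ (x + 1) * (b₁ * b₂ * q ^ (x + 1) - (q ^ x)⁻¹) * (1 - q * b₂) *
        (1 - b₁ * b₂ * b₃ * q ^ (K + 3)) * (1 - (q ^ (K + 1))⁻¹)) =
      -(q * b₂ * (b₁ * q ^ x - 1) * (q ^ x - b₃ * q * (q * q ^ K)) *
          (b₁ * b₂ * q * q ^ x * (q * q ^ K) - 1) * (q ^ x - 1) /
        (q ^ x * (1 - b₁ * b₂ * q * (q ^ x) ^ 2) * (1 - q * b₂) *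
          (1 - b₁ * b₂ * b₃ * q ^ (K + 3)) * (q * q ^ K - 1))) := by
    rw [← neg_div, div_eq_div_iff (by simp only [mul_ne_zero_iff]; exact
      ⟨⟨⟨⟨⟨⟨hb₁, hb₂⟩, pow_ne_zero _ hq⟩, hDC'⟩, hE⟩, hG⟩, hH⟩) (by simp only [mul_ne_zero_iff]; exact
      ⟨⟨⟨⟨hX, hCD⟩, hE⟩, hG⟩, hH'⟩), pow_succ q (K + 2), pow_succ q (K + 1), pow_succ q K,
      pow_succ q x]
    generalize 1 - b₁ * b₂ * b₃ * (q ^ K * q * q * q) = g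
    field_simp
    ring
  rw [c1, c2] at key
  linear_combination key - q * b₂ * (b₁ * q ^ x - 1) * (q ^ x - b₃ * q * (q * q ^ K)) *
          (b₁ * b₂ * q * q ^ x * (q * q ^ K) - 1) /
        (q ^ x * (1 - b₁ * b₂ * q * (q ^ x) ^ 2) * (1 - q * b₂) *
          (1 - b₁ * b₂ * b₃ * q ^ (K + 3)) * (q * q ^ K - 1)) * e2

theorem mixed_coeff_boundary {q Y b₂ δ : ℂ} (hq : q ≠ 0) (hY : Y ≠ 0) (hY1 : 1 - Y⁻¹ ≠ 0)
    (h : Y⁻¹ - δ * Y ≠ 0) :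
    (q * Y⁻¹ - q * b₂) / (q * Y⁻¹ * (Y⁻¹ - δ * Y)) * (1 - δ * Y * Y) =
      -((1 - q * b₂ * Y / q) * (1 - Y) / (1 - Y⁻¹)) := by
  have e1 : 1 - δ * Y * Y = Y * (Y⁻¹ - δ * Y) := by field_simp
  have e2 : 1 - Y = -(Y * (1 - Y⁻¹)) := by field_simp; ring
  rw [e1, e2]
  generalize Y⁻¹ - δ * Y = W at *
  generalize 1 - Y⁻¹ = V at *
  field_simp

theorem mixed_coeff₁ {q X b₁ b₂ : ℂ} (hq : q ≠ 0) (hX : X ≠ 0) (hb₁ : b₁ ≠ 0) (hb₂ : b₂ ≠ 0)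
    (h : 1 - b₁ * b₂ * (q * X) ^ 2 ≠ 0) :
    (q * (b₁ * b₂ * (q * X)) - q * b₂) / (q * (b₁ * b₂ * (q * X)) *
      ((q * X)⁻¹ - b₁ * b₂ * (q * X))) =
      -((1 - b₁ * q * X) / (1 - b₁ * b₂ * (q * X) ^ 2)) / b₁ := by
  have e : (q * X)⁻¹ - b₁ * b₂ * (q * X) = (1 - b₁ * b₂ * (q * X) ^ 2) / (q * X) := by
    field_simp
  rw [e]
  generalize 1 - b₁ * b₂ * (q * X) ^ 2 = W at *
  field_simp
  ring

theorem mixed_coeff₂ {q X b₁ b₂ : ℂ} (hq : q ≠ 0) (hX : X ≠ 0) (hb₁ : b₁ ≠ 0)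
    (h : 1 - b₁ * b₂ * (q * X) ^ 2 ≠ 0) :
    (q * (q * X)⁻¹ - q * b₂) / (q * (q * X)⁻¹ *
      ((q * X)⁻¹ - b₁ * b₂ * (q * X))) =
      b₁ * q * X * (1 - q * b₂ * X) / (1 - b₁ * b₂ * (q * X) ^ 2) / b₁ := by
  have e : (q * X)⁻¹ - b₁ * b₂ * (q * X) = (1 - b₁ * b₂ * (q * X) ^ 2) / (q * X) := by
    field_simp
  rw [e]
  generalize 1 - b₁ * b₂ * (q * X) ^ 2 = W at *
  field_simp

theorem mixed_coeff₃ {q Q κ b₁ β : ℂ} (hq : q ≠ 0) (hQ : Q ≠ 0) (hκ : κ ≠ 0) (hb₁ : b₁ ≠ 0)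
    (hβ : β ≠ 0) (h : 1 - β * q * Q ^ 2 ≠ 0) (hG : 1 - b₁ * β * (q ^ 3 * κ) ≠ 0)
    (hH : q * κ - 1 ≠ 0) :
    q * (β * (q * Q)) * (b₁ * β * (q ^ 3 * κ) - Q⁻¹) * ((q * κ)⁻¹ - Q⁻¹) /
        ((Q⁻¹ - β * (q * Q)) * (b₁ * β * (q ^ 3 * κ) * (q * κ)⁻¹)) *
      ((1 - β * (q * Q)) / ((1 - b₁ * β * (q ^ 3 * κ)) * (1 - (q * κ)⁻¹))) =
      (1 - b₁ * β * (q ^ 3 * κ) * Q) * (q * κ - Q) * (1 - β * q * Q) /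
          ((1 - β * q * Q ^ 2) * (1 - b₁ * β * (q ^ 3 * κ)) * (q * κ - 1)) / b₁ := by
  have e : Q⁻¹ - β * (q * Q) = (1 - β * q * Q ^ 2) / Q := by field_simp
  have e' : 1 - (q * κ)⁻¹ = (q * κ - 1) / (q * κ) := by field_simp
  rw [e, e']
  generalize 1 - β * q * Q ^ 2 = W at *
  generalize q * κ - 1 = V at *
  generalize 1 - b₁ * β * (q ^ 3 * κ) = U at *
  field_simp
  ring

theorem mixed_coeff₄ {q Q κ b₁ β : ℂ} (hq : q ≠ 0) (hQ : Q ≠ 0) (hκ : κ ≠ 0) (hb₁ : b₁ ≠ 0)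
    (hβ : β ≠ 0) (h : 1 - β * q * Q ^ 2 ≠ 0) (hG : 1 - b₁ * β * (q ^ 3 * κ) ≠ 0)
    (hH : q * κ - 1 ≠ 0) :
    q * Q⁻¹ * (b₁ * β * (q ^ 3 * κ) - β * (q * Q)) * ((q * κ)⁻¹ - β * (q * Q)) /
        ((Q⁻¹ - β * (q * Q)) * (b₁ * β * (q ^ 3 * κ) * (q * κ)⁻¹)) *
      ((1 - Q⁻¹) / ((1 - b₁ * β * (q ^ 3 * κ)) * (1 - (q * κ)⁻¹))) =
      (b₁ * q * (q * κ) - Q) * (1 - β * q * Q * (q * κ)) * (Q - 1) /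
          (Q * (1 - β * q * Q ^ 2) * (1 - b₁ * β * (q ^ 3 * κ)) * (q * κ - 1)) / b₁ := by
  have e : Q⁻¹ - β * (q * Q) = (1 - β * q * Q ^ 2) / Q := by field_simp
  have e' : 1 - (q * κ)⁻¹ = (q * κ - 1) / (q * κ) := by field_simp
  rw [e, e']
  generalize 1 - β * q * Q ^ 2 = W at *
  generalize q * κ - 1 = V at *
  generalize 1 - b₁ * β * (q ^ 3 * κ) = U at *
  field_simp

/-- In `sum_serTerm_mixed` take C = q^(-a-1) and D = b₁b₂q^(a+1). Then the series with qC belongs to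
the variable a and the one with qD to a + 1, so two values of the variable on the left are traded
for two degrees on the right. -/
theorem racahPhi_mixed {q b₁ b₂ b₃ : ℂ} (h : Gen3 q b₁ b₂ b₃) (i : ℕ) {a K : ℕ}
    (ha : a ≤ K) :
    (1 - b₁ * q * q ^ a) / (1 - b₁ * b₂ * (q * q ^ a) ^ 2) *
          racahPhi q i a b₁ b₂ b₃ (K + 1) +
        b₁ * q * q ^ a * (1 - q * b₂ * q ^ a) / (1 - b₁ * b₂ * (q * q ^ a) ^ 2) *
          racahPhi q i (a + 1) b₁ b₂ b₃ (K + 1) =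
      (1 - b₁ * b₂ * b₃ * q ^ (K + 3) * q ^ i) * (q * q ^ K - q ^ i) * (1 - b₂ * b₃ * q * q ^ i) /
          ((1 - b₂ * b₃ * q * (q ^ i) ^ 2) * (1 - b₁ * b₂ * b₃ * q ^ (K + 3)) * (q * q ^ K - 1)) *
          racahPhi q i a (q * b₁) b₂ (q * b₃) K -
        (b₁ * q * (q * q ^ K) - q ^ i) * (1 - b₂ * b₃ * q * q ^ i * (q * q ^ K)) * (q ^ i - 1) /
          (q ^ i * (1 - b₂ * b₃ * q * (q ^ i) ^ 2) * (1 - b₁ * b₂ * b₃ * q ^ (K + 3)) *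
            (q * q ^ K - 1)) *
          racahPhi q (i - 1) a (q * b₁) b₂ (q * b₃) K := by
  have hq := h.nr.1
  have hQ : q ^ i ≠ 0 := pow_ne_zero _ hq
  have hX : q ^ a ≠ 0 := pow_ne_zero _ hq
  have hX1 : q ^ (a + 1) ≠ 0 := pow_ne_zero _ hq
  have hκ : q ^ K ≠ 0 := pow_ne_zero _ hq
  have hb₁ := h.n1.1
  have hb₂ := h.n2.1
  have hb₃ := h.n3.1
  have hb : b₁ * b₂ * b₃ * q ^ (K + 3) ≠ 0 :=
    mul_ne_zero (mul_ne_zero (mul_ne_zero hb₁ hb₂) hb₃) (pow_ne_zero _ hq)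
  have hG : 1 - b₁ * b₂ * b₃ * q ^ (K + 3) ≠ 0 := h.n123.one_sub _
  have hH' : q * q ^ K - 1 ≠ 0 := sub_ne_zero.2 fun e => h.nr.one_sub K (by rw [e, sub_self])
  have hH : 1 - (q ^ (K + 1))⁻¹ ≠ 0 := by simpa using h.nr.one_sub_inv_pow (Nat.succ_pos K)
  have hC1 : 1 - (q ^ (a + 1))⁻¹ ≠ 0 := by simpa using h.nr.one_sub_inv_pow (Nat.succ_pos a)
  have hD1 : 1 - b₁ * b₂ * q ^ (a + 1) ≠ 0 := h.n12.one_sub _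
  have hCD : 1 - b₁ * b₂ * (q * q ^ a) ^ 2 ≠ 0 :=
    h.n12.one_sub_of_eq (2 + a * 2 : ℕ) (by rw [zpow_natCast]; ring)
  have hCD' : (q ^ (a + 1))⁻¹ - b₁ * b₂ * q ^ (a + 1) ≠ 0 :=
    inv_sub_ne_zero hX1 (by convert hCD using 1; ring)
  have hAB := h.n23.one_sub_sq i
  have hAB' : (q ^ i)⁻¹ - b₂ * b₃ * q ^ (i + 1) ≠ 0 :=
    inv_sub_ne_zero hQ (by convert hAB using 1; ring)
  have hE : ∀ j < a + 1, 1 - q * b₂ * q ^ j ≠ 0 := fun j _ => by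
    rw [mul_comm q, mul_assoc, ← pow_succ']
    exact h.n2.one_sub _
  have key := sum_serTerm_mixed (A := (q ^ i)⁻¹) (B := b₂ * b₃ * q ^ (i + 1))
    (C := (q ^ (a + 1))⁻¹) (D := b₁ * b₂ * q ^ (a + 1)) (E := q * b₂)
    (G := b₁ * b₂ * b₃ * q ^ (K + 3)) (H := (q ^ (K + 1))⁻¹) hq (inv_ne_zero hX1)
    (mul_ne_zero (mul_ne_zero hb₁ hb₂) (pow_ne_zero _ hq)) hb
    (inv_ne_zero (pow_ne_zero _ hq)) hAB' hCD' hC1 hD1 hG hH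
    (by rw [pow_succ q K, pow_succ q i]; field_simp; ring) (a + 1) hE
    (fun j _ => by
      rw [mul_assoc, ← pow_add]
      exact h.n123.one_sub _)
    (fun j hj => h.nr.one_sub_inv_pow (by omega)) (fun j _ => h.nr.one_sub j)
  have e1 : ∑ j ∈ range (a + 1), serTerm q (q ^ i)⁻¹ (b₂ * b₃ * q ^ (i + 1))
      (q * (q ^ (a + 1))⁻¹) (b₁ * b₂ * q ^ (a + 1)) (q * b₂) (b₁ * b₂ * b₃ * q ^ (K + 3))
      (q ^ (K + 1))⁻¹ j = racahPhi q i a b₁ b₂ b₃ (K + 1) := by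
    rw [racahPhi_eq_sum_right hq (Nat.lt_succ_self a), mul_inv_pow_succ hq]
  have e3 : ∑ j ∈ range (a + 1), serTerm q (q ^ i)⁻¹ (q * (b₂ * b₃ * q ^ (i + 1)))
      (q * (q ^ (a + 1))⁻¹) (q * (b₁ * b₂ * q ^ (a + 1))) (q * b₂)
      (q * (b₁ * b₂ * b₃ * q ^ (K + 3))) (q * (q ^ (K + 1))⁻¹) j =
      racahPhi q i a (q * b₁) b₂ (q * b₃) K := by
    rw [racahPhi_eq_sum_right hq (Nat.lt_succ_self a), mul_inv_pow_succ hq, mul_inv_pow_succ hq]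
    refine sum_congr rfl fun j _ => ?_
    congr 1 <;> ring
  have e4 : (q ^ i - 1) * ∑ j ∈ range (a + 1), serTerm q (q * (q ^ i)⁻¹) (b₂ * b₃ * q ^ (i + 1))
      (q * (q ^ (a + 1))⁻¹) (q * (b₁ * b₂ * q ^ (a + 1))) (q * b₂)
      (q * (b₁ * b₂ * b₃ * q ^ (K + 3))) (q * (q ^ (K + 1))⁻¹) j =
      (q ^ i - 1) * racahPhi q (i - 1) a (q * b₁) b₂ (q * b₃) K := by
    cases i with
    | zero => simp
    | succ i =>
      rw [racahPhi_eq_sum_right hq (Nat.lt_succ_self a)]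
      congr 1
      refine sum_congr rfl fun j _ => ?_
      simp only [mul_inv_pow_succ hq, Nat.add_sub_cancel]
      congr 1 <;> ring
  -- Truncation after k = a omits the last term of the polynomial at a + 1. That missing term is
  -- exactly the boundary term of the telescoping, as `mixed_coeff_boundary` confirms.
  have e2 : ∑ j ∈ range (a + 1), serTerm q (q ^ i)⁻¹ (b₂ * b₃ * q ^ (i + 1))
      (q ^ (a + 1))⁻¹ (q * (b₁ * b₂ * q ^ (a + 1))) (q * b₂) (b₁ * b₂ * b₃ * q ^ (K + 3))
      (q ^ (K + 1))⁻¹ j = racahPhi q i (a + 1) b₁ b₂ b₃ (K + 1) -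
      serTerm q (q ^ i)⁻¹ (b₂ * b₃ * q ^ (i + 1))
      (q ^ (a + 1))⁻¹ (q * (b₁ * b₂ * q ^ (a + 1))) (q * b₂) (b₁ * b₂ * b₃ * q ^ (K + 3))
      (q ^ (K + 1))⁻¹ (a + 1) := by
    rw [racahPhi_eq_sum_right hq (Nat.lt_succ_self (a + 1)), eq_sub_iff_add_eq,
      sum_range_succ _ (a + 1)]
    have e : q * (b₁ * b₂ * q ^ (a + 1)) = b₁ * b₂ * q ^ (a + 1 + 1) := by ring
    rw [e]
  have e5 : (1 - b₁ * b₂ * q ^ (a + 1)) * serTerm q (q ^ i)⁻¹ (b₂ * b₃ * q ^ (i + 1))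
      (q ^ (a + 1))⁻¹ (q * (b₁ * b₂ * q ^ (a + 1))) (q * b₂) (b₁ * b₂ * b₃ * q ^ (K + 3))
      (q ^ (K + 1))⁻¹ (a + 1) = serTerm q (q ^ i)⁻¹ (b₂ * b₃ * q ^ (i + 1))
      (q ^ (a + 1))⁻¹ (b₁ * b₂ * q ^ (a + 1)) (q * b₂) (b₁ * b₂ * b₃ * q ^ (K + 3))
      (q ^ (K + 1))⁻¹ (a + 1) * (1 - b₁ * b₂ * q ^ (a + 1) * q ^ (a + 1)) := by
    have := one_sub_mul_qPoch (b₁ * b₂ * q ^ (a + 1)) q (a + 1)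
    simp only [serTerm]
    linear_combination qPoch (q ^ i)⁻¹ q (a + 1) * qPoch (b₂ * b₃ * q ^ (i + 1)) q (a + 1) *
      qPoch (q ^ (a + 1))⁻¹ q (a + 1) / (qPoch (q * b₂) q (a + 1) *
      qPoch (b₁ * b₂ * b₃ * q ^ (K + 3)) q (a + 1) * qPoch (q ^ (K + 1))⁻¹ q (a + 1)) *
      (q ^ (a + 1) / qPoch q q (a + 1)) * this
  rw [e1, e2, e3] at key
  generalize ∑ j ∈ range (a + 1), serTerm q (q * (q ^ i)⁻¹) (b₂ * b₃ * q ^ (i + 1))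
      (q * (q ^ (a + 1))⁻¹) (q * (b₁ * b₂ * q ^ (a + 1))) (q * b₂)
      (q * (b₁ * b₂ * b₃ * q ^ (K + 3))) (q * (q ^ (K + 1))⁻¹) j = S at key e4
  generalize serTerm q (q ^ i)⁻¹ (b₂ * b₃ * q ^ (i + 1))
      (q ^ (a + 1))⁻¹ (b₁ * b₂ * q ^ (a + 1)) (q * b₂) (b₁ * b₂ * b₃ * q ^ (K + 3))
      (q ^ (K + 1))⁻¹ (a + 1) = s at key e5
  generalize serTerm q (q ^ i)⁻¹ (b₂ * b₃ * q ^ (i + 1))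
      (q ^ (a + 1))⁻¹ (q * (b₁ * b₂ * q ^ (a + 1))) (q * b₂) (b₁ * b₂ * b₃ * q ^ (K + 3))
      (q ^ (K + 1))⁻¹ (a + 1) = s' at key e5
  have hβ : b₂ * b₃ ≠ 0 := mul_ne_zero hb₂ hb₃
  have p3 : q ^ (K + 3) = q ^ 3 * q ^ K := by ring
  have c0 := mixed_coeff_boundary (b₂ := b₂) hq hX1 hC1 hCD'
  have c1 := mixed_coeff₁ hq hX hb₁ hb₂ hCD
  have c2 := mixed_coeff₂ (b₂ := b₂) hq hX hb₁ hCD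
  have hG' := hG
  rw [mul_assoc b₁ b₂ b₃, p3] at hG'
  have c3 := mixed_coeff₃ hq hQ hκ hb₁ hβ hAB hG' hH'
  have c4 := mixed_coeff₄ hq hQ hκ hb₁ hβ hAB hG' hH'
  rw [← mul_assoc b₁ b₂ b₃, ← p3] at c3 c4
  rw [pow_succ' q a, pow_succ' q i, pow_succ' q K] at *
  -- The telescoped relation is the claim multiplied by (1-D)/b₁, which genericity allows to cancel.
  have hy : (1 - b₁ * b₂ * (q * q ^ a)) / b₁ ≠ 0 := div_ne_zero hD1 hb₁
  rw [← sub_eq_zero]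
  refine (mul_eq_zero.1 ?_).resolve_left hy
  linear_combination key + (1 - b₁ * b₂ * (q * q ^ a)) * racahPhi q i a b₁ b₂ b₃ (K + 1) * c1 -
    (1 - b₁ * b₂ * (q * q ^ a)) * racahPhi q i (a + 1) b₁ b₂ b₃ (K + 1) * c2 +
    (1 - b₁ * b₂ * (q * q ^ a)) * racahPhi q i a (q * b₁) b₂ (q * b₃) K * c3 -
    (1 - b₁ * b₂ * (q * q ^ a)) * S * c4 -
    (1 - b₁ * b₂ * (q * q ^ a)) / b₁ *
      ((b₁ * q * (q * q ^ K) - q ^ i) * (1 - b₂ * b₃ * q * q ^ i * (q * q ^ K)) /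
          (q ^ i * (1 - b₂ * b₃ * q * (q ^ i) ^ 2) * (1 - b₁ * b₂ * b₃ * q ^ (K + 3)) *
            (q * q ^ K - 1))) * e4 +
    (q * (q * q ^ a)⁻¹ - q * b₂) / (q * (q * q ^ a)⁻¹ *
      ((q * q ^ a)⁻¹ - b₁ * b₂ * (q * q ^ a))) * e5 + s * c0

/-! ### Weights and orthogonality -/

/-- The weight of the `q`-Racah polynomials at `x`, for size `x + t`. -/
def racahWeight (q b₁ b₂ b₃ : ℂ) (x t : ℕ) : ℂ :=
  qPoch q q (x + t) * qPoch (q * b₂) q x * qPoch (b₁ * b₂ * b₃ * q ^ (x + t + 2)) q x *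
      qPoch (q * b₃) q t * qPoch (q * (b₁ * b₂)) q x * (1 - b₁ * b₂ * q * (q ^ x) ^ 2) /
    (qPoch q q x * qPoch q q t * (q * b₂) ^ x * qPoch (q * (b₁ * b₂)) q (2 * x + t + 1) *
      qPoch (q * b₁) q x)

/-- An equation a'f = ag records the ratio a'/a = g/f without dividing. This lemma and `ratio_div`
multiply and divide such records, so that a weight shift reduces to one equation for each q-product.
-/
theorem ratio_mul {a a' b b' f g k l : ℂ} (h : a' * f = a * g) (h' : b' * k = b * l) :
    a' * b' * (f * k) = a * b * (g * l) := by
  linear_combination b' * k * h + a * g * h'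

theorem ratio_div {a a' b b' f g k l : ℂ} (h : a' * f = a * g) (h' : b' * k = b * l) (hk : k ≠ 0)
    (hl : l ≠ 0) : a' / b' * (f * l) = a / b * (g * k) := by
  have e : b' = b * l / k := by rw [eq_div_iff hk, h']
  rcases eq_or_ne b 0 with hb | hb
  · simp [e, hb]
  rw [e]
  field_simp
  linear_combination h

/-- Companion of `racahPhi_forward`, with the same change of parameters, variable and size. -/
theorem racahWeight_succ {q b₁ b₂ b₃ : ℂ} (h : Gen3 q b₁ b₂ b₃) (x t : ℕ) :
    racahWeight q b₁ b₂ b₃ (x + 1) t *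
        ((1 - q * (b₁ * b₂) * (q * q ^ x)) * ((1 - q * q ^ x) * (q * b₂) * (1 - q * b₁))) =
      racahWeight q (q * b₁) (q * b₂) b₃ x t * ((1 - q * q ^ (x + t)) * (1 - q * b₂) *
        (1 - b₁ * b₂ * b₃ * q ^ (x + t + 3)) * q ^ x) := by
  have hq := h.nr.1
  have hb2 := h.n2.1
  have n1 := h.nr.one_sub x
  have n2 : 1 - q * b₁ ≠ 0 := (h.n1.mul_left hq).one_sub'
  have n4 : 1 - q * (b₁ * b₂) ≠ 0 := (h.n12.mul_left hq).one_sub'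
  have n5 : 1 - q * (q * (b₁ * b₂)) ≠ 0 := ((h.n12.mul_left hq).mul_left hq).one_sub'
  have e1 : qPoch q q (x + 1 + t) * 1 = qPoch q q (x + t) * (1 - q * q ^ (x + t)) := by
    rw [mul_one, ← qPoch_succ, add_right_comm]
  have e2 := qPoch_succ_left_mul_one (q * b₂) q x
  have e3 : qPoch (b₁ * b₂ * b₃ * q ^ (x + 1 + t + 2)) q (x + 1) * 1 =
      qPoch (q * b₁ * (q * b₂) * b₃ * q ^ (x + t + 2)) q x *
        (1 - b₁ * b₂ * b₃ * q ^ (x + t + 3)) := by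
    rw [qPoch_succ', show q * (b₁ * b₂ * b₃ * q ^ (x + 1 + t + 2)) =
      q * b₁ * (q * b₂) * b₃ * q ^ (x + t + 2) by ring]
    ring
  have e3' := Eq.refl (qPoch (q * b₃) q t * 1)
  have e0 : q * (q * (q * (b₁ * b₂))) = q * (q * b₁ * (q * b₂)) := by ring
  have e4 : qPoch (q * (b₁ * b₂)) q (x + 1) * (1 - q * (b₁ * b₂) * (q * q ^ x)) =
      qPoch (q * (q * b₁ * (q * b₂))) q x * ((1 - q * (b₁ * b₂)) * (1 - q * (q * (b₁ * b₂)))) := by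
    rw [← pow_succ', ← qPoch_succ, qPoch_succ', qPoch_succ', e0]
    ring
  have e5 : (1 - b₁ * b₂ * q * (q ^ (x + 1)) ^ 2) * 1 =
      (1 - q * b₁ * (q * b₂) * q * (q ^ x) ^ 2) * 1 := by ring
  have d1 := qPoch_succ_mul_one q q x
  have d2 := Eq.refl (qPoch q q t * 1)
  have d3 : (q * b₂) ^ (x + 1) * q ^ x = (q * (q * b₂)) ^ x * (q * b₂) := by ring
  have d4 : qPoch (q * (b₁ * b₂)) q (2 * (x + 1) + t + 1) * 1 =
      qPoch (q * (q * b₁ * (q * b₂))) q (2 * x + t + 1) *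
        ((1 - q * (b₁ * b₂)) * (1 - q * (q * (b₁ * b₂)))) := by
    rw [show 2 * (x + 1) + t + 1 = 2 * x + t + 1 + 1 + 1 by ring, qPoch_succ', qPoch_succ', e0]
    ring
  have d5 := qPoch_succ_left_mul_one (q * b₁) q x
  have key : racahWeight q b₁ b₂ b₃ (x + 1) t * _ = racahWeight q (q * b₁) (q * b₂) b₃ x t * _ :=
    ratio_div (ratio_mul (ratio_mul (ratio_mul (ratio_mul (ratio_mul e1 e2) e3) e3') e4) e5)
    (ratio_mul (ratio_mul (ratio_mul (ratio_mul d1 d2) d3) d4) d5) (by simp [hq])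
    (by simp [n1, n2, n4, n5, hq, hb2])
  refine mul_right_cancel₀ (mul_ne_zero n4 n5) ?_
  linear_combination (exp := 1) key

/-- Companion of `racahPhi_backward`, again with the same change of parameters and size. -/
theorem racahWeight_shift {q b₁ b₂ b₃ : ℂ} (h : Gen3 q b₁ b₂ b₃) (x t : ℕ) :
    racahWeight q b₁ b₂ b₃ x (t + 1) *
        ((1 - q * b₂ * q ^ x) * (1 - b₁ * b₂ * b₃ * q ^ (x + t + 3) * q ^ x) *
          (1 - q * (b₁ * b₂) * q ^ x) * (1 - b₁ * b₂ * q * q * (q ^ x) ^ 2) * (1 - q * q ^ t)) =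
      racahWeight q b₁ (q * b₂) (q * b₃) x t * ((1 - q * q ^ (x + t)) * (1 - q * b₂) *
        (1 - b₁ * b₂ * b₃ * q ^ (x + t + 3)) * (1 - q * b₃) * (1 - b₁ * b₂ * q * (q ^ x) ^ 2) *
          q ^ x) := by
  have hq := h.nr.1
  have n1 := h.nr.one_sub t
  have n4 : 1 - q * (b₁ * b₂) ≠ 0 := (h.n12.mul_left hq).one_sub'
  have e0 : q * (q * (b₁ * b₂)) = q * (b₁ * (q * b₂)) := by ring
  have e1 : qPoch q q (x + (t + 1)) * 1 = qPoch q q (x + t) * (1 - q * q ^ (x + t)) := by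
    rw [mul_one, ← qPoch_succ, add_assoc]
  have e2 : qPoch (q * b₂) q x * (1 - q * b₂ * q ^ x) =
      qPoch (q * (q * b₂)) q x * (1 - q * b₂) := by
    rw [← one_sub_mul_qPoch, mul_comm]
  have e3 : qPoch (b₁ * b₂ * b₃ * q ^ (x + (t + 1) + 2)) q x *
        (1 - b₁ * b₂ * b₃ * q ^ (x + t + 3) * q ^ x) =
      qPoch (b₁ * (q * b₂) * (q * b₃) * q ^ (x + t + 2)) q x *
        (1 - b₁ * b₂ * b₃ * q ^ (x + t + 3)) := by
    rw [show x + (t + 1) + 2 = x + t + 3 by ring, ← one_sub_mul_qPoch, mul_comm]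
    congr 2
    ring
  have e3' := qPoch_succ_left_mul_one (q * b₃) q t
  have e4 : qPoch (q * (b₁ * b₂)) q x * (1 - q * (b₁ * b₂) * q ^ x) =
      qPoch (q * (b₁ * (q * b₂))) q x * (1 - q * (b₁ * b₂)) := by
    rw [← one_sub_mul_qPoch, e0, mul_comm]
  have e5 : (1 - b₁ * b₂ * q * (q ^ x) ^ 2) * (1 - b₁ * b₂ * q * q * (q ^ x) ^ 2) =
      (1 - b₁ * (q * b₂) * q * (q ^ x) ^ 2) * (1 - b₁ * b₂ * q * (q ^ x) ^ 2) := by ring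
  have d1 := Eq.refl (qPoch q q x * 1)
  have d2 := qPoch_succ_mul_one q q t
  have d3 : (q * b₂) ^ x * q ^ x = (q * (q * b₂)) ^ x * 1 := by ring
  have d4 : qPoch (q * (b₁ * b₂)) q (2 * x + (t + 1) + 1) * 1 =
      qPoch (q * (b₁ * (q * b₂))) q (2 * x + t + 1) * (1 - q * (b₁ * b₂)) := by
    rw [show 2 * x + (t + 1) + 1 = 2 * x + t + 1 + 1 by ring, qPoch_succ', e0]
    ring
  have d5 := Eq.refl (qPoch (q * b₁) q x * 1)
  have key : racahWeight q b₁ b₂ b₃ x (t + 1) * _ = racahWeight q b₁ (q * b₂) (q * b₃) x t * _ :=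
    ratio_div (ratio_mul (ratio_mul (ratio_mul (ratio_mul (ratio_mul e1 e2) e3) e3') e4) e5)
    (ratio_mul (ratio_mul (ratio_mul (ratio_mul d1 d2) d3) d4) d5) (by simp [hq])
    (by simp [n1, n4])
  refine mul_right_cancel₀ n4 ?_
  linear_combination (exp := 1) key

theorem racahWeight_step {q b₁ b₂ b₃ : ℂ} (h : Gen3 q b₁ b₂ b₃) (x t : ℕ) :
    racahWeight q b₁ b₂ b₃ (x + 1) t *
        ((1 - q * b₃ * q ^ t) * (1 - b₁ * b₂ * q * (q ^ x) ^ 2) * (1 - q * q ^ x) * (q * b₂) *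
          (1 - q * (b₁ * b₂) * q ^ (2 * x + t + 2)) * (1 - q * b₁ * q ^ x)) =
      racahWeight q b₁ b₂ b₃ x (t + 1) * ((1 - q * b₂ * q ^ x) *
        (1 - b₁ * b₂ * b₃ * q ^ (x + t + 3) * q ^ x) * (1 - q * (b₁ * b₂) * q ^ x) *
          (1 - b₁ * b₂ * q * (q ^ (x + 1)) ^ 2) * (1 - q * q ^ t)) := by
  have hq := h.nr.1
  have n1 := h.nr.one_sub t
  have n2 := h.nr.one_sub x
  have n3 := (h.n1.mul_left hq).one_sub x
  have n4 := (h.n12.mul_left hq).one_sub (2 * x + t + 2)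
  have e1 : qPoch q q (x + 1 + t) * 1 = qPoch q q (x + (t + 1)) * 1 := by
    rw [add_right_comm, add_assoc]
  have e2 := qPoch_succ_mul_one (q * b₂) q x
  have e3 : qPoch (b₁ * b₂ * b₃ * q ^ (x + 1 + t + 2)) q (x + 1) * 1 =
      qPoch (b₁ * b₂ * b₃ * q ^ (x + (t + 1) + 2)) q x *
        (1 - b₁ * b₂ * b₃ * q ^ (x + t + 3) * q ^ x) := by
    rw [show x + (t + 1) + 2 = x + t + 3 by ring, show x + 1 + t + 2 = x + t + 3 by ring,
      mul_one, qPoch_succ]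
  have e3' : qPoch (q * b₃) q t * (1 - q * b₃ * q ^ t) = qPoch (q * b₃) q (t + 1) * 1 := by
    rw [mul_one, qPoch_succ]
  have e4 := qPoch_succ_mul_one (q * (b₁ * b₂)) q x
  have e5 := mul_comm (1 - b₁ * b₂ * q * (q ^ (x + 1)) ^ 2) (1 - b₁ * b₂ * q * (q ^ x) ^ 2)
  have d1 := qPoch_succ_mul_one q q x
  have d2 : qPoch q q t * (1 - q * q ^ t) = qPoch q q (t + 1) * 1 := by
    rw [mul_one, qPoch_succ]
  have d3 : (q * b₂) ^ (x + 1) * 1 = (q * b₂) ^ x * (q * b₂) := by ring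
  have d4 : qPoch (q * (b₁ * b₂)) q (2 * (x + 1) + t + 1) * 1 =
      qPoch (q * (b₁ * b₂)) q (2 * x + (t + 1) + 1) *
        (1 - q * (b₁ * b₂) * q ^ (2 * x + t + 2)) := by
    rw [show 2 * (x + 1) + t + 1 = 2 * x + t + 2 + 1 by ring,
      show 2 * x + (t + 1) + 1 = 2 * x + t + 2 by ring, mul_one, qPoch_succ]
  have d5 := qPoch_succ_mul_one (q * b₁) q x
  have key : racahWeight q b₁ b₂ b₃ (x + 1) t * _ = racahWeight q b₁ b₂ b₃ x (t + 1) * _ :=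
    ratio_div (ratio_mul (ratio_mul (ratio_mul (ratio_mul (ratio_mul e1 e2) e3) e3') e4) e5)
    (ratio_mul (ratio_mul (ratio_mul (ratio_mul d1 d2) d3) d4) d5) (by simp [n1])
    (by simp [n2, n3, n4, hq, h.n2.1])
  linear_combination (exp := 1) key

/-- The first coefficient in `racahPhi_backward`. -/
def backA (q b₁ b₂ b₃ : ℂ) (K x : ℕ) : ℂ :=
  (1 - q * b₂ * q ^ x) * (1 - b₁ * b₂ * b₃ * q ^ (K + 3) * q ^ x) * (q * q ^ K - q ^ x) *
      (1 - b₁ * b₂ * q * q ^ x) /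
    (q ^ x * (1 - b₁ * b₂ * q * (q ^ x) ^ 2) * (1 - q * b₂) *
      (1 - b₁ * b₂ * b₃ * q ^ (K + 3)) * (q * q ^ K - 1))

/-- The second coefficient in `racahPhi_backward`. -/
def backB (q b₁ b₂ b₃ : ℂ) (K x : ℕ) : ℂ :=
  -(q * b₂ * (b₁ * q ^ x - 1) * (q ^ x - b₃ * q * (q * q ^ K)) *
      (b₁ * b₂ * q * q ^ x * (q * q ^ K) - 1) * (q ^ x - 1) /
    (q ^ x * (1 - b₁ * b₂ * q * (q ^ x) ^ 2) * (1 - q * b₂) *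
      (1 - b₁ * b₂ * b₃ * q ^ (K + 3)) * (q * q ^ K - 1)))

theorem racahPhi_backward' {q b₁ b₂ b₃ : ℂ} (h : Gen3 q b₁ b₂ b₃) {n K : ℕ} (x : ℕ)
    (hn : n ≤ K) :
    racahPhi q (n + 1) x b₁ b₂ b₃ (K + 1) =
      backA q b₁ b₂ b₃ K x * racahPhi q n x b₁ (q * b₂) (q * b₃) K +
        backB q b₁ b₂ b₃ K x * racahPhi q n (x - 1) b₁ (q * b₂) (q * b₃) K := by
  rw [racahPhi_backward h x hn, backA, backB, neg_mul, sub_eq_add_neg]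

/-- This value and `backA_last` are the two zeros at the ends of the summation interval. They remove
the boundary terms from every summation by parts below. -/
theorem backB_zero (q b₁ b₂ b₃ : ℂ) (K : ℕ) : backB q b₁ b₂ b₃ K 0 = 0 := by simp [backB]

theorem backA_last (q b₁ b₂ b₃ : ℂ) (K : ℕ) : backA q b₁ b₂ b₃ K (K + 1) = 0 := by
  simp [backA, pow_succ, mul_comm]

theorem racahWeight_mul_backA {q b₁ b₂ b₃ : ℂ} (h : Gen3 q b₁ b₂ b₃) (x t : ℕ) :
    racahWeight q b₁ b₂ b₃ x (t + 1) * backA q b₁ b₂ b₃ (x + t) x =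
      racahWeight q b₁ (q * b₂) (q * b₃) x t *
        (q ^ x * (1 - q * b₃) / (1 - b₁ * b₂ * (q * q ^ x) ^ 2)) := by
  have hq := h.nr.1
  have n0 : q ^ x ≠ 0 := pow_ne_zero _ hq
  have n1 := h.nr.one_sub t
  have n2 : 1 - q * b₂ ≠ 0 := (h.n2.mul_left hq).one_sub'
  have n3 : 1 - b₁ * b₂ * b₃ * q ^ (x + t + 3) ≠ 0 := h.n123.one_sub _
  have n4 := h.n12.one_sub_sq x
  have n5 : 1 - b₁ * b₂ * (q * q ^ x) ^ 2 ≠ 0 :=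
    h.n12.one_sub_of_eq (2 + x * 2 : ℕ) (by rw [zpow_natCast]; ring)
  have n6 : 1 - q * q ^ (x + t) ≠ 0 := h.nr.one_sub _
  have n7 : q * q ^ (x + t) - 1 ≠ 0 := by rw [← neg_sub]; exact neg_ne_zero.2 n6
  have key := racahWeight_shift h x t
  have e : q * q ^ (x + t) - q ^ x = -(q ^ x * (1 - q * q ^ t)) := by ring
  rw [backA, e, ← mul_div_assoc, ← mul_div_assoc, div_eq_div_iff
    (by simp only [mul_ne_zero_iff]; tauto) n5]
  linear_combination -q ^ x * key

/-- The backward shift is in divergence form with respect to the weight: the coefficient of the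
lower neighbour at x + 1 is minus the other coefficient at x. Summation by parts therefore produces
a plain difference. -/
theorem racahWeight_mul_backB {q b₁ b₂ b₃ : ℂ} (h : Gen3 q b₁ b₂ b₃) (x t : ℕ) :
    racahWeight q b₁ b₂ b₃ (x + 1) t * backB q b₁ b₂ b₃ (x + t) (x + 1) =
      -(racahWeight q b₁ b₂ b₃ x (t + 1) * backA q b₁ b₂ b₃ (x + t) x) := by
  have hq := h.nr.1
  have n0 : q ^ x ≠ 0 := pow_ne_zero _ hq
  have n0' : q ^ (x + 1) ≠ 0 := pow_ne_zero _ hq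
  have n1 := h.nr.one_sub t
  have n2 : 1 - q * b₂ ≠ 0 := (h.n2.mul_left hq).one_sub'
  have n3 : 1 - b₁ * b₂ * b₃ * q ^ (x + t + 3) ≠ 0 := h.n123.one_sub _
  have n4 := h.n12.one_sub_sq x
  have n5 := h.n12.one_sub_sq (x + 1)
  have n6 : 1 - q * q ^ (x + t) ≠ 0 := h.nr.one_sub _
  have n7 : q * q ^ (x + t) - 1 ≠ 0 := by rw [← neg_sub]; exact neg_ne_zero.2 n6
  have key := racahWeight_step h x t
  rw [backA, backB, ← mul_div_assoc, mul_neg, ← mul_div_assoc, neg_inj, div_eq_div_iff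
    (by simp only [mul_ne_zero_iff]; tauto) (by simp only [mul_ne_zero_iff]; tauto)]
  have e : q * q ^ (x + t) - q ^ x = -(q ^ x * (1 - q * q ^ t)) := by ring
  have e' : q ^ (x + 1) - b₃ * q * (q * q ^ (x + t)) = q ^ (x + 1) * (1 - q * b₃ * q ^ t) := by
    ring
  have e'' : b₁ * b₂ * q * q ^ (x + 1) * (q * q ^ (x + t)) - 1 =
    -(1 - q * (b₁ * b₂) * q ^ (2 * x + t + 2)) := by ring
  have e3 : b₁ * q ^ (x + 1) - 1 = -(1 - q * b₁ * q ^ x) := by ring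
  have e4 : q ^ (x + 1) - 1 = -(1 - q * q ^ x) := by ring
  have e5 : 1 - b₁ * b₂ * q * q ^ x = 1 - q * (b₁ * b₂) * q ^ x := by ring
  rw [e, e', e'', e3, e4, e5]
  generalize 1 - b₁ * b₂ * b₃ * q ^ (x + t + 3) = u at *
  generalize 1 - q * b₁ * q ^ x = u1 at *
  generalize 1 - q * b₃ * q ^ t = u2 at *
  generalize 1 - q * (b₁ * b₂) * q ^ (2 * x + t + 2) = u3 at *
  generalize 1 - q * q ^ x = u4 at *
  generalize 1 - q * (b₁ * b₂) * q ^ x = u5 at *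
  generalize 1 - b₁ * b₂ * q * (q ^ (x + 1)) ^ 2 = u6 at *
  generalize 1 - b₁ * b₂ * q * (q ^ x) ^ 2 = u7 at *
  generalize q * q ^ (x + t) - 1 = u8 at *
  linear_combination -q ^ x * q ^ (x + 1) * (1 - q * b₂) * u * u8 * key

theorem sum_by_parts (M : ℕ) (w a b G H : ℕ → ℂ) (hb : b 0 = 0) (ha : a (M + 1) = 0)
    (h : ∀ x ≤ M, w (x + 1) * b (x + 1) = -(w x * a x)) :
    ∑ x ∈ range (M + 2), w x * (a x * G x + b x * G (x - 1)) * H x =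
      ∑ x ∈ range (M + 1), w x * a x * G x * (H x - H (x + 1)) := by
  have e : ∀ x, w x * (a x * G x + b x * G (x - 1)) * H x =
      w x * a x * G x * H x + w x * b x * G (x - 1) * H x := fun x => by ring
  rw [sum_congr rfl fun x _ => e x, sum_add_distrib, sum_range_succ _ (M + 1),
    sum_range_succ' _ (M + 1), ha, hb]
  simp only [mul_zero, zero_mul, add_zero]
  rw [← sum_add_distrib]
  refine sum_congr rfl fun x hx => ?_
  rw [h x (Nat.lt_succ_iff.1 (mem_range.1 hx)), Nat.add_sub_cancel]
  ring

/-- The inner product of two `q`-Racah polynomials. -/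
def racahInner (q b₁ b₂ b₃ : ℂ) (n m K : ℕ) : ℂ :=
  ∑ x ∈ range (K + 1), racahWeight q b₁ b₂ b₃ x (K - x) * racahPhi q n x b₁ b₂ b₃ K *
    racahPhi q m x b₁ b₂ b₃ K

theorem racahInner_comm (q b₁ b₂ b₃ : ℂ) (n m K : ℕ) :
    racahInner q b₁ b₂ b₃ n m K = racahInner q b₁ b₂ b₃ m n K :=
  sum_congr rfl fun x _ => by ring

/-- Summation by parts moves the backward shift from the first polynomial to a difference of the
second. For m = 0 that difference vanishes. -/
theorem racahInner_succ_left {q b₁ b₂ b₃ : ℂ} (h : Gen3 q b₁ b₂ b₃) {n m K : ℕ} (hn : n ≤ K) :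
    racahInner q b₁ b₂ b₃ (n + 1) m (K + 1) =
      ∑ x ∈ range (K + 1), racahWeight q b₁ (q * b₂) (q * b₃) x (K - x) *
        (q ^ x * (1 - q * b₃) / (1 - b₁ * b₂ * (q * q ^ x) ^ 2)) *
        racahPhi q n x b₁ (q * b₂) (q * b₃) K *
        (racahPhi q m x b₁ b₂ b₃ (K + 1) - racahPhi q m (x + 1) b₁ b₂ b₃ (K + 1)) := by
  rw [racahInner, sum_congr rfl fun x _ => by rw [racahPhi_backward' h x hn],
    sum_by_parts K (fun x => racahWeight q b₁ b₂ b₃ x (K + 1 - x)) _ _ _ _ (backB_zero _ _ _ _ _)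
      (backA_last _ _ _ _ _)]
  · refine sum_congr rfl fun x hx => ?_
    obtain ⟨t, rfl⟩ := Nat.exists_eq_add_of_le (Nat.lt_succ_iff.1 (mem_range.1 hx))
    rw [show x + t + 1 - x = t + 1 by omega, show x + t - x = t by omega,
      racahWeight_mul_backA h]
  · intro x hx
    obtain ⟨t, rfl⟩ := Nat.exists_eq_add_of_le hx
    rw [show x + t + 1 - x = t + 1 by omega, show x + t + 1 - (x + 1) = t by omega]
    exact racahWeight_mul_backB h x t

theorem racahInner_succ_zero {q b₁ b₂ b₃ : ℂ} (h : Gen3 q b₁ b₂ b₃) {n K : ℕ} (hn : n ≤ K) :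
    racahInner q b₁ b₂ b₃ (n + 1) 0 (K + 1) = 0 := by
  rw [racahInner_succ_left h hn]
  simp [racahPhi_zero_left]

theorem racahInner_succ_succ {q b₁ b₂ b₃ : ℂ} (h : Gen3 q b₁ b₂ b₃) {n m K : ℕ} (hn : n ≤ K) :
    racahInner q b₁ b₂ b₃ (n + 1) (m + 1) (K + 1) =
      (1 - q * b₃) * (q * q ^ m - 1) * (1 - b₂ * b₃ * q * (q * q ^ m)) * q ^ K /
        (q ^ m * (1 - q * b₂) * (1 - b₁ * b₂ * b₃ * q ^ (K + 3)) * (q * q ^ K - 1)) *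
      racahInner q b₁ (q * b₂) (q * b₃) n m K := by
  have hq := h.nr.1
  have n1 : q ^ m ≠ 0 := pow_ne_zero _ hq
  have n2 : 1 - q * b₂ ≠ 0 := (h.n2.mul_left hq).one_sub'
  have n3 : 1 - b₁ * b₂ * b₃ * q ^ (K + 3) ≠ 0 := h.n123.one_sub _
  have n6 : 1 - q * q ^ K ≠ 0 := h.nr.one_sub _
  have n7 : q * q ^ K - 1 ≠ 0 := by rw [← neg_sub]; exact neg_ne_zero.2 n6
  rw [racahInner_succ_left h hn, racahInner, mul_sum]
  refine sum_congr rfl fun x _ => ?_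
  have n0 : q ^ x ≠ 0 := pow_ne_zero _ hq
  have n5 : 1 - b₁ * b₂ * (q * q ^ x) ^ 2 ≠ 0 :=
    h.n12.one_sub_of_eq (2 + x * 2 : ℕ) (by rw [zpow_natCast]; ring)
  -- The forward shift is applied with reversed parameters and with degree and variable exchanged.
  -- By duality it evaluates a difference in x.
  have f := racahPhi_forward h.symm x m K
  rw [racahPhi_symm hq (x + 1), racahPhi_symm hq x, racahPhi_symm hq x] at f
  have f' : racahPhi q (m + 1) x b₁ b₂ b₃ (K + 1) - racahPhi q (m + 1) (x + 1) b₁ b₂ b₃ (K + 1) =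
      (1 - b₁ * b₂ * (q * q ^ x) ^ 2) * ((q * q ^ m - 1) * (1 - b₂ * b₃ * q * (q * q ^ m)) *
          q ^ K) /
        (q ^ x * q ^ m * (1 - q * b₂) * (1 - b₁ * b₂ * b₃ * q ^ (K + 3)) * (q * q ^ K - 1)) *
        racahPhi q m x b₁ (q * b₂) (q * b₃) K := by
    rw [← neg_sub, f, ← neg_mul, ← neg_div]
    congr 1
    rw [show b₃ * b₂ * b₁ = b₁ * b₂ * b₃ by ring, div_eq_div_iff
      (by simp only [mul_ne_zero_iff]; tauto) (by simp only [mul_ne_zero_iff]; tauto)]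
    ring
  rw [f']
  generalize 1 - b₁ * b₂ * (q * q ^ x) ^ 2 = u at *
  generalize 1 - b₁ * b₂ * b₃ * q ^ (K + 3) = v at *
  generalize q * q ^ K - 1 = w at *
  generalize 1 - b₂ * b₃ * q * (q * q ^ m) = z at *
  generalize q * q ^ m - 1 = z' at *
  generalize 1 - q * b₂ = z'' at *
  field_simp

/-- Write 1 = Φ₁ + (1 - Φ₁). The Φ₁ part sums to zero by orthogonality of degrees 1 and 0. By the
forward shift, 1 - Φ₁ supplies the factor that turns the weight into the one for qb₁, qb₂ at the
smaller size. -/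
theorem racahInner_zero_succ {q b₁ b₂ b₃ : ℂ} (h : Gen3 q b₁ b₂ b₃) (K : ℕ) :
    racahInner q b₁ b₂ b₃ 0 0 (K + 1) =
      (1 - b₂ * b₃ * q ^ 2) * q ^ K / (q * b₂ * (1 - q * b₁)) *
      racahInner q (q * b₁) (q * b₂) b₃ 0 0 K := by
  have hq := h.nr.1
  have n2 : 1 - q * b₂ ≠ 0 := (h.n2.mul_left hq).one_sub'
  have n3 : 1 - b₁ * b₂ * b₃ * q ^ (K + 3) ≠ 0 := h.n123.one_sub _
  have n4 : 1 - q * b₁ ≠ 0 := (h.n1.mul_left hq).one_sub'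
  have n6 : 1 - q * q ^ K ≠ 0 := h.nr.one_sub _
  have n7 : q * q ^ K - 1 ≠ 0 := by rw [← neg_sub]; exact neg_ne_zero.2 n6
  have h0 := racahInner_succ_zero h (Nat.zero_le K)
  rw [racahInner, racahInner, mul_sum]
  rw [racahInner] at h0
  rw [sum_range_succ'] at h0 ⊢
  simp only [racahPhi_zero_left, racahPhi_zero_right hq, mul_one, Nat.add_sub_add_right] at h0 ⊢
  have e : ∀ x ∈ range (K + 1), racahWeight q b₁ b₂ b₃ (x + 1) (K - x) =
      racahWeight q b₁ b₂ b₃ (x + 1) (K - x) * racahPhi q (0 + 1) (x + 1) b₁ b₂ b₃ (K + 1) +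
        (1 - b₂ * b₃ * q ^ 2) * q ^ K / (q * b₂ * (1 - q * b₁)) *
          racahWeight q (q * b₁) (q * b₂) b₃ x (K - x) := by
    intro x hx
    obtain ⟨t, rfl⟩ := Nat.exists_eq_add_of_le (Nat.lt_succ_iff.1 (mem_range.1 hx))
    have n0 : q ^ x ≠ 0 := pow_ne_zero _ hq
    have hb₂ := h.n2.1
    have f := racahPhi_forward h 0 x (x + t)
    rw [racahPhi_zero_left, racahPhi_zero_left, sub_eq_iff_eq_add] at f
    have key := racahWeight_succ h x t
    rw [f, show x + t - x = t by omega, mul_one, mul_add, mul_one, add_right_comm,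
      right_eq_add, ← mul_div_assoc, div_mul_eq_mul_div, div_add_div _ _
      (by simp only [mul_ne_zero_iff]; simp [*]) (by simp only [mul_ne_zero_iff]; tauto),
      div_eq_zero_iff]
    left
    have e1 : b₁ * b₂ * q * (q * q ^ x) = q * (b₁ * b₂) * (q * q ^ x) := by ring
    rw [e1]
    generalize 1 - q * (b₁ * b₂) * (q * q ^ x) = u1 at *
    generalize 1 - b₁ * b₂ * b₃ * q ^ (x + t + 3) = u2 at *
    have e2 : q * q ^ x - 1 = -(1 - q * q ^ x) := by ring
    have e3 : q * q ^ (x + t) - 1 = -(1 - q * q ^ (x + t)) := by ring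
    rw [e2, e3]
    generalize 1 - q * q ^ x = u3 at *
    generalize 1 - q * q ^ (x + t) = u4 at *
    generalize 1 - q * b₁ = u5 at *
    linear_combination -(b₂ * b₃ * q ^ 2 - 1) * q * q ^ (x + t) * key
  rw [sum_congr rfl e, sum_add_distrib, add_right_comm, h0, zero_add]

theorem racahWeight_zero {q b₁ b₂ b₃ : ℂ} (h : Gen3 q b₁ b₂ b₃) (K : ℕ) :
    racahWeight q b₁ b₂ b₃ 0 K = qPoch (q * b₃) q K / qPoch (q * (q * (b₁ * b₂))) q K := by
  have h1 := h.nr.qPoch_ne_zero K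
  have h2 : 1 - q * (b₁ * b₂) ≠ 0 := (h.n12.mul_left h.nr.1).one_sub'
  rw [racahWeight, show 2 * 0 + K + 1 = K + 1 by ring, qPoch_succ']
  simp only [qPoch_zero, zero_add, pow_zero, one_pow, mul_one, one_mul]
  rw [show 1 - b₁ * b₂ * q = 1 - q * (b₁ * b₂) by ring]
  generalize 1 - q * (b₁ * b₂) = u at *
  field_simp

theorem racahInner_zero_zero {q b₁ b₂ b₃ : ℂ} (h : Gen3 q b₁ b₂ b₃) (K : ℕ) :
    racahInner q b₁ b₂ b₃ 0 0 K = ((q * b₂) ^ K * racahWeight q b₃ b₂ b₁ 0 K)⁻¹ := by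
  induction K generalizing b₁ b₂ b₃ with
  | zero =>
    rw [racahWeight_zero h.symm, racahInner]
    simp [racahWeight_zero h, racahPhi_zero_left, qPoch_zero]
  | succ K ih =>
    have hq := h.nr.1
    have hb₂ := h.n2.1
    have e : q * (q * (b₃ * (q * b₂))) = q * (q * (q * (b₃ * b₂))) := by ring
    have h1 : 1 - q * b₁ ≠ 0 := (h.n1.mul_left hq).one_sub'
    have hβ : Nz q (b₃ * b₂) := by simpa [mul_comm] using h.n23
    have h2 : 1 - q * (q * (b₃ * b₂)) ≠ 0 := ((hβ.mul_left hq).mul_left hq).one_sub'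
    have h3 : qPoch (q * (q * (q * (b₃ * b₂)))) q K ≠ 0 :=
      (((hβ.mul_left hq).mul_left hq).mul_left hq).qPoch_ne_zero _
    have h4 : qPoch (q * (q * b₁)) q K ≠ 0 := ((h.n1.mul_left hq).mul_left hq).qPoch_ne_zero _
    rw [racahInner_zero_succ h, ih h.shift₁.shift₂, racahWeight_zero h.shift₁.shift₂.symm,
      racahWeight_zero h.symm, qPoch_succ', qPoch_succ' (q * (q * (b₃ * b₂))), e,
      show 1 - b₂ * b₃ * q ^ 2 = 1 - q * (q * (b₃ * b₂)) by ring, mul_pow q (q * b₂), pow_succ]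
    generalize qPoch (q * (q * (q * (b₃ * b₂)))) q K = u at *
    generalize qPoch (q * (q * b₁)) q K = v at *
    generalize 1 - q * (q * (b₃ * b₂)) = w at *
    generalize 1 - q * b₁ = z at *
    field_simp

/-- Orthogonality of the `q`-Racah polynomials. -/
theorem racahInner_eq {q b₁ b₂ b₃ : ℂ} (h : Gen3 q b₁ b₂ b₃) {n m K : ℕ} (hn : n ≤ K)
    (hm : m ≤ K) :
    racahInner q b₁ b₂ b₃ n m K =
      if n = m then ((q * b₂) ^ K * racahWeight q b₃ b₂ b₁ n (K - n))⁻¹ else 0 := by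
  induction K generalizing b₁ b₂ b₃ n m with
  | zero =>
    obtain rfl : n = 0 := by omega
    obtain rfl : m = 0 := by omega
    rw [if_pos rfl, racahInner_zero_zero h]
  | succ K ih =>
    rcases n with _ | n <;> rcases m with _ | m
    · rw [if_pos rfl, racahInner_zero_zero h, Nat.sub_zero]
    · rw [if_neg (by omega), racahInner_comm, racahInner_succ_zero h (by omega)]
    · rw [if_neg (by omega), racahInner_succ_zero h (by omega)]
    · rw [racahInner_succ_succ h (by omega), ih h.shift₂.shift₃ (by omega) (by omega)]
      simp only [Nat.add_right_cancel_iff]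
      split_ifs with hnm
      · subst hnm
        obtain ⟨t, rfl⟩ := Nat.exists_eq_add_of_le (Nat.succ_le_succ_iff.1 hn)
        have hq := h.nr.1
        have hb₂ := h.n2.1
        -- The norm is an inverse weight with reversed parameters, so its recursion is the forward
        -- weight shift read for the reversed parameters.
        have key := racahWeight_succ h.symm n t
        rw [show n + t - n = t by omega, show n + t + 1 - (n + 1) = t by omega]
        have n0 : q ^ n ≠ 0 := pow_ne_zero _ hq
        have n1 := h.nr.one_sub n
        have n2 : 1 - q * b₂ ≠ 0 := (h.n2.mul_left hq).one_sub'
        have n3 : 1 - b₁ * b₂ * b₃ * q ^ (n + t + 3) ≠ 0 := h.n123.one_sub _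
        have n4 : 1 - q * b₃ ≠ 0 := (h.n3.mul_left hq).one_sub'
        have n5 : 1 - q * (b₃ * b₂) * (q * q ^ n) ≠ 0 :=
          h.n23.one_sub_of_eq (2 + n : ℕ) (by rw [zpow_natCast]; ring)
        have n6 : 1 - q * q ^ (n + t) ≠ 0 := h.nr.one_sub _
        rw [show b₃ * b₂ * b₁ = b₁ * b₂ * b₃ by ring] at key
        rw [show 1 - b₂ * b₃ * q * (q * q ^ n) = 1 - q * (b₃ * b₂) * (q * q ^ n) by ring,
          show q * q ^ n - 1 = -(1 - q * q ^ n) by ring,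
          show q * q ^ (n + t) - 1 = -(1 - q * q ^ (n + t)) by ring, mul_pow q (q * b₂),
          pow_succ (q * b₂) (n + t)]
        generalize 1 - q * (b₃ * b₂) * (q * q ^ n) = u1 at *
        generalize 1 - b₁ * b₂ * b₃ * q ^ (n + t + 3) = u2 at *
        generalize 1 - q * q ^ (n + t) = u3 at *
        generalize 1 - q * q ^ n = u4 at *
        generalize 1 - q * b₂ = u5 at *
        generalize 1 - q * b₃ = u6 at *
        have hw : racahWeight q (q * b₃) (q * b₂) b₁ n t =
            racahWeight q b₃ b₂ b₁ (n + 1) t * (u1 * (u4 * (q * b₂) * u6)) /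
              (u3 * u5 * u2 * q ^ n) := by
          rw [eq_div_iff (by simp only [mul_ne_zero_iff]; tauto), key]
        rw [hw]
        generalize (q * b₂) ^ (n + t) = p
        have hp : q ^ (n + t) ≠ 0 := pow_ne_zero _ hq
        generalize q ^ (n + t) = p' at *
        rcases eq_or_ne (racahWeight q b₃ b₂ b₁ (n + 1) t) 0 with h0 | h0
        · simp [h0]
        rcases eq_or_ne p 0 with h1 | h1
        · simp [h1]
        field_simp
      · rw [mul_zero]

/-! ### The Racah relation -/

/-- The ratio of the weight in the Racah relation to the orthogonality weight. -/
def kernelRatio (q c₁ c₂ : ℂ) (x : ℕ) : ℂ :=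
  (-1) ^ x * q ^ x.choose 2 * (q * c₁) ^ x * qPoch (q * c₂) q x / qPoch (q * c₁) q x

/-- The weight in the Racah relation at `x`, for size `x + t`. -/
def kernelWeight (q c₁ c₂ c₃ : ℂ) (x t : ℕ) : ℂ :=
  racahWeight q c₂ c₁ c₃ x t * kernelRatio q c₁ c₂ x

/-- `kernelRatio` cancels precisely the power and the Pochhammer quotient in which c₁ and c₂ enter
the orthogonality weight asymmetrically. As a result the two degrees can be exchanged in the Racah
relation. -/
theorem kernelWeight_symm {q c₁ c₂ c₃ : ℂ} (h : Gen3 q c₁ c₂ c₃) (x t : ℕ) :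
    kernelWeight q c₁ c₂ c₃ x t = kernelWeight q c₂ c₁ c₃ x t := by
  have h1 := (h.n1.mul_left h.nr.1).qPoch_ne_zero x
  have h2 := (h.n2.mul_left h.nr.1).qPoch_ne_zero x
  have hq := h.nr.1
  have hc₁ := h.n1.1
  have hc₂ := h.n2.1
  have h3 : (q * c₁) ^ x ≠ 0 := pow_ne_zero _ (mul_ne_zero hq hc₁)
  have h4 : (q * c₂) ^ x ≠ 0 := pow_ne_zero _ (mul_ne_zero hq hc₂)
  rw [kernelWeight, kernelWeight, racahWeight, racahWeight, kernelRatio, kernelRatio, mul_comm c₂ c₁,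
    ← mul_div_assoc, ← mul_div_assoc, div_mul_eq_mul_div, div_mul_eq_mul_div, div_div, div_div]
  generalize qPoch (q * c₁) q x = u1 at *
  generalize qPoch (q * c₂) q x = u2 at *
  generalize (q * c₁) ^ x = u3 at *
  generalize (q * c₂) ^ x = u4 at *
  generalize qPoch (q * (c₁ * c₂)) q (2 * x + t + 1) = u5
  field_simp

theorem kernelRatio_succ {q c₁ c₂ : ℂ} {x : ℕ} (h : 1 - q * c₁ * q ^ x ≠ 0) :
    kernelRatio q c₁ c₂ (x + 1) * (1 - q * c₁ * q ^ x) =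
      -(kernelRatio q c₁ c₂ x * (q * c₁ * q ^ x * (1 - q * c₂ * q ^ x))) := by
  rw [kernelRatio, kernelRatio, Nat.choose_succ_succ' x 1, Nat.choose_one_right, qPoch_succ,
    qPoch_succ, pow_succ, pow_succ, pow_add]
  generalize 1 - q * c₁ * q ^ x = u at *
  generalize 1 - q * c₂ * q ^ x = v at *
  field_simp

theorem kernelRatio_shift {q c₁ c₂ : ℂ} {x : ℕ} (h0 : 1 - q * c₁ ≠ 0)
    (h : 1 - q * c₁ * q ^ x ≠ 0) :
    kernelRatio q (q * c₁) c₂ x * (1 - q * c₁ * q ^ x) =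
      kernelRatio q c₁ c₂ x * (q ^ x * (1 - q * c₁)) := by
  rw [kernelRatio, kernelRatio, qPoch_mul_left h0, mul_pow q (q * c₁)]
  generalize 1 - q * c₁ * q ^ x = u at *
  generalize 1 - q * c₁ = v at *
  field_simp

theorem kernelRatio_succ_shift {q c₁ c₂ : ℂ} {x : ℕ} (hq : q ≠ 0) (h0 : 1 - q * c₁ ≠ 0) :
    kernelRatio q c₁ c₂ (x + 1) * (1 - q * c₁) =
      -(kernelRatio q (q * c₁) (q * c₂) x * (q * c₁ * (1 - q * c₂))) := by
  rw [kernelRatio, kernelRatio, Nat.choose_succ_succ' x 1, Nat.choose_one_right, qPoch_succ',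
    qPoch_succ', pow_succ, pow_succ, pow_add, mul_pow q (q * c₁)]
  generalize 1 - q * c₁ = u at *
  generalize 1 - q * c₂ = v at *
  field_simp

/-- Against the kernel weight, the backward coefficients at x and x + 1 become, up to a common
factor, the two coefficients on the left of `racahPhi_mixed`. The second one is
`kernelWeight_mul_backB`. -/
theorem kernelWeight_mul_backA {q c₁ c₂ c₃ : ℂ} (h : Gen3 q c₂ c₁ c₃) (x t : ℕ) :
    kernelWeight q c₁ c₂ c₃ x (t + 1) * backA q c₂ c₁ c₃ (x + t) x =
      kernelWeight q (q * c₁) c₂ (q * c₃) x t * ((1 - q * c₃) / (1 - q * c₁) *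
        ((1 - c₁ * q * q ^ x) / (1 - c₁ * c₂ * (q * q ^ x) ^ 2))) := by
  have n1 : 1 - q * c₁ ≠ 0 := (h.n2.mul_left h.nr.1).one_sub'
  have n2 : 1 - q * c₁ * q ^ x ≠ 0 := (h.n2.mul_left h.nr.1).one_sub _
  have key := racahWeight_mul_backA h x t
  have e := kernelRatio_shift (c₂ := c₂) n1 n2
  rw [← eq_div_iff n2] at e
  rw [kernelWeight, kernelWeight, mul_right_comm, key, e, mul_comm c₂ c₁,
    show 1 - c₁ * q * q ^ x = 1 - q * c₁ * q ^ x by ring]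
  generalize 1 - q * c₁ * q ^ x = u at *
  generalize 1 - q * c₁ = v at *
  generalize (1 - c₁ * c₂ * (q * q ^ x) ^ 2) = w
  field_simp

theorem kernelWeight_mul_backB {q c₁ c₂ c₃ : ℂ} (h : Gen3 q c₂ c₁ c₃) (x t : ℕ) :
    kernelWeight q c₁ c₂ c₃ (x + 1) t * backB q c₂ c₁ c₃ (x + t) (x + 1) =
      kernelWeight q (q * c₁) c₂ (q * c₃) x t * ((1 - q * c₃) / (1 - q * c₁) *
        (c₁ * q * q ^ x * (1 - q * c₂ * q ^ x) / (1 - c₁ * c₂ * (q * q ^ x) ^ 2))) := by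
  have n1 : 1 - q * c₁ ≠ 0 := (h.n2.mul_left h.nr.1).one_sub'
  have n2 : 1 - q * c₁ * q ^ x ≠ 0 := (h.n2.mul_left h.nr.1).one_sub _
  have n3 : q ^ x ≠ 0 := pow_ne_zero _ h.nr.1
  have key := racahWeight_mul_backB h x t
  rw [racahWeight_mul_backA h x t] at key
  have e := kernelRatio_shift (c₂ := c₂) n1 n2
  have e' := kernelRatio_succ (c₂ := c₂) n2
  rw [← eq_div_iff n2] at e e'
  rw [kernelWeight, kernelWeight, mul_right_comm, key, e, e', mul_comm c₂ c₁]
  generalize 1 - q * c₁ * q ^ x = u at *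
  generalize 1 - q * c₁ = v at *
  generalize (1 - c₁ * c₂ * (q * q ^ x) ^ 2) = w
  field_simp

/-- The first coefficient in `racahPhi_mixed`. -/
def mixA (q b₁ b₂ b₃ : ℂ) (K i : ℕ) : ℂ :=
  (1 - b₁ * b₂ * b₃ * q ^ (K + 3) * q ^ i) * (q * q ^ K - q ^ i) * (1 - b₂ * b₃ * q * q ^ i) /
    ((1 - b₂ * b₃ * q * (q ^ i) ^ 2) * (1 - b₁ * b₂ * b₃ * q ^ (K + 3)) * (q * q ^ K - 1))

/-- The second coefficient in `racahPhi_mixed`. -/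
def mixB (q b₁ b₂ b₃ : ℂ) (K i : ℕ) : ℂ :=
  -((b₁ * q * (q * q ^ K) - q ^ i) * (1 - b₂ * b₃ * q * q ^ i * (q * q ^ K)) * (q ^ i - 1) /
    (q ^ i * (1 - b₂ * b₃ * q * (q ^ i) ^ 2) * (1 - b₁ * b₂ * b₃ * q ^ (K + 3)) *
      (q * q ^ K - 1)))

theorem racahPhi_mixed' {q b₁ b₂ b₃ : ℂ} (h : Gen3 q b₁ b₂ b₃) (i : ℕ) {a K : ℕ}
    (ha : a ≤ K) :
    (1 - b₁ * q * q ^ a) / (1 - b₁ * b₂ * (q * q ^ a) ^ 2) *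
          racahPhi q i a b₁ b₂ b₃ (K + 1) +
        b₁ * q * q ^ a * (1 - q * b₂ * q ^ a) / (1 - b₁ * b₂ * (q * q ^ a) ^ 2) *
          racahPhi q i (a + 1) b₁ b₂ b₃ (K + 1) =
      mixA q b₁ b₂ b₃ K i * racahPhi q i a (q * b₁) b₂ (q * b₃) K +
        mixB q b₁ b₂ b₃ K i * racahPhi q (i - 1) a (q * b₁) b₂ (q * b₃) K := by
  rw [racahPhi_mixed h i ha, mixA, mixB, neg_mul, ← sub_eq_add_neg]

/-- The left side of the Racah relation. -/
def racahKernel (q c₁ c₂ c₃ : ℂ) (i b K : ℕ) : ℂ :=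
  ∑ a ∈ range (K + 1), kernelWeight q c₁ c₂ c₃ a (K - a) * racahPhi q i a c₁ c₂ c₃ K *
    racahPhi q b a c₂ c₁ c₃ K

theorem racahKernel_symm {q c₁ c₂ c₃ : ℂ} (h : Gen3 q c₁ c₂ c₃) (i b K : ℕ) :
    racahKernel q c₁ c₂ c₃ i b K = racahKernel q c₂ c₁ c₃ b i K :=
  sum_congr rfl fun x _ => by rw [kernelWeight_symm h, mul_right_comm]

/-- Apply the backward shift to the degree b + 1 and reindex the lower neighbour. Then Φ_i(x) and
Φ_i(x+1) stand against the same Φ_b(x), with the weights required by the mixed relation. -/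
theorem racahKernel_succ_right {q c₁ c₂ c₃ : ℂ} (h : Gen3 q c₁ c₂ c₃) (h' : Gen3 q c₂ c₁ c₃)
    (i : ℕ) {b K : ℕ} (hb : b ≤ K) :
    racahKernel q c₁ c₂ c₃ i (b + 1) (K + 1) = (1 - q * c₃) / (1 - q * c₁) *
      (mixA q c₁ c₂ c₃ K i * racahKernel q (q * c₁) c₂ (q * c₃) i b K +
        mixB q c₁ c₂ c₃ K i * racahKernel q (q * c₁) c₂ (q * c₃) (i - 1) b K) := by
  have e : ∀ x, kernelWeight q c₁ c₂ c₃ x (K + 1 - x) * racahPhi q i x c₁ c₂ c₃ (K + 1) *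
      racahPhi q (b + 1) x c₂ c₁ c₃ (K + 1) =
      kernelWeight q c₁ c₂ c₃ x (K + 1 - x) * backA q c₂ c₁ c₃ K x *
        racahPhi q i x c₁ c₂ c₃ (K + 1) * racahPhi q b x c₂ (q * c₁) (q * c₃) K +
      kernelWeight q c₁ c₂ c₃ x (K + 1 - x) * backB q c₂ c₁ c₃ K x *
        racahPhi q i x c₁ c₂ c₃ (K + 1) * racahPhi q b (x - 1) c₂ (q * c₁) (q * c₃) K := by
    intro x
    rw [racahPhi_backward' h' x hb]
    ring
  rw [racahKernel, sum_congr rfl fun x _ => e x, sum_add_distrib, sum_range_succ _ (K + 1),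
    sum_range_succ' _ (K + 1), backA_last, backB_zero]
  simp only [mul_zero, zero_mul, add_zero]
  rw [← sum_add_distrib, racahKernel, racahKernel, mul_sum, mul_sum, ← sum_add_distrib, mul_sum]
  refine sum_congr rfl fun x hx => ?_
  obtain ⟨t, rfl⟩ := Nat.exists_eq_add_of_le (Nat.lt_succ_iff.1 (mem_range.1 hx))
  have key := racahPhi_mixed' h i (Nat.le_add_right x t)
  rw [show x + t + 1 - x = t + 1 by omega, show x + t + 1 - (x + 1) = t by omega,
    show x + t - x = t by omega, kernelWeight_mul_backA h', kernelWeight_mul_backB h',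
    Nat.add_sub_cancel]
  linear_combination kernelWeight q (q * c₁) c₂ (q * c₃) x t * ((1 - q * c₃) / (1 - q * c₁)) *
    racahPhi q b x c₂ (q * c₁) (q * c₃) (x + t) * key

/-- The factors on the right side of the Racah relation. -/
def kernelFactor (q c₂ c₃ : ℂ) (i : ℕ) : ℂ :=
  (-1) ^ i * qPoch (q * c₃) q i / (qPoch (q * c₂) q i * c₃ ^ i * q ^ (i + 1).choose 2)

/-- The constant on the right side of the Racah relation. -/
def kernelConst (q c₃ : ℂ) (K : ℕ) : ℂ := (-1) ^ K * c₃ ^ K * q ^ (K + 1).choose 2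

theorem kernelConst_succ (q c₃ : ℂ) (K : ℕ) :
    kernelConst q c₃ (K + 1) = -(q * q ^ K * c₃ * kernelConst q c₃ K) := by
  rw [kernelConst, kernelConst, Nat.choose_succ_succ' (K + 1) 1, Nat.choose_one_right]
  ring

theorem kernelConst_succ_shift (q c₃ : ℂ) (K : ℕ) :
    kernelConst q c₃ (K + 1) = -(q * c₃ * kernelConst q (q * c₃) K) := by
  rw [kernelConst, kernelConst, Nat.choose_succ_succ' (K + 1) 1, Nat.choose_one_right]
  ring

theorem kernelFactor_zero (q c₂ c₃ : ℂ) : kernelFactor q c₂ c₃ 0 = 1 := by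
  simp [kernelFactor, qPoch_zero]

theorem kernelFactor_shift {q c₂ c₃ : ℂ} (hq : q ≠ 0) (h : 1 - q * c₃ ≠ 0) (i : ℕ) :
    kernelFactor q c₂ (q * c₃) i =
      kernelFactor q c₂ c₃ i * ((1 - q * c₃ * q ^ i) / (q ^ i * (1 - q * c₃))) := by
  rw [kernelFactor, kernelFactor, qPoch_mul_left h, mul_pow q c₃]
  generalize 1 - q * c₃ * q ^ i = u at *
  generalize 1 - q * c₃ = v at *
  field_simp

theorem kernelFactor_succ_shift {q c₂ c₃ : ℂ} (hq : q ≠ 0) (j : ℕ) :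
    kernelFactor q c₂ c₃ (j + 1) = -(kernelFactor q c₂ (q * c₃) j *
      ((1 - q * c₃) / ((1 - q * c₂ * q ^ j) * (q * c₃)))) := by
  rw [kernelFactor, kernelFactor, Nat.choose_succ_succ' (j + 1) 1, Nat.choose_one_right,
    qPoch_succ', qPoch_succ, pow_add q (j + 1), pow_succ (-1 : ℂ), pow_succ c₃,
    mul_pow q c₃, pow_succ q j]
  generalize 1 - q * c₂ * q ^ j = u at *
  generalize 1 - q * c₃ = v at *
  field_simp

theorem kernelFactor_succ_shift' {q c₂ c₃ : ℂ} (hq : q ≠ 0) (j : ℕ) :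
    kernelFactor q c₂ c₃ (j + 1) = -(kernelFactor q (q * c₂) (q * c₃) j *
      ((1 - q * c₃) / ((1 - q * c₂) * (q * c₃)))) := by
  rw [kernelFactor, kernelFactor, Nat.choose_succ_succ' (j + 1) 1, Nat.choose_one_right,
    qPoch_succ', qPoch_succ', pow_add q (j + 1), pow_succ (-1 : ℂ), pow_succ c₃,
    mul_pow q c₃, pow_succ q j]
  generalize 1 - q * c₂ = u at *
  generalize 1 - q * c₃ = v at *
  field_simp

/-- Together with `kernelFactor_mul_backB`: multiplication by `kernelFactor` turns the backward
coefficients of the closed form into the mixed coefficients of the sum. Both sides of the Racah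
relation therefore obey one recursion. -/
theorem kernelFactor_mul_backA {q c₁ c₂ c₃ : ℂ} (hq : q ≠ 0) (h : 1 - q * c₃ ≠ 0) (K i : ℕ) :
    kernelFactor q c₂ c₃ i * backA q c₂ c₃ c₁ K i =
      mixA q c₁ c₂ c₃ K i * kernelFactor q c₂ (q * c₃) i := by
  have h0 : q ^ i ≠ 0 := pow_ne_zero _ hq
  rw [kernelFactor_shift hq h, backA, mixA, show c₂ * c₃ * c₁ = c₁ * c₂ * c₃ by ring]
  generalize 1 - q * c₃ * q ^ i = u at *
  generalize 1 - q * c₃ = v at *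
  generalize 1 - c₁ * c₂ * c₃ * q ^ (K + 3) = w
  generalize 1 - c₁ * c₂ * c₃ * q ^ (K + 3) * q ^ i = w'
  generalize q * q ^ K - q ^ i = w2
  generalize q * q ^ K - 1 = w3
  generalize 1 - c₂ * c₃ * q * (q ^ i) ^ 2 = w4
  field_simp

theorem kernelFactor_mul_backB {q c₁ c₂ c₃ : ℂ} (hq : q ≠ 0) (h : 1 - q * c₃ ≠ 0)
    (hc : c₃ ≠ 0) (K i : ℕ) (h2 : 1 - q * c₂ * q ^ (i - 1) ≠ 0) :
    kernelFactor q c₂ c₃ i * backB q c₂ c₃ c₁ K i =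
      mixB q c₁ c₂ c₃ K i * kernelFactor q c₂ (q * c₃) (i - 1) := by
  rcases i with _ | j
  · simp [backB, mixB]
  rw [Nat.add_sub_cancel] at *
  have h0 : q ^ j ≠ 0 := pow_ne_zero _ hq
  rw [kernelFactor_succ_shift hq, backB, mixB, show c₂ * c₃ * c₁ = c₁ * c₂ * c₃ by ring,
    show c₂ * q ^ (j + 1) - 1 = -(1 - q * c₂ * q ^ j) by ring,
    show c₂ * c₃ * q * q ^ (j + 1) * (q * q ^ K) - 1 =
      -(1 - c₂ * c₃ * q * q ^ (j + 1) * (q * q ^ K)) by ring,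
    show q ^ (j + 1) - c₁ * q * (q * q ^ K) = -(c₁ * q * (q * q ^ K) - q ^ (j + 1)) by ring]
  generalize 1 - q * c₂ * q ^ j = u at *
  generalize 1 - q * c₃ = v at *
  generalize 1 - c₁ * c₂ * c₃ * q ^ (K + 3) = w
  generalize 1 - c₂ * c₃ * q * q ^ (j + 1) * (q * q ^ K) = w'
  generalize c₁ * q * (q * q ^ K) - q ^ (j + 1) = w2
  generalize q * q ^ K - 1 = w3
  generalize 1 - c₂ * c₃ * q * (q ^ (j + 1)) ^ 2 = w4
  generalize q ^ (j + 1) - 1 = w5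
  field_simp

/-- The forward shift between degrees 0 and 1, summed against the kernel weight. It reaches the
corner (0,0), which the ladder in b cannot. -/
theorem racahKernel_zero_succ {q c₁ c₂ c₃ : ℂ} (h : Gen3 q c₁ c₂ c₃) (h' : Gen3 q c₂ c₁ c₃)
    (K : ℕ) :
    racahKernel q c₁ c₂ c₃ 1 0 (K + 1) = racahKernel q c₁ c₂ c₃ 0 0 (K + 1) +
      q ^ K * (1 - c₂ * c₃ * q ^ 2) / (1 - q * c₂) *
        racahKernel q (q * c₁) (q * c₂) c₃ 0 0 K := by
  have hq := h.nr.1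
  rw [racahKernel, racahKernel, sum_range_succ', sum_range_succ' _ (K + 1)]
  simp only [racahPhi_zero_left, racahPhi_zero_right hq, mul_one, Nat.add_sub_add_right]
  rw [racahKernel, mul_sum, add_right_comm, ← sum_add_distrib]
  congr 1
  refine sum_congr rfl fun x hx => ?_
  obtain ⟨t, rfl⟩ := Nat.exists_eq_add_of_le (Nat.lt_succ_iff.1 (mem_range.1 hx))
  have n0 : q ^ x ≠ 0 := pow_ne_zero _ hq
  have hc₁ := h.n1.1
  have f := racahPhi_forward h 0 x (x + t)
  rw [racahPhi_zero_left, racahPhi_zero_left, sub_eq_iff_eq_add] at f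
  have n1 : 1 - q * c₁ ≠ 0 := (h.n1.mul_left hq).one_sub'
  have n2 : 1 - q * c₂ ≠ 0 := (h.n2.mul_left hq).one_sub'
  have n3 : 1 - c₁ * c₂ * c₃ * q ^ (x + t + 3) ≠ 0 := h.n123.one_sub _
  have n6 : 1 - q * q ^ (x + t) ≠ 0 := h.nr.one_sub _
  have n7 : 1 - q * q ^ x ≠ 0 := h.nr.one_sub _
  have n8 : 1 - q * (c₁ * c₂) * (q * q ^ x) ≠ 0 :=
    h.n12.one_sub_of_eq (2 + x : ℕ) (by rw [zpow_natCast]; ring)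
  have key := racahWeight_succ h' x t
  have key' := kernelRatio_succ_shift (x := x) (c₂ := c₂) hq n1
  rw [← eq_div_iff n1] at key'
  rw [show c₂ * c₁ * c₃ = c₁ * c₂ * c₃ by ring, mul_comm c₂ c₁, ← eq_div_iff (by
    simp only [mul_ne_zero_iff]; tauto)] at key
  simp only [racahPhi_zero_left, mul_one] at f ⊢
  rw [show x + t - x = t by omega]
  rw [show racahPhi q 1 (x + 1) c₁ c₂ c₃ (x + t + 1) = _ from f, kernelWeight, kernelWeight, key,
    key', show q * q ^ x - 1 = -(1 - q * q ^ x) by ring,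
    show q * q ^ (x + t) - 1 = -(1 - q * q ^ (x + t)) by ring,
    show c₁ * c₂ * q * (q * q ^ x) = q * (c₁ * c₂) * (q * q ^ x) by ring, pow_zero, mul_one, one_mul]
  generalize 1 - q * c₁ = u1 at *
  generalize 1 - q * c₂ = u2 at *
  generalize 1 - q * q ^ x = u3 at *
  generalize 1 - q * q ^ (x + t) = u4 at *
  generalize 1 - q * (c₁ * c₂) * (q * q ^ x) = u5 at *
  generalize 1 - c₁ * c₂ * c₃ * q ^ (x + t + 3) = u6 at *
  field_simp
  ring

/-- The Racah relation. -/
theorem racahKernel_eq {q c₁ c₂ c₃ : ℂ} (h : Gen3 q c₁ c₂ c₃) (h' : Gen3 q c₂ c₁ c₃) {i b K : ℕ}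
    (hi : i ≤ K) (hb : b ≤ K) :
    racahKernel q c₁ c₂ c₃ i b K = kernelConst q c₃ K * kernelFactor q c₂ c₃ i *
      kernelFactor q c₁ c₃ b * racahPhi q i b c₁ c₃ c₂ K := by
  induction K generalizing c₁ c₂ c₃ i b with
  | zero =>
    obtain rfl : i = 0 := by omega
    obtain rfl : b = 0 := by omega
    simp [racahKernel, kernelWeight, racahWeight_zero h', kernelRatio, racahPhi_zero_left,
      qPoch_zero, kernelConst, kernelFactor_zero]
  | succ K ih =>
    -- The ladder settles every entry with positive second degree. It is stated for all parameters
    -- so that it can also be used with c₁ and c₂ exchanged, which covers b = 0 < i.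
    have main : ∀ {c₁ c₂ c₃ : ℂ}, Gen3 q c₁ c₂ c₃ → Gen3 q c₂ c₁ c₃ → ∀ {i b : ℕ}, i ≤ K + 1 →
        b ≤ K → racahKernel q c₁ c₂ c₃ i (b + 1) (K + 1) =
          kernelConst q c₃ (K + 1) * kernelFactor q c₂ c₃ i * kernelFactor q c₁ c₃ (b + 1) *
            racahPhi q i (b + 1) c₁ c₃ c₂ (K + 1) := by
      intro c₁ c₂ c₃ h h' i b hi hb
      have hq := h.nr.1
      have hc₃ := h.n3.1
      have n1 : 1 - q * c₁ ≠ 0 := (h.n1.mul_left hq).one_sub'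
      have n3 : 1 - q * c₃ ≠ 0 := (h.n3.mul_left hq).one_sub'
      have hh : Gen3 q c₂ c₃ c₁ := ⟨h.nr, h.n2, h.n3, h.n1, h.n23, by
        simpa [mul_comm] using h'.n23, by
        rw [show c₂ * c₃ * c₁ = c₁ * c₂ * c₃ by ring]
        exact h.n123⟩
      have e1 : mixA q c₁ c₂ c₃ K i * racahKernel q (q * c₁) c₂ (q * c₃) i b K =
          mixA q c₁ c₂ c₃ K i * (kernelConst q (q * c₃) K * kernelFactor q c₂ (q * c₃) i *
            kernelFactor q (q * c₁) (q * c₃) b * racahPhi q i b (q * c₁) (q * c₃) c₂ K) := by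
        -- At i = K + 1 the induction hypothesis does not apply, but the coefficient vanishes there.
        rcases Nat.lt_or_ge K i with hK | hK
        · obtain rfl : i = K + 1 := by omega
          have : mixA q c₁ c₂ c₃ K (K + 1) = 0 := by simp [mixA, pow_succ, mul_comm]
          rw [this, zero_mul, zero_mul]
        · rw [ih h.shift₁.shift₃ h'.shift₂.shift₃ hK hb]
      have e2 : mixB q c₁ c₂ c₃ K i * racahKernel q (q * c₁) c₂ (q * c₃) (i - 1) b K =
          mixB q c₁ c₂ c₃ K i * (kernelConst q (q * c₃) K * kernelFactor q c₂ (q * c₃) (i - 1) *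
            kernelFactor q (q * c₁) (q * c₃) b *
              racahPhi q (i - 1) b (q * c₁) (q * c₃) c₂ K) := by
        rcases i with _ | i
        · simp [mixB]
        · rw [ih h.shift₁.shift₃ h'.shift₂.shift₃ (by omega) hb]
      have e3 : kernelConst q c₃ (K + 1) * kernelFactor q c₁ c₃ (b + 1) =
          (1 - q * c₃) / (1 - q * c₁) * kernelConst q (q * c₃) K *
            kernelFactor q (q * c₁) (q * c₃) b := by
        rw [kernelConst_succ_shift, kernelFactor_succ_shift' hq]
        generalize 1 - q * c₁ = u1 at *
        field_simp
      have eA := kernelFactor_mul_backA (c₁ := c₁) (c₂ := c₂) hq n3 K i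
      have eB := kernelFactor_mul_backB (c₁ := c₁) (c₂ := c₂) hq n3 hc₃ K i
        ((h.n2.mul_left hq).one_sub _)
      rw [racahKernel_succ_right h h' i hb, e1, e2, racahPhi_symm hq i (b + 1),
        racahPhi_backward' hh i hb, racahPhi_symm hq i b, racahPhi_symm hq (i - 1) b]
      generalize racahPhi q b i c₂ (q * c₃) (q * c₁) K = F₁
      generalize racahPhi q b (i - 1) c₂ (q * c₃) (q * c₁) K = F₂
      linear_combination (-((1 - q * c₃) / (1 - q * c₁) * kernelConst q (q * c₃) K *
        kernelFactor q (q * c₁) (q * c₃) b)) * (F₁ * eA + F₂ * eB) -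
        kernelFactor q c₂ c₃ i * (backA q c₂ c₃ c₁ K i * F₁ + backB q c₂ c₃ c₁ K i * F₂) * e3
    -- The entry (1,0) is the entry (0,1) for exchanged parameters and hence known.
    -- `racahKernel_zero_succ` is then solved for the entry (0,0).
    have hz : racahKernel q c₁ c₂ c₃ 0 0 (K + 1) = kernelConst q c₃ (K + 1) := by
      have hq := h.nr.1
      have hc₃ := h.n3.1
      have n2 : 1 - q * c₂ ≠ 0 := (h.n2.mul_left hq).one_sub'
      have e := racahKernel_zero_succ h h' K
      rw [racahKernel_symm h, main h' h (Nat.zero_le _) (Nat.zero_le _), racahPhi_zero_left,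
        kernelFactor_zero, kernelFactor_succ_shift' hq, kernelFactor_zero,
        ih h.shift₁.shift₂ h'.shift₁.shift₂ (Nat.zero_le _) (Nat.zero_le _), kernelFactor_zero,
        kernelFactor_zero, racahPhi_zero_left, ← sub_eq_iff_eq_add] at e
      rw [← e, kernelConst_succ]
      field_simp
      ring
    rcases b with _ | b
    · rcases i with _ | i
      · rw [hz, kernelFactor_zero, kernelFactor_zero, racahPhi_zero_left, mul_one, mul_one, mul_one]
      · rw [racahKernel_symm h, main h' h (by omega) (by omega), racahPhi_symm h.nr.1]
        ring
    · exact main h h' hi (by omega)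

/-! ### The pentagon relation: parameters and summation weight -/

section

theorem Nz.of_mul_eq_one {q c e : ℂ} (hq : q ≠ 0) (h : Nz q c) (k : ℤ) (he : c * e * q ^ k = 1) :
    Nz q e := by
  refine ⟨by rintro rfl; simp at he, fun m hm => h.2 (k - m) ?_⟩
  rw [zpow_sub₀ hq, ← he, ← mul_div_assoc, div_eq_iff (zpow_ne_zero _ hq)]
  linear_combination -(c * q ^ k) * hm

/-- Genericity of the five cyclically ordered parameters of the pentagon relation. -/
structure Gen5 (q d₁ d₂ d₃ d₄ d₅ : ℂ) (N : ℕ) : Prop where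
  nr : Nr q
  con : q ^ (2 * N + 3) * d₁ * d₂ * d₃ * d₄ * d₅ = 1
  n1 : Nz q d₁
  n2 : Nz q d₂
  n3 : Nz q d₃
  n4 : Nz q d₄
  n5 : Nz q d₅
  n12 : Nz q (d₁ * d₂)
  n23 : Nz q (d₂ * d₃)
  n34 : Nz q (d₃ * d₄)
  n45 : Nz q (d₄ * d₅)
  n51 : Nz q (d₅ * d₁)

variable {q d₁ d₂ d₃ d₄ d₅ : ℂ} {N : ℕ}

theorem Gen5.n15 (h : Gen5 q d₁ d₂ d₃ d₄ d₅ N) : Nz q (d₁ * d₅) :=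
  mul_comm d₅ d₁ ▸ h.n51

/-- Rotation and reflection of the pentagon preserve the hypotheses, so a statement about one
adjacent triple yields all of them. -/
theorem Gen5.rot (h : Gen5 q d₁ d₂ d₃ d₄ d₅ N) : Gen5 q d₂ d₃ d₄ d₅ d₁ N :=
  ⟨h.nr, by rw [← h.con]; ring, h.n2, h.n3, h.n4, h.n5, h.n1, h.n23, h.n34, h.n45, h.n51, h.n12⟩

theorem Gen5.mirror (h : Gen5 q d₁ d₂ d₃ d₄ d₅ N) : Gen5 q d₄ d₃ d₂ d₁ d₅ N :=
  ⟨h.nr, by rw [← h.con]; ring, h.n4, h.n3, h.n2, h.n1, h.n5, by simpa [mul_comm] using h.n34,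
    by simpa [mul_comm] using h.n23, by simpa [mul_comm] using h.n12,
    by simpa [mul_comm] using h.n51, by simpa [mul_comm] using h.n45⟩

/-- By the constraint, a product of three adjacent parameters is, up to a power of q, inverse to the
product of the other two. Its genericity need not be assumed separately. -/
theorem Gen5.gen3 (h : Gen5 q d₁ d₂ d₃ d₄ d₅ N) : Gen3 q d₁ d₂ d₃ :=
  ⟨h.nr, h.n1, h.n2, h.n3, h.n12, h.n23, h.n45.of_mul_eq_one h.nr.1 (2 * N + 3 : ℕ) (by
    rw [zpow_natCast, ← h.con]
    ring)⟩

/-- Raising two parameters by q compensates in the constraint for the drop of q^(2N+3) when N is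
lowered. -/
theorem Gen5.shift (h : Gen5 q d₁ d₂ d₃ d₄ d₅ (N + 1)) : Gen5 q (q * d₁) (q * d₂) d₃ d₄ d₅ N :=
  ⟨h.nr, by rw [← h.con]; ring, h.n1.mul_left h.nr.1, h.n2.mul_left h.nr.1, h.n3, h.n4, h.n5,
    by
      rw [show q * d₁ * (q * d₂) = q * (q * (d₁ * d₂)) by ring]
      exact (h.n12.mul_left h.nr.1).mul_left h.nr.1,
    by
      rw [mul_assoc]
      exact h.n23.mul_left h.nr.1,
    h.n34, h.n45, by
      rw [show d₅ * (q * d₁) = q * (d₅ * d₁) by ring]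
      exact h.n51.mul_left h.nr.1⟩

theorem Gen5.shift₁₅ (h : Gen5 q d₁ d₂ d₃ d₄ d₅ (N + 1)) :
    Gen5 q (q * d₁) d₂ d₃ d₄ (q * d₅) N :=
  h.rot.rot.rot.rot.shift.rot

theorem Gen5.shift₂₃ (h : Gen5 q d₁ d₂ d₃ d₄ d₅ (N + 1)) :
    Gen5 q d₁ (q * d₂) (q * d₃) d₄ d₅ N :=
  h.rot.shift.rot.rot.rot.rot

/-- The summation weight in the pentagon relation, for `N = x + y + t = x + b + s`. -/
def pentWeight (q d₁ D d₄ d₅ : ℂ) (x y t b s : ℕ) : ℂ :=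
  (-1) ^ x * q ^ x.choose 2 * (qPoch q q (y + t) * qPoch (q * D) q (2 * x + y + t + 1) *
    qPoch (q * D) q x * (1 - D * q * (q ^ x) ^ 2) * qPoch (q * d₄) q s * qPoch (q * d₁) q t) /
  ((q ^ (b + y + 1) * d₅) ^ x * qPoch q q x * qPoch q q s * qPoch q q t *
    qPoch (q * D) q (2 * x + t + 1) * qPoch (q * D) q (2 * x + s + 1) *
    qPoch (q * (d₁ * d₅)) q (2 * b + s + 1) * qPoch (q * (d₄ * d₅)) q (2 * y + t + 1))

/-- The weight of the pentagon relation, extended by zero. -/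
def pentV (q d₁ D d₄ d₅ : ℂ) (N x y b : ℕ) : ℂ :=
  if x + y ≤ N ∧ x + b ≤ N then pentWeight q d₁ D d₄ d₅ x y (N - x - y) b (N - x - b) else 0

theorem pentWeight_shift_left (h : Gen5 q d₁ d₂ d₃ d₄ d₅ (N + 1)) (x y t b s : ℕ) :
    pentWeight q d₁ (d₂ * d₃) d₄ d₅ x y (t + 1) (b + 1) s *
        ((1 - q * q ^ t) * (1 - q * (d₂ * d₃) * q ^ (2 * x + t + 1)) *
        ((1 - q * (d₁ * d₅)) * (1 - q * (q * (d₁ * d₅))) * (1 - q * (d₄ * d₅)))) =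
      pentWeight q (q * d₁) (d₂ * d₃) d₄ (q * d₅) x y t b s *
        ((1 - q * q ^ (y + t)) * (1 - q * (d₂ * d₃) * q ^ (2 * x + y + t + 1)) * (1 - q * d₁)) := by
  have hq := h.nr.1
  have n1 := h.nr.one_sub t
  have n2 := (h.n23.mul_left hq).one_sub (2 * x + t + 1)
  have h15 := h.n15
  have n3 := (h15.mul_left hq).one_sub'
  have n4 := ((h15.mul_left hq).mul_left hq).one_sub'
  have n5 := (h.n45.mul_left hq).one_sub'
  have e0 := Eq.refl (((-1 : ℂ) ^ x * q ^ x.choose 2) * 1)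
  have e1 : qPoch q q (y + (t + 1)) * 1 = qPoch q q (y + t) * (1 - q * q ^ (y + t)) := by
    rw [mul_one, ← qPoch_succ, add_assoc]
  have e2 : qPoch (q * (d₂ * d₃)) q (2 * x + y + (t + 1) + 1) * 1 =
      qPoch (q * (d₂ * d₃)) q (2 * x + y + t + 1) *
        (1 - q * (d₂ * d₃) * q ^ (2 * x + y + t + 1)) := by
    rw [mul_one, ← qPoch_succ, ← add_assoc]
  have e3 := Eq.refl (qPoch (q * (d₂ * d₃)) q x * 1)
  have e4 := Eq.refl ((1 - d₂ * d₃ * q * (q ^ x) ^ 2) * 1)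
  have e5 := Eq.refl (qPoch (q * d₄) q s * 1)
  have e6 := qPoch_succ_left_mul_one (q * d₁) q t
  have f1 : (q ^ (b + 1 + y + 1) * d₅) ^ x * 1 = (q ^ (b + y + 1) * (q * d₅)) ^ x * 1 := by
    congr 2
    ring
  have f2 := Eq.refl (qPoch q q x * 1)
  have f3 := Eq.refl (qPoch q q s * 1)
  have f4 := qPoch_succ_mul_one q q t
  have f5 : qPoch (q * (d₂ * d₃)) q (2 * x + (t + 1) + 1) * 1 =
      qPoch (q * (d₂ * d₃)) q (2 * x + t + 1) * (1 - q * (d₂ * d₃) * q ^ (2 * x + t + 1)) := by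
    rw [mul_one, ← qPoch_succ, ← add_assoc]
  have f6 := Eq.refl (qPoch (q * (d₂ * d₃)) q (2 * x + s + 1) * 1)
  have f7 : qPoch (q * (d₁ * d₅)) q (2 * (b + 1) + s + 1) * 1 =
      qPoch (q * (q * d₁ * (q * d₅))) q (2 * b + s + 1) *
        ((1 - q * (d₁ * d₅)) * (1 - q * (q * (d₁ * d₅)))) := by
    rw [show 2 * (b + 1) + s + 1 = 2 * b + s + 1 + 1 + 1 by ring, qPoch_succ', qPoch_succ',
      show q * (q * (q * (d₁ * d₅))) = q * (q * d₁ * (q * d₅)) by ring]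
    ring
  have f8 : qPoch (q * (d₄ * d₅)) q (2 * y + (t + 1) + 1) * 1 =
      qPoch (q * (d₄ * (q * d₅))) q (2 * y + t + 1) * (1 - q * (d₄ * d₅)) := by
    rw [← add_assoc, qPoch_succ', show q * (q * (d₄ * d₅)) = q * (d₄ * (q * d₅)) by ring]
    ring
  have key : pentWeight q d₁ (d₂ * d₃) d₄ d₅ x y (t + 1) (b + 1) s * _ =
      pentWeight q (q * d₁) (d₂ * d₃) d₄ (q * d₅) x y t b s * _ :=
    ratio_div (ratio_mul e0 (ratio_mul (ratio_mul (ratio_mul (ratio_mul (ratio_mul e1 e2) e3) e4)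
      e5) e6)) (ratio_mul (ratio_mul (ratio_mul (ratio_mul (ratio_mul (ratio_mul (ratio_mul
        f1 f2) f3) f4) f5) f6) f7) f8) (by simp)
      (by simp only [mul_ne_zero_iff, one_mul, ne_eq, one_ne_zero, not_false_eq_true]; tauto)
  linear_combination (exp := 1) key

end

section

variable {q d₁ d₂ d₃ d₄ d₅ : ℂ} {N : ℕ}

theorem pentWeight_shift_right (h : Gen5 q d₁ d₂ d₃ d₄ d₅ (N + 1)) (x y t b s : ℕ) :
    pentWeight q d₁ (d₂ * d₃) d₄ d₅ x (y + 1) t (b + 1) s *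
        ((1 - q * d₁ * q ^ t) * (1 - q * (q * (d₄ * d₅)) * q ^ (2 * y + t + 1)) * q ^ x *
        ((1 - q * (d₁ * d₅)) * (1 - q * (q * (d₁ * d₅))) * (1 - q * (d₄ * d₅)))) =
      pentWeight q (q * d₁) (d₂ * d₃) d₄ (q * d₅) x y t b s *
        ((1 - q * q ^ (y + t)) * (1 - q * (d₂ * d₃) * q ^ (2 * x + y + t + 1)) * (1 - q * d₁)) := by
  have hq := h.nr.1
  have n1 := ((h.n45.mul_left hq).mul_left hq).one_sub (2 * y + t + 1)
  have n2 : q ^ x ≠ 0 := pow_ne_zero _ hq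
  have h15 := h.n15
  have n3 := (h15.mul_left hq).one_sub'
  have n4 := ((h15.mul_left hq).mul_left hq).one_sub'
  have n5 := (h.n45.mul_left hq).one_sub'
  have e0 := Eq.refl (((-1 : ℂ) ^ x * q ^ x.choose 2) * 1)
  have e1 : qPoch q q (y + 1 + t) * 1 = qPoch q q (y + t) * (1 - q * q ^ (y + t)) := by
    rw [mul_one, ← qPoch_succ, add_right_comm]
  have e2 : qPoch (q * (d₂ * d₃)) q (2 * x + (y + 1) + t + 1) * 1 =
      qPoch (q * (d₂ * d₃)) q (2 * x + y + t + 1) *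
        (1 - q * (d₂ * d₃) * q ^ (2 * x + y + t + 1)) := by
    rw [mul_one, ← qPoch_succ]
    congr 1
    ring
  have e3 := Eq.refl (qPoch (q * (d₂ * d₃)) q x * 1)
  have e4 := Eq.refl ((1 - d₂ * d₃ * q * (q ^ x) ^ 2) * 1)
  have e5 := Eq.refl (qPoch (q * d₄) q s * 1)
  have e6 := qPoch_mul_one_sub (q * d₁) q t
  have f1 : (q ^ (b + 1 + (y + 1) + 1) * d₅) ^ x * 1 =
      (q ^ (b + y + 1) * (q * d₅)) ^ x * q ^ x := by
    rw [← mul_pow, mul_one]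
    congr 1
    ring
  have f2 := Eq.refl (qPoch q q x * 1)
  have f3 := Eq.refl (qPoch q q s * 1)
  have f4 := Eq.refl (qPoch q q t * 1)
  have f5 := Eq.refl (qPoch (q * (d₂ * d₃)) q (2 * x + t + 1) * 1)
  have f6 := Eq.refl (qPoch (q * (d₂ * d₃)) q (2 * x + s + 1) * 1)
  have f7 : qPoch (q * (d₁ * d₅)) q (2 * (b + 1) + s + 1) * 1 =
      qPoch (q * (q * d₁ * (q * d₅))) q (2 * b + s + 1) *
        ((1 - q * (d₁ * d₅)) * (1 - q * (q * (d₁ * d₅)))) := by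
    rw [show 2 * (b + 1) + s + 1 = 2 * b + s + 1 + 1 + 1 by ring, qPoch_succ', qPoch_succ',
      show q * (q * (q * (d₁ * d₅))) = q * (q * d₁ * (q * d₅)) by ring]
    ring
  have f8 : qPoch (q * (d₄ * d₅)) q (2 * (y + 1) + t + 1) * 1 =
      qPoch (q * (d₄ * (q * d₅))) q (2 * y + t + 1) * ((1 - q * (d₄ * d₅)) *
        (1 - q * (q * (d₄ * d₅)) * q ^ (2 * y + t + 1))) := by
    rw [show 2 * (y + 1) + t + 1 = 2 * y + t + 1 + 1 + 1 by ring, qPoch_succ', qPoch_succ,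
      show q * (d₄ * (q * d₅)) = q * (q * (d₄ * d₅)) by ring]
    ring
  have key : pentWeight q d₁ (d₂ * d₃) d₄ d₅ x (y + 1) t (b + 1) s * _ =
      pentWeight q (q * d₁) (d₂ * d₃) d₄ (q * d₅) x y t b s * _ :=
    ratio_div (ratio_mul e0 (ratio_mul (ratio_mul (ratio_mul (ratio_mul (ratio_mul e1 e2) e3) e4)
      e5) e6)) (ratio_mul (ratio_mul (ratio_mul (ratio_mul (ratio_mul (ratio_mul (ratio_mul
        f1 f2) f3) f4) f5) f6) f7) f8) (by simp)
      (by simp only [mul_ne_zero_iff, one_mul, ne_eq, one_ne_zero, not_false_eq_true]; tauto)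
  linear_combination (exp := 1) key

theorem one_sub_inv_eq {w z : ℂ} (hw : w ≠ 0) (e : z = w) : 1 - w⁻¹ = -((1 - z) / w) := by
  rw [e]
  field_simp
  ring

theorem one_sub_inv_mul_eq {w z Y : ℂ} (hw : w ≠ 0) (e : w = z * Y) :
    1 - w⁻¹ * Y = -(Y * (1 - z) / w) := by
  field_simp
  linear_combination e

/-- The coefficient of the first kind in the reduction of the pentagon sum. -/
def pentG (q d₁ d₄ d₅ : ℂ) (y : ℕ) : ℂ :=
  (1 - q * d₁) / ((1 - q * (d₁ * d₅)) * (1 - q * (q * (d₁ * d₅))) * (1 - q * (d₄ * d₅))) *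
    (q ^ y * (1 - q * d₅ * q ^ y) * (1 - d₄ * d₅ * q * q ^ y) /
      ((1 - d₄ * d₅ * q * (q ^ y) ^ 2) * (1 - q * d₅)))

/-- The coefficient of the second kind in the reduction of the pentagon sum. -/
def pentG' (q d₁ D d₄ d₅ : ℂ) (N y : ℕ) : ℂ :=
  (1 - q * d₁) / ((1 - q * (d₁ * d₅)) * (1 - q * (q * (d₁ * d₅))) * (1 - q * (d₄ * d₅))) *
    (q * d₅ * (d₄ * q ^ y - 1) * (q ^ y - 1) * D * q ^ (N + 2) /
      ((1 - d₄ * d₅ * q * (q ^ y) ^ 2) * (1 - q * d₅)))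

/-- The triple product in the backward coefficient becomes the inverse of the complementary pair, so
its factors cancel against the Pochhammer symbols of D = d₂d₃ in the weight. -/
theorem Gen5.one_sub_eq (h : Gen5 q d₁ d₂ d₃ d₄ d₅ (N + 1)) (k m : ℕ) (hk : k + m = 2 * N + 5) :
    d₄ * d₅ * d₁ * q ^ k = (d₂ * d₃ * q ^ m)⁻¹ := by
  refine eq_inv_of_mul_eq_one_left ?_
  rw [← h.con, show 2 * (N + 1) + 3 = k + m by omega]
  ring

/-- The weight ratio cancels all dependence on x in the backward coefficient. What remains depends
on y alone and can be taken out of the sum over x. The same happens in `pentV_mul_backB`. -/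
theorem pentV_mul_backA (h : Gen5 q d₁ d₂ d₃ d₄ d₅ (N + 1)) {x : ℕ} (hx : x ≤ N) (y b : ℕ) :
    pentV q d₁ (d₂ * d₃) d₄ d₅ (N + 1) x y (b + 1) * backA q d₄ d₅ d₁ (N - x) y =
      pentV q (q * d₁) (d₂ * d₃) d₄ (q * d₅) N x y b * pentG q d₁ d₄ d₅ y := by
  by_cases hb : x + b ≤ N
  swap
  · rw [pentV, pentV, if_neg (by omega), if_neg (by omega), zero_mul, zero_mul]
  rcases lt_trichotomy (x + y) (N + 1) with hy | hy | hy
  · obtain ⟨t, ht⟩ := Nat.exists_eq_add_of_le (show x + y ≤ N by omega)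
    obtain ⟨s, hs⟩ := Nat.exists_eq_add_of_le hb
    rw [pentV, pentV, if_pos (by omega), if_pos (by omega), show N + 1 - x - y = t + 1 by omega,
      show N + 1 - x - (b + 1) = s by omega, show N - x - y = t by omega,
      show N - x - b = s by omega, show N - x = y + t by omega]
    have hq := h.nr.1
    have key := pentWeight_shift_left h x y t b s
    have eG := h.one_sub_eq (y + t + 3) (2 * x + y + t + 2) (by omega)
    have h15 := h.n15
    have n0 : q ^ y ≠ 0 := pow_ne_zero _ hq
    have n1 := h.nr.one_sub t
    have n2 := (h.n23.mul_left hq).one_sub (2 * x + t + 1)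
    have n3 := (h15.mul_left hq).one_sub'
    have n4 := ((h15.mul_left hq).mul_left hq).one_sub'
    have n5 := (h.n45.mul_left hq).one_sub'
    have n6 := (h.n5.mul_left hq).one_sub'
    have n7 := (h.n23.mul_left hq).one_sub (2 * x + y + t + 1)
    have n8 := h.nr.one_sub (y + t)
    have n9 := h.n45.one_sub_sq y
    have hD : d₂ * d₃ * q ^ (2 * x + y + t + 2) ≠ 0 := mul_ne_zero h.n23.1 (pow_ne_zero _ hq)
    have e1 : 1 - (d₂ * d₃ * q ^ (2 * x + y + t + 2))⁻¹ =
        -((1 - q * (d₂ * d₃) * q ^ (2 * x + y + t + 1)) /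
          (d₂ * d₃ * q ^ (2 * x + y + t + 2))) :=
      one_sub_inv_eq hD (by ring)
    have e2 : 1 - (d₂ * d₃ * q ^ (2 * x + y + t + 2))⁻¹ * q ^ y =
        -(q ^ y * (1 - q * (d₂ * d₃) * q ^ (2 * x + t + 1)) /
          (d₂ * d₃ * q ^ (2 * x + y + t + 2))) :=
      one_sub_inv_mul_eq hD (by ring)
    have e3 : q * q ^ (y + t) - q ^ y = -(q ^ y * (1 - q * q ^ t)) := by ring
    have e4 : q * q ^ (y + t) - 1 = -(1 - q * q ^ (y + t)) := by ring
    rw [backA, pentG, eG, e1, e2, e3, e4]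
    rw [← eq_div_iff (by simp only [mul_ne_zero_iff]; tauto)] at key
    rw [key]
    generalize pentWeight q (q * d₁) (d₂ * d₃) d₄ (q * d₅) x y t b s = v
    generalize 1 - q * (d₂ * d₃) * q ^ (2 * x + y + t + 1) = u1 at *
    generalize 1 - q * (d₂ * d₃) * q ^ (2 * x + t + 1) = u2 at *
    generalize 1 - q * q ^ t = u3 at *
    generalize 1 - q * q ^ (y + t) = u4 at *
    generalize 1 - q * (d₁ * d₅) = u5 at *
    generalize 1 - q * (q * (d₁ * d₅)) = u6 at *
    generalize 1 - q * (d₄ * d₅) = u7 at *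
    generalize 1 - q * d₅ = u8 at *
    generalize 1 - d₄ * d₅ * q * (q ^ y) ^ 2 = u9 at *
    generalize d₂ * d₃ * q ^ (2 * x + y + t + 2) = u10 at *
    field_simp
  -- The edge where only the larger support contains the point. The backward coefficient vanishes
  -- there.
  · obtain rfl : y = N - x + 1 := by omega
    rw [backA_last, mul_zero, pentV, if_neg (by omega), zero_mul]
  · rw [pentV, pentV, if_neg (by omega), if_neg (by omega), zero_mul, zero_mul]

theorem pentV_mul_backB (h : Gen5 q d₁ d₂ d₃ d₄ d₅ (N + 1)) {x : ℕ} (hx : x ≤ N) (y b : ℕ) :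
    pentV q d₁ (d₂ * d₃) d₄ d₅ (N + 1) x y (b + 1) * backB q d₄ d₅ d₁ (N - x) y =
      pentV q (q * d₁) (d₂ * d₃) d₄ (q * d₅) N x (y - 1) b *
        pentG' q d₁ (d₂ * d₃) d₄ d₅ N y := by
  rcases y with _ | y
  · simp [backB_zero, pentG']
  rw [Nat.add_sub_cancel]
  by_cases hb : x + b ≤ N
  swap
  · rw [pentV, pentV, if_neg (by omega), if_neg (by omega), zero_mul, zero_mul]
  by_cases hy : x + y ≤ N
  swap
  · rw [pentV, pentV, if_neg (by omega), if_neg (by omega), zero_mul, zero_mul]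
  obtain ⟨t, ht⟩ := Nat.exists_eq_add_of_le hy
  obtain ⟨s, hs⟩ := Nat.exists_eq_add_of_le hb
  rw [pentV, pentV, if_pos (by omega), if_pos (by omega), show N + 1 - x - (y + 1) = t by omega,
    show N + 1 - x - (b + 1) = s by omega, show N - x - y = t by omega,
    show N - x - b = s by omega, show N - x = y + t by omega]
  have hq := h.nr.1
  have key := pentWeight_shift_right h x y t b s
  have eG := h.one_sub_eq (y + t + 3) (2 * x + y + t + 2) (by omega)
  have h15 := h.n15
  have n0 : q ^ (y + 1) ≠ 0 := pow_ne_zero _ hq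
  have n0' : q ^ x ≠ 0 := pow_ne_zero _ hq
  have n1 := (h.n1.mul_left hq).one_sub t
  have n2 := ((h.n45.mul_left hq).mul_left hq).one_sub (2 * y + t + 1)
  have n3 := (h15.mul_left hq).one_sub'
  have n4 := ((h15.mul_left hq).mul_left hq).one_sub'
  have n5 := (h.n45.mul_left hq).one_sub'
  have n6 := (h.n5.mul_left hq).one_sub'
  have n7 := (h.n23.mul_left hq).one_sub (2 * x + y + t + 1)
  have n8 := h.nr.one_sub (y + t)
  have n9 := h.n45.one_sub_sq (y + 1)
  have hD : d₂ * d₃ * q ^ (2 * x + y + t + 2) ≠ 0 := mul_ne_zero h.n23.1 (pow_ne_zero _ hq)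
  have e1 : 1 - (d₂ * d₃ * q ^ (2 * x + y + t + 2))⁻¹ =
      -((1 - q * (d₂ * d₃) * q ^ (2 * x + y + t + 1)) /
        (d₂ * d₃ * q ^ (2 * x + y + t + 2))) :=
    one_sub_inv_eq hD (by ring)
  have e2 : d₄ * d₅ * q * q ^ (y + 1) * (q * q ^ (y + t)) - 1 =
      -(1 - q * (q * (d₄ * d₅)) * q ^ (2 * y + t + 1)) := by ring
  have e3 : q ^ (y + 1) - d₁ * q * (q * q ^ (y + t)) = q ^ (y + 1) * (1 - q * d₁ * q ^ t) := by
    ring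
  have e4 : q * q ^ (y + t) - 1 = -(1 - q * q ^ (y + t)) := by ring
  have e5 : d₂ * d₃ * q ^ (N + 2) = d₂ * d₃ * q ^ (2 * x + y + t + 2) / q ^ x := by
    rw [eq_div_iff n0', ht]
    ring
  rw [backB, pentG', mul_assoc _ (d₂ * d₃), e5, eG, e1, e2, e3, e4]
  rw [← eq_div_iff (by simp only [mul_ne_zero_iff]; tauto)] at key
  rw [key]
  generalize pentWeight q (q * d₁) (d₂ * d₃) d₄ (q * d₅) x y t b s = v
  generalize 1 - q * (d₂ * d₃) * q ^ (2 * x + y + t + 1) = u1 at *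
  generalize 1 - q * (q * (d₄ * d₅)) * q ^ (2 * y + t + 1) = u2 at *
  generalize 1 - q * d₁ * q ^ t = u3 at *
  generalize 1 - q * q ^ (y + t) = u4 at *
  generalize 1 - q * (d₁ * d₅) = u5 at *
  generalize 1 - q * (q * (d₁ * d₅)) = u6 at *
  generalize 1 - q * (d₄ * d₅) = u7 at *
  generalize 1 - q * d₅ = u8 at *
  generalize 1 - d₄ * d₅ * q * (q ^ (y + 1)) ^ 2 = u9 at *
  generalize d₂ * d₃ * q ^ (2 * x + y + t + 2) = u10 at *
  generalize d₄ * q ^ (y + 1) - 1 = u11 at *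
  generalize q ^ (y + 1) - 1 = u12 at *
  field_simp

end

/-! ### The pentagon relation: factors of the product side -/

section

variable {q d₁ d₂ d₃ d₄ d₅ : ℂ} {N : ℕ}

/-- The part of the pentagon factor that depends on `a` and `l`, for `N = a + l + m`. -/
def pentWa (q d₁ d₂ d₃ d₄ d₅ : ℂ) (N a l m : ℕ) : ℂ :=
  (q ^ (N + 1) * d₁ * d₄) ^ N * (q ^ (N + 1) * d₂ * d₅) ^ a * (q ^ (N + 1) * d₃ * d₅) ^ l *
    (qPoch q q (l + m) * qPoch q q (a + m) * qPoch (q * d₅) q m * qPoch (q * d₁) q a *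
      qPoch (q * d₄) q l * qPoch (q * (d₁ * d₂)) q (2 * a + l + m + 1) *
      qPoch (q * (d₃ * d₄)) q (2 * l + a + m + 1)) /
    (q ^ (a * l) * qPoch q q m * qPoch (q * d₂) q a * qPoch (q * d₃) q l *
      qPoch (q * (d₁ * d₂)) q (2 * a + m + 1) * qPoch (q * (d₃ * d₄)) q (2 * l + m + 1))

/-- The part of the pentagon factor that depends on `y`. -/
def pentWy (q P d₄ d₅ : ℂ) (y t : ℕ) : ℂ :=
  qPoch (q * d₄) q y / (P ^ y * qPoch q q t * qPoch (q * d₅) q y *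
    qPoch (q * (d₄ * d₅)) q (2 * y + t + 1))

theorem pentWa_mirror (q d₁ d₂ d₃ d₄ d₅ : ℂ) (N a l m : ℕ) :
    pentWa q d₄ d₃ d₂ d₁ d₅ N l a m = pentWa q d₁ d₂ d₃ d₄ d₅ N a l m := by
  rw [pentWa, pentWa, mul_comm d₄ d₃, mul_comm d₂ d₁, mul_comm l a,
    mul_right_comm (q ^ (N + 1)) d₄ d₁]
  ring

theorem pentWy_shift_left (h : Gen5 q d₁ d₂ d₃ d₄ d₅ (N + 1)) {P : ℂ} (y t : ℕ) :
    pentWy q P d₄ d₅ y (t + 1) * ((1 - q * q ^ t) * (1 - q * d₅) * (1 - q * (d₄ * d₅))) =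
      pentWy q P d₄ (q * d₅) y t * (1 - q * d₅ * q ^ y) := by
  have hq := h.nr.1
  have n1 := h.nr.one_sub t
  have n2 := (h.n5.mul_left hq).one_sub'
  have n3 := (h.n5.mul_left hq).one_sub y
  have n4 := (h.n45.mul_left hq).one_sub'
  have e1 := Eq.refl (qPoch (q * d₄) q y * 1)
  have f1 := Eq.refl (P ^ y * 1)
  have f2 := qPoch_succ_mul_one q q t
  have f3 := qPoch_mul_one_sub (q * d₅) q y
  have f4 : qPoch (q * (d₄ * d₅)) q (2 * y + (t + 1) + 1) * 1 =
      qPoch (q * (d₄ * (q * d₅))) q (2 * y + t + 1) * (1 - q * (d₄ * d₅)) := by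
    rw [← add_assoc, qPoch_succ', show q * (q * (d₄ * d₅)) = q * (d₄ * (q * d₅)) by ring]
    ring
  have key : pentWy q P d₄ d₅ y (t + 1) * _ = pentWy q P d₄ (q * d₅) y t * _ :=
    ratio_div e1 (ratio_mul (ratio_mul (ratio_mul f1 f2) f3) f4) (by simpa using n3)
      (by simp only [mul_ne_zero_iff]; simp [n1, n2, n4])
  linear_combination (exp := 1) key

theorem pentWy_shift_right (h : Gen5 q d₁ d₂ d₃ d₄ d₅ (N + 1)) {P : ℂ} (hP : P ≠ 0) (y t : ℕ) :
    pentWy q P d₄ d₅ (y + 1) t * (P * (1 - q * d₅) * ((1 - q * (d₄ * d₅)) *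
        (1 - q * (q * (d₄ * d₅)) * q ^ (2 * y + t + 1)))) =
      pentWy q P d₄ (q * d₅) y t * (1 - q * d₄ * q ^ y) := by
  have hq := h.nr.1
  have n2 := (h.n5.mul_left hq).one_sub'
  have n3 := ((h.n45.mul_left hq).mul_left hq).one_sub (2 * y + t + 1)
  have n4 := (h.n45.mul_left hq).one_sub'
  have e1 := qPoch_succ_mul_one (q * d₄) q y
  have f1 : P ^ (y + 1) * 1 = P ^ y * P := by rw [mul_one, pow_succ]
  have f2 := Eq.refl (qPoch q q t * 1)
  have f3 := qPoch_succ_left_mul_one (q * d₅) q y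
  have f4 : qPoch (q * (d₄ * d₅)) q (2 * (y + 1) + t + 1) * 1 =
      qPoch (q * (d₄ * (q * d₅))) q (2 * y + t + 1) * ((1 - q * (d₄ * d₅)) *
        (1 - q * (q * (d₄ * d₅)) * q ^ (2 * y + t + 1))) := by
    rw [show 2 * (y + 1) + t + 1 = 2 * y + t + 1 + 1 + 1 by ring, qPoch_succ', qPoch_succ,
      show q * (d₄ * (q * d₅)) = q * (q * (d₄ * d₅)) by ring]
    ring
  have key : pentWy q P d₄ d₅ (y + 1) t * _ = pentWy q P d₄ (q * d₅) y t * _ :=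
    ratio_div e1 (ratio_mul (ratio_mul (ratio_mul f1 f2) f3) f4) (by simp)
      (by simp only [mul_ne_zero_iff]; simp [hP, n2, n3, n4])
  linear_combination (exp := 1) key

theorem pentWy_shift_both (h : Gen5 q d₁ d₂ d₃ d₄ d₅ (N + 1)) {P : ℂ} (hP : P ≠ 0) (b s : ℕ) :
    pentWy q P d₁ d₅ (b + 1) s * (P * (1 - q * d₅) * ((1 - q * (d₁ * d₅)) *
        (1 - q * (q * (d₁ * d₅))))) =
      pentWy q P (q * d₁) (q * d₅) b s * (1 - q * d₁) := by
  have hq := h.nr.1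
  have h15 := h.n15
  have n2 := (h.n5.mul_left hq).one_sub'
  have n3 := ((h15.mul_left hq).mul_left hq).one_sub'
  have n4 := (h15.mul_left hq).one_sub'
  have e1 := qPoch_succ_left_mul_one (q * d₁) q b
  have f1 : P ^ (b + 1) * 1 = P ^ b * P := by rw [mul_one, pow_succ]
  have f2 := Eq.refl (qPoch q q s * 1)
  have f3 := qPoch_succ_left_mul_one (q * d₅) q b
  have f4 : qPoch (q * (d₁ * d₅)) q (2 * (b + 1) + s + 1) * 1 =
      qPoch (q * (q * d₁ * (q * d₅))) q (2 * b + s + 1) * ((1 - q * (d₁ * d₅)) *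
        (1 - q * (q * (d₁ * d₅)))) := by
    rw [show 2 * (b + 1) + s + 1 = 2 * b + s + 1 + 1 + 1 by ring, qPoch_succ', qPoch_succ',
      show q * (q * (q * (d₁ * d₅))) = q * (q * d₁ * (q * d₅)) by ring]
    ring
  have key : pentWy q P d₁ d₅ (b + 1) s * _ = pentWy q P (q * d₁) (q * d₅) b s * _ :=
    ratio_div e1 (ratio_mul (ratio_mul (ratio_mul f1 f2) f3) f4) (by simp)
      (by simp only [mul_ne_zero_iff]; simp [hP, n2, n3, n4])
  linear_combination (exp := 1) key

theorem pentWa_shift_left (h : Gen5 q d₁ d₂ d₃ d₄ d₅ (N + 1)) (a l m : ℕ) :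
    pentWa q d₁ d₂ d₃ d₄ d₅ (N + 1) a l (m + 1) * ((1 - q * d₁ * q ^ a) * (1 - q * q ^ m) *
        (1 - q * (d₃ * d₄) * q ^ (2 * l + m + 1))) =
      pentWa q (q * d₁) d₂ d₃ d₄ (q * d₅) N a l m * (q ^ (N + 2) * d₁ * d₄ *
        (1 - q * q ^ (l + m)) * (1 - q * q ^ (a + m)) * (1 - q * d₅) * (1 - q * d₁) *
          (1 - q * (d₃ * d₄) * q ^ (2 * l + a + m + 1))) := by
  have hq := h.nr.1
  have n1 := h.nr.one_sub m
  have n2 := (h.n1.mul_left hq).one_sub a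
  have n3 := (h.n34.mul_left hq).one_sub (2 * l + m + 1)
  have n4 := (h.n12.mul_left hq).one_sub'
  have e1 : (q ^ (N + 1 + 1) * d₁ * d₄) ^ (N + 1) * 1 =
      (q ^ (N + 1) * (q * d₁) * d₄) ^ N * (q ^ (N + 2) * d₁ * d₄) := by ring
  have e2 : (q ^ (N + 1 + 1) * d₂ * d₅) ^ a * 1 = (q ^ (N + 1) * d₂ * (q * d₅)) ^ a * 1 := by
    ring
  have e3 : (q ^ (N + 1 + 1) * d₃ * d₅) ^ l * 1 = (q ^ (N + 1) * d₃ * (q * d₅)) ^ l * 1 := by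
    ring
  have e4 : qPoch q q (l + (m + 1)) * 1 = qPoch q q (l + m) * (1 - q * q ^ (l + m)) := by
    rw [mul_one, ← qPoch_succ, add_assoc]
  have e5 : qPoch q q (a + (m + 1)) * 1 = qPoch q q (a + m) * (1 - q * q ^ (a + m)) := by
    rw [mul_one, ← qPoch_succ, add_assoc]
  have e6 := qPoch_succ_left_mul_one (q * d₅) q m
  have e7 := qPoch_mul_one_sub (q * d₁) q a
  have e8 := Eq.refl (qPoch (q * d₄) q l * 1)
  have e9 : qPoch (q * (d₁ * d₂)) q (2 * a + l + (m + 1) + 1) * 1 =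
      qPoch (q * (q * d₁ * d₂)) q (2 * a + l + m + 1) * (1 - q * (d₁ * d₂)) := by
    rw [← add_assoc, qPoch_succ', show q * (q * (d₁ * d₂)) = q * (q * d₁ * d₂) by ring]
    ring
  have e10 : qPoch (q * (d₃ * d₄)) q (2 * l + a + (m + 1) + 1) * 1 =
      qPoch (q * (d₃ * d₄)) q (2 * l + a + m + 1) *
        (1 - q * (d₃ * d₄) * q ^ (2 * l + a + m + 1)) := by
    rw [mul_one, ← qPoch_succ, ← add_assoc]
  have f1 := Eq.refl (q ^ (a * l) * 1)
  have f2 := qPoch_succ_mul_one q q m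
  have f3 := Eq.refl (qPoch (q * d₂) q a * 1)
  have f4 := Eq.refl (qPoch (q * d₃) q l * 1)
  have f5 : qPoch (q * (d₁ * d₂)) q (2 * a + (m + 1) + 1) * 1 =
      qPoch (q * (q * d₁ * d₂)) q (2 * a + m + 1) * (1 - q * (d₁ * d₂)) := by
    rw [← add_assoc, qPoch_succ', show q * (q * (d₁ * d₂)) = q * (q * d₁ * d₂) by ring]
    ring
  have f6 : qPoch (q * (d₃ * d₄)) q (2 * l + (m + 1) + 1) * 1 =
      qPoch (q * (d₃ * d₄)) q (2 * l + m + 1) * (1 - q * (d₃ * d₄) * q ^ (2 * l + m + 1)) := by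
    rw [mul_one, ← qPoch_succ, ← add_assoc]
  have key : pentWa q d₁ d₂ d₃ d₄ d₅ (N + 1) a l (m + 1) * _ =
      pentWa q (q * d₁) d₂ d₃ d₄ (q * d₅) N a l m * _ :=
    ratio_div (ratio_mul (ratio_mul (ratio_mul e1 e2) e3) (ratio_mul (ratio_mul (ratio_mul
      (ratio_mul (ratio_mul (ratio_mul e4 e5) e6) e7) e8) e9) e10))
      (ratio_mul (ratio_mul (ratio_mul (ratio_mul (ratio_mul f1 f2) f3) f4) f5) f6) (by simp)
      (by simp only [mul_ne_zero_iff]; simp [n1, n3, n4])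
  refine mul_right_cancel₀ n4 ?_
  linear_combination (exp := 1) key

theorem pentWa_shift_right (h : Gen5 q d₁ d₂ d₃ d₄ d₅ (N + 1)) (a l m : ℕ) :
    pentWa q d₁ d₂ d₃ d₄ d₅ (N + 1) (a + 1) l m * ((1 - q * d₅ * q ^ m) * q ^ l *
        (1 - q * d₂ * q ^ a) * (1 - q * (q * (d₁ * d₂)) * q ^ (2 * a + m + 1))) =
      pentWa q (q * d₁) d₂ d₃ d₄ (q * d₅) N a l m * (q ^ (N + 2) * d₁ * d₄ *
        (q ^ (N + 2) * d₂ * d₅) * (1 - q * q ^ (a + m)) * (1 - q * d₅) * (1 - q * d₁) *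
          (1 - q * (q * (d₁ * d₂)) * q ^ (2 * a + l + m + 1)) *
          (1 - q * (d₃ * d₄) * q ^ (2 * l + a + m + 1))) := by
  have hq := h.nr.1
  have n1 : q ^ l ≠ 0 := pow_ne_zero _ hq
  have n2 := (h.n2.mul_left hq).one_sub a
  have n3 := ((h.n12.mul_left hq).mul_left hq).one_sub (2 * a + m + 1)
  have n4 := (h.n12.mul_left hq).one_sub'
  have e1 : (q ^ (N + 1 + 1) * d₁ * d₄) ^ (N + 1) * 1 =
      (q ^ (N + 1) * (q * d₁) * d₄) ^ N * (q ^ (N + 2) * d₁ * d₄) := by ring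
  have e2 : (q ^ (N + 1 + 1) * d₂ * d₅) ^ (a + 1) * 1 =
      (q ^ (N + 1) * d₂ * (q * d₅)) ^ a * (q ^ (N + 2) * d₂ * d₅) := by
    ring
  have e3 : (q ^ (N + 1 + 1) * d₃ * d₅) ^ l * 1 = (q ^ (N + 1) * d₃ * (q * d₅)) ^ l * 1 := by
    ring
  have e4 := Eq.refl (qPoch q q (l + m) * 1)
  have e5 : qPoch q q (a + 1 + m) * 1 = qPoch q q (a + m) * (1 - q * q ^ (a + m)) := by
    rw [mul_one, ← qPoch_succ, add_right_comm]
  have e6 := qPoch_mul_one_sub (q * d₅) q m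
  have e7 := qPoch_succ_left_mul_one (q * d₁) q a
  have e8 := Eq.refl (qPoch (q * d₄) q l * 1)
  have e9 : qPoch (q * (d₁ * d₂)) q (2 * (a + 1) + l + m + 1) * 1 =
      qPoch (q * (q * d₁ * d₂)) q (2 * a + l + m + 1) * ((1 - q * (d₁ * d₂)) *
        (1 - q * (q * (d₁ * d₂)) * q ^ (2 * a + l + m + 1))) := by
    rw [show 2 * (a + 1) + l + m + 1 = 2 * a + l + m + 1 + 1 + 1 by ring, qPoch_succ',
      qPoch_succ, show q * (q * d₁ * d₂) = q * (q * (d₁ * d₂)) by ring]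
    ring
  have e10 : qPoch (q * (d₃ * d₄)) q (2 * l + (a + 1) + m + 1) * 1 =
      qPoch (q * (d₃ * d₄)) q (2 * l + a + m + 1) *
        (1 - q * (d₃ * d₄) * q ^ (2 * l + a + m + 1)) := by
    rw [mul_one, ← qPoch_succ]
    congr 1
    ring
  have f1 : q ^ ((a + 1) * l) * 1 = q ^ (a * l) * q ^ l := by ring
  have f2 := Eq.refl (qPoch q q m * 1)
  have f3 := qPoch_succ_mul_one (q * d₂) q a
  have f4 := Eq.refl (qPoch (q * d₃) q l * 1)
  have f5 : qPoch (q * (d₁ * d₂)) q (2 * (a + 1) + m + 1) * 1 =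
      qPoch (q * (q * d₁ * d₂)) q (2 * a + m + 1) * ((1 - q * (d₁ * d₂)) *
        (1 - q * (q * (d₁ * d₂)) * q ^ (2 * a + m + 1))) := by
    rw [show 2 * (a + 1) + m + 1 = 2 * a + m + 1 + 1 + 1 by ring, qPoch_succ',
      qPoch_succ, show q * (q * d₁ * d₂) = q * (q * (d₁ * d₂)) by ring]
    ring
  have f6 := Eq.refl (qPoch (q * (d₃ * d₄)) q (2 * l + m + 1) * 1)
  have key : pentWa q d₁ d₂ d₃ d₄ d₅ (N + 1) (a + 1) l m * _ =
      pentWa q (q * d₁) d₂ d₃ d₄ (q * d₅) N a l m * _ :=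
    ratio_div (ratio_mul (ratio_mul (ratio_mul e1 e2) e3) (ratio_mul (ratio_mul (ratio_mul
      (ratio_mul (ratio_mul (ratio_mul e4 e5) e6) e7) e8) e9) e10))
      (ratio_mul (ratio_mul (ratio_mul (ratio_mul (ratio_mul f1 f2) f3) f4) f5) f6) (by simp)
      (by simp only [mul_ne_zero_iff]; simp [hq, n2, n3, n4])
  refine mul_right_cancel₀ n4 ?_
  linear_combination (exp := 1) key

/-- Counterpart of `pentV_mul_backA` for the polynomial with index pair (a,b). Since l + m = N - a,
the resulting coefficient does not depend on l. -/
theorem pentWa_mul_backA (h : Gen5 q d₁ d₂ d₃ d₄ d₅ (N + 1)) {a l m : ℕ} (hN : N = a + l + m) :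
    pentWa q d₁ d₂ d₃ d₄ d₅ (N + 1) a l (m + 1) * backA q d₂ d₁ d₅ (a + m) a =
      pentWa q (q * d₁) d₂ d₃ d₄ (q * d₅) N a l m * (q ^ (N + 2) * d₁ * d₄ * (1 - q * d₅) *
        (1 - q * q ^ (l + m)) * (q ^ a * (1 - d₂ * d₁ * q * q ^ a) /
          (1 - d₂ * d₁ * q * (q ^ a) ^ 2))) := by
  have hq := h.nr.1
  have key := pentWa_shift_left h a l m
  have eG : d₂ * d₁ * d₅ * q ^ (a + m + 3) = (d₃ * d₄ * q ^ (2 * l + a + m + 2))⁻¹ := by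
    rw [← h.rot.one_sub_eq (a + m + 3) (2 * l + a + m + 2) (by omega)]
    ring
  have hz : d₃ * d₄ * q ^ (2 * l + a + m + 2) ≠ 0 := mul_ne_zero h.n34.1 (pow_ne_zero _ hq)
  have n0 : q ^ a ≠ 0 := pow_ne_zero _ hq
  have n1 := h.nr.one_sub m
  have n2 := (h.n1.mul_left hq).one_sub a
  have n3 := (h.n34.mul_left hq).one_sub (2 * l + m + 1)
  have n5 := (h.n1.mul_left hq).one_sub'
  have n6 := h.nr.one_sub (a + m)
  have n7 := (h.n34.mul_left hq).one_sub (2 * l + a + m + 1)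
  have n9 : 1 - d₂ * d₁ * q * (q ^ a) ^ 2 ≠ 0 :=
    h.n12.one_sub_of_eq (1 + a * 2 : ℕ) (by rw [zpow_natCast]; ring)
  have e1 : 1 - (d₃ * d₄ * q ^ (2 * l + a + m + 2))⁻¹ =
      -((1 - q * (d₃ * d₄) * q ^ (2 * l + a + m + 1)) / (d₃ * d₄ * q ^ (2 * l + a + m + 2))) :=
    one_sub_inv_eq hz (by ring)
  have e2 : 1 - (d₃ * d₄ * q ^ (2 * l + a + m + 2))⁻¹ * q ^ a =
      -(q ^ a * (1 - q * (d₃ * d₄) * q ^ (2 * l + m + 1)) /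
        (d₃ * d₄ * q ^ (2 * l + a + m + 2))) :=
    one_sub_inv_mul_eq hz (by ring)
  have e3 : q * q ^ (a + m) - q ^ a = -(q ^ a * (1 - q * q ^ m)) := by ring
  have e4 : q * q ^ (a + m) - 1 = -(1 - q * q ^ (a + m)) := by ring
  rw [backA, eG, e1, e2, e3, e4]
  rw [← eq_div_iff (by simp only [mul_ne_zero_iff]; tauto)] at key
  rw [key]
  generalize pentWa q (q * d₁) d₂ d₃ d₄ (q * d₅) N a l m = v
  generalize 1 - q * (d₃ * d₄) * q ^ (2 * l + a + m + 1) = u1 at *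
  generalize 1 - q * (d₃ * d₄) * q ^ (2 * l + m + 1) = u2 at *
  generalize 1 - q * d₁ * q ^ a = u3 at *
  generalize 1 - q * q ^ (a + m) = u4 at *
  generalize 1 - q * q ^ (l + m) = u5 at *
  generalize 1 - q * q ^ m = u6 at *
  generalize 1 - q * d₁ = u7 at *
  generalize 1 - q * d₅ = u8 at *
  generalize 1 - d₂ * d₁ * q * (q ^ a) ^ 2 = u9 at *
  generalize d₃ * d₄ * q ^ (2 * l + a + m + 2) = u10 at *
  field_simp

theorem pentWa_mul_backB (h : Gen5 q d₁ d₂ d₃ d₄ d₅ (N + 1)) {a l m : ℕ} (hN : N = a + l + m) :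
    pentWa q d₁ d₂ d₃ d₄ d₅ (N + 1) (a + 1) l m * backB q d₂ d₁ d₅ (a + m) (a + 1) =
      -(pentWa q (q * d₁) d₂ d₃ d₄ (q * d₅) N a l m * (q ^ (N + 2) * d₁ * d₄ * (1 - q * d₅) *
        (1 - d₁ * d₂ * q ^ (N + a + 3)) * ((q ^ (a + 1) - 1) /
          (1 - d₂ * d₁ * q * (q ^ (a + 1)) ^ 2)))) := by
  have hq := h.nr.1
  have key := pentWa_shift_right h a l m
  have eG : d₂ * d₁ * d₅ * q ^ (a + m + 3) = (d₃ * d₄ * q ^ (2 * l + a + m + 2))⁻¹ := by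
    rw [← h.rot.one_sub_eq (a + m + 3) (2 * l + a + m + 2) (by omega)]
    ring
  have hz : d₃ * d₄ * q ^ (2 * l + a + m + 2) ≠ 0 := mul_ne_zero h.n34.1 (pow_ne_zero _ hq)
  have hcon : q ^ (N + 2) * d₂ * d₅ * (q * d₁) * (d₃ * d₄ * q ^ (2 * l + a + m + 2)) = q ^ l := by
    have := h.con
    calc _ = q ^ l * (q ^ (2 * (N + 1) + 3) * d₁ * d₂ * d₃ * d₄ * d₅) := by
          rw [hN]
          ring
      _ = q ^ l := by rw [this, mul_one]
  have n0 : q ^ (a + 1) ≠ 0 := pow_ne_zero _ hq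
  have n0' : q ^ l ≠ 0 := pow_ne_zero _ hq
  have n1 := (h.n5.mul_left hq).one_sub m
  have n2 := (h.n2.mul_left hq).one_sub a
  have n3 := ((h.n12.mul_left hq).mul_left hq).one_sub (2 * a + m + 1)
  have n5 := (h.n1.mul_left hq).one_sub'
  have n6 := h.nr.one_sub (a + m)
  have n7 := (h.n34.mul_left hq).one_sub (2 * l + a + m + 1)
  have n9 : 1 - d₂ * d₁ * q * (q ^ (a + 1)) ^ 2 ≠ 0 :=
    h.n12.one_sub_of_eq (1 + (a + 1) * 2 : ℕ) (by rw [zpow_natCast]; ring)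
  have e1 : 1 - (d₃ * d₄ * q ^ (2 * l + a + m + 2))⁻¹ =
      -((1 - q * (d₃ * d₄) * q ^ (2 * l + a + m + 1)) / (d₃ * d₄ * q ^ (2 * l + a + m + 2))) :=
    one_sub_inv_eq hz (by ring)
  have e2 : d₂ * q ^ (a + 1) - 1 = -(1 - q * d₂ * q ^ a) := by ring
  have e3 : q ^ (a + 1) - d₅ * q * (q * q ^ (a + m)) = q ^ (a + 1) * (1 - q * d₅ * q ^ m) := by
    ring
  have e4 : q * q ^ (a + m) - 1 = -(1 - q * q ^ (a + m)) := by ring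
  have e5 : d₂ * d₁ * q * q ^ (a + 1) * (q * q ^ (a + m)) - 1 =
      -(1 - q * (q * (d₁ * d₂)) * q ^ (2 * a + m + 1)) := by ring
  have e6 : 1 - d₁ * d₂ * q ^ (N + a + 3) =
      1 - q * (q * (d₁ * d₂)) * q ^ (2 * a + l + m + 1) := by
    rw [hN]
    ring
  rw [backB, eG, e1, e2, e3, e4, e5, e6]
  rw [← eq_div_iff (by simp only [mul_ne_zero_iff]; tauto), ← hcon] at key
  rw [← hcon] at n0'
  rw [key]
  have hd : q ^ (N + 2) * d₂ * d₅ ≠ 0 := fun h0 => n0' (by rw [h0]; ring)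
  have hd1 : q * d₁ ≠ 0 := (h.n1.mul_left hq).1
  generalize pentWa q (q * d₁) d₂ d₃ d₄ (q * d₅) N a l m = v
  generalize q ^ (N + 2) * d₂ * d₅ = u0 at *
  generalize 1 - q * (d₃ * d₄) * q ^ (2 * l + a + m + 1) = u1 at *
  generalize 1 - q * d₂ * q ^ a = u2 at *
  generalize 1 - q * d₅ * q ^ m = u3 at *
  generalize 1 - q * q ^ (a + m) = u4 at *
  generalize 1 - q * (q * (d₁ * d₂)) * q ^ (2 * a + l + m + 1) = u5 at *
  generalize 1 - q * (q * (d₁ * d₂)) * q ^ (2 * a + m + 1) = u6 at *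
  generalize q ^ (N + 2) * d₁ * d₄ = u11
  generalize 1 - q * d₁ = u7 at *
  generalize 1 - q * d₅ = u8 at *
  generalize 1 - d₂ * d₁ * q * (q ^ (a + 1)) ^ 2 = u9 at *
  generalize d₃ * d₄ * q ^ (2 * l + a + m + 2) = u10 at *
  generalize q * d₁ = u12 at *
  generalize q ^ (a + 1) - 1 = u13 at *
  field_simp

end

/-! ### The pentagon relation: matching of coefficients -/

section

variable {q d₁ d₂ d₃ d₄ d₅ : ℂ} {N : ℕ}

/-- The first coefficient in `racahPhi_contiguous_size`. -/
def sizeA (q D : ℂ) (n K : ℕ) : ℂ :=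
  (1 - D * q * q ^ n) * (q * q ^ K - q ^ n) / ((1 - D * q * (q ^ n) ^ 2) * (q * q ^ K - 1))

/-- The second coefficient in `racahPhi_contiguous_size`. -/
def sizeB (q D : ℂ) (n K : ℕ) : ℂ :=
  (q ^ n - 1) * (1 - D * q * q ^ n * (q * q ^ K)) / ((1 - D * q * (q ^ n) ^ 2) * (q * q ^ K - 1))

/-- The first coefficient in `racahPhi_contiguous`. -/
def conA (q D G : ℂ) (n : ℕ) : ℂ :=
  (1 - D * q * q ^ n) * (1 - G * q ^ n) / ((1 - D * q * (q ^ n) ^ 2) * (1 - G))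

/-- The second coefficient in `racahPhi_contiguous`. -/
def conB (q D G : ℂ) (n : ℕ) : ℂ :=
  (q ^ n - 1) * (G - D * q * q ^ n) / ((1 - D * q * (q ^ n) ^ 2) * (1 - G))

theorem racahPhi_size {q b₁ b₂ b₃ : ℂ} (h : Gen3 q b₁ b₂ b₃) {n x K : ℕ} (hx : x ≤ K) :
    racahPhi q n x b₁ b₂ b₃ (K + 1) = sizeA q (b₂ * b₃) n K * racahPhi q n x b₁ b₂ (q * b₃) K +
      sizeB q (b₂ * b₃) n K * racahPhi q (n - 1) x b₁ b₂ (q * b₃) K :=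
  racahPhi_contiguous_size h hx

theorem racahPhi_con {q b₁ b₂ b₃ : ℂ} (h : Gen3 q b₁ b₂ b₃) (n x K : ℕ) :
    racahPhi q n x b₁ b₂ b₃ K =
      conA q (b₂ * b₃) (b₁ * b₂ * b₃ * q ^ (K + 2)) n * racahPhi q n x b₁ b₂ (q * b₃) K +
      conB q (b₂ * b₃) (b₁ * b₂ * b₃ * q ^ (K + 2)) n * racahPhi q (n - 1) x b₁ b₂ (q * b₃) K :=
  racahPhi_contiguous h n x K

/-- The coefficient in `pentWa_mul_backA`. -/
def pentA (q d₁ d₂ d₄ d₅ : ℂ) (N a τ : ℕ) : ℂ :=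
  q ^ (N + 2) * d₁ * d₄ * (1 - q * d₅) * (1 - q * q ^ τ) *
    (q ^ a * (1 - d₂ * d₁ * q * q ^ a) / (1 - d₂ * d₁ * q * (q ^ a) ^ 2))

/-- The coefficient in `pentWa_mul_backB`. -/
def pentB (q d₁ d₂ d₄ d₅ : ℂ) (N a : ℕ) : ℂ :=
  -(q ^ (N + 2) * d₁ * d₄ * (1 - q * d₅) * (1 - d₁ * d₂ * q ^ (N + a + 3)) *
    ((q ^ (a + 1) - 1) / (1 - d₂ * d₁ * q * (q ^ (a + 1)) ^ 2)))

/-- The four lemmas `pent_match₁` to `pent_match₄` compare the coefficients of the smaller pentagon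
at (a,y), (a,y-1), (a-1,y), (a-1,y-1). On the sum side the y-shift comes from the backward relation
and the a-shift from a contiguous one. On the product side the roles are exchanged. -/
theorem pent_match₁ (h : Gen5 q d₁ d₂ d₃ d₄ d₅ (N + 1)) {a τ y t b s : ℕ} (ha : N = a + τ)
    (hy : N = y + t) :
    pentG q d₁ d₄ d₅ y * sizeA q (d₂ * d₁) a t *
        (pentWy q (q ^ (N + 2) * d₁ * d₄) d₄ (q * d₅) y t *
          pentWy q (q ^ (N + 2) * d₁ * d₄) (q * d₁) (q * d₅) b s) =
      pentA q d₁ d₂ d₄ d₅ N a τ * sizeA q (d₄ * d₅) y τ *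
        (pentWy q (q ^ (N + 2) * d₁ * d₄) d₄ d₅ y (t + 1) *
          pentWy q (q ^ (N + 2) * d₁ * d₄) d₁ d₅ (b + 1) s) := by
  have hq := h.nr.1
  have hP : q ^ (N + 2) * d₁ * d₄ ≠ 0 :=
    mul_ne_zero (mul_ne_zero (pow_ne_zero _ hq) h.n1.1) h.n4.1
  have k1 := pentWy_shift_left h (P := q ^ (N + 2) * d₁ * d₄) y t
  have k2 := pentWy_shift_both h hP b s
  have h15 := h.n15
  have n1 := h.nr.one_sub t
  have n1' := h.nr.one_sub τ
  have n3 := (h15.mul_left hq).one_sub'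
  have n4 := ((h15.mul_left hq).mul_left hq).one_sub'
  have n5 := (h.n45.mul_left hq).one_sub'
  have n6 := (h.n5.mul_left hq).one_sub'
  have n7 := h.n45.one_sub_sq y
  have n8 : 1 - d₂ * d₁ * q * (q ^ a) ^ 2 ≠ 0 :=
    h.n12.one_sub_of_eq (1 + a * 2 : ℕ) (by rw [zpow_natCast]; ring)
  rw [← eq_div_iff (mul_ne_zero (mul_ne_zero hP n6) (mul_ne_zero n3 n4))] at k2
  rw [← eq_div_iff (mul_ne_zero (mul_ne_zero n1 n6) n5)] at k1
  have e1 : q * q ^ t - 1 = -(1 - q * q ^ t) := by ring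
  have e2 : q * q ^ τ - 1 = -(1 - q * q ^ τ) := by ring
  have e3 : q ^ a * q ^ τ = q ^ y * q ^ t := by rw [← pow_add, ← pow_add, ← ha, hy]
  rw [k1, k2, pentG, pentA, sizeA, sizeA, e1, e2]
  generalize q ^ (N + 2) * d₁ * d₄ = P at *
  generalize pentWy q P d₄ (q * d₅) y t = w1
  generalize pentWy q P (q * d₁) (q * d₅) b s = w2
  generalize 1 - q * q ^ t = u1 at *
  generalize 1 - q * q ^ τ = u2 at *
  generalize 1 - q * (d₁ * d₅) = u3 at *
  generalize 1 - q * (q * (d₁ * d₅)) = u4 at *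
  generalize 1 - q * (d₄ * d₅) = u5 at *
  generalize 1 - q * d₅ = u6 at *
  generalize 1 - d₄ * d₅ * q * (q ^ y) ^ 2 = u7 at *
  generalize 1 - d₂ * d₁ * q * (q ^ a) ^ 2 = u8 at *
  generalize 1 - d₄ * d₅ * q * q ^ y = u9 at *
  generalize 1 - d₂ * d₁ * q * q ^ a = u10 at *
  generalize 1 - q * d₅ * q ^ y = u11 at *
  generalize 1 - q * d₁ = u12 at *
  generalize q ^ a = A at *
  generalize q ^ τ = B at *
  generalize q ^ y = Y at *
  generalize q ^ t = T at *
  field_simp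
  linear_combination (exp := 1) (u12 * u11 * u9 * u10 * w1 * w2 * q) * e3

theorem pent_match₂ (h : Gen5 q d₁ d₂ d₃ d₄ d₅ (N + 1)) {a τ y t b s : ℕ} (ha : N = a + τ)
    (hy : N = y + t) :
    pentG' q d₁ (d₂ * d₃) d₄ d₅ N (y + 1) *
        conA q (d₂ * d₁) (d₃ * d₂ * d₁ * q ^ (t + 2)) a *
        (pentWy q (q ^ (N + 2) * d₁ * d₄) d₄ (q * d₅) y t *
          pentWy q (q ^ (N + 2) * d₁ * d₄) (q * d₁) (q * d₅) b s) =
      pentA q d₁ d₂ d₄ d₅ N a τ * sizeB q (d₄ * d₅) (y + 1) τ *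
        (pentWy q (q ^ (N + 2) * d₁ * d₄) d₄ d₅ (y + 1) t *
          pentWy q (q ^ (N + 2) * d₁ * d₄) d₁ d₅ (b + 1) s) := by
  have hq := h.nr.1
  have hP : q ^ (N + 2) * d₁ * d₄ ≠ 0 :=
    mul_ne_zero (mul_ne_zero (pow_ne_zero _ hq) h.n1.1) h.n4.1
  have k1 := pentWy_shift_right h hP y t
  have k2 := pentWy_shift_both h hP b s
  have h15 := h.n15
  have n1' := h.nr.one_sub τ
  have n2 := ((h.n45.mul_left hq).mul_left hq).one_sub (2 * y + t + 1)
  have n3 := (h15.mul_left hq).one_sub'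
  have n4 := ((h15.mul_left hq).mul_left hq).one_sub'
  have n5 := (h.n45.mul_left hq).one_sub'
  have n6 := (h.n5.mul_left hq).one_sub'
  have n7 := h.n45.one_sub_sq (y + 1)
  have n8 : 1 - d₂ * d₁ * q * (q ^ a) ^ 2 ≠ 0 :=
    h.n12.one_sub_of_eq (1 + a * 2 : ℕ) (by rw [zpow_natCast]; ring)
  rw [← eq_div_iff (mul_ne_zero (mul_ne_zero hP n6) (mul_ne_zero n3 n4))] at k2
  rw [← eq_div_iff (mul_ne_zero (mul_ne_zero hP n6) (mul_ne_zero n5 n2))] at k1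
  have e2 : q * q ^ τ - 1 = -(1 - q * q ^ τ) := by ring
  have e3 : q ^ a * q ^ τ = q ^ N := by rw [← pow_add, ← ha]
  have e4 : q ^ y * q ^ t = q ^ N := by rw [← pow_add, ← hy]
  have n9 : q * (q * (d₄ * d₅)) * q ^ (2 * y + t + 1) ≠ 0 :=
    mul_ne_zero ((h.n45.mul_left hq).mul_left hq).1 (pow_ne_zero _ hq)
  have e5 : d₃ * d₂ * d₁ * q ^ (t + 2) = (q * (q * (d₄ * d₅)) * q ^ (2 * y + t + 1))⁻¹ := by
    refine eq_inv_of_mul_eq_one_left ?_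
    rw [← h.con, hy]
    ring
  have e6 : q ^ (N + 2) * d₁ * d₄ * (q * d₅ * (d₂ * d₃) * q ^ (N + 2)) = 1 := by
    rw [← h.con]
    ring
  have e7 : q * d₅ * (d₄ * q ^ (y + 1) - 1) * (q ^ (y + 1) - 1) * (d₂ * d₃) * q ^ (N + 2) =
      (q ^ (N + 2) * d₁ * d₄)⁻¹ * (-(1 - q * d₄ * q ^ y) * (q ^ (y + 1) - 1)) := by
    rw [eq_inv_mul_iff_mul_eq₀ hP]
    linear_combination (-(1 - q * d₄ * q ^ y) * (q ^ (y + 1) - 1)) * e6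
  have e8 : q ^ a * (1 - d₄ * d₅ * q * q ^ (y + 1) * (q * q ^ τ)) =
      q ^ a - q * (q * (d₄ * d₅)) * q ^ (2 * y + t + 1) := by
    linear_combination (-(d₄ * d₅ * q * q ^ (y + 1) * q)) * (e3 - e4)
  have e9 : 1 - (q * (q * (d₄ * d₅)) * q ^ (2 * y + t + 1))⁻¹ =
      -((1 - q * (q * (d₄ * d₅)) * q ^ (2 * y + t + 1)) /
        (q * (q * (d₄ * d₅)) * q ^ (2 * y + t + 1))) := one_sub_inv_eq n9 rfl
  rw [k1, k2, pentG', pentA, conA, sizeB, e2, e5, e7, e9]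
  generalize q ^ (N + 2) * d₁ * d₄ = P at *
  generalize pentWy q P d₄ (q * d₅) y t = w1
  generalize pentWy q P (q * d₁) (q * d₅) b s = w2
  generalize 1 - q * (q * (d₄ * d₅)) * q ^ (2 * y + t + 1) = u1 at *
  generalize q * (q * (d₄ * d₅)) * q ^ (2 * y + t + 1) = u0 at *
  generalize 1 - q * q ^ τ = u2 at *
  generalize 1 - q * (d₁ * d₅) = u3 at *
  generalize 1 - q * (q * (d₁ * d₅)) = u4 at *
  generalize 1 - q * (d₄ * d₅) = u5 at *
  generalize 1 - q * d₅ = u6 at *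
  generalize 1 - d₄ * d₅ * q * (q ^ (y + 1)) ^ 2 = u7 at *
  generalize 1 - d₂ * d₁ * q * (q ^ a) ^ 2 = u8 at *
  generalize 1 - d₂ * d₁ * q * q ^ a = u10 at *
  generalize 1 - q * d₄ * q ^ y = u11 at *
  generalize 1 - q * d₁ = u12 at *
  generalize 1 - d₄ * d₅ * q * q ^ (y + 1) * (q * q ^ τ) = u13 at *
  generalize q ^ (y + 1) - 1 = u14 at *
  generalize q ^ a = A at *
  field_simp
  linear_combination (exp := 1) (u12 * u11 * u14 * u10 * w1 * w2) * e8

theorem pent_match₃ (h : Gen5 q d₁ d₂ d₃ d₄ d₅ (N + 1)) {a τ y t b s : ℕ} (ha : N = a + τ)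
    (hy : N = y + t) :
    pentG q d₁ d₄ d₅ y * sizeB q (d₂ * d₁) (a + 1) t *
        (pentWy q (q ^ (N + 2) * d₁ * d₄) d₄ (q * d₅) y t *
          pentWy q (q ^ (N + 2) * d₁ * d₄) (q * d₁) (q * d₅) b s) =
      pentB q d₁ d₂ d₄ d₅ N a * conA q (d₄ * d₅) (d₃ * d₄ * d₅ * q ^ (τ + 2)) y *
        (pentWy q (q ^ (N + 2) * d₁ * d₄) d₄ d₅ y (t + 1) *
          pentWy q (q ^ (N + 2) * d₁ * d₄) d₁ d₅ (b + 1) s) := by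
  have hq := h.nr.1
  have hP : q ^ (N + 2) * d₁ * d₄ ≠ 0 :=
    mul_ne_zero (mul_ne_zero (pow_ne_zero _ hq) h.n1.1) h.n4.1
  have k1 := pentWy_shift_left h (P := q ^ (N + 2) * d₁ * d₄) y t
  have k2 := pentWy_shift_both h hP b s
  have h15 := h.n15
  have n1 := h.nr.one_sub t
  have n2 := h.n12.one_sub (N + a + 3)
  have n3 := (h15.mul_left hq).one_sub'
  have n4 := ((h15.mul_left hq).mul_left hq).one_sub'
  have n5 := (h.n45.mul_left hq).one_sub'
  have n6 := (h.n5.mul_left hq).one_sub'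
  have n7 := h.n45.one_sub_sq y
  have n8 : 1 - d₂ * d₁ * q * (q ^ (a + 1)) ^ 2 ≠ 0 :=
    h.n12.one_sub_of_eq (1 + (a + 1) * 2 : ℕ) (by rw [zpow_natCast]; ring)
  rw [← eq_div_iff (mul_ne_zero (mul_ne_zero hP n6) (mul_ne_zero n3 n4))] at k2
  rw [← eq_div_iff (mul_ne_zero (mul_ne_zero n1 n6) n5)] at k1
  have e1 : q * q ^ t - 1 = -(1 - q * q ^ t) := by ring
  have e4 : q ^ y * q ^ t = q ^ N := by rw [← pow_add, ← hy]
  have n9 : d₁ * d₂ * q ^ (N + a + 3) ≠ 0 := mul_ne_zero h.n12.1 (pow_ne_zero _ hq)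
  have e5 : d₃ * d₄ * d₅ * q ^ (τ + 2) = (d₁ * d₂ * q ^ (N + a + 3))⁻¹ := by
    refine eq_inv_of_mul_eq_one_left ?_
    rw [← h.con, show 2 * (N + 1) + 3 = τ + 2 + (N + a + 3) by omega, pow_add]
    ring
  have e8 : q ^ y * (1 - d₂ * d₁ * q * q ^ (a + 1) * (q * q ^ t)) =
      q ^ y - d₁ * d₂ * q ^ (N + a + 3) := by
    linear_combination (-(d₂ * d₁ * q * q ^ (a + 1) * q)) * e4
  have e9 : 1 - (d₁ * d₂ * q ^ (N + a + 3))⁻¹ =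
      -((1 - d₁ * d₂ * q ^ (N + a + 3)) / (d₁ * d₂ * q ^ (N + a + 3))) := one_sub_inv_eq n9 rfl
  rw [k1, k2, pentG, pentB, conA, sizeB, e1, e5, e9]
  generalize q ^ (N + 2) * d₁ * d₄ = P at *
  generalize pentWy q P d₄ (q * d₅) y t = w1
  generalize pentWy q P (q * d₁) (q * d₅) b s = w2
  generalize 1 - d₁ * d₂ * q ^ (N + a + 3) = u1 at *
  generalize d₁ * d₂ * q ^ (N + a + 3) = u0 at *
  generalize 1 - q * q ^ t = u2 at *
  generalize 1 - q * (d₁ * d₅) = u3 at *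
  generalize 1 - q * (q * (d₁ * d₅)) = u4 at *
  generalize 1 - q * (d₄ * d₅) = u5 at *
  generalize 1 - q * d₅ = u6 at *
  generalize 1 - d₄ * d₅ * q * (q ^ y) ^ 2 = u7 at *
  generalize 1 - d₂ * d₁ * q * (q ^ (a + 1)) ^ 2 = u8 at *
  generalize 1 - d₄ * d₅ * q * q ^ y = u10 at *
  generalize 1 - q * d₅ * q ^ y = u11 at *
  generalize 1 - q * d₁ = u12 at *
  generalize 1 - d₂ * d₁ * q * q ^ (a + 1) * (q * q ^ t) = u13 at *
  generalize q ^ (a + 1) - 1 = u14 at *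
  generalize q ^ y = Y at *
  field_simp
  linear_combination (exp := 1) -(u12 * u11 * u10 * u14 * w1 * w2) * e8

theorem pent_match₄ (h : Gen5 q d₁ d₂ d₃ d₄ d₅ (N + 1)) {a τ y t b s : ℕ} (ha : N = a + τ)
    (hy : N = y + t) :
    pentG' q d₁ (d₂ * d₃) d₄ d₅ N (y + 1) *
        conB q (d₂ * d₁) (d₃ * d₂ * d₁ * q ^ (t + 2)) (a + 1) *
        (pentWy q (q ^ (N + 2) * d₁ * d₄) d₄ (q * d₅) y t *
          pentWy q (q ^ (N + 2) * d₁ * d₄) (q * d₁) (q * d₅) b s) =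
      pentB q d₁ d₂ d₄ d₅ N a * conB q (d₄ * d₅) (d₃ * d₄ * d₅ * q ^ (τ + 2)) (y + 1) *
        (pentWy q (q ^ (N + 2) * d₁ * d₄) d₄ d₅ (y + 1) t *
          pentWy q (q ^ (N + 2) * d₁ * d₄) d₁ d₅ (b + 1) s) := by
  have hq := h.nr.1
  have hP : q ^ (N + 2) * d₁ * d₄ ≠ 0 :=
    mul_ne_zero (mul_ne_zero (pow_ne_zero _ hq) h.n1.1) h.n4.1
  have k1 := pentWy_shift_right h hP y t
  have k2 := pentWy_shift_both h hP b s
  have h15 := h.n15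
  have n1 := h.n12.one_sub (N + a + 3)
  have n2 := ((h.n45.mul_left hq).mul_left hq).one_sub (2 * y + t + 1)
  have n3 := (h15.mul_left hq).one_sub'
  have n4 := ((h15.mul_left hq).mul_left hq).one_sub'
  have n5 := (h.n45.mul_left hq).one_sub'
  have n6 := (h.n5.mul_left hq).one_sub'
  have n7 := h.n45.one_sub_sq (y + 1)
  have n8 : 1 - d₂ * d₁ * q * (q ^ (a + 1)) ^ 2 ≠ 0 :=
    h.n12.one_sub_of_eq (1 + (a + 1) * 2 : ℕ) (by rw [zpow_natCast]; ring)
  rw [← eq_div_iff (mul_ne_zero (mul_ne_zero hP n6) (mul_ne_zero n3 n4))] at k2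
  rw [← eq_div_iff (mul_ne_zero (mul_ne_zero hP n6) (mul_ne_zero n5 n2))] at k1
  have n9 : q * (q * (d₄ * d₅)) * q ^ (2 * y + t + 1) ≠ 0 :=
    mul_ne_zero ((h.n45.mul_left hq).mul_left hq).1 (pow_ne_zero _ hq)
  have n9' : d₁ * d₂ * q ^ (N + a + 3) ≠ 0 := mul_ne_zero h.n12.1 (pow_ne_zero _ hq)
  have e5 : d₃ * d₂ * d₁ * q ^ (t + 2) = (q * (q * (d₄ * d₅)) * q ^ (2 * y + t + 1))⁻¹ := by
    refine eq_inv_of_mul_eq_one_left ?_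
    rw [← h.con, hy]
    ring
  have e5' : d₃ * d₄ * d₅ * q ^ (τ + 2) = (d₁ * d₂ * q ^ (N + a + 3))⁻¹ := by
    refine eq_inv_of_mul_eq_one_left ?_
    rw [← h.con, show 2 * (N + 1) + 3 = τ + 2 + (N + a + 3) by omega, pow_add]
    ring
  have e6 : q ^ (N + 2) * d₁ * d₄ * (q * d₅ * (d₂ * d₃) * q ^ (N + 2)) = 1 := by
    rw [← h.con]
    ring
  have e7 : q * d₅ * (d₄ * q ^ (y + 1) - 1) * (q ^ (y + 1) - 1) * (d₂ * d₃) * q ^ (N + 2) =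
      (q ^ (N + 2) * d₁ * d₄)⁻¹ * (-(1 - q * d₄ * q ^ y) * (q ^ (y + 1) - 1)) := by
    rw [eq_inv_mul_iff_mul_eq₀ hP]
    linear_combination (-(1 - q * d₄ * q ^ y) * (q ^ (y + 1) - 1)) * e6
  have e8 : d₂ * d₁ * q * q ^ (a + 1) * (q * (q * (d₄ * d₅)) * q ^ (2 * y + t + 1)) =
      d₄ * d₅ * q * q ^ (y + 1) * (d₁ * d₂ * q ^ (N + a + 3)) := by
    rw [hy]
    ring
  have e9 : 1 - (q * (q * (d₄ * d₅)) * q ^ (2 * y + t + 1))⁻¹ =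
      -((1 - q * (q * (d₄ * d₅)) * q ^ (2 * y + t + 1)) /
        (q * (q * (d₄ * d₅)) * q ^ (2 * y + t + 1))) := one_sub_inv_eq n9 rfl
  have e9' : 1 - (d₁ * d₂ * q ^ (N + a + 3))⁻¹ =
      -((1 - d₁ * d₂ * q ^ (N + a + 3)) / (d₁ * d₂ * q ^ (N + a + 3))) := one_sub_inv_eq n9' rfl
  rw [k1, k2, pentG', pentB, conB, conB, e5, e5', e7, e9, e9']
  generalize q ^ (N + 2) * d₁ * d₄ = P at *
  generalize pentWy q P d₄ (q * d₅) y t = w1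
  generalize pentWy q P (q * d₁) (q * d₅) b s = w2
  generalize 1 - q * (q * (d₄ * d₅)) * q ^ (2 * y + t + 1) = u1 at *
  generalize q * (q * (d₄ * d₅)) * q ^ (2 * y + t + 1) = u0 at *
  generalize 1 - d₁ * d₂ * q ^ (N + a + 3) = u2 at *
  generalize d₁ * d₂ * q ^ (N + a + 3) = u15 at *
  generalize 1 - q * (d₁ * d₅) = u3 at *
  generalize 1 - q * (q * (d₁ * d₅)) = u4 at *
  generalize 1 - q * (d₄ * d₅) = u5 at *
  generalize 1 - q * d₅ = u6 at *
  generalize 1 - d₄ * d₅ * q * (q ^ (y + 1)) ^ 2 = u7 at *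
  generalize 1 - d₂ * d₁ * q * (q ^ (a + 1)) ^ 2 = u8 at *
  generalize 1 - q * d₄ * q ^ y = u11 at *
  generalize 1 - q * d₁ = u12 at *
  generalize d₂ * d₁ * q * q ^ (a + 1) = u13 at *
  generalize d₄ * d₅ * q * q ^ (y + 1) = u16 at *
  generalize q ^ (y + 1) - 1 = u14 at *
  field_simp
  linear_combination (exp := 1) (u12 * u11 * u14 * (1 - q * q ^ a) * w1 * w2) * e8

end

/-! ### The pentagon relation: lowering b -/

section

variable {q d₁ d₂ d₃ d₄ d₅ : ℂ} {N : ℕ}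

/-- The sum side of the pentagon relation. -/
def pentS (q d₁ d₂ d₃ d₄ d₅ : ℂ) (N a l y b : ℕ) : ℂ :=
  ∑ x ∈ range (N + 1), pentV q d₁ (d₂ * d₃) d₄ d₅ N x y b * racahPhi q a x d₃ d₂ d₁ (N - y) *
    racahPhi q y b d₁ d₅ d₄ (N - x) * racahPhi q x l d₄ d₃ d₂ (N - b)

/-- The factor `pentWa`, extended by zero. -/
def pentU (q d₁ d₂ d₃ d₄ d₅ : ℂ) (N a l : ℕ) : ℂ :=
  if a + l ≤ N then pentWa q d₁ d₂ d₃ d₄ d₅ N a l (N - a - l) else 0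

/-- The product side of the pentagon relation. -/
def pentT (q d₁ d₂ d₃ d₄ d₅ : ℂ) (N a l y b : ℕ) : ℂ :=
  pentU q d₁ d₂ d₃ d₄ d₅ N a l * (pentWy q (q ^ (N + 1) * d₁ * d₄) d₄ d₅ y (N - y) *
    pentWy q (q ^ (N + 1) * d₁ * d₄) d₁ d₅ b (N - b)) *
    racahPhi q y l d₃ d₄ d₅ (N - a) * racahPhi q a b d₅ d₁ d₂ (N - l)

theorem Gen5.gen3₃₄₅ (h : Gen5 q d₁ d₂ d₃ d₄ d₅ N) : Gen3 q d₃ d₄ d₅ := h.rot.rot.gen3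

theorem Gen5.gen3₄₅₁ (h : Gen5 q d₁ d₂ d₃ d₄ d₅ N) : Gen3 q d₄ d₅ d₁ := h.rot.rot.rot.gen3

theorem Gen5.gen3₂₁₅ (h : Gen5 q d₁ d₂ d₃ d₄ d₅ N) : Gen3 q d₂ d₁ d₅ :=
  h.rot.rot.rot.rot.gen3.symm

theorem pentG'_zero (q d₁ D d₄ d₅ : ℂ) (N : ℕ) : pentG' q d₁ D d₄ d₅ N 0 = 0 := by
  simp [pentG']

theorem sizeA_last (q D : ℂ) (K : ℕ) : sizeA q D (K + 1) K = 0 := by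
  simp [sizeA, pow_succ']

theorem sizeB_zero (q D : ℂ) (K : ℕ) : sizeB q D 0 K = 0 := by simp [sizeB]

theorem conB_zero (q D G : ℂ) : conB q D G 0 = 0 := by simp [conB]

theorem pentV_mul_racahPhi (h : Gen5 q d₁ d₂ d₃ d₄ d₅ (N + 1)) {x : ℕ} (hx : x ≤ N) (y b : ℕ) :
    pentV q d₁ (d₂ * d₃) d₄ d₅ (N + 1) x y (b + 1) *
        racahPhi q y (b + 1) d₁ d₅ d₄ (N + 1 - x) =
      pentG q d₁ d₄ d₅ y * (pentV q (q * d₁) (d₂ * d₃) d₄ (q * d₅) N x y b *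
          racahPhi q y b (q * d₁) (q * d₅) d₄ (N - x)) +
        pentG' q d₁ (d₂ * d₃) d₄ d₅ N y * (pentV q (q * d₁) (d₂ * d₃) d₄ (q * d₅) N x (y - 1) b *
          racahPhi q (y - 1) b (q * d₁) (q * d₅) d₄ (N - x)) := by
  have hq := h.nr.1
  by_cases hb : x + b ≤ N
  · rw [racahPhi_symm hq, show N + 1 - x = N - x + 1 by omega,
      racahPhi_backward' h.gen3₄₅₁ y (by omega), ← racahPhi_symm hq, ← racahPhi_symm hq (y - 1)]
    have e1 := pentV_mul_backA h hx y b
    have e2 := pentV_mul_backB h hx y b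
    linear_combination racahPhi q y b (q * d₁) (q * d₅) d₄ (N - x) * e1 +
      racahPhi q (y - 1) b (q * d₁) (q * d₅) d₄ (N - x) * e2
  · rw [pentV, pentV, pentV, if_neg (by omega), if_neg (by omega), if_neg (by omega)]
    ring

/-- The backward shift on Φ_y(b+1) produces y and y - 1 with d₁, d₅ raised. Then Φ_a(x) must follow
the change of d₁. In the y-terms its size N + 1 - y drops by one, and the size relation applies. In
the (y-1)-terms the size stays, and the plain contiguous relation applies. The third polynomial is
unaffected, since its size is N + 1 - (b + 1) = N - b. -/
theorem pentS_succ (h : Gen5 q d₁ d₂ d₃ d₄ d₅ (N + 1)) (a l b : ℕ) {y : ℕ} (hy : y ≤ N + 1) :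
    pentS q d₁ d₂ d₃ d₄ d₅ (N + 1) a l y (b + 1) =
      (pentG q d₁ d₄ d₅ y * sizeA q (d₂ * d₁) a (N - y) *
          pentS q (q * d₁) d₂ d₃ d₄ (q * d₅) N a l y b +
        pentG' q d₁ (d₂ * d₃) d₄ d₅ N y *
          conA q (d₂ * d₁) (d₃ * d₂ * d₁ * q ^ (N - (y - 1) + 2)) a *
          pentS q (q * d₁) d₂ d₃ d₄ (q * d₅) N a l (y - 1) b) +
      (pentG q d₁ d₄ d₅ y * sizeB q (d₂ * d₁) a (N - y) *
          pentS q (q * d₁) d₂ d₃ d₄ (q * d₅) N (a - 1) l y b +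
        pentG' q d₁ (d₂ * d₃) d₄ d₅ N y *
          conB q (d₂ * d₁) (d₃ * d₂ * d₁ * q ^ (N - (y - 1) + 2)) a *
          pentS q (q * d₁) d₂ d₃ d₄ (q * d₅) N (a - 1) l (y - 1) b) := by
  -- The top summand lies outside the support because b + 1 > 0, so the ranges for N + 1 and N
  -- agree.
  have hV : pentV q d₁ (d₂ * d₃) d₄ d₅ (N + 1) (N + 1) y (b + 1) = 0 := if_neg (by omega)
  simp only [pentS]
  rw [sum_range_succ, hV]
  simp only [mul_sum, zero_mul, add_zero, ← sum_add_distrib]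
  refine sum_congr rfl fun x hx => ?_
  have hx' : x ≤ N := Nat.lt_succ_iff.1 (mem_range.1 hx)
  have e0 := pentV_mul_racahPhi h hx' y b
  have e1 : pentV q (q * d₁) (d₂ * d₃) d₄ (q * d₅) N x y b *
      racahPhi q a x d₃ d₂ d₁ (N + 1 - y) = pentV q (q * d₁) (d₂ * d₃) d₄ (q * d₅) N x y b *
      (sizeA q (d₂ * d₁) a (N - y) * racahPhi q a x d₃ d₂ (q * d₁) (N - y) +
        sizeB q (d₂ * d₁) a (N - y) * racahPhi q (a - 1) x d₃ d₂ (q * d₁) (N - y)) := by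
    by_cases hxy : x + y ≤ N
    · rw [show N + 1 - y = N - y + 1 by omega, racahPhi_size h.gen3.symm (by omega)]
    · rw [pentV, if_neg (by omega), zero_mul, zero_mul]
  have e2 : pentG' q d₁ (d₂ * d₃) d₄ d₅ N y * racahPhi q a x d₃ d₂ d₁ (N + 1 - y) =
      pentG' q d₁ (d₂ * d₃) d₄ d₅ N y *
      (conA q (d₂ * d₁) (d₃ * d₂ * d₁ * q ^ (N - (y - 1) + 2)) a *
          racahPhi q a x d₃ d₂ (q * d₁) (N - (y - 1)) +
        conB q (d₂ * d₁) (d₃ * d₂ * d₁ * q ^ (N - (y - 1) + 2)) a *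
          racahPhi q (a - 1) x d₃ d₂ (q * d₁) (N - (y - 1))) := by
    rcases y with _ | y
    · rw [pentG'_zero, zero_mul, zero_mul]
    · rw [Nat.add_sub_cancel, Nat.add_sub_add_right, racahPhi_con h.gen3.symm]
  rw [Nat.add_sub_add_right]
  generalize pentV q d₁ (d₂ * d₃) d₄ d₅ (N + 1) x y (b + 1) = v at *
  generalize pentV q (q * d₁) (d₂ * d₃) d₄ (q * d₅) N x y b = v1 at *
  generalize pentV q (q * d₁) (d₂ * d₃) d₄ (q * d₅) N x (y - 1) b = v2 at *
  generalize racahPhi q a x d₃ d₂ d₁ (N + 1 - y) = F at *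
  generalize racahPhi q y b (q * d₁) (q * d₅) d₄ (N - x) = F1 at *
  generalize racahPhi q (y - 1) b (q * d₁) (q * d₅) d₄ (N - x) = F2 at *
  generalize racahPhi q x l d₄ d₃ d₂ (N - b) = F3 at *
  linear_combination (exp := 1) F * F3 * e0 + pentG q d₁ d₄ d₅ y * F1 * F3 * e1 +
    v2 * F2 * F3 * e2

theorem pentU_mul_backA (h : Gen5 q d₁ d₂ d₃ d₄ d₅ (N + 1)) (a : ℕ) {l : ℕ} (hl : l ≤ N) :
    pentU q d₁ d₂ d₃ d₄ d₅ (N + 1) a l * backA q d₂ d₁ d₅ (N - l) a =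
      pentU q (q * d₁) d₂ d₃ d₄ (q * d₅) N a l * pentA q d₁ d₂ d₄ d₅ N a (N - a) := by
  rcases lt_trichotomy (a + l) (N + 1) with ha | ha | ha
  · obtain ⟨m, hm⟩ := Nat.exists_eq_add_of_le (show a + l ≤ N by omega)
    rw [pentU, pentU, if_pos (by omega), if_pos (by omega), show N + 1 - a - l = m + 1 by omega,
      show N - a - l = m by omega, show N - l = a + m by omega, show N - a = l + m by omega,
      pentWa_mul_backA h hm, pentA]
  · obtain rfl : a = N - l + 1 := by omega
    rw [backA_last, mul_zero, pentU, if_neg (by omega), zero_mul]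
  · rw [pentU, pentU, if_neg (by omega), if_neg (by omega), zero_mul, zero_mul]

theorem pentU_mul_backB (h : Gen5 q d₁ d₂ d₃ d₄ d₅ (N + 1)) (a : ℕ) {l : ℕ} (hl : l ≤ N) :
    pentU q d₁ d₂ d₃ d₄ d₅ (N + 1) (a + 1) l * backB q d₂ d₁ d₅ (N - l) (a + 1) =
      pentU q (q * d₁) d₂ d₃ d₄ (q * d₅) N a l * pentB q d₁ d₂ d₄ d₅ N a := by
  by_cases ha : a + l ≤ N
  · obtain ⟨m, hm⟩ := Nat.exists_eq_add_of_le ha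
    rw [pentU, pentU, if_pos (by omega), if_pos (by omega), show N + 1 - (a + 1) - l = m by omega,
      show N - a - l = m by omega, show N - l = a + m by omega,
      pentWa_mul_backB h hm, pentB, mul_neg]
  · rw [pentU, pentU, if_neg (by omega), if_neg (by omega), zero_mul, zero_mul]

theorem pentT_succ (h : Gen5 q d₁ d₂ d₃ d₄ d₅ (N + 1)) (a y : ℕ) {l b : ℕ} (hb : b + l ≤ N) :
    pentT q d₁ d₂ d₃ d₄ d₅ (N + 1) a l y (b + 1) =
      (pentWy q (q ^ (N + 2) * d₁ * d₄) d₄ d₅ y (N + 1 - y) *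
        pentWy q (q ^ (N + 2) * d₁ * d₄) d₁ d₅ (b + 1) (N - b)) *
      racahPhi q y l d₃ d₄ d₅ (N + 1 - a) *
      (pentU q d₁ d₂ d₃ d₄ d₅ (N + 1) a l * backA q d₂ d₁ d₅ (N - l) a *
          racahPhi q a b (q * d₅) (q * d₁) d₂ (N - l) +
        pentU q d₁ d₂ d₃ d₄ d₅ (N + 1) a l * backB q d₂ d₁ d₅ (N - l) a *
          racahPhi q (a - 1) b (q * d₅) (q * d₁) d₂ (N - l)) := by
  have hq := h.nr.1
  rw [pentT, racahPhi_symm hq a (b + 1), show N + 1 - l = N - l + 1 by omega,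
    racahPhi_backward' h.gen3₂₁₅ a (by omega), ← racahPhi_symm hq a b, ← racahPhi_symm hq (a - 1),
    Nat.add_sub_add_right]
  ring

theorem pentT_shift (q d₁ d₂ d₃ d₄ d₅ : ℂ) (N a l y b : ℕ) :
    pentT q (q * d₁) d₂ d₃ d₄ (q * d₅) N a l y b =
      pentU q (q * d₁) d₂ d₃ d₄ (q * d₅) N a l *
        (pentWy q (q ^ (N + 2) * d₁ * d₄) d₄ (q * d₅) y (N - y) *
          pentWy q (q ^ (N + 2) * d₁ * d₄) (q * d₁) (q * d₅) b (N - b)) *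
        racahPhi q y l d₃ d₄ (q * d₅) (N - a) *
        racahPhi q a b (q * d₅) (q * d₁) d₂ (N - l) := by
  rw [pentT, show q ^ (N + 1) * (q * d₁) * d₄ = q ^ (N + 2) * d₁ * d₄ by ring]

/-- The two terms of unchanged index a reassemble, by the size relation for Φ_y(l), into the first
term of the backward shift in a on the product side. `pentS_partB` does the same for index a - 1,
with the plain contiguous relation. -/
theorem pentS_partA (h : Gen5 q d₁ d₂ d₃ d₄ d₅ (N + 1))
    (IH : ∀ a l y b : ℕ, a + y ≤ N → b + l ≤ N →
      pentS q (q * d₁) d₂ d₃ d₄ (q * d₅) N a l y b = pentT q (q * d₁) d₂ d₃ d₄ (q * d₅) N a l y b)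
    {a l y b : ℕ} (ha : a + y ≤ N + 1) (hb : b + l ≤ N) :
    pentG q d₁ d₄ d₅ y * sizeA q (d₂ * d₁) a (N - y) *
          pentS q (q * d₁) d₂ d₃ d₄ (q * d₅) N a l y b +
        pentG' q d₁ (d₂ * d₃) d₄ d₅ N y *
          conA q (d₂ * d₁) (d₃ * d₂ * d₁ * q ^ (N - (y - 1) + 2)) a *
          pentS q (q * d₁) d₂ d₃ d₄ (q * d₅) N a l (y - 1) b =
      (pentWy q (q ^ (N + 2) * d₁ * d₄) d₄ d₅ y (N + 1 - y) *
        pentWy q (q ^ (N + 2) * d₁ * d₄) d₁ d₅ (b + 1) (N - b)) *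
      racahPhi q y l d₃ d₄ d₅ (N + 1 - a) *
      (pentU q (q * d₁) d₂ d₃ d₄ (q * d₅) N a l * pentA q d₁ d₂ d₄ d₅ N a (N - a) *
          racahPhi q a b (q * d₅) (q * d₁) d₂ (N - l)) := by
  by_cases haN : a ≤ N
  swap
  -- The extreme case a = N + 1, y = 0, where both sides vanish.
  · obtain rfl : y = 0 := by omega
    obtain rfl : a = N + 1 := by omega
    rw [pentG'_zero, Nat.sub_zero, sizeA_last, pentU, if_neg (by omega)]
    ring
  have e1 : pentG q d₁ d₄ d₅ y * sizeA q (d₂ * d₁) a (N - y) *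
      pentS q (q * d₁) d₂ d₃ d₄ (q * d₅) N a l y b =
      pentA q d₁ d₂ d₄ d₅ N a (N - a) * sizeA q (d₄ * d₅) y (N - a) *
      (pentWy q (q ^ (N + 2) * d₁ * d₄) d₄ d₅ y (N + 1 - y) *
        pentWy q (q ^ (N + 2) * d₁ * d₄) d₁ d₅ (b + 1) (N - b)) *
      (pentU q (q * d₁) d₂ d₃ d₄ (q * d₅) N a l *
      racahPhi q y l d₃ d₄ (q * d₅) (N - a) * racahPhi q a b (q * d₅) (q * d₁) d₂ (N - l)) := by
    by_cases hay : a + y ≤ N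
    · rw [show N + 1 - y = N - y + 1 by omega,
        ← pent_match₁ h (show N = a + (N - a) by omega) (show N = y + (N - y) by omega),
        IH _ _ _ _ hay hb, pentT_shift]
      ring
    -- Here the induction hypothesis does not apply, but the size coefficients vanish on both sides.
    -- The exception is a = 0, where N - y is truncated to 0; then the sum itself has empty support.
    · obtain rfl : y = N - a + 1 := by omega
      rw [sizeA_last]
      rcases a with _ | a
      · rw [pentS, sum_eq_zero fun x _ => by rw [pentV, if_neg (by omega)]; ring]
        ring
      · have e : sizeA q (d₂ * d₁) (a + 1) (N - (N - (a + 1) + 1)) = 0 := by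
          rw [show N - (N - (a + 1) + 1) = a by omega, sizeA_last]
        rw [e]
        ring
  have e2 : pentG' q d₁ (d₂ * d₃) d₄ d₅ N y *
      conA q (d₂ * d₁) (d₃ * d₂ * d₁ * q ^ (N - (y - 1) + 2)) a *
      pentS q (q * d₁) d₂ d₃ d₄ (q * d₅) N a l (y - 1) b =
      pentA q d₁ d₂ d₄ d₅ N a (N - a) * sizeB q (d₄ * d₅) y (N - a) *
      (pentWy q (q ^ (N + 2) * d₁ * d₄) d₄ d₅ y (N + 1 - y) *
        pentWy q (q ^ (N + 2) * d₁ * d₄) d₁ d₅ (b + 1) (N - b)) *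
      (pentU q (q * d₁) d₂ d₃ d₄ (q * d₅) N a l *
      racahPhi q (y - 1) l d₃ d₄ (q * d₅) (N - a) *
      racahPhi q a b (q * d₅) (q * d₁) d₂ (N - l)) := by
    rcases y with _ | y
    · rw [pentG'_zero, sizeB_zero]
      ring
    · rw [Nat.add_sub_cancel, Nat.add_sub_add_right,
        ← pent_match₂ h (show N = a + (N - a) by omega) (show N = y + (N - y) by omega),
        IH _ _ _ _ (by omega) hb, pentT_shift]
      ring
  have e3 : pentU q (q * d₁) d₂ d₃ d₄ (q * d₅) N a l * racahPhi q y l d₃ d₄ d₅ (N + 1 - a) =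
      pentU q (q * d₁) d₂ d₃ d₄ (q * d₅) N a l *
        (sizeA q (d₄ * d₅) y (N - a) * racahPhi q y l d₃ d₄ (q * d₅) (N - a) +
          sizeB q (d₄ * d₅) y (N - a) * racahPhi q (y - 1) l d₃ d₄ (q * d₅) (N - a)) := by
    by_cases hal : a + l ≤ N
    · rw [show N + 1 - a = N - a + 1 by omega, racahPhi_size h.gen3₃₄₅ (by omega)]
    · rw [pentU, if_neg hal, zero_mul, zero_mul]
  rw [e1, e2]
  generalize pentWy q (q ^ (N + 2) * d₁ * d₄) d₄ d₅ y (N + 1 - y) *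
    pentWy q (q ^ (N + 2) * d₁ * d₄) d₁ d₅ (b + 1) (N - b) = w
  generalize racahPhi q a b (q * d₅) (q * d₁) d₂ (N - l) = F
  linear_combination (exp := 1) -(w * pentA q d₁ d₂ d₄ d₅ N a (N - a) * F) * e3

theorem pentS_partB (h : Gen5 q d₁ d₂ d₃ d₄ d₅ (N + 1))
    (IH : ∀ a l y b : ℕ, a + y ≤ N → b + l ≤ N →
      pentS q (q * d₁) d₂ d₃ d₄ (q * d₅) N a l y b = pentT q (q * d₁) d₂ d₃ d₄ (q * d₅) N a l y b)
    {a l y b : ℕ} (ha : a + y ≤ N) (hb : b + l ≤ N) :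
    pentG q d₁ d₄ d₅ y * sizeB q (d₂ * d₁) (a + 1) (N - y) *
          pentS q (q * d₁) d₂ d₃ d₄ (q * d₅) N a l y b +
        pentG' q d₁ (d₂ * d₃) d₄ d₅ N y *
          conB q (d₂ * d₁) (d₃ * d₂ * d₁ * q ^ (N - (y - 1) + 2)) (a + 1) *
          pentS q (q * d₁) d₂ d₃ d₄ (q * d₅) N a l (y - 1) b =
      (pentWy q (q ^ (N + 2) * d₁ * d₄) d₄ d₅ y (N + 1 - y) *
        pentWy q (q ^ (N + 2) * d₁ * d₄) d₁ d₅ (b + 1) (N - b)) *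
      racahPhi q y l d₃ d₄ d₅ (N - a) *
      (pentU q (q * d₁) d₂ d₃ d₄ (q * d₅) N a l * pentB q d₁ d₂ d₄ d₅ N a *
          racahPhi q a b (q * d₅) (q * d₁) d₂ (N - l)) := by
  have e1 : pentG q d₁ d₄ d₅ y * sizeB q (d₂ * d₁) (a + 1) (N - y) *
      pentS q (q * d₁) d₂ d₃ d₄ (q * d₅) N a l y b =
      pentB q d₁ d₂ d₄ d₅ N a * conA q (d₄ * d₅) (d₃ * d₄ * d₅ * q ^ (N - a + 2)) y *
      (pentWy q (q ^ (N + 2) * d₁ * d₄) d₄ d₅ y (N + 1 - y) *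
        pentWy q (q ^ (N + 2) * d₁ * d₄) d₁ d₅ (b + 1) (N - b)) *
      (pentU q (q * d₁) d₂ d₃ d₄ (q * d₅) N a l *
      racahPhi q y l d₃ d₄ (q * d₅) (N - a) * racahPhi q a b (q * d₅) (q * d₁) d₂ (N - l)) := by
    rw [show N + 1 - y = N - y + 1 by omega,
      ← pent_match₃ h (show N = a + (N - a) by omega) (show N = y + (N - y) by omega),
      IH _ _ _ _ ha hb, pentT_shift]
    ring
  have e2 : pentG' q d₁ (d₂ * d₃) d₄ d₅ N y *
      conB q (d₂ * d₁) (d₃ * d₂ * d₁ * q ^ (N - (y - 1) + 2)) (a + 1) *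
      pentS q (q * d₁) d₂ d₃ d₄ (q * d₅) N a l (y - 1) b =
      pentB q d₁ d₂ d₄ d₅ N a * conB q (d₄ * d₅) (d₃ * d₄ * d₅ * q ^ (N - a + 2)) y *
      (pentWy q (q ^ (N + 2) * d₁ * d₄) d₄ d₅ y (N + 1 - y) *
        pentWy q (q ^ (N + 2) * d₁ * d₄) d₁ d₅ (b + 1) (N - b)) *
      (pentU q (q * d₁) d₂ d₃ d₄ (q * d₅) N a l *
      racahPhi q (y - 1) l d₃ d₄ (q * d₅) (N - a) *
      racahPhi q a b (q * d₅) (q * d₁) d₂ (N - l)) := by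
    rcases y with _ | y
    · rw [pentG'_zero, conB_zero]
      ring
    · rw [Nat.add_sub_cancel, Nat.add_sub_add_right,
        ← pent_match₄ h (show N = a + (N - a) by omega) (show N = y + (N - y) by omega),
        IH _ _ _ _ (by omega) hb, pentT_shift]
      ring
  rw [e1, e2, racahPhi_con h.gen3₃₄₅ y l]
  ring

theorem pent_step (h : Gen5 q d₁ d₂ d₃ d₄ d₅ (N + 1))
    (IH : ∀ a l y b : ℕ, a + y ≤ N → b + l ≤ N →
      pentS q (q * d₁) d₂ d₃ d₄ (q * d₅) N a l y b = pentT q (q * d₁) d₂ d₃ d₄ (q * d₅) N a l y b)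
    {a l y b : ℕ} (ha : a + y ≤ N + 1) (hb : b + l ≤ N) :
    pentS q d₁ d₂ d₃ d₄ d₅ (N + 1) a l y (b + 1) =
      pentT q d₁ d₂ d₃ d₄ d₅ (N + 1) a l y (b + 1) := by
  rw [pentS_succ h a l b (by omega), pentT_succ h a y hb, pentS_partA h IH ha hb,
    pentU_mul_backA h a (by omega), mul_add]
  congr 1
  rcases a with _ | a
  · rw [sizeB_zero, conB_zero, backB_zero]
    ring
  · rw [Nat.add_sub_cancel, Nat.add_sub_add_right, pentU_mul_backB h a (by omega),
      pentS_partB h IH (by omega) hb]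

theorem pentV_mirror (q d₁ D d₄ d₅ : ℂ) (N x y b : ℕ) :
    pentV q d₄ D d₁ d₅ N x b y = pentV q d₁ D d₄ d₅ N x y b := by
  by_cases hx : x + y ≤ N ∧ x + b ≤ N
  · rw [pentV, pentV, if_pos hx.symm, if_pos hx]
    obtain ⟨t, ht⟩ := Nat.exists_eq_add_of_le hx.1
    obtain ⟨s, hs⟩ := Nat.exists_eq_add_of_le hx.2
    rw [show N - x - y = t by omega, show N - x - b = s by omega, pentWeight, pentWeight,
      show b + s = y + t by omega, show 2 * x + b + s + 1 = 2 * x + y + t + 1 by omega,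
      show y + b + 1 = b + y + 1 by omega]
    congr 1 <;> ring
  · rw [pentV, pentV, if_neg (by omega), if_neg hx]

/-- The reflection d₁ ↔ d₄, d₂ ↔ d₃ together with a ↔ l, y ↔ b is realized by duality of each
polynomial and by the symmetry of the weight. It exchanges the roles of y and b in the induction. -/
theorem pentS_mirror (hq : q ≠ 0) (d₁ d₂ d₃ d₄ d₅ : ℂ) (N a l y b : ℕ) :
    pentS q d₄ d₃ d₂ d₁ d₅ N l a b y = pentS q d₁ d₂ d₃ d₄ d₅ N a l y b := by
  refine sum_congr rfl fun x _ => ?_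
  rw [mul_comm d₃ d₂, pentV_mirror, racahPhi_symm hq l x, racahPhi_symm hq b y,
    racahPhi_symm hq x a, mul_right_comm _ (racahPhi q x l _ _ _ _),
    mul_right_comm _ (racahPhi q x l _ _ _ _), mul_right_comm _ (racahPhi q y b _ _ _ _)]

theorem pentT_mirror (hq : q ≠ 0) (d₁ d₂ d₃ d₄ d₅ : ℂ) (N a l y b : ℕ) :
    pentT q d₄ d₃ d₂ d₁ d₅ N l a b y = pentT q d₁ d₂ d₃ d₄ d₅ N a l y b := by
  rw [pentT, pentT, pentU, pentU, racahPhi_symm hq b a, racahPhi_symm hq l y, pentWa_mirror,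
    Nat.sub_right_comm N l a, mul_right_comm _ d₄ d₁]
  simp only [add_comm l a]
  ring

end

/-! ### The pentagon relation at y = b = 0: recursion of the sum -/

section

variable {q d₁ d₂ d₃ d₄ d₅ : ℂ} {N : ℕ}

theorem pentWeight_zero (q d₁ D d₄ d₅ : ℂ) (x t : ℕ) :
    pentWeight q d₁ D d₄ d₅ x 0 t 0 t =
      (-1) ^ x * q ^ x.choose 2 * (qPoch q q t * qPoch (q * D) q (2 * x + t + 1) *
        qPoch (q * D) q x * (1 - D * q * (q ^ x) ^ 2) * qPoch (q * d₄) q t * qPoch (q * d₁) q t) /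
      ((q * d₅) ^ x * qPoch q q x * qPoch q q t * qPoch q q t *
        qPoch (q * D) q (2 * x + t + 1) * qPoch (q * D) q (2 * x + t + 1) *
        qPoch (q * (d₁ * d₅)) q (t + 1) * qPoch (q * (d₄ * d₅)) q (t + 1)) := by
  simp only [pentWeight, zero_add, add_zero, mul_zero, pow_one]

theorem pentWeight_zero_succ (h : Gen5 q d₁ d₂ d₃ d₄ d₅ (N + 1)) (x t : ℕ) :
    pentWeight q d₁ (d₂ * d₃) d₄ d₅ (x + 1) 0 t 0 t *
        ((1 - q * q ^ x) * (1 - q * (d₂ * d₃) * (q * q ^ x)) * (q * d₅)) =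
      -(q ^ x * pentWeight q d₁ (q * d₂ * (q * d₃)) d₄ d₅ x 0 t 0 t) := by
  have hq := h.nr.1
  have n1 := h.nr.one_sub x
  have n2 := (h.n23.mul_left hq).one_sub'
  have n3 := ((h.n23.mul_left hq).mul_left hq).one_sub'
  have n5 := h.n5.1
  have eD : q * (q * (q * (d₂ * d₃))) = q * (q * d₂ * (q * d₃)) := by ring
  have e0 : ((-1 : ℂ) ^ (x + 1) * q ^ (x + 1).choose 2) * 1 =
      ((-1 : ℂ) ^ x * q ^ x.choose 2) * -(q ^ x) := by
    rw [Nat.choose_succ_succ' x 1, Nat.choose_one_right]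
    ring
  have e1 := Eq.refl (qPoch q q t * 1)
  have e2 : ∀ k, qPoch (q * (d₂ * d₃)) q (2 * (x + 1) + k + 1) * 1 =
      qPoch (q * (q * d₂ * (q * d₃))) q (2 * x + k + 1) *
        ((1 - q * (d₂ * d₃)) * (1 - q * (q * (d₂ * d₃)))) := fun k => by
    rw [show 2 * (x + 1) + k + 1 = 2 * x + k + 1 + 1 + 1 by ring, qPoch_succ', qPoch_succ', eD]
    ring
  have e3 : qPoch (q * (d₂ * d₃)) q (x + 1) * (1 - q * (d₂ * d₃) * (q * q ^ x)) =
      qPoch (q * (q * d₂ * (q * d₃))) q x *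
        ((1 - q * (d₂ * d₃)) * (1 - q * (q * (d₂ * d₃)))) := by
    rw [← pow_succ', ← qPoch_succ, qPoch_succ', qPoch_succ', eD]
    ring
  have e4 : (1 - d₂ * d₃ * q * (q ^ (x + 1)) ^ 2) * 1 =
      (1 - q * d₂ * (q * d₃) * q * (q ^ x) ^ 2) * 1 := by ring
  have e5 := Eq.refl (qPoch (q * d₄) q t * 1)
  have e6 := Eq.refl (qPoch (q * d₁) q t * 1)
  have f1 : (q * d₅) ^ (x + 1) * 1 = (q * d₅) ^ x * (q * d₅) := by
    ring
  have f2 := qPoch_succ_mul_one q q x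
  have f3 := Eq.refl (qPoch q q t * 1)
  have f7 := Eq.refl (qPoch (q * (d₁ * d₅)) q (t + 1) * 1)
  have f8 := Eq.refl (qPoch (q * (d₄ * d₅)) q (t + 1) * 1)
  have key := ratio_div (ratio_mul e0 (ratio_mul (ratio_mul (ratio_mul (ratio_mul (ratio_mul e1 (e2 t))
      e3) e4) e5) e6)) (ratio_mul (ratio_mul (ratio_mul (ratio_mul (ratio_mul (ratio_mul (ratio_mul
        f1 f2) f3) f3) (e2 t)) (e2 t)) f7) f8) (by simp)
      (by simp only [mul_ne_zero_iff]; simp [hq, n1, n2, n3, n5])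
  rw [pentWeight_zero, pentWeight_zero]
  refine mul_right_cancel₀ (mul_ne_zero (mul_ne_zero n2 n3) (mul_ne_zero n2 n3)) ?_
  linear_combination (exp := 1) key

/-- For y = b = 0 the middle polynomial equals 1. The difference in a vanishes at x = 0 and
otherwise is a forward shift. The backward shift of Φ_{x+1}(l) raises the same parameters d₂, d₃, so
the result consists again of sums of the same kind with size N. -/
theorem pentS_zero_succ_sub (h : Gen5 q d₁ d₂ d₃ d₄ d₅ (N + 1)) (a l : ℕ) :
    pentS q d₁ d₂ d₃ d₄ d₅ (N + 1) (a + 1) l 0 0 - pentS q d₁ d₂ d₃ d₄ d₅ (N + 1) a l 0 0 =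
      (d₂ * d₁ * (q * q ^ a) ^ 2 - 1) * (q * q ^ N) / (q ^ a * (1 - q * d₂) *
        (1 - d₃ * d₂ * d₁ * q ^ (N + 3)) * (q * q ^ N - 1) * (q * (q * d₅))) *
      (backA q d₄ d₃ d₂ N l * pentS q d₁ (q * d₂) (q * d₃) d₄ d₅ N a l 0 0 +
        backB q d₄ d₃ d₂ N l * pentS q d₁ (q * d₂) (q * d₃) d₄ d₅ N a (l - 1) 0 0) := by
  have hq := h.nr.1
  simp only [pentS]
  rw [sum_range_succ' _ (N + 1), sum_range_succ' _ (N + 1), add_sub_add_comm,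
    racahPhi_zero_right hq (a + 1), racahPhi_zero_right hq a, sub_self, add_zero, ← sum_sub_distrib, mul_sum,
    mul_sum, ← sum_add_distrib, mul_sum]
  refine sum_congr rfl fun x hx => ?_
  obtain ⟨t, ht⟩ := Nat.exists_eq_add_of_le (Nat.lt_succ_iff.1 (mem_range.1 hx))
  have key := pentWeight_zero_succ h x t
  have e1 := racahPhi_forward h.gen3.symm a x N
  have e2 := racahPhi_backward' h.rot.gen3.symm (n := x) (K := N) l (by omega)
  simp only [Nat.sub_zero, racahPhi_zero_left, mul_one]
  rw [e2, pentV, pentV, if_pos (by omega), if_pos (by omega), show N + 1 - (x + 1) - 0 = t by omega,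
    show N - x - 0 = t by omega]
  have n0 : q ^ x ≠ 0 := pow_ne_zero _ hq
  have n0' : q ^ a ≠ 0 := pow_ne_zero _ hq
  have n1 := h.nr.one_sub x
  have n2 : 1 - q * (d₂ * d₃) * (q * q ^ x) ≠ 0 :=
    h.n23.one_sub_of_eq (2 + x : ℕ) (by rw [zpow_natCast]; ring)
  have n3 := h.n5.1
  have n4 := (h.n2.mul_left hq).one_sub'
  have n5 := h.gen3.symm.n123.one_sub (N + 3)
  have n6 := h.nr.one_sub N
  have e3 : q * q ^ N - 1 = -(1 - q * q ^ N) := by ring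
  have e4 : q * q ^ x - 1 = -(1 - q * q ^ x) := by ring
  have e5 : 1 - d₃ * d₂ * q * (q * q ^ x) = 1 - q * (d₂ * d₃) * (q * q ^ x) := by ring
  rw [e3, e4, e5] at e1
  rw [e3]
  rw [← eq_div_iff (mul_ne_zero (mul_ne_zero n1 n2) (mul_ne_zero hq n3))] at key
  rw [key]
  generalize racahPhi q (a + 1) (x + 1) d₃ d₂ d₁ (N + 1) = F1 at *
  generalize racahPhi q a (x + 1) d₃ d₂ d₁ (N + 1) = F2 at *
  generalize racahPhi q a x (q * d₃) (q * d₂) d₁ N = F3 at *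
  generalize pentWeight q d₁ (q * d₂ * (q * d₃)) d₄ d₅ x 0 t 0 t = v at *
  generalize racahPhi q x l d₄ (q * d₃) (q * d₂) N = F4 at *
  generalize racahPhi q x (l - 1) d₄ (q * d₃) (q * d₂) N = F5 at *
  generalize backA q d₄ d₃ d₂ N l = A at *
  generalize backB q d₄ d₃ d₂ N l = B at *
  obtain rfl : F1 = F2 + _ := eq_add_of_sub_eq' e1
  generalize 1 - q * (d₂ * d₃) * (q * q ^ x) = u1 at *
  generalize 1 - q * q ^ x = u2 at *
  generalize 1 - q * q ^ N = u3 at *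
  generalize 1 - q * d₂ = u4 at *
  generalize 1 - d₃ * d₂ * d₁ * q ^ (N + 3) = u5 at *
  generalize d₂ * d₁ * (q * q ^ a) ^ 2 - 1 = u6 at *
  field_simp
  ring

end

/-! ### The pentagon relation at y = b = 0: recursion of the product -/

section

variable {q d₁ d₂ d₃ d₄ d₅ : ℂ} {N : ℕ}

theorem pentWa_step (h : Gen5 q d₁ d₂ d₃ d₄ d₅ N) (M a l m : ℕ) :
    pentWa q d₁ d₂ d₃ d₄ d₅ M (a + 1) l m * ((1 - q * q ^ (l + m)) * (1 - q * d₅ * q ^ m) * q ^ l *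
        (1 - q * d₂ * q ^ a) * (1 - q * (d₁ * d₂) * q ^ (2 * a + m + 2))) =
      pentWa q d₁ d₂ d₃ d₄ d₅ M a l (m + 1) * ((q ^ (M + 1) * d₂ * d₅) * (1 - q * d₁ * q ^ a) *
        (1 - q * (d₁ * d₂) * q ^ (2 * a + l + m + 2)) *
        ((1 - q * q ^ m) * (1 - q * (d₃ * d₄) * q ^ (2 * l + m + 1)))) := by
  have hq := h.nr.1
  have n1 := h.nr.one_sub m
  have n2 := (h.n34.mul_left hq).one_sub (2 * l + m + 1)
  have n0 : q ^ l ≠ 0 := pow_ne_zero _ hq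
  have n3 := (h.n2.mul_left hq).one_sub a
  have n4 := (h.n12.mul_left hq).one_sub (2 * a + m + 2)
  have e1 := Eq.refl ((q ^ (M + 1) * d₁ * d₄) ^ M * 1)
  have e2 : (q ^ (M + 1) * d₂ * d₅) ^ (a + 1) * 1 =
    (q ^ (M + 1) * d₂ * d₅) ^ a * (q ^ (M + 1) * d₂ * d₅) := by rw [pow_succ, mul_one]
  have e3 := Eq.refl ((q ^ (M + 1) * d₃ * d₅) ^ l * 1)
  have e4 : qPoch q q (l + m) * (1 - q * q ^ (l + m)) = qPoch q q (l + (m + 1)) * 1 := by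
    rw [mul_one, ← qPoch_succ, add_assoc]
  have e5 : qPoch q q (a + 1 + m) * 1 = qPoch q q (a + (m + 1)) * 1 := by
    rw [add_assoc, add_comm 1 m]
  have e6 : qPoch (q * d₅) q m * (1 - q * d₅ * q ^ m) = qPoch (q * d₅) q (m + 1) * 1 := by
    rw [mul_one, ← qPoch_succ]
  have e7 := qPoch_succ_mul_one (q * d₁) q a
  have e8 := Eq.refl (qPoch (q * d₄) q l * 1)
  have e9 : qPoch (q * (d₁ * d₂)) q (2 * (a + 1) + l + m + 1) * 1 =
      qPoch (q * (d₁ * d₂)) q (2 * a + l + (m + 1) + 1) *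
        (1 - q * (d₁ * d₂) * q ^ (2 * a + l + m + 2)) := by
    rw [mul_one, show 2 * a + l + (m + 1) + 1 = 2 * a + l + m + 2 by ring, ← qPoch_succ]
    congr 1
    ring
  have e10 : qPoch (q * (d₃ * d₄)) q (2 * l + (a + 1) + m + 1) * 1 =
      qPoch (q * (d₃ * d₄)) q (2 * l + a + (m + 1) + 1) * 1 := by
    congr 2
    ring
  have f1 : q ^ ((a + 1) * l) * 1 = q ^ (a * l) * q ^ l := by ring
  have f2 : qPoch q q m * (1 - q * q ^ m) = qPoch q q (m + 1) * 1 := by rw [mul_one, qPoch_succ]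
  have f3 := qPoch_succ_mul_one (q * d₂) q a
  have f4 := Eq.refl (qPoch (q * d₃) q l * 1)
  have f5 : qPoch (q * (d₁ * d₂)) q (2 * (a + 1) + m + 1) * 1 =
      qPoch (q * (d₁ * d₂)) q (2 * a + (m + 1) + 1) *
        (1 - q * (d₁ * d₂) * q ^ (2 * a + m + 2)) := by
    rw [mul_one, show 2 * a + (m + 1) + 1 = 2 * a + m + 2 by ring, ← qPoch_succ]
    congr 1
    ring
  have f6 : qPoch (q * (d₃ * d₄)) q (2 * l + m + 1) * (1 - q * (d₃ * d₄) * q ^ (2 * l + m + 1)) =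
      qPoch (q * (d₃ * d₄)) q (2 * l + (m + 1) + 1) * 1 := by
    rw [mul_one, ← qPoch_succ]
    rfl
  have key : pentWa q d₁ d₂ d₃ d₄ d₅ M (a + 1) l m * _ =
      pentWa q d₁ d₂ d₃ d₄ d₅ M a l (m + 1) * _ :=
    ratio_div (ratio_mul (ratio_mul (ratio_mul e1 e2) e3) (ratio_mul (ratio_mul (ratio_mul
      (ratio_mul (ratio_mul (ratio_mul e4 e5) e6) e7) e8) e9) e10))
      (ratio_mul (ratio_mul (ratio_mul (ratio_mul (ratio_mul f1 f2) f3) f4) f5) f6)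
      (by simp only [mul_ne_zero_iff]; simp [n1, n2])
      (by simp only [mul_ne_zero_iff]; simp [n0, n3, n4])
  linear_combination (exp := 1) key

/-- This ratio and `pentWa_shift₂₃'` realize on the product side the change d₂, d₃ to qd₂, qd₃ made
by `pentS_zero_succ_sub`, for the indices l and l - 1. -/
theorem pentWa_shift₂₃ (h : Gen5 q d₁ d₂ d₃ d₄ d₅ (N + 1)) (M a l m : ℕ) :
    pentWa q d₁ (q * d₂) (q * d₃) d₄ d₅ M a l m * ((1 - q * q ^ (l + m)) * (1 - q * q ^ (a + m)) *
        (1 - q * d₅ * q ^ m) * (1 - q * d₂ * q ^ a) * (1 - q * d₃ * q ^ l) *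
        (q ^ M * (q ^ (M + 2) * d₁ * d₄))) =
      pentWa q d₁ d₂ d₃ d₄ d₅ (M + 1) a l (m + 1) *
        ((1 - q * q ^ m) * (1 - q * d₂) * (1 - q * d₃)) := by
  have hq := h.nr.1
  have n1 := h.nr.one_sub m
  have n2 := (h.n2.mul_left hq).one_sub'
  have n3 := (h.n3.mul_left hq).one_sub'
  have n2' := (h.n2.mul_left hq).one_sub a
  have n3' := (h.n3.mul_left hq).one_sub l
  have n4 := (h.n12.mul_left hq).one_sub'
  have n5 := (h.n34.mul_left hq).one_sub'
  have hA : q * (q * (d₁ * d₂)) = q * (d₁ * (q * d₂)) := by ring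
  have hB : q * (q * (d₃ * d₄)) = q * (q * d₃ * d₄) := by ring
  have e1 : (q ^ (M + 1) * d₁ * d₄) ^ M * (q ^ M * (q ^ (M + 2) * d₁ * d₄)) =
      (q ^ (M + 1 + 1) * d₁ * d₄) ^ (M + 1) * 1 := by ring
  have e2 : (q ^ (M + 1) * (q * d₂) * d₅) ^ a * 1 = (q ^ (M + 1 + 1) * d₂ * d₅) ^ a * 1 := by ring
  have e3 : (q ^ (M + 1) * (q * d₃) * d₅) ^ l * 1 = (q ^ (M + 1 + 1) * d₃ * d₅) ^ l * 1 := by ring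
  have e4 : qPoch q q (l + m) * (1 - q * q ^ (l + m)) = qPoch q q (l + (m + 1)) * 1 := by
    rw [mul_one, ← qPoch_succ, add_assoc]
  have e5 : qPoch q q (a + m) * (1 - q * q ^ (a + m)) = qPoch q q (a + (m + 1)) * 1 := by
    rw [mul_one, ← qPoch_succ, add_assoc]
  have e6 : qPoch (q * d₅) q m * (1 - q * d₅ * q ^ m) = qPoch (q * d₅) q (m + 1) * 1 := by
    rw [mul_one, ← qPoch_succ]
  have e7 := Eq.refl (qPoch (q * d₁) q a * 1)
  have e8 := Eq.refl (qPoch (q * d₄) q l * 1)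
  have e9 : qPoch (q * (d₁ * (q * d₂))) q (2 * a + l + m + 1) * (1 - q * (d₁ * d₂)) =
      qPoch (q * (d₁ * d₂)) q (2 * a + l + (m + 1) + 1) * 1 := by
    rw [mul_one, ← hA, mul_comm, ← qPoch_succ']
    rfl
  have e10 : qPoch (q * (q * d₃ * d₄)) q (2 * l + a + m + 1) * (1 - q * (d₃ * d₄)) =
      qPoch (q * (d₃ * d₄)) q (2 * l + a + (m + 1) + 1) * 1 := by
    rw [mul_one, ← hB, mul_comm, ← qPoch_succ']
    rfl
  have f1 := Eq.refl (q ^ (a * l) * 1)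
  have f2 : qPoch q q m * (1 - q * q ^ m) = qPoch q q (m + 1) * 1 := by rw [mul_one, qPoch_succ]
  have f3 : qPoch (q * (q * d₂)) q a * (1 - q * d₂) =
      qPoch (q * d₂) q a * (1 - q * d₂ * q ^ a) := by
    rw [mul_comm, one_sub_mul_qPoch]
  have f4 : qPoch (q * (q * d₃)) q l * (1 - q * d₃) =
      qPoch (q * d₃) q l * (1 - q * d₃ * q ^ l) := by
    rw [mul_comm, one_sub_mul_qPoch]
  have f5 : qPoch (q * (d₁ * (q * d₂))) q (2 * a + m + 1) * (1 - q * (d₁ * d₂)) =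
      qPoch (q * (d₁ * d₂)) q (2 * a + (m + 1) + 1) * 1 := by
    rw [mul_one, ← hA, mul_comm, ← qPoch_succ']
    rfl
  have f6 : qPoch (q * (q * d₃ * d₄)) q (2 * l + m + 1) * (1 - q * (d₃ * d₄)) =
      qPoch (q * (d₃ * d₄)) q (2 * l + (m + 1) + 1) * 1 := by
    rw [mul_one, ← hB, mul_comm, ← qPoch_succ']
    rfl
  have key : pentWa q d₁ (q * d₂) (q * d₃) d₄ d₅ M a l m * _ =
      pentWa q d₁ d₂ d₃ d₄ d₅ (M + 1) a l (m + 1) * _ :=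
    ratio_div (ratio_mul (ratio_mul (ratio_mul e1 e2) e3) (ratio_mul (ratio_mul (ratio_mul
      (ratio_mul (ratio_mul (ratio_mul e4 e5) e6) e7) e8) e9) e10))
      (ratio_mul (ratio_mul (ratio_mul (ratio_mul (ratio_mul f1 f2) f3) f4) f5) f6)
      (by simp only [mul_ne_zero_iff]; simp [n1, n2, n3, n4, n5])
      (by simp only [mul_ne_zero_iff]; simp [n2', n3'])
  refine mul_right_cancel₀ (mul_ne_zero n4 n5) ?_
  linear_combination (exp := 1) key

theorem pentWa_shift₂₃' (h : Gen5 q d₁ d₂ d₃ d₄ d₅ (N + 1)) (M a l m : ℕ) :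
    pentWa q d₁ (q * d₂) (q * d₃) d₄ d₅ M a l m * ((1 - q * q ^ (l + m)) * (1 - q * d₄ * q ^ l) *
        (1 - q * d₂ * q ^ a) * (1 - q * (d₁ * d₂) * q ^ (2 * a + m + 1)) *
        (1 - q * (q * (d₃ * d₄)) * q ^ (2 * l + a + m + 1)) *
        (q ^ M * (q ^ (M + 2) * d₁ * d₄) * (q ^ (M + 2) * d₃ * d₅))) =
      pentWa q d₁ d₂ d₃ d₄ d₅ (M + 1) a (l + 1) m *
        (q ^ a * (1 - q * d₂) * (1 - q * d₃) *
          (1 - q * (q * (d₃ * d₄)) * q ^ (2 * l + m + 1))) := by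
  have hq := h.nr.1
  have n0 : q ^ a ≠ 0 := pow_ne_zero _ hq
  have n2 := (h.n2.mul_left hq).one_sub'
  have n3 := (h.n3.mul_left hq).one_sub'
  have n2' := (h.n2.mul_left hq).one_sub a
  have n4 := (h.n12.mul_left hq).one_sub'
  have n4' := (h.n12.mul_left hq).one_sub (2 * a + m + 1)
  have n5 := (h.n34.mul_left hq).one_sub'
  have n5' := ((h.n34.mul_left hq).mul_left hq).one_sub (2 * l + m + 1)
  have hA : q * (q * (d₁ * d₂)) = q * (d₁ * (q * d₂)) := by ring
  have hB : q * (q * (d₃ * d₄)) = q * (q * d₃ * d₄) := by ring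
  have e1 : (q ^ (M + 1) * d₁ * d₄) ^ M * (q ^ M * (q ^ (M + 2) * d₁ * d₄)) =
      (q ^ (M + 1 + 1) * d₁ * d₄) ^ (M + 1) * 1 := by ring
  have e2 : (q ^ (M + 1) * (q * d₂) * d₅) ^ a * 1 = (q ^ (M + 1 + 1) * d₂ * d₅) ^ a * 1 := by ring
  have e3 : (q ^ (M + 1) * (q * d₃) * d₅) ^ l * (q ^ (M + 2) * d₃ * d₅) =
    (q ^ (M + 1 + 1) * d₃ * d₅) ^ (l + 1) * 1 := by ring
  have e4 : qPoch q q (l + m) * (1 - q * q ^ (l + m)) = qPoch q q (l + 1 + m) * 1 := by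
    rw [mul_one, ← qPoch_succ, add_right_comm]
  have e5 := Eq.refl (qPoch q q (a + m) * 1)
  have e6 := Eq.refl (qPoch (q * d₅) q m * 1)
  have e7 := Eq.refl (qPoch (q * d₁) q a * 1)
  have e8 : qPoch (q * d₄) q l * (1 - q * d₄ * q ^ l) = qPoch (q * d₄) q (l + 1) * 1 := by
    rw [mul_one, qPoch_succ]
  have e9 : qPoch (q * (d₁ * (q * d₂))) q (2 * a + l + m + 1) * (1 - q * (d₁ * d₂)) =
      qPoch (q * (d₁ * d₂)) q (2 * a + (l + 1) + m + 1) * 1 := by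
    rw [mul_one, ← hA, mul_comm, ← qPoch_succ']
    congr 1
    ring
  have e10 : qPoch (q * (q * d₃ * d₄)) q (2 * l + a + m + 1) * ((1 - q * (d₃ * d₄)) *
        (1 - q * (q * (d₃ * d₄)) * q ^ (2 * l + a + m + 1))) =
      qPoch (q * (d₃ * d₄)) q (2 * (l + 1) + a + m + 1) * 1 := by
    rw [show 2 * (l + 1) + a + m + 1 = 2 * l + a + m + 1 + 1 + 1 by ring,
      qPoch_succ' _ _ (2 * l + a + m + 1 + 1),
      qPoch_succ _ _ (2 * l + a + m + 1), hB]
    ring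
  have f1 : q ^ (a * l) * q ^ a = q ^ (a * (l + 1)) * 1 := by ring
  have f2 := Eq.refl (qPoch q q m * 1)
  have f3 : qPoch (q * (q * d₂)) q a * (1 - q * d₂) =
      qPoch (q * d₂) q a * (1 - q * d₂ * q ^ a) := by
    rw [mul_comm, one_sub_mul_qPoch]
  have f4 : qPoch (q * (q * d₃)) q l * (1 - q * d₃) = qPoch (q * d₃) q (l + 1) * 1 := by
    rw [qPoch_succ']
    ring
  have f5 : qPoch (q * (d₁ * (q * d₂))) q (2 * a + m + 1) * (1 - q * (d₁ * d₂)) =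
      qPoch (q * (d₁ * d₂)) q (2 * a + m + 1) * (1 - q * (d₁ * d₂) * q ^ (2 * a + m + 1)) := by
    rw [← hA, mul_comm, one_sub_mul_qPoch]
  have f6 : qPoch (q * (q * d₃ * d₄)) q (2 * l + m + 1) * ((1 - q * (d₃ * d₄)) *
        (1 - q * (q * (d₃ * d₄)) * q ^ (2 * l + m + 1))) =
      qPoch (q * (d₃ * d₄)) q (2 * (l + 1) + m + 1) * 1 := by
    rw [show 2 * (l + 1) + m + 1 = 2 * l + m + 1 + 1 + 1 by ring,
      qPoch_succ' _ _ (2 * l + m + 1 + 1), qPoch_succ _ _ (2 * l + m + 1), hB]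
    ring
  have key : pentWa q d₁ (q * d₂) (q * d₃) d₄ d₅ M a l m * _ =
      pentWa q d₁ d₂ d₃ d₄ d₅ (M + 1) a (l + 1) m * _ :=
    ratio_div (ratio_mul (ratio_mul (ratio_mul e1 e2) e3) (ratio_mul (ratio_mul (ratio_mul
      (ratio_mul (ratio_mul (ratio_mul e4 e5) e6) e7) e8) e9) e10))
      (ratio_mul (ratio_mul (ratio_mul (ratio_mul (ratio_mul f1 f2) f3) f4) f5) f6)
      (by simp only [mul_ne_zero_iff]; simp [n0, n2, n3, n4, n5, n5'])
      (by simp only [mul_ne_zero_iff]; simp [n2', n4'])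
  refine mul_right_cancel₀ (mul_ne_zero n4 n5) ?_
  linear_combination (exp := 1) key

/-- The recursion in a of the product side divided by its value at (a,l). Here A, L, M stand for
q^a, q^l, q^m, and α, β, s, δ contain d₁, d₂, d₃d₄, d₅. The only relation among them that is needed
is the constraint αβsM²δ = 1. -/
theorem pent_aux {q A L M α β s δ E₄ c d₃ : ℂ} (hq : q ≠ 0) (hA : A ≠ 0) (hL : L ≠ 0)
    (hM : M ≠ 0) (hα : α ≠ 0) (hβ : β ≠ 0) (hδ : δ ≠ 0) (hE₄ : E₄ ≠ 0) (hc : c ≠ 0) (hd₃ : d₃ ≠ 0)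
    (hE₁' : 1 - α * δ * L * M ≠ 0) (hE₄' : 1 - E₄ ≠ 0) (hQ : 1 - A * L * M ≠ 0) (hs : 1 - s ≠ 0)
    (h₁ : 1 - L * M ≠ 0) (h₂ : 1 - δ * M ≠ 0) (h₃ : 1 - β ≠ 0) (h₄ : 1 - α * β * M ≠ 0)
    (hcon : α * β * s * M ^ 2 * δ = 1) :
    β * δ * M * (1 - α) * (1 - α * β * L * M) * ((1 - M) * (1 - s * M)) /
        ((1 - L * M) * (1 - δ * M) * (1 - β) * (1 - α * β * M)) - 1 =
      (α * β - 1) * (A * L * M) /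
          (A * c * (1 - E₄⁻¹) * (A * L * M - 1) * (q * (q * δ))) *
        ((1 - A * L * M) ^ 2 * (1 - E₄) * (1 - α * δ * L * M)) *
        (-((1 - M) * c * (1 - (α * δ * L * M)⁻¹ * L) * (L - s) /
            ((1 - L * M) * (1 - δ * M) * (1 - β) * (α * δ * L * M * E₄ / (δ * q) ^ 2) * L * (1 - s) *
              (1 - (α * δ * L * M)⁻¹) * (A * L * M - 1))) +
          -(A * c * (1 - s * M) * (q * d₃ * (L * (1 - β * M)) * (L - 1)) /
            ((1 - L * M) * (1 - β) * (1 - α * β * M) * (α * δ * L * M * E₄ / (δ * q) ^ 2) *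
              (q * (A * L * M) * d₃ * δ) * L * (1 - s) * (1 - (α * δ * L * M)⁻¹) *
              (A * L * M - 1)))) := by
  have e1 : 1 - E₄⁻¹ = -((1 - E₄) / E₄) := by field_simp; ring
  have e2 : 1 - (α * δ * L * M)⁻¹ = -((1 - α * δ * L * M) / (α * δ * L * M)) := by
    field_simp
    ring
  have e3 : A * L * M - 1 = -(1 - A * L * M) := by ring
  rw [e1, e2, e3]
  -- The essential part of the identity, free of the common denominators. It is verified after
  -- eliminating δ by the constraint.
  have key : β * δ * M * (1 - α) * (1 - α * β * L * M) * ((1 - M) * (1 - s * M)) -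
      (1 - L * M) * (1 - δ * M) * (1 - β) * (1 - α * β * M) = (α * β - 1) / (1 - s) *
      (-(L - s) * (M * δ - α⁻¹) * (1 - M) * (1 - α * β * M) -
        (1 - β * M) * (L - 1) * (1 - s * M) * (1 - δ * M)) := by
    rw [eq_comm, div_mul_eq_mul_div, div_eq_iff hs]
    obtain rfl : δ = (α * β * s * M ^ 2)⁻¹ := eq_inv_of_mul_eq_one_right hcon
    have hs0 : s ≠ 0 := by rintro rfl; simp at hcon
    field_simp
    ring
  rw [div_sub_one (by simp only [mul_ne_zero_iff]; tauto), key]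
  generalize 1 - E₄ = u1 at *
  generalize 1 - A * L * M = u2 at *
  generalize 1 - L * M = u3 at *
  generalize 1 - α * β * M = u4 at *
  have e4 : 1 - (α * δ * L * M)⁻¹ * L = (M * δ - α⁻¹) / (δ * M) := by field_simp
  rw [e4]
  generalize 1 - α * δ * L * M = u5 at *
  generalize M * δ - α⁻¹ = u10
  generalize 1 - δ * M = u6 at *
  generalize 1 - β = u7 at *
  generalize 1 - s * M = u8 at *
  generalize 1 - s = u9 at *
  generalize 1 - β * M = u11 at *
  generalize 1 - M = u12 at *
  generalize L - s = u13 at *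
  generalize L - 1 = u14 at *
  generalize α * β - 1 = u15 at *
  field_simp
  ring

end

section

variable {q d₁ d₂ d₃ d₄ d₅ : ℂ} {N : ℕ}

theorem pentU_succ (h : Gen5 q d₁ d₂ d₃ d₄ d₅ (N + 1)) {a l m : ℕ} (hN : N + 1 = a + l + m)
    (ha : a ≤ N) :
    pentU q d₁ d₂ d₃ d₄ d₅ (N + 1) (a + 1) l = pentU q d₁ d₂ d₃ d₄ d₅ (N + 1) a l *
      (q * d₂ * q ^ a * d₅ * q ^ m * (1 - q * d₁ * q ^ a) *
        (1 - q * d₁ * q ^ a * (q * d₂ * q ^ a) * q ^ l * q ^ m) *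
        ((1 - q ^ m) * (1 - d₃ * d₄ * q * (q ^ l) ^ 2 * q ^ m)) /
        ((1 - q ^ l * q ^ m) * (1 - d₅ * q ^ m) * (1 - q * d₂ * q ^ a) *
          (1 - q * d₁ * q ^ a * (q * d₂ * q ^ a) * q ^ m))) := by
  have hq := h.nr.1
  -- For m = 0 the left side leaves the support, and on the right the factor 1 - q^m vanishes.
  rcases m with _ | m
  · rw [pentU, if_neg (by omega), pow_zero]
    ring
  have h₁ : 1 - q ^ l * q ^ (m + 1) ≠ 0 := by
    convert h.nr.one_sub (l + m) using 2
    ring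
  have h₂ : 1 - d₅ * q ^ (m + 1) ≠ 0 := h.n5.one_sub _
  have h₃ : 1 - q * d₂ * q ^ a ≠ 0 := (h.n2.mul_left hq).one_sub a
  have h₄ : 1 - q * d₁ * q ^ a * (q * d₂ * q ^ a) * q ^ (m + 1) ≠ 0 :=
    h.n12.one_sub_of_eq (2 * a + m + 3 : ℕ) (by rw [zpow_natCast]; ring)
  have key := pentWa_step h (N + 1) a l m
  obtain rfl : N = a + l + m := by omega
  rw [pentU, pentU, if_pos (by omega), if_pos (by omega),
    show a + l + m + 1 - (a + 1) - l = m by omega, show a + l + m + 1 - a - l = m + 1 by omega,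
    ← mul_div_assoc, eq_div_iff (by simp only [mul_ne_zero_iff]; tauto)]
  refine mul_right_cancel₀ (pow_ne_zero l hq) ?_
  linear_combination (exp := 1) key

theorem backA_mul_pentU (h : Gen5 q d₁ d₂ d₃ d₄ d₅ (N + 1)) {a l m : ℕ} (hN : N + 1 = a + l + m)
    (ha : a ≤ N) :
    backA q d₄ d₃ d₂ N l * pentU q d₁ (q * d₂) (q * d₃) d₄ d₅ N a l =
      pentU q d₁ d₂ d₃ d₄ d₅ (N + 1) a l *
        -((1 - q ^ m) * (1 - q * d₂) * (1 - d₄ * d₃ * d₂ * q ^ (N + 3) * q ^ l) *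
          (q ^ l - d₃ * d₄ * q * (q ^ l) ^ 2) /
            ((1 - q ^ l * q ^ m) * (1 - d₅ * q ^ m) * (1 - q * d₂ * q ^ a) *
              (q ^ N * (q ^ (N + 2) * d₁ * d₄)) * q ^ l * (1 - d₃ * d₄ * q * (q ^ l) ^ 2) *
              (1 - d₄ * d₃ * d₂ * q ^ (N + 3)) * (q ^ a * q ^ l * q ^ m - 1))) := by
  have hq := h.nr.1
  rcases m with _ | m
  · rw [pentU, if_neg (by omega), pow_zero]
    ring
  have h₁ : 1 - q ^ l * q ^ (m + 1) ≠ 0 := by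
    convert h.nr.one_sub (l + m) using 2
    ring
  have h₂ : 1 - d₅ * q ^ (m + 1) ≠ 0 := h.n5.one_sub _
  have h₃ : 1 - q * d₂ * q ^ a ≠ 0 := (h.n2.mul_left hq).one_sub a
  have h₄ : 1 - d₃ * d₄ * q * (q ^ l) ^ 2 ≠ 0 :=
    h.n34.one_sub_of_eq (1 + 2 * l : ℕ) (by rw [zpow_natCast]; ring)
  have h₅ : 1 - d₄ * d₃ * d₂ * q ^ (N + 3) ≠ 0 := h.rot.gen3.symm.n123.one_sub _
  have h₆ := h.nr.one_sub N
  have h₇ := (h.n3.mul_left hq).one_sub'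
  have h₇' := (h.n3.mul_left hq).one_sub l
  have h₈ := h.nr.one_sub (a + m)
  have h₉ : q ^ l ≠ 0 := pow_ne_zero _ hq
  have h₁₀ : q ^ N * (q ^ (N + 2) * d₁ * d₄) ≠ 0 := mul_ne_zero (pow_ne_zero _ hq)
    (mul_ne_zero (mul_ne_zero (pow_ne_zero _ hq) h.n1.1) h.n4.1)
  have key := pentWa_shift₂₃ h N a l m
  have hNm : N = a + l + m := by omega
  have e0 : q * q ^ N - q ^ l = -(q ^ l * (1 - q * q ^ (a + m))) := by
    rw [hNm]
    ring
  have e0' : q * q ^ N - 1 = -(1 - q * q ^ N) := by ring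
  have e1 : q ^ a * q ^ l * q ^ (m + 1) - 1 = -(1 - q * q ^ N) := by
    rw [hNm]
    ring
  have e2 : 1 - d₄ * d₃ * q * (q ^ l) ^ 2 = 1 - d₃ * d₄ * q * (q ^ l) ^ 2 := by ring
  have e3 : q ^ l - d₃ * d₄ * q * (q ^ l) ^ 2 = q ^ l * (1 - d₄ * d₃ * q * q ^ l) := by ring
  have e4 : 1 - q * q ^ m = 1 - q ^ (m + 1) := by ring
  have e5 : 1 - q * d₅ * q ^ m = 1 - d₅ * q ^ (m + 1) := by ring
  have e6 : 1 - q * q ^ (l + m) = 1 - q ^ l * q ^ (m + 1) := by ring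
  rw [e4, e5, e6, ← eq_div_iff (by simp only [mul_ne_zero_iff] at h₁₀ ⊢; tauto)] at key
  rw [pentU, pentU, if_pos (by omega), if_pos (by omega), show N - a - l = m by omega,
    show N + 1 - a - l = m + 1 by omega, key, backA, e0, e0', e1, e2, e3]
  generalize pentWa q d₁ d₂ d₃ d₄ d₅ (N + 1) a l (m + 1) = v
  generalize q ^ N * (q ^ (N + 2) * d₁ * d₄) = u1 at *
  generalize 1 - d₄ * d₃ * d₂ * q ^ (N + 3) * q ^ l = u2
  generalize 1 - d₄ * d₃ * d₂ * q ^ (N + 3) = u3 at *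
  generalize 1 - q ^ l * q ^ (m + 1) = u4 at *
  generalize 1 - d₅ * q ^ (m + 1) = u5 at *
  generalize 1 - q * d₂ * q ^ a = u6 at *
  generalize 1 - q * d₃ * q ^ l = u7 at *
  generalize 1 - q * d₃ = u8 at *
  generalize 1 - q * d₂ = u9 at *
  generalize 1 - q * q ^ N = u10 at *
  generalize 1 - q * q ^ (a + m) = u11 at *
  generalize 1 - d₃ * d₄ * q * (q ^ l) ^ 2 = u12 at *
  generalize 1 - d₄ * d₃ * q * q ^ l = u13 at *
  generalize 1 - q ^ (m + 1) = u14 at *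
  field_simp

theorem backB_mul_pentU (h : Gen5 q d₁ d₂ d₃ d₄ d₅ (N + 1)) {a l m : ℕ} (hN : N + 1 = a + l + m)
    (ha : a ≤ N) :
    backB q d₄ d₃ d₂ N l * pentU q d₁ (q * d₂) (q * d₃) d₄ d₅ N a (l - 1) =
      pentU q d₁ d₂ d₃ d₄ d₅ (N + 1) a l *
        -(q ^ a * (1 - q * d₂) * (1 - d₃ * d₄ * q * (q ^ l) ^ 2 * q ^ m) *
          (q * d₃ * (q ^ l * (1 - q * d₂ * q ^ a * q ^ m)) * (q ^ l - 1)) /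
            ((1 - q ^ l * q ^ m) * (1 - q * d₂ * q ^ a) * (1 - q * d₁ * q ^ a * (q * d₂ * q ^ a) * q ^ m) *
              (q ^ N * (q ^ (N + 2) * d₁ * d₄)) *
              (q * (q ^ a * q ^ l * q ^ m) * d₃ * d₅) * q ^ l * (1 - d₃ * d₄ * q * (q ^ l) ^ 2) *
              (1 - d₄ * d₃ * d₂ * q ^ (N + 3)) *
              (q ^ a * q ^ l * q ^ m - 1))) := by
  have hq := h.nr.1
  rcases l with _ | l
  · rw [backB_zero, pow_zero, sub_self]
    ring
  have h₁ : 1 - q ^ (l + 1) * q ^ m ≠ 0 := by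
    convert h.nr.one_sub (l + m) using 2
    ring
  have h₃ : 1 - q * d₂ * q ^ a ≠ 0 := (h.n2.mul_left hq).one_sub a
  have h₄ : 1 - d₃ * d₄ * q * (q ^ (l + 1)) ^ 2 ≠ 0 :=
    h.n34.one_sub_of_eq (1 + 2 * (l + 1) : ℕ) (by rw [zpow_natCast]; ring)
  have h₅ : 1 - d₄ * d₃ * d₂ * q ^ (N + 3) ≠ 0 := h.rot.gen3.symm.n123.one_sub _
  have h₆ := h.nr.one_sub N
  have h₇ := (h.n3.mul_left hq).one_sub'
  have h₈ := (h.n4.mul_left hq).one_sub l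
  have h₉ : q ^ (l + 1) ≠ 0 := pow_ne_zero _ hq
  have h₉' : q ^ a ≠ 0 := pow_ne_zero _ hq
  have h₁₀ : q ^ N * (q ^ (N + 2) * d₁ * d₄) ≠ 0 := mul_ne_zero (pow_ne_zero _ hq)
    (mul_ne_zero (mul_ne_zero (pow_ne_zero _ hq) h.n1.1) h.n4.1)
  have h₁₁ := ((h.n34.mul_left hq).mul_left hq).one_sub (2 * l + a + m + 1)
  have h₁₂ : 1 - q * d₁ * q ^ a * (q * d₂ * q ^ a) * q ^ m ≠ 0 :=
    h.n12.one_sub_of_eq (2 * a + m + 2 : ℕ) (by rw [zpow_natCast]; ring)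
  have h₁₃ : q ^ (N + 2) * d₃ * d₅ ≠ 0 :=
    mul_ne_zero (mul_ne_zero (pow_ne_zero _ hq) h.n3.1) h.n5.1
  have key := pentWa_shift₂₃' h N a l m
  have hNm : N = a + l + m := by omega
  have e0 : q ^ (l + 1) - d₂ * q * (q * q ^ N) = q ^ (l + 1) * (1 - q * d₂ * q ^ a * q ^ m) := by
    rw [hNm]
    ring
  have e0' : q * q ^ N - 1 = -(1 - q * q ^ N) := by ring
  have e1 : q ^ a * q ^ (l + 1) * q ^ m - 1 = -(1 - q * q ^ N) := by
    rw [hNm]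
    ring
  have e2 : 1 - d₄ * d₃ * q * (q ^ (l + 1)) ^ 2 = 1 - d₃ * d₄ * q * (q ^ (l + 1)) ^ 2 := by ring
  have e3 : d₄ * d₃ * q * q ^ (l + 1) * (q * q ^ N) - 1 =
      -(1 - q * (q * (d₃ * d₄)) * q ^ (2 * l + a + m + 1)) := by
    rw [hNm]
    ring
  have e4 : d₄ * q ^ (l + 1) - 1 = -(1 - q * d₄ * q ^ l) := by ring
  have e5 : 1 - q * (d₁ * d₂) * q ^ (2 * a + m + 1) =
      1 - q * d₁ * q ^ a * (q * d₂ * q ^ a) * q ^ m := by ring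
  have e6 : 1 - q * q ^ (l + m) = 1 - q ^ (l + 1) * q ^ m := by ring
  have e7 : 1 - q * (q * (d₃ * d₄)) * q ^ (2 * l + m + 1) =
      1 - d₃ * d₄ * q * (q ^ (l + 1)) ^ 2 * q ^ m := by ring
  have e8 : q * (q ^ a * q ^ (l + 1) * q ^ m) * d₃ * d₅ = q ^ (N + 2) * d₃ * d₅ := by
    rw [hNm]
    ring
  rw [e5, e6, e7, ← eq_div_iff (by simp only [mul_ne_zero_iff] at h₁₀ h₁₃ ⊢; tauto)] at key
  rw [Nat.add_sub_cancel, pentU, pentU, if_pos (by omega), if_pos (by omega),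
    show N - a - l = m by omega, show N + 1 - a - (l + 1) = m by omega, key, backB, e0, e0', e1,
    e2, e3, e4, e8]
  generalize pentWa q d₁ d₂ d₃ d₄ d₅ (N + 1) a (l + 1) m = v
  generalize q ^ N * (q ^ (N + 2) * d₁ * d₄) = u1 at *
  generalize q ^ (N + 2) * d₃ * d₅ = u2 at *
  generalize 1 - d₄ * d₃ * d₂ * q ^ (N + 3) = u3 at *
  generalize 1 - q ^ (l + 1) * q ^ m = u4 at *
  generalize 1 - q * d₂ * q ^ a * q ^ m = u5
  generalize 1 - q * d₁ * q ^ a * (q * d₂ * q ^ a) * q ^ m = u6 at *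
  generalize 1 - q * d₂ * q ^ a = u7 at *
  generalize 1 - q * d₃ = u8 at *
  generalize 1 - q * d₂ = u9 at *
  generalize 1 - q * q ^ N = u10 at *
  generalize 1 - q * (q * (d₃ * d₄)) * q ^ (2 * l + a + m + 1) = u11 at *
  generalize 1 - d₃ * d₄ * q * (q ^ (l + 1)) ^ 2 * q ^ m = u12 at *
  generalize 1 - d₃ * d₄ * q * (q ^ (l + 1)) ^ 2 = u13 at *
  generalize 1 - q * d₄ * q ^ l = u14 at *
  generalize q ^ (l + 1) - 1 = u15 at *
  generalize q ^ (l + 1) = u16 at *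
  generalize q ^ a = u17 at *
  field_simp

/-- All three shifted factors are rational multiples of the one at (a,l). The constraint rewrites
both triple products, and the claim becomes `pent_aux`. -/
theorem pentU_sub (h : Gen5 q d₁ d₂ d₃ d₄ d₅ (N + 1)) {a l m : ℕ} (hN : N + 1 = a + l + m)
    (ha : a ≤ N) :
    pentU q d₁ d₂ d₃ d₄ d₅ (N + 1) (a + 1) l - pentU q d₁ d₂ d₃ d₄ d₅ (N + 1) a l =
      (d₂ * d₁ * (q * q ^ a) ^ 2 - 1) * (q * q ^ N) / (q ^ a * (1 - q * d₂) *
        (1 - d₃ * d₂ * d₁ * q ^ (N + 3)) * (q * q ^ N - 1) * (q * (q * d₅))) *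
      ((1 - q * q ^ N) ^ 2 * (1 - d₄ * d₅ * q ^ (N + 2)) * (1 - d₁ * d₅ * q ^ (N + 2))) *
      (backA q d₄ d₃ d₂ N l * pentU q d₁ (q * d₂) (q * d₃) d₄ d₅ N a l +
        backB q d₄ d₃ d₂ N l * pentU q d₁ (q * d₂) (q * d₃) d₄ d₅ N a (l - 1)) := by
  have hq := h.nr.1
  have hQ : q * q ^ N = q ^ a * q ^ l * q ^ m := by
    rw [← pow_add, ← pow_add, ← hN]
    ring
  have hE₁ : d₁ * d₅ * q ^ (N + 2) = q * d₁ * q ^ a * d₅ * q ^ l * q ^ m := by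
    linear_combination (d₁ * d₅ * q) * hQ
  have hg : d₄ * d₃ * d₂ * q ^ (N + 3) = (q * d₁ * q ^ a * d₅ * q ^ l * q ^ m)⁻¹ := by
    rw [← hE₁]
    refine eq_inv_of_mul_eq_one_left ?_
    rw [← h.con]
    ring
  have hg' : d₃ * d₂ * d₁ * q ^ (N + 3) = (d₄ * d₅ * q ^ (N + 2))⁻¹ := by
    refine eq_inv_of_mul_eq_one_left ?_
    rw [← h.con]
    ring
  have hP : q ^ N * (q ^ (N + 2) * d₁ * d₄) =
      q * d₁ * q ^ a * d₅ * q ^ l * q ^ m * (d₄ * d₅ * q ^ (N + 2)) / (d₅ * q) ^ 2 := by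
    rw [← hE₁, eq_div_iff (pow_ne_zero _ (mul_ne_zero h.n5.1 hq))]
    ring
  have hαβ : d₂ * d₁ * (q * q ^ a) ^ 2 = q * d₁ * q ^ a * (q * d₂ * q ^ a) := by ring
  have hcon : (q * d₁ * q ^ a) * (q * d₂ * q ^ a) * (d₃ * d₄ * q * (q ^ l) ^ 2) * (q ^ m) ^ 2 * d₅ = 1 := by
    rw [← h.con, show 2 * (N + 1) + 3 = (a + l + m) * 2 + 3 by rw [hN]; ring]
    ring
  have aux := pent_aux (q := q) (A := q ^ a) (L := q ^ l) (M := q ^ m) (α := q * d₁ * q ^ a)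
    (β := q * d₂ * q ^ a) (s := d₃ * d₄ * q * (q ^ l) ^ 2) (δ := d₅)
    (E₄ := d₄ * d₅ * q ^ (N + 2)) (c := 1 - q * d₂) (d₃ := d₃) hq (pow_ne_zero _ hq)
    (pow_ne_zero _ hq) (pow_ne_zero _ hq) (mul_ne_zero (mul_ne_zero hq h.n1.1) (pow_ne_zero _ hq))
    (mul_ne_zero (mul_ne_zero hq h.n2.1) (pow_ne_zero _ hq)) h.n5.1
    (mul_ne_zero h.n45.1 (pow_ne_zero _ hq)) (h.n2.mul_left hq).one_sub' h.n3.1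
    (by
      rw [← hE₁, mul_comm d₁]
      exact h.n51.one_sub _)
    (h.n45.one_sub _)
    (by
      rw [← hQ]
      exact h.nr.one_sub _)
    (h.n34.one_sub_of_eq (1 + 2 * l : ℕ) (by rw [zpow_natCast]; ring))
    (by
      obtain ⟨k, hk⟩ : ∃ k, l + m = k + 1 := ⟨l + m - 1, by omega⟩
      rw [← pow_add, hk, pow_succ']
      exact h.nr.one_sub _)
    (h.n5.one_sub _) ((h.n2.mul_left hq).one_sub a)
    (h.n12.one_sub_of_eq (2 * a + m + 2 : ℕ) (by rw [zpow_natCast]; ring)) hcon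
  rw [pentU_succ h hN ha, backA_mul_pentU h hN ha, backB_mul_pentU h hN ha, hg, hg', hP, hαβ, hQ,
    hE₁, ← mul_add,
    mul_left_comm (_ * _) (pentU q d₁ d₂ d₃ d₄ d₅ (N + 1) a l), ← aux, mul_sub_one]

end

/-! ### The pentagon relation: base case and induction -/

section

variable {q d₁ d₂ d₃ d₄ d₅ : ℂ} {N : ℕ}

/-- Writing the last x factors backwards and extracting a monomial from each turns them into a
Pochhammer symbol with inverse base. Inverse bases are what the constraint produces, so this lets
the different weights be compared. -/
theorem qPoch_reverse {q c : ℂ} (hq : q ≠ 0) (hc : c ≠ 0) (t x : ℕ) :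
    qPoch (q * c) q (t + x) * q ^ x.choose 2 =
      qPoch (q * c) q t * (-(c * q ^ (t + x))) ^ x * qPoch (c * q ^ (t + x))⁻¹ q x := by
  induction x generalizing t with
  | zero => simp [qPoch_zero]
  | succ x ih =>
    have e := ih (t + 1)
    rw [add_right_comm t 1 x, add_assoc t x 1, qPoch_succ _ _ t] at e
    rw [Nat.choose_succ_succ' x 1, Nat.choose_one_right, qPoch_succ _ _ x, pow_add, pow_succ,
      mul_left_comm, e]
    have e' : -(c * q ^ (t + (x + 1))) * (1 - (c * q ^ (t + (x + 1)))⁻¹ * q ^ x) =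
        q ^ x * (1 - q * c * q ^ t) := by
      have hc' : c * q ^ (t + (x + 1)) ≠ 0 := mul_ne_zero hc (pow_ne_zero _ hq)
      field_simp
      ring
    linear_combination (exp := 1) -(qPoch (q * c) q t * (-(c * q ^ (t + (x + 1)))) ^ x *
      qPoch (c * q ^ (t + (x + 1)))⁻¹ q x) * e'

theorem Nz.inv_mul_pow {q c : ℂ} (hq : q ≠ 0) (h : Nz q c) (k : ℕ) : Nz q (c * q ^ k)⁻¹ :=
  h.of_mul_eq_one hq k (by
    have := h.1
    rw [zpow_natCast]
    field_simp)

theorem pentT_zero (hq : q ≠ 0) (d₁ d₂ d₃ d₄ d₅ : ℂ) (N a l : ℕ) :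
    pentT q d₁ d₂ d₃ d₄ d₅ N a l 0 0 = pentU q d₁ d₂ d₃ d₄ d₅ N a l *
      (qPoch q q N ^ 2 * qPoch (q * (d₄ * d₅)) q (N + 1) * qPoch (q * (d₁ * d₅)) q (N + 1))⁻¹ := by
  rw [pentT, racahPhi_zero_left, racahPhi_zero_right hq, pentWy, pentWy]
  simp only [qPoch_zero, pow_zero, mul_zero, zero_add, one_mul, mul_one, Nat.sub_zero]
  ring

theorem pentT_zero_succ_sub (h : Gen5 q d₁ d₂ d₃ d₄ d₅ (N + 1)) {a : ℕ} (ha : a ≤ N) (l : ℕ) :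
    pentT q d₁ d₂ d₃ d₄ d₅ (N + 1) (a + 1) l 0 0 - pentT q d₁ d₂ d₃ d₄ d₅ (N + 1) a l 0 0 =
      (d₂ * d₁ * (q * q ^ a) ^ 2 - 1) * (q * q ^ N) / (q ^ a * (1 - q * d₂) *
        (1 - d₃ * d₂ * d₁ * q ^ (N + 3)) * (q * q ^ N - 1) * (q * (q * d₅))) *
      (backA q d₄ d₃ d₂ N l * pentT q d₁ (q * d₂) (q * d₃) d₄ d₅ N a l 0 0 +
        backB q d₄ d₃ d₂ N l * pentT q d₁ (q * d₂) (q * d₃) d₄ d₅ N a (l - 1) 0 0) := by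
  have hq := h.nr.1
  have h15 := h.n15
  have n1 := h.nr.one_sub N
  have n2 := h.n45.one_sub (N + 2)
  have n3 := h15.one_sub (N + 2)
  rw [pentT_zero hq, pentT_zero hq, pentT_zero hq, pentT_zero hq]
  by_cases hal : a + l ≤ N + 1
  · obtain ⟨m, hm⟩ := Nat.exists_eq_add_of_le hal
    have key := pentU_sub h hm ha
    rw [← sub_mul, key, qPoch_succ q q N, qPoch_succ _ q (N + 1), qPoch_succ _ q (N + 1),
      show q * (d₄ * d₅) * q ^ (N + 1) = d₄ * d₅ * q ^ (N + 2) by ring,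
      show q * (d₁ * d₅) * q ^ (N + 1) = d₁ * d₅ * q ^ (N + 2) by ring]
    generalize 1 - q * q ^ N = u1 at *
    generalize 1 - d₄ * d₅ * q ^ (N + 2) = u2 at *
    generalize 1 - d₁ * d₅ * q ^ (N + 2) = u3 at *
    field_simp
  · rw [pentU, pentU, pentU, pentU, if_neg (by omega), if_neg (by omega), if_neg (by omega),
      if_neg (by omega)]
    ring

/-- At y = b = 0 the pentagon weight is, up to a constant in x, an ordinary q-Racah weight. The
parameters are chosen so that the first two multiply to d₂d₃, while reversal of q times the first
one gives the symbol of d₄. The corner case of the pentagon is then a known total mass. -/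
theorem pentWeight_eq_racahWeight (h : Gen5 q d₁ d₂ d₃ d₄ d₅ N) {x t : ℕ} (hN : N = t + x) :
    pentWeight q d₁ (d₂ * d₃) d₄ d₅ x 0 t 0 t =
      qPoch (q * d₄) q N / (qPoch q q N * qPoch (q * (d₁ * d₅)) q (N + 1) *
        qPoch (q * (d₄ * d₅)) q (N + 1)) *
      racahWeight q (d₄ * q ^ (N + 1))⁻¹ (d₂ * d₃ * d₄ * q ^ (N + 1)) d₁ x t := by
  have hq := h.nr.1
  have h15 := h.n15
  have hd : d₄ * q ^ (N + 1) ≠ 0 := mul_ne_zero h.n4.1 (pow_ne_zero _ hq)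
  have eD : (d₄ * q ^ (N + 1))⁻¹ * (d₂ * d₃ * d₄ * q ^ (N + 1)) = d₂ * d₃ := by
    have := h.n4.1
    field_simp
  have e1 : q * (d₄ * q ^ (N + 1))⁻¹ = (d₄ * q ^ (t + x))⁻¹ := by
    have := h.n4.1
    rw [hN]
    field_simp
    ring
  have e2 : q * (d₂ * d₃ * d₄ * q ^ (N + 1)) = (d₁ * d₅ * q ^ (t + 1 + x))⁻¹ := by
    refine eq_inv_of_mul_eq_one_left ?_
    rw [← h.con, hN]
    ring
  have e3 : d₂ * d₃ * d₁ * q ^ (x + t + 2) = (d₄ * d₅ * q ^ (t + 1 + x))⁻¹ := by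
    refine eq_inv_of_mul_eq_one_left ?_
    rw [← h.con, hN]
    ring
  have k1 := qPoch_reverse hq h.n4.1 t x
  have k2 := qPoch_reverse hq h15.1 (t + 1) x
  have k3 := qPoch_reverse hq h.n45.1 (t + 1) x
  rw [racahWeight, pentWeight_zero, eD, e1, e2, e3, hN, show t + x + 1 = t + 1 + x by ring,
    add_comm x t]
  have n1 := (h.n4.inv_mul_pow hq (t + x)).qPoch_ne_zero x
  have n2 := (h15.inv_mul_pow hq (t + 1 + x)).qPoch_ne_zero x
  have n3 := (h.n45.inv_mul_pow hq (t + 1 + x)).qPoch_ne_zero x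
  have n4 := (h15.mul_left hq).qPoch_ne_zero (t + 1)
  have n5 := (h.n45.mul_left hq).qPoch_ne_zero (t + 1)
  have n6 : q ^ x.choose 2 ≠ 0 := pow_ne_zero _ hq
  have n7 := h.nr.qPoch_ne_zero (t + x)
  have n8 := h.nr.qPoch_ne_zero t
  have n9 := h.nr.qPoch_ne_zero x
  have n10 := (h.n23.mul_left hq).qPoch_ne_zero (2 * x + t + 1)
  have hs : ((-1 : ℂ) ^ x) * (-1) ^ x = 1 := by rw [← mul_pow]; simp
  have e4 : (-(d₄ * q ^ (t + x))) ^ x * (q * d₅) ^ x =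
      (-1) ^ x * (d₄ * d₅ * q ^ (t + 1 + x)) ^ x := by
    rw [← mul_pow, ← mul_pow]
    congr 1
    ring
  have n11 : (q * d₅) ^ x ≠ 0 := pow_ne_zero _ (mul_ne_zero hq h.n5.1)
  have n12 : (d₄ * d₅ * q ^ (t + 1 + x)) ^ x ≠ 0 :=
    pow_ne_zero _ (mul_ne_zero h.n45.1 (pow_ne_zero _ hq))
  have n13 : (d₁ * d₅ * q ^ (t + 1 + x)) ^ x ≠ 0 :=
    pow_ne_zero _ (mul_ne_zero h15.1 (pow_ne_zero _ hq))
  rw [← eq_div_iff n11] at e4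
  rw [← eq_div_iff n6] at k1 k2 k3
  have n14 : ((-1 : ℂ)) ^ x ≠ 0 := left_ne_zero_of_mul_eq_one hs
  rw [e4] at k1
  rw [neg_pow (d₁ * d₅ * _)] at k2
  rw [neg_pow (d₄ * d₅ * _)] at k3
  rw [k1, k2, k3, inv_pow (d₁ * d₅ * q ^ (t + 1 + x))]
  generalize (-1 : ℂ) ^ x = s at *
  generalize (d₁ * d₅ * q ^ (t + 1 + x)) ^ x = u1 at *
  generalize (d₄ * d₅ * q ^ (t + 1 + x)) ^ x = u2 at *
  generalize (q * d₅) ^ x = u3 at *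
  generalize q ^ x.choose 2 = u4 at *
  generalize qPoch (d₄ * q ^ (t + x))⁻¹ q x = u5 at *
  generalize qPoch (d₁ * d₅ * q ^ (t + 1 + x))⁻¹ q x = u6 at *
  generalize qPoch (d₄ * d₅ * q ^ (t + 1 + x))⁻¹ q x = u7 at *
  generalize qPoch q q t = u8 at *
  generalize qPoch q q x = u9 at *
  generalize qPoch q q (t + x) = u10 at *
  generalize qPoch (q * (d₂ * d₃)) q (2 * x + t + 1) = u11 at *
  generalize qPoch (q * (d₁ * d₅)) q (t + 1) = u12 at *
  generalize qPoch (q * (d₄ * d₅)) q (t + 1) = u13 at *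
  generalize qPoch (q * d₄) q t = u14 at *
  generalize qPoch (q * d₁) q t = u15 at *
  generalize 1 - d₂ * d₃ * q * (q ^ x) ^ 2 = u16
  generalize qPoch (q * (d₂ * d₃)) q x = u17
  field_simp
  linear_combination (exp := 1) (u17 * u16 * u14 * u15) * hs

theorem pentS_zero_zero (h : Gen5 q d₁ d₂ d₃ d₄ d₅ N) :
    pentS q d₁ d₂ d₃ d₄ d₅ N 0 0 0 0 = pentT q d₁ d₂ d₃ d₄ d₅ N 0 0 0 0 := by
  have hq := h.nr.1
  have h15 := h.n15
  have n4 := (h15.mul_left hq).qPoch_ne_zero (N + 1)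
  have n5 := (h.n45.mul_left hq).qPoch_ne_zero (N + 1)
  have eD : (d₄ * q ^ (N + 1))⁻¹ * (d₂ * d₃ * d₄ * q ^ (N + 1)) = d₂ * d₃ := by
    have := h.n4.1
    field_simp
  have e2 : d₂ * d₃ * d₄ * q ^ (N + 1) = (d₁ * d₅ * q ^ (N + 2))⁻¹ := by
    refine eq_inv_of_mul_eq_one_left ?_
    rw [← h.con]
    ring
  have e3 : d₂ * d₃ * d₄ * q ^ (N + 1) * d₁ = (d₅ * q ^ (N + 2))⁻¹ := by
    refine eq_inv_of_mul_eq_one_left ?_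
    rw [← h.con]
    ring
  have e4 : d₂ * d₃ * d₁ = (d₄ * d₅ * q ^ (2 * N + 3))⁻¹ := by
    refine eq_inv_of_mul_eq_one_left ?_
    rw [← h.con]
    ring
  have hg : Gen3 q (d₄ * q ^ (N + 1))⁻¹ (d₂ * d₃ * d₄ * q ^ (N + 1)) d₁ := by
    refine ⟨h.nr, h.n4.inv_mul_pow hq _, ?_, h.n1, ?_, ?_, ?_⟩
    · rw [e2]
      exact h15.inv_mul_pow hq _
    · rw [eD]
      exact h.n23
    · rw [e3]
      exact h.n5.inv_mul_pow hq _
    · rw [eD, e4]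
      exact h.n45.inv_mul_pow hq _
  have hS : pentS q d₁ d₂ d₃ d₄ d₅ N 0 0 0 0 =
      qPoch (q * d₄) q N / (qPoch q q N * qPoch (q * (d₁ * d₅)) q (N + 1) *
        qPoch (q * (d₄ * d₅)) q (N + 1)) *
      racahInner q (d₄ * q ^ (N + 1))⁻¹ (d₂ * d₃ * d₄ * q ^ (N + 1)) d₁ 0 0 N := by
    rw [pentS, racahInner, mul_sum]
    refine sum_congr rfl fun x hx => ?_
    obtain ⟨t, ht⟩ := Nat.exists_eq_add_of_le' (Nat.lt_succ_iff.1 (mem_range.1 hx))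
    simp only [racahPhi_zero_left, racahPhi_zero_right hq, mul_one]
    rw [pentV, if_pos (by omega), Nat.sub_zero, show N - x = t by omega,
      pentWeight_eq_racahWeight h ht]
  have hU : pentU q d₁ d₂ d₃ d₄ d₅ N 0 0 =
      (q ^ (N + 1) * d₁ * d₄) ^ N * (qPoch q q N * qPoch (q * d₅) q N) := by
    have n1 := h.nr.qPoch_ne_zero N
    have n2 := (h.n12.mul_left hq).qPoch_ne_zero (N + 1)
    have n3 := (h.n34.mul_left hq).qPoch_ne_zero (N + 1)
    rw [pentU, if_pos (by omega), pentWa]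
    simp only [qPoch_zero, pow_zero, mul_zero, zero_add, one_mul, mul_one, Nat.sub_zero]
    generalize qPoch (q * (d₁ * d₂)) q (N + 1) = u1 at *
    generalize qPoch (q * (d₃ * d₄)) q (N + 1) = u2 at *
    field_simp
  have k1 := qPoch_reverse hq h.n4.1 0 N
  have k2 := qPoch_reverse hq h.n5.1 0 N
  rw [hS, racahInner_zero_zero hg, racahWeight_zero hg.symm, pentT_zero hq, hU]
  have f1 : q * (d₄ * q ^ (N + 1))⁻¹ = (d₄ * q ^ (0 + N))⁻¹ := by
    have := h.n4.1
    field_simp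
    ring
  have f2 : q * (q * (d₁ * (d₂ * d₃ * d₄ * q ^ (N + 1)))) = (d₅ * q ^ (0 + N))⁻¹ := by
    refine eq_inv_of_mul_eq_one_left ?_
    rw [← h.con]
    ring
  have f3 : q * (d₂ * d₃ * d₄ * q ^ (N + 1)) = (d₁ * d₅ * q ^ (N + 1))⁻¹ := by
    refine eq_inv_of_mul_eq_one_left ?_
    rw [← h.con]
    ring
  have f4 : (q ^ (N + 1) * d₁ * d₄) ^ N * (-(d₅ * q ^ (0 + N))) ^ N =
      (-(d₄ * q ^ (0 + N))) ^ N * (d₁ * d₅ * q ^ (N + 1)) ^ N := by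
    rw [← mul_pow, ← mul_pow]
    congr 1
    ring
  rw [f1, f2, f3, inv_pow]
  have n1 := h.nr.qPoch_ne_zero N
  have n6 := (h.n4.inv_mul_pow hq (0 + N)).qPoch_ne_zero N
  have n7 := (h.n5.inv_mul_pow hq (0 + N)).qPoch_ne_zero N
  have n8 : (d₁ * d₅ * q ^ (N + 1)) ^ N ≠ 0 :=
    pow_ne_zero _ (mul_ne_zero h15.1 (pow_ne_zero _ hq))
  have n9 : q ^ N.choose 2 ≠ 0 := pow_ne_zero _ hq
  have n10 : (-(d₅ * q ^ (0 + N))) ^ N ≠ 0 :=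
    pow_ne_zero _ (neg_ne_zero.2 (mul_ne_zero h.n5.1 (pow_ne_zero _ hq)))
  rw [← eq_div_iff n9, zero_add, qPoch_zero, one_mul] at k1 k2
  rw [zero_add] at *
  rw [k1, k2]
  rw [← eq_div_iff n10] at f4
  rw [f4]
  generalize (-(d₄ * q ^ N)) ^ N = v1 at *
  generalize (-(d₅ * q ^ N)) ^ N = v2 at *
  generalize (d₁ * d₅ * q ^ (N + 1)) ^ N = v3 at *
  generalize q ^ N.choose 2 = v4 at *
  generalize qPoch (d₄ * q ^ N)⁻¹ q N = v5 at *
  generalize qPoch (d₅ * q ^ N)⁻¹ q N = v6 at *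
  generalize qPoch (q * (d₁ * d₅)) q (N + 1) = v7 at *
  generalize qPoch (q * (d₄ * d₅)) q (N + 1) = v8 at *
  field_simp

/-- Both sides obey the same first-order recursion in a, so equality propagates from a = 0. At l = N
+ 1 one smaller instance is unavailable, but its coefficient vanishes. -/
theorem pent_zero_of_zero (h : Gen5 q d₁ d₂ d₃ d₄ d₅ (N + 1))
    (IH : ∀ a l : ℕ, a ≤ N → l ≤ N → pentS q d₁ (q * d₂) (q * d₃) d₄ d₅ N a l 0 0 =
      pentT q d₁ (q * d₂) (q * d₃) d₄ d₅ N a l 0 0) {a l : ℕ} (ha : a ≤ N + 1) (hl : l ≤ N + 1)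
    (h0 : pentS q d₁ d₂ d₃ d₄ d₅ (N + 1) 0 l 0 0 = pentT q d₁ d₂ d₃ d₄ d₅ (N + 1) 0 l 0 0) :
    pentS q d₁ d₂ d₃ d₄ d₅ (N + 1) a l 0 0 = pentT q d₁ d₂ d₃ d₄ d₅ (N + 1) a l 0 0 := by
  induction a with
  | zero => exact h0
  | succ a ih =>
    rw [← sub_add_cancel (pentS q d₁ d₂ d₃ d₄ d₅ (N + 1) (a + 1) l 0 0), pentS_zero_succ_sub h,
      ← sub_add_cancel (pentT q d₁ d₂ d₃ d₄ d₅ (N + 1) (a + 1) l 0 0),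
      pentT_zero_succ_sub h (by omega), ih (by omega), IH a (l - 1) (by omega) (by omega)]
    congr 3
    rcases Nat.lt_or_ge N l with hl' | hl'
    · obtain rfl : l = N + 1 := by omega
      rw [backA_last]
      ring
    · rw [IH a l (by omega) hl']

/-- The pentagon relation. -/
theorem pentagon (h : Gen5 q d₁ d₂ d₃ d₄ d₅ N) {a l y b : ℕ} (ha : a + y ≤ N) (hb : b + l ≤ N) :
    pentS q d₁ d₂ d₃ d₄ d₅ N a l y b = pentT q d₁ d₂ d₃ d₄ d₅ N a l y b := by
  induction N generalizing d₁ d₂ d₃ d₄ d₅ a l y b with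
  | zero =>
    obtain rfl : a = 0 := by omega
    obtain rfl : l = 0 := by omega
    obtain rfl : y = 0 := by omega
    obtain rfl : b = 0 := by omega
    exact pentS_zero_zero h
  | succ N ih =>
    have hq := h.nr.1
    rcases b with _ | b
    · rcases y with _ | y
      -- For y = b = 0 the recursion in a reduces to a = 0. Reflection makes l the first index, and
      -- the same recursion reduces to the corner.
      · refine pent_zero_of_zero h (fun a l ha hl => ih h.shift₂₃ (by omega) (by omega)) (by omega)
          (by omega) ?_
        rw [← pentS_mirror hq, ← pentT_mirror hq]
        exact pent_zero_of_zero h.mirror (fun a l ha hl => ih h.mirror.shift₂₃ (by omega) (by omega))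
          (by omega) (by omega) (pentS_zero_zero h.mirror)
      -- For b = 0 < y reflection gives a positive last index.
      · rw [← pentS_mirror hq, ← pentT_mirror hq]
        exact pent_step h.mirror (fun a l y b ha hb => ih h.mirror.shift₁₅ ha hb) (by omega)
          (by omega)
    · exact pent_step h (fun a l y b ha hb => ih h.shift₁₅ ha hb) ha (by omega)

end

/-! ### Orthogonality and Racah relation for the normalized functions -/

theorem qPoch_add (a q : ℂ) (m n : ℕ) :
    qPoch a q (m + n) = qPoch a q m * qPoch (a * q ^ m) q n := by
  rw [qPoch, prod_range_add]
  congr 1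
  exact prod_congr rfl fun l _ => by rw [pow_add]; ring

theorem phi43_eq_racahPhi (q : ℂ) (n x : ℕ) (b₁ b₂ b₃ : ℂ) (K : ℕ) :
    phi43 q n (b₂ * b₃ * q ^ (n + 1)) (q ^ (-(x : ℤ))) (b₁ * b₂ * q ^ (x + 1))
      (q * b₂) (b₁ * b₂ * b₃ * q ^ (K + 2)) (q ^ (-(K : ℤ))) = racahPhi q n x b₁ b₂ b₃ K := by
  refine sum_congr rfl fun k _ => ?_
  simp only [serTerm, zpow_neg, zpow_natCast]

/-- The normalization is the orthogonality weight for reversed parameters times (r s₂)^K. This is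
why the normalized functions form mutually inverse matrices. -/
theorem Omega_eq {r s₁ s₂ s₃ : ℂ} (h : Gen3 (r ^ 2) (s₁ ^ 2) (s₂ ^ 2) (s₃ ^ 2)) (n t : ℕ) :
    Omega r n s₁ s₂ s₃ (n + t) =
      (r * s₂) ^ (n + t) * racahWeight (r ^ 2) (s₃ ^ 2) (s₂ ^ 2) (s₁ ^ 2) n t := by
  have hr : r ≠ 0 := fun e => h.nr.1 (by simp [e])
  have hs : s₂ ≠ 0 := fun e => h.n2.1 (by simp [e])
  have e1 := inv_reducedPoch (s₂ ^ 2 * s₃ ^ 2) (r ^ 2) n (n + t) (by omega) (h.n23.one_sub _)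
  have e2 := qPoch_add (r ^ 2 * (s₂ ^ 2 * s₃ ^ 2)) (r ^ 2) n (n + t + 1)
  have h2 := (h.n23.mul_left h.nr.1).qPoch_ne_zero n
  have h3 := (h.n23.mul_zpow h.nr.1 (n + 1 : ℕ)).qPoch_ne_zero (n + t + 1)
  rw [zpow_natCast] at h3
  rw [show r ^ 2 * (s₂ ^ 2 * s₃ ^ 2) * (r ^ 2) ^ n = s₂ ^ 2 * s₃ ^ 2 * (r ^ 2) ^ (n + 1) by ring,
    show n + (n + t + 1) = 2 * n + t + 1 by ring] at e2
  have e3 : (r * s₂) ^ (2 * (n : ℤ) - ((n + t : ℕ) : ℤ)) * (r * s₂) ^ (n + t) =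
      (r ^ 2 * s₂ ^ 2) ^ n := by
    rw [← zpow_natCast (r * s₂) (n + t), ← zpow_add₀ (mul_ne_zero hr hs), ← mul_pow, ← pow_mul,
      ← zpow_natCast]
    congr 1
    push_cast
    ring
  have h4 : (r * s₂) ^ (2 * (n : ℤ) - ((n + t : ℕ) : ℤ)) ≠ 0 := zpow_ne_zero _ (mul_ne_zero hr hs)
  have h5 : (r * s₂) ^ (n + t) ≠ 0 := pow_ne_zero _ (mul_ne_zero hr hs)
  rw [Omega, qBinom, if_pos (by omega), racahWeight, mul_comm (s₃ ^ 2) (s₂ ^ 2), e2, ← e3,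
    show n + t - n = t by omega]
  rw [div_eq_mul_inv _ (_ * reducedPoch _ _ _ _ * _), mul_inv, mul_inv, e1,
    show s₂ ^ 2 * s₃ ^ 2 * s₁ ^ 2 = s₁ ^ 2 * s₂ ^ 2 * s₃ ^ 2 by ring,
    show s₂ ^ 2 * s₃ ^ 2 * (r ^ 2) ^ (2 * n + 1) = s₂ ^ 2 * s₃ ^ 2 * r ^ 2 * ((r ^ 2) ^ n) ^ 2 by
      ring]
  generalize (r * s₂) ^ (2 * (n : ℤ) - ((n + t : ℕ) : ℤ)) = u at *
  generalize (r * s₂) ^ (n + t) = v at *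
  generalize qPoch (s₂ ^ 2 * s₃ ^ 2 * (r ^ 2) ^ (n + 1)) (r ^ 2) (n + t + 1) = w1 at *
  generalize qPoch (r ^ 2 * (s₂ ^ 2 * s₃ ^ 2)) (r ^ 2) n = w2 at *
  generalize 1 - s₂ ^ 2 * s₃ ^ 2 * r ^ 2 * ((r ^ 2) ^ n) ^ 2 = w3
  generalize qPoch (s₁ ^ 2 * s₂ ^ 2 * s₃ ^ 2 * (r ^ 2) ^ (n + t + 2)) (r ^ 2) n = w4
  have := h.nr.qPoch_ne_zero n
  have := h.nr.qPoch_ne_zero t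
  have := (h.n3.mul_left h.nr.1).qPoch_ne_zero n
  generalize qPoch (r ^ 2) (r ^ 2) n = w5 at *
  generalize qPoch (r ^ 2) (r ^ 2) t = w6 at *
  generalize qPoch (r ^ 2) (r ^ 2) (n + t) = w7 at *
  generalize qPoch (r ^ 2 * s₃ ^ 2) (r ^ 2) n = w8 at *
  generalize qPoch (r ^ 2 * s₂ ^ 2) (r ^ 2) n = w9 at *
  generalize qPoch (r ^ 2 * s₁ ^ 2) (r ^ 2) t = w10 at *
  field_simp

theorem racah_eq {r s₁ s₂ s₃ : ℂ} (h : Gen3 (r ^ 2) (s₁ ^ 2) (s₂ ^ 2) (s₃ ^ 2)) {n x K : ℕ}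
    (hn : n ≤ K) (hx : x ≤ K) :
    racah r n x s₁ s₂ s₃ K =
      (r * s₂) ^ K * racahWeight (r ^ 2) (s₃ ^ 2) (s₂ ^ 2) (s₁ ^ 2) n (K - n) *
        racahPhi (r ^ 2) n x (s₁ ^ 2) (s₂ ^ 2) (s₃ ^ 2) K := by
  obtain ⟨t, rfl⟩ := Nat.exists_eq_add_of_le hn
  rw [racah]
  rw [if_pos ⟨hn, hx⟩, phi43_eq_racahPhi, Omega_eq h, show n + t - n = t by omega]

theorem racah_eq_zero_left (r s₁ s₂ s₃ : ℂ) {n K : ℕ} (x : ℕ) (h : K < n) :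
    racah r n x s₁ s₂ s₃ K = 0 := if_neg (by omega)

theorem racah_eq_zero_right (r s₁ s₂ s₃ : ℂ) {x K : ℕ} (n : ℕ) (h : K < x) :
    racah r n x s₁ s₂ s₃ K = 0 := if_neg (by omega)

theorem racahWeight_ne_zero {q b₁ b₂ b₃ : ℂ} (h : Gen3 q b₁ b₂ b₃) (x t : ℕ) :
    racahWeight q b₁ b₂ b₃ x t ≠ 0 := by
  have hq := h.nr.1
  have n4 := (h.n123.mul_zpow hq (x + t + 2 : ℕ)).qPoch_ne_zero x
  rw [zpow_natCast] at n4
  have n6 := h.n12.one_sub_sq x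
  have n7 : (q * b₂) ^ x ≠ 0 := pow_ne_zero _ (mul_ne_zero hq h.n2.1)
  exact div_ne_zero (mul_ne_zero (mul_ne_zero (mul_ne_zero (mul_ne_zero (mul_ne_zero
    (h.nr.qPoch_ne_zero _) ((h.n2.mul_left hq).qPoch_ne_zero _)) n4)
    ((h.n3.mul_left hq).qPoch_ne_zero _)) ((h.n12.mul_left hq).qPoch_ne_zero _)) n6)
    (mul_ne_zero (mul_ne_zero (mul_ne_zero (mul_ne_zero (h.nr.qPoch_ne_zero _)
      (h.nr.qPoch_ne_zero _)) n7) ((h.n12.mul_left hq).qPoch_ne_zero _))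
      ((h.n1.mul_left hq).qPoch_ne_zero _))

/-- A sum over a larger range than the support. -/
theorem sum_range_of_support {f : ℕ → ℂ} {K M : ℕ} (hK : K ≤ M) (h : ∀ a, K < a → f a = 0) :
    ∑ a ∈ range (M + 1), f a = ∑ a ∈ range (K + 1), f a :=
  (sum_subset (range_mono (by omega)) fun a _ ha => h a (by simpa using ha)).symm

/-- Orthogonality of the `q`-Racah functions. -/
theorem sum_racah_mul_racah {r s₁ s₂ s₃ : ℂ} (h : Gen3 (r ^ 2) (s₁ ^ 2) (s₂ ^ 2) (s₃ ^ 2))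
    {n m K M : ℕ} (hK : K ≤ M) (hn : n ≤ K) (hm : m ≤ K) :
    ∑ x ∈ range (M + 1), racah r n x s₁ s₂ s₃ K * racah r x m s₃ s₂ s₁ K =
      if n = m then 1 else 0 := by
  have hq := h.nr.1
  rw [sum_range_of_support hK fun a ha => by rw [racah_eq_zero_right _ _ _ _ _ ha, zero_mul]]
  have e : ∀ x ∈ range (K + 1), racah r n x s₁ s₂ s₃ K * racah r x m s₃ s₂ s₁ K =
      (r * s₂) ^ K * (r * s₂) ^ K *
        racahWeight (r ^ 2) (s₃ ^ 2) (s₂ ^ 2) (s₁ ^ 2) n (K - n) *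
      (racahWeight (r ^ 2) (s₁ ^ 2) (s₂ ^ 2) (s₃ ^ 2) x (K - x) *
        racahPhi (r ^ 2) n x (s₁ ^ 2) (s₂ ^ 2) (s₃ ^ 2) K *
        racahPhi (r ^ 2) m x (s₁ ^ 2) (s₂ ^ 2) (s₃ ^ 2) K) := fun x hx => by
    have hx := Nat.lt_succ_iff.1 (mem_range.1 hx)
    rw [racah_eq h hn hx, racah_eq h.symm hx hm, racahPhi_symm hq x m]
    ring
  rw [sum_congr rfl e, ← mul_sum, ← racahInner, racahInner_eq h hn hm]
  split_ifs with hnm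
  · rw [← mul_pow, show r * s₂ * (r * s₂) = r ^ 2 * s₂ ^ 2 by ring]
    refine mul_inv_cancel₀ (mul_ne_zero (pow_ne_zero _ (mul_ne_zero hq h.n2.1)) ?_)
    exact racahWeight_ne_zero h.symm _ _
  · ring

theorem choose_succ_two (n : ℕ) : (n + 1).choose 2 = n + n.choose 2 := by
  rw [Nat.choose_succ_succ' n 1, Nat.choose_one_right]

/-- The half-integer powers of ω and ξ combine to integral ones, which identifies the weight ratio
of the Racah relation. -/
theorem omega_mul_xi {r s₁ s₂ : ℂ} (hs : s₂ ≠ 0) (a : ℕ) :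
    omega r a (s₁ * s₂) * xi r a s₂ s₁ = kernelRatio (r ^ 2) (s₁ ^ 2) (s₂ ^ 2) a := by
  rw [omega, xi, kernelRatio, choose_succ_two, pow_add, div_pow s₁ s₂, mul_pow s₁ s₂,
    mul_pow (r ^ 2), ← pow_mul s₁, mul_comm 2 a, pow_mul s₁ a]
  have := pow_ne_zero a hs
  generalize s₂ ^ a = u at *
  field_simp

theorem xi_div_omega {r s₁ s₃ : ℂ} (hr : r ≠ 0) (h1 : s₁ ≠ 0) (h3 : s₃ ≠ 0) (b : ℕ) :
    xi r b s₃ s₁ / omega r b (s₁ * s₃) = kernelFactor (r ^ 2) (s₁ ^ 2) (s₃ ^ 2) b := by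
  rw [omega, xi, kernelFactor, div_pow s₁ s₃, mul_pow s₁ s₃, ← pow_mul s₃, mul_comm 2 b,
    pow_mul s₃ b]
  have h5 : ((-1 : ℂ)) ^ b * (-1) ^ b = 1 := by rw [← mul_pow]; simp
  have h6 : ((-1 : ℂ)) ^ b ≠ 0 := pow_ne_zero _ (by norm_num)
  have h7 : (r ^ 2) ^ (b + 1).choose 2 ≠ 0 := pow_ne_zero _ (pow_ne_zero _ hr)
  have := pow_ne_zero b h1
  have := pow_ne_zero b h3
  generalize (r ^ 2) ^ (b + 1).choose 2 = e at *
  generalize s₃ ^ b = u at *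
  generalize s₁ ^ b = v at *
  generalize (-1 : ℂ) ^ b = w at *
  field_simp
  have h8 := sq w
  rw [h5] at h8
  rw [h8, mul_one]

theorem kernelFactor_mul_kernelRatio {q c₂ c₃ : ℂ} (hq : q ≠ 0) (hc : Nz q c₃) (hc' : Nz q c₂)
    (i : ℕ) : kernelFactor q c₂ c₃ i * kernelRatio q c₃ c₂ i = 1 := by
  rw [kernelFactor, kernelRatio, choose_succ_two, pow_add, mul_pow q c₃]
  have h5 : ((-1 : ℂ)) ^ i * (-1) ^ i = 1 := by rw [← mul_pow]; simp
  have h6 : ((-1 : ℂ)) ^ i ≠ 0 := pow_ne_zero _ (by norm_num)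
  have := pow_ne_zero i hq
  have := pow_ne_zero i hc.1
  have := pow_ne_zero (i.choose 2) hq
  have := (hc.mul_left hq).qPoch_ne_zero i
  have := (hc'.mul_left hq).qPoch_ne_zero i
  generalize (-1 : ℂ) ^ i = w at *
  generalize q ^ i.choose 2 = u1 at *
  generalize qPoch (q * c₃) q i = u2 at *
  generalize qPoch (q * c₂) q i = u3 at *
  field_simp
  linear_combination (exp := 1) h5

/-- The Racah relation for the `q`-Racah functions. -/
theorem sum_omega_mul_racah_mul_racah {r s₁ s₂ s₃ : ℂ}
    (h : Gen3 (r ^ 2) (s₁ ^ 2) (s₂ ^ 2) (s₃ ^ 2)) (h' : Gen3 (r ^ 2) (s₂ ^ 2) (s₁ ^ 2) (s₃ ^ 2))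
    (h'' : Gen3 (r ^ 2) (s₁ ^ 2) (s₃ ^ 2) (s₂ ^ 2))
    {i b K M : ℕ} (hK : K ≤ M) (hi : i ≤ K) (hb : b ≤ K) :
    ∑ a ∈ range (M + 1), omega r a (s₁ * s₂) * xi r a s₂ s₁ * racah r i a s₁ s₂ s₃ K *
        racah r a b s₃ s₁ s₂ K =
      omega r K (r * s₁ * s₂ * s₃) * (xi r i s₂ s₃ / omega r i (s₂ * s₃)) *
        (xi r b s₃ s₁ / omega r b (s₁ * s₃)) * racah r i b s₁ s₃ s₂ K := by
  have hq := h.nr.1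
  have hr : r ≠ 0 := fun e => h.nr.1 (by simp [e])
  have h1 : s₁ ≠ 0 := fun e => h.n1.1 (by simp [e])
  have h2 : s₂ ≠ 0 := fun e => h.n2.1 (by simp [e])
  have h3 : s₃ ≠ 0 := fun e => h.n3.1 (by simp [e])
  rw [sum_range_of_support hK fun a ha => by rw [racah_eq_zero_right _ _ _ _ _ ha]; ring]
  have e : ∀ a ∈ range (K + 1), omega r a (s₁ * s₂) * xi r a s₂ s₁ * racah r i a s₁ s₂ s₃ K *
        racah r a b s₃ s₁ s₂ K =
      (r * s₁) ^ K * (r * s₂) ^ K *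
        racahWeight (r ^ 2) (s₃ ^ 2) (s₂ ^ 2) (s₁ ^ 2) i (K - i) *
      (kernelWeight (r ^ 2) (s₁ ^ 2) (s₂ ^ 2) (s₃ ^ 2) a (K - a) *
        racahPhi (r ^ 2) i a (s₁ ^ 2) (s₂ ^ 2) (s₃ ^ 2) K *
        racahPhi (r ^ 2) b a (s₂ ^ 2) (s₁ ^ 2) (s₃ ^ 2) K) := fun a ha => by
    have ha := Nat.lt_succ_iff.1 (mem_range.1 ha)
    rw [racah_eq h hi ha, racah_eq h'.symm ha hb, racahPhi_symm hq a b, omega_mul_xi h2,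
      kernelWeight]
    ring
  rw [sum_congr rfl e, ← mul_sum, ← racahKernel, racahKernel_eq h h' hi hb, xi_div_omega hr h1 h3,
    mul_comm s₂ s₃, xi_div_omega hr h3 h2, racah_eq h'' hi hb, kernelConst, omega]
  have e1 := kernelFactor_mul_kernelRatio hq h.n3 h.n2 i
  have e2 := kernelFactor_mul_kernelRatio hq h.n2 h.n3 i
  have e3 := kernelWeight_symm h''.symm i (K - i)
  rw [kernelWeight, kernelWeight] at e3
  -- The functions on the two sides are normalized with c₂ and c₃ in different order. Symmetry of
  -- the kernel weight shows that this is compensated by the kernel factors, which are inverse to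
  -- the kernel ratios.
  have e4 : kernelFactor (r ^ 2) (s₂ ^ 2) (s₃ ^ 2) i *
      racahWeight (r ^ 2) (s₃ ^ 2) (s₂ ^ 2) (s₁ ^ 2) i (K - i) =
      kernelFactor (r ^ 2) (s₃ ^ 2) (s₂ ^ 2) i *
      racahWeight (r ^ 2) (s₂ ^ 2) (s₃ ^ 2) (s₁ ^ 2) i (K - i) := by
    generalize kernelFactor (r ^ 2) (s₂ ^ 2) (s₃ ^ 2) i = f at *
    generalize kernelFactor (r ^ 2) (s₃ ^ 2) (s₂ ^ 2) i = g at *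
    linear_combination (exp := 1) f * g * e3 -
      f * racahWeight (r ^ 2) (s₃ ^ 2) (s₂ ^ 2) (s₁ ^ 2) i (K - i) * e2 +
      g * racahWeight (r ^ 2) (s₂ ^ 2) (s₃ ^ 2) (s₁ ^ 2) i (K - i) * e1
  linear_combination (exp := 1) (r * s₁) ^ K * (r * s₂) ^ K * (-1) ^ K * (s₃ ^ 2) ^ K *
    (r ^ 2) ^ (K + 1).choose 2 * kernelFactor (r ^ 2) (s₁ ^ 2) (s₃ ^ 2) b *
    racahPhi (r ^ 2) i b (s₁ ^ 2) (s₃ ^ 2) (s₂ ^ 2) K * e4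

/-! ### The pentagon relation for the normalized functions: weights -/

section

variable {q d₁ d₂ d₃ d₄ d₅ : ℂ} {N : ℕ}

/-- The `y`-dependent part of the ratio between `q`-Racah weights and the pentagon weight. -/
def pentKy (q D d₄ d₅ : ℂ) (N y : ℕ) : ℂ :=
  qPoch (q * d₅) q y * qPoch (q * (d₄ * d₅)) q y * (1 - d₄ * d₅ * q * (q ^ y) ^ 2) *
      q ^ y.choose 2 /
    (qPoch q q y * (q * d₅) ^ y * qPoch (q * d₄) q y * (-(D * q ^ (N + 1))) ^ y)

/-- The `b`-dependent part of the ratio between `q`-Racah weights and the pentagon weight. -/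
def pentKb (q d₁ d₅ : ℂ) (N b : ℕ) : ℂ :=
  qPoch q q (N - b) * qPoch (q * (d₁ * d₅)) q (N + b + 1)

/-- The normalizations of the functions with index pairs (y,b) and (x,l) separate into a function of
y, a function of b and the pentagon weight. The constraint and reversal bring the two triple
products into the form of the weight. -/
theorem racahWeight_mul_racahWeight (h : Gen5 q d₁ d₂ d₃ d₄ d₅ N) {x y t b s : ℕ}
    (ht : N = x + y + t) (hs : N = x + b + s) :
    (q ^ (N + 1) * d₁ * d₃) ^ x * (qPoch (q * d₂) q x / qPoch (q * d₃) q x) *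
        racahWeight q d₄ d₅ d₁ y t * racahWeight q d₂ d₃ d₄ x s =
      pentKy q (d₂ * d₃) d₄ d₅ N y * pentKb q d₁ d₅ N b *
        pentWeight q d₁ (d₂ * d₃) d₄ d₅ x y t b s := by
  have hq := h.nr.1
  have h15 := h.n15
  have e1 : d₄ * d₅ * d₁ * q ^ (y + t + 2) = (d₂ * d₃ * q ^ (2 * x + t + 1 + y))⁻¹ := by
    refine eq_inv_of_mul_eq_one_left ?_
    rw [← h.con, ht]
    ring
  have e2 : d₂ * d₃ * d₄ * q ^ (x + s + 2) = (d₁ * d₅ * q ^ (2 * b + s + 1 + x))⁻¹ := by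
    refine eq_inv_of_mul_eq_one_left ?_
    rw [← h.con, hs]
    ring
  have k1 := qPoch_reverse hq h.n23.1 (2 * x + t + 1) y
  have k2 := qPoch_reverse hq h15.1 (2 * b + s + 1) x
  have p1 : (-(d₂ * d₃ * q ^ (2 * x + t + 1 + y))) ^ y =
      (-(d₂ * d₃ * q ^ (N + 1))) ^ y * q ^ (x * y) := by
    rw [pow_mul, ← mul_pow, ht]
    ring
  have p2 : (-(d₁ * d₅ * q ^ (2 * b + s + 1 + x))) ^ x =
      (-1) ^ x * (q ^ N * d₁) ^ x * (q ^ (b + 1) * d₅) ^ x := by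
    rw [← mul_pow, ← mul_pow, hs]
    ring
  have p3 : (q ^ (N + 1) * d₁ * d₃) ^ x = (q ^ N * d₁) ^ x * (q * d₃) ^ x := by
    rw [← mul_pow]
    ring
  have p4 : (q ^ (b + y + 1) * d₅) ^ x = (q ^ (b + 1) * d₅) ^ x * q ^ (x * y) := by
    rw [mul_comm x y, pow_mul, ← mul_pow]
    ring
  rw [racahWeight, racahWeight, pentKy, pentKb, pentWeight, e1, e2, p3, p4,
    show N - b = x + s by omega, show N + b + 1 = 2 * b + s + 1 + x by omega,
    show 2 * x + y + t + 1 = 2 * x + t + 1 + y by ring]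
  rw [p1] at k1
  rw [p2] at k2
  have m1 := (h.n23.inv_mul_pow hq (2 * x + t + 1 + y)).qPoch_ne_zero y
  have m2 := (h15.inv_mul_pow hq (2 * b + s + 1 + x)).qPoch_ne_zero x
  have a1 : (-(d₂ * d₃ * q ^ (N + 1))) ^ y ≠ 0 :=
    pow_ne_zero _ (neg_ne_zero.2 (mul_ne_zero h.n23.1 (pow_ne_zero _ hq)))
  have a2 : q ^ (x * y) ≠ 0 := pow_ne_zero _ hq
  have a3 : (q ^ N * d₁) ^ x ≠ 0 := pow_ne_zero _ (mul_ne_zero (pow_ne_zero _ hq) h.n1.1)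
  have a4 : (q ^ (b + 1) * d₅) ^ x ≠ 0 := pow_ne_zero _ (mul_ne_zero (pow_ne_zero _ hq) h.n5.1)
  have a5 : (-1 : ℂ) ^ x ≠ 0 := pow_ne_zero _ (by norm_num)
  have a6 : (-1 : ℂ) ^ x * (-1) ^ x = 1 := by rw [← mul_pow]; simp
  have a7 : (q * d₃) ^ x ≠ 0 := pow_ne_zero _ (mul_ne_zero hq h.n3.1)
  have a8 : (q * d₅) ^ y ≠ 0 := pow_ne_zero _ (mul_ne_zero hq h.n5.1)
  have a9 : q ^ y.choose 2 ≠ 0 := pow_ne_zero _ hq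
  have b1 : q ^ x.choose 2 ≠ 0 := pow_ne_zero _ hq
  have b2 := (h.n23.mul_left hq).qPoch_ne_zero (2 * x + t + 1)
  have b3 := (h15.mul_left hq).qPoch_ne_zero (2 * b + s + 1)
  have b4 := (h.n3.mul_left hq).qPoch_ne_zero x
  have b5 := (h.n2.mul_left hq).qPoch_ne_zero x
  have b6 := (h.n4.mul_left hq).qPoch_ne_zero y
  have b7 := (h.n45.mul_left hq).qPoch_ne_zero (2 * y + t + 1)
  have b8 := (h.n23.mul_left hq).qPoch_ne_zero (2 * x + s + 1)
  have c1 := h.nr.qPoch_ne_zero x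
  have c2 := h.nr.qPoch_ne_zero y
  have c3 := h.nr.qPoch_ne_zero s
  have c4 := h.nr.qPoch_ne_zero t
  generalize qPoch (d₂ * d₃ * q ^ (2 * x + t + 1 + y))⁻¹ q y = A at *
  generalize qPoch (d₁ * d₅ * q ^ (2 * b + s + 1 + x))⁻¹ q x = B at *
  generalize qPoch (q * (d₂ * d₃)) q (2 * x + t + 1 + y) = u1 at *
  generalize qPoch (q * (d₁ * d₅)) q (2 * b + s + 1 + x) = u2 at *
  generalize qPoch (q * (d₂ * d₃)) q (2 * x + t + 1) = u3 at *
  generalize qPoch (q * (d₁ * d₅)) q (2 * b + s + 1) = u4 at *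
  generalize qPoch (q * (d₂ * d₃)) q (2 * x + s + 1) = u5 at *
  generalize qPoch (q * (d₄ * d₅)) q (2 * y + t + 1) = u6 at *
  generalize (-(d₂ * d₃ * q ^ (N + 1))) ^ y = v1 at *
  generalize q ^ (x * y) = v2 at *
  generalize (q ^ N * d₁) ^ x = v3 at *
  generalize (q ^ (b + 1) * d₅) ^ x = v4 at *
  generalize (-1 : ℂ) ^ x = v5 at *
  generalize (q * d₃) ^ x = v6 at *
  generalize (q * d₅) ^ y = v7 at *
  generalize q ^ y.choose 2 = v8 at *
  generalize q ^ x.choose 2 = v9 at *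
  generalize 1 - d₄ * d₅ * q * (q ^ y) ^ 2 = w1
  generalize 1 - d₂ * d₃ * q * (q ^ x) ^ 2 = w2
  generalize qPoch (q * (d₄ * d₅)) q y = w3
  generalize qPoch (q * (d₂ * d₃)) q x = w4
  generalize qPoch (q * d₃) q x = u7 at *
  generalize qPoch (q * d₂) q x = u8 at *
  generalize qPoch (q * d₄) q y = u9 at *
  generalize qPoch (q * d₅) q y = w5
  generalize qPoch (q * d₁) q t = w6
  generalize qPoch (q * d₄) q s = w7
  generalize qPoch q q x = z1 at *
  generalize qPoch q q y = z2 at *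
  generalize qPoch q q s = z3 at *
  generalize qPoch q q t = z4 at *
  generalize qPoch q q (x + s) = z5
  generalize qPoch q q (y + t) = z6
  rw [← eq_div_iff a9] at k1
  rw [← eq_div_iff b1] at k2
  rw [k1, k2]
  clear k1 k2 e1 e2 p1 p2 p3 p4 h15 h
  field_simp
  have a7' := sq v5
  rw [a6] at a7'
  simp only [a7', mul_one]

/-- After summation the leftover factors must equal the normalizations of the two remaining
functions, up to monomials. Three reversals, one for each triple product, make the Pochhammer
symbols agree. -/
theorem racahWeight_mul_pentKy (h : Gen5 q d₁ d₂ d₃ d₄ d₅ N) {a y n l m : ℕ}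
    (hn : N = a + y + n) (hm : N = a + l + m) :
    racahWeight q d₁ d₂ d₃ a n * pentKy q (d₂ * d₃) d₄ d₅ N y *
        pentWa q d₁ d₂ d₃ d₄ d₅ N a l m *
        pentWy q (q ^ (N + 1) * d₁ * d₄) d₄ d₅ y (N - y) *
        ((-(d₄ * d₅ * q ^ (N + 1))) ^ a * (q * d₂) ^ a *
          ((q * d₅) ^ y * (-(d₂ * d₃ * q ^ (N + 1))) ^ y * (q ^ (N + 1) * d₁ * d₄) ^ y)) =
      (q ^ (N + 1) * d₁ * d₄) ^ N *
        ((q ^ (N + 1) * d₂ * d₅) ^ a * (q * d₁) ^ a * (-(d₃ * d₄ * q ^ (N + 1))) ^ a) *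
        (q ^ (N + 1) * d₃ * d₅) ^ l * ((q * d₄) ^ y * (-(d₁ * d₂ * q ^ (N + 1))) ^ y) *
        (qPoch (q * d₅) q y / qPoch (q * d₄) q y * (qPoch (q * d₂) q a / qPoch (q * d₁) q a) *
          (qPoch (q * d₄) q l / qPoch (q * d₃) q l)) *
        racahWeight q d₅ d₄ d₃ y n * racahWeight q d₂ d₁ d₅ a m := by
  have hq := h.nr.1
  have e1 : d₁ * d₂ * d₃ * q ^ (a + n + 2) = (d₄ * d₅ * q ^ (2 * y + n + 1 + a))⁻¹ := by
    refine eq_inv_of_mul_eq_one_left ?_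
    rw [← h.con, hn]
    ring
  have e2 : d₅ * d₄ * d₃ * q ^ (y + n + 2) = (d₁ * d₂ * q ^ (2 * a + n + 1 + y))⁻¹ := by
    refine eq_inv_of_mul_eq_one_left ?_
    rw [← h.con, hn]
    ring
  have e3 : d₂ * d₁ * d₅ * q ^ (a + m + 2) = (d₃ * d₄ * q ^ (2 * l + m + 1 + a))⁻¹ := by
    refine eq_inv_of_mul_eq_one_left ?_
    rw [← h.con, hm]
    ring
  have k1 := qPoch_reverse hq h.n45.1 (2 * y + n + 1) a
  have k2 := qPoch_reverse hq h.n12.1 (2 * a + n + 1) y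
  have k3 := qPoch_reverse hq h.n34.1 (2 * l + m + 1) a
  have p1 : (-(d₄ * d₅ * q ^ (2 * y + n + 1 + a))) ^ a =
      (-(d₄ * d₅ * q ^ (N + 1))) ^ a * q ^ (y * a) := by
    rw [pow_mul, ← mul_pow, hn]
    ring
  have p2 : (-(d₁ * d₂ * q ^ (2 * a + n + 1 + y))) ^ y =
      (-(d₁ * d₂ * q ^ (N + 1))) ^ y * q ^ (y * a) := by
    rw [mul_comm y a, pow_mul, ← mul_pow, hn]
    ring
  have p3 : (-(d₃ * d₄ * q ^ (2 * l + m + 1 + a))) ^ a =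
      (-(d₃ * d₄ * q ^ (N + 1))) ^ a * q ^ (a * l) := by
    rw [mul_comm a l, pow_mul, ← mul_pow, hm]
    ring
  rw [racahWeight, racahWeight, racahWeight, pentKy, pentWa, pentWy, e1, e2, e3,
    mul_comm d₅ d₄, mul_comm d₂ d₁,
    show N - y = a + n by omega, show y + n = l + m by omega,
    show 2 * y + (a + n) + 1 = 2 * y + n + 1 + a by ring,
    show 2 * a + l + m + 1 = 2 * a + n + 1 + y by omega,
    show 2 * l + a + m + 1 = 2 * l + m + 1 + a by ring]
  rw [p1] at k1
  rw [p2] at k2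
  rw [p3] at k3
  have m1 := (h.n45.inv_mul_pow hq (2 * y + n + 1 + a)).qPoch_ne_zero a
  have hN : q ^ (N + 1) ≠ 0 := pow_ne_zero _ hq
  have a1 : (-(d₄ * d₅ * q ^ (N + 1))) ^ a ≠ 0 :=
    pow_ne_zero _ (neg_ne_zero.2 (mul_ne_zero h.n45.1 hN))
  have a2 : (-(d₂ * d₃ * q ^ (N + 1))) ^ y ≠ 0 :=
    pow_ne_zero _ (neg_ne_zero.2 (mul_ne_zero h.n23.1 hN))
  have a3 : (q ^ (N + 1) * d₁ * d₄) ^ y ≠ 0 :=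
    pow_ne_zero _ (mul_ne_zero (mul_ne_zero hN h.n1.1) h.n4.1)
  have a4 : (q * d₁) ^ a ≠ 0 := pow_ne_zero _ (mul_ne_zero hq h.n1.1)
  have a5 : (q * d₂) ^ a ≠ 0 := pow_ne_zero _ (mul_ne_zero hq h.n2.1)
  have a6 : (q * d₄) ^ y ≠ 0 := pow_ne_zero _ (mul_ne_zero hq h.n4.1)
  have a7 : (q * d₅) ^ y ≠ 0 := pow_ne_zero _ (mul_ne_zero hq h.n5.1)
  have a8 : q ^ (y * a) ≠ 0 := pow_ne_zero _ hq
  have a9 : q ^ (a * l) ≠ 0 := pow_ne_zero _ hq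
  have a10 : q ^ a.choose 2 ≠ 0 := pow_ne_zero _ hq
  have a11 : q ^ y.choose 2 ≠ 0 := pow_ne_zero _ hq
  have b1 := (h.n45.mul_left hq).qPoch_ne_zero (2 * y + n + 1)
  have b2 := (h.n12.mul_left hq).qPoch_ne_zero (2 * a + n + 1)
  have b3 := (h.n34.mul_left hq).qPoch_ne_zero (2 * l + m + 1)
  have b4 := (h.n12.mul_left hq).qPoch_ne_zero (2 * a + m + 1)
  have b5 := (h.n1.mul_left hq).qPoch_ne_zero a
  have b6 := (h.n2.mul_left hq).qPoch_ne_zero a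
  have b7 := (h.n3.mul_left hq).qPoch_ne_zero l
  have b8 := (h.n4.mul_left hq).qPoch_ne_zero y
  have b9 := (h.n5.mul_left hq).qPoch_ne_zero y
  have c1 := h.nr.qPoch_ne_zero a
  have c2 := h.nr.qPoch_ne_zero y
  have c3 := h.nr.qPoch_ne_zero n
  have c4 := h.nr.qPoch_ne_zero m
  have c5 := h.nr.qPoch_ne_zero (a + n)
  generalize qPoch (d₄ * d₅ * q ^ (2 * y + n + 1 + a))⁻¹ q a = A at *
  generalize qPoch (d₁ * d₂ * q ^ (2 * a + n + 1 + y))⁻¹ q y = B at *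
  generalize qPoch (d₃ * d₄ * q ^ (2 * l + m + 1 + a))⁻¹ q a = C at *
  generalize qPoch (q * (d₄ * d₅)) q (2 * y + n + 1 + a) = u1 at *
  generalize qPoch (q * (d₁ * d₂)) q (2 * a + n + 1 + y) = u2 at *
  generalize qPoch (q * (d₃ * d₄)) q (2 * l + m + 1 + a) = u3 at *
  generalize qPoch (q * (d₄ * d₅)) q (2 * y + n + 1) = u4 at *
  generalize qPoch (q * (d₁ * d₂)) q (2 * a + n + 1) = u5 at *
  generalize qPoch (q * (d₃ * d₄)) q (2 * l + m + 1) = u6 at *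
  generalize qPoch (q * (d₁ * d₂)) q (2 * a + m + 1) = u7 at *
  generalize qPoch (q * (d₁ * d₂)) q a = u8
  generalize qPoch (q * (d₄ * d₅)) q y = u9
  generalize 1 - d₄ * d₅ * q * (q ^ y) ^ 2 = w1
  generalize 1 - d₁ * d₂ * q * (q ^ a) ^ 2 = w2
  generalize (-(d₄ * d₅ * q ^ (N + 1))) ^ a = v1 at *
  generalize (-(d₂ * d₃ * q ^ (N + 1))) ^ y = v2 at *
  generalize (-(d₁ * d₂ * q ^ (N + 1))) ^ y = v3 at *
  generalize (-(d₃ * d₄ * q ^ (N + 1))) ^ a = v4 at *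
  generalize (q ^ (N + 1) * d₁ * d₄) ^ y = v5 at *
  generalize (q ^ (N + 1) * d₁ * d₄) ^ N = v6
  generalize (q ^ (N + 1) * d₂ * d₅) ^ a = v7
  generalize (q ^ (N + 1) * d₃ * d₅) ^ l = v8
  generalize (q * d₁) ^ a = v9 at *
  generalize (q * d₂) ^ a = v10 at *
  generalize (q * d₄) ^ y = v11 at *
  generalize (q * d₅) ^ y = v12 at *
  generalize q ^ (y * a) = v13 at *
  generalize q ^ (a * l) = v14 at *
  generalize q ^ a.choose 2 = v15 at *
  generalize q ^ y.choose 2 = v16 at *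
  generalize qPoch (q * d₁) q a = z1 at *
  generalize qPoch (q * d₂) q a = z2 at *
  generalize qPoch (q * d₃) q l = z3 at *
  generalize qPoch (q * d₄) q y = z4 at *
  generalize qPoch (q * d₅) q y = z5 at *
  generalize qPoch (q * d₄) q l = z6
  generalize qPoch (q * d₃) q n = z7
  generalize qPoch (q * d₅) q m = z8
  generalize qPoch q q (a + n) = z9 at *
  generalize qPoch q q (a + m) = z10
  generalize qPoch q q (l + m) = z11
  generalize qPoch q q a = z12 at *
  generalize qPoch q q y = z13 at *
  generalize qPoch q q n = z14 at *
  generalize qPoch q q m = z15 at *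
  obtain ⟨A, rfl⟩ : ∃ A', A = A' * v15 := ⟨A / v15, (div_mul_cancel₀ _ a10).symm⟩
  obtain ⟨B, rfl⟩ : ∃ B', B = B' * v16 := ⟨B / v16, (div_mul_cancel₀ _ a11).symm⟩
  obtain ⟨C, rfl⟩ : ∃ C', C = C' * v15 := ⟨C / v15, (div_mul_cancel₀ _ a10).symm⟩
  rw [← mul_assoc] at k1 k2 k3
  have k1 := mul_right_cancel₀ a10 k1
  have k2 := mul_right_cancel₀ a11 k2
  have k3 := mul_right_cancel₀ a10 k3
  subst k1 k2 k3
  have m1 := left_ne_zero_of_mul m1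
  clear e1 e2 e3 p1 p2 p3 h
  simp only [← mul_div_assoc, div_mul_eq_mul_div, div_div]
  rw [div_eq_div_iff (by simp only [mul_ne_zero_iff]; tauto) (by simp only [mul_ne_zero_iff]; tauto)]
  ring

end

/-! ### The pentagon relation for the normalized functions: statement -/

section

variable {r s₀ s₁ s₂ s₃ s₄ : ℂ} {N : ℕ}

theorem racah_pentagon_term (h : Gen5 (r ^ 2) (s₁ ^ 2) (s₂ ^ 2) (s₄ ^ 2) (s₀ ^ 2) (s₃ ^ 2) N)
    (hcon : r ^ (2 * N + 3) * s₀ * s₁ * s₂ * s₃ * s₄ = 1) {a b l x y : ℕ} (ha : a + y ≤ N)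
    (hb : b + l ≤ N) (hx : x ≤ N) :
    (s₁ / s₀) ^ x * xi r x s₂ s₄ * racah r a x s₄ s₂ s₁ (N - y) * racah r y b s₁ s₃ s₀ (N - x) *
        racah r x l s₀ s₄ s₂ (N - b) =
      (r * s₂) ^ (N - y) * (r * s₃) ^ N * (r * s₄) ^ (N - b) *
        racahWeight (r ^ 2) (s₁ ^ 2) (s₂ ^ 2) (s₄ ^ 2) a (N - y - a) *
        pentKy (r ^ 2) (s₂ ^ 2 * s₄ ^ 2) (s₀ ^ 2) (s₃ ^ 2) N y *
        pentKb (r ^ 2) (s₁ ^ 2) (s₃ ^ 2) N b *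
        (pentV (r ^ 2) (s₁ ^ 2) (s₂ ^ 2 * s₄ ^ 2) (s₀ ^ 2) (s₃ ^ 2) N x y b *
          racahPhi (r ^ 2) a x (s₄ ^ 2) (s₂ ^ 2) (s₁ ^ 2) (N - y) *
          racahPhi (r ^ 2) y b (s₁ ^ 2) (s₃ ^ 2) (s₀ ^ 2) (N - x) *
          racahPhi (r ^ 2) x l (s₀ ^ 2) (s₄ ^ 2) (s₂ ^ 2) (N - b)) := by
  have h0 : s₀ ≠ 0 := fun e => h.n4.1 (by simp [e])
  have h2 : s₂ ≠ 0 := fun e => h.n2.1 (by simp [e])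
  rw [pentV]
  by_cases hy : N < x + y
  -- Outside the support of the pentagon weight one of the normalized functions vanishes, so the two
  -- conventions for extension by zero agree.
  · rw [racah_eq_zero_left (n := y) r s₁ s₃ s₀ b (by omega), if_neg (by omega)]
    ring
  by_cases hxb : N < x + b
  · rw [racah_eq_zero_left (n := x) r s₀ s₄ s₂ l (by omega), if_neg (by omega)]
    ring
  have e := racahWeight_mul_racahWeight h (x := x) (y := y) (b := b) (t := N - x - y)
    (s := N - x - b) (by omega) (by omega)
  have p : (s₁ / s₀) ^ x * (s₄ / s₂) ^ x * (r * s₃) ^ (N - x) =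
      ((r ^ 2) ^ (N + 1) * s₁ ^ 2 * s₄ ^ 2) ^ x * (r * s₃) ^ N := by
    rw [show (r * s₃) ^ N = (r * s₃) ^ x * (r * s₃) ^ (N - x) by rw [← pow_add]; congr 1; omega,
      ← mul_assoc, ← mul_pow, ← mul_pow]
    congr 2
    rw [div_mul_div_comm, div_eq_iff (mul_ne_zero h0 h2)]
    linear_combination -(s₁ * s₄) * hcon
  rw [racah_eq h.gen3.symm (by omega) (by omega), racah_eq h.gen3₄₅₁.symm (by omega) (by omega),
    racah_eq h.rot.gen3.symm (by omega) (by omega), if_pos (by omega), xi,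
    show N - b - x = N - x - b by omega]
  generalize racahWeight (r ^ 2) (s₁ ^ 2) (s₂ ^ 2) (s₄ ^ 2) a (N - y - a) = w1
  generalize racahWeight (r ^ 2) (s₀ ^ 2) (s₃ ^ 2) (s₁ ^ 2) y (N - x - y) = w2 at *
  generalize racahWeight (r ^ 2) (s₂ ^ 2) (s₄ ^ 2) (s₀ ^ 2) x (N - x - b) = w3 at *
  generalize racahPhi (r ^ 2) a x (s₄ ^ 2) (s₂ ^ 2) (s₁ ^ 2) (N - y) = f1
  generalize racahPhi (r ^ 2) y b (s₁ ^ 2) (s₃ ^ 2) (s₀ ^ 2) (N - x) = f2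
  generalize racahPhi (r ^ 2) x l (s₀ ^ 2) (s₄ ^ 2) (s₂ ^ 2) (N - b) = f3
  generalize qPoch (r ^ 2 * s₂ ^ 2) (r ^ 2) x / qPoch (r ^ 2 * s₄ ^ 2) (r ^ 2) x = g at *
  generalize (r * s₂) ^ (N - y) = v1
  generalize (r * s₄) ^ (N - b) = v2
  generalize (s₁ / s₀) ^ x = v3 at *
  generalize (s₄ / s₂) ^ x = v4 at *
  generalize (r * s₃) ^ (N - x) = v5 at *
  generalize (r * s₃) ^ N = v6 at *
  generalize ((r ^ 2) ^ (N + 1) * s₁ ^ 2 * s₄ ^ 2) ^ x = v7 at *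
  linear_combination (exp := 1) v1 * v2 * v6 * w1 * f1 * f2 * f3 * e +
    g * v1 * v2 * w1 * w2 * w3 * f1 * f2 * f3 * p

theorem pentKb_mul_pentWy (h : Gen5 (r ^ 2) (s₁ ^ 2) (s₂ ^ 2) (s₄ ^ 2) (s₀ ^ 2) (s₃ ^ 2) N)
    (hcon : r ^ (2 * N + 3) * s₀ * s₁ * s₂ * s₃ * s₄ = 1) {b : ℕ} (hb : b ≤ N) :
    (r * s₄) ^ (N - b) * pentKb (r ^ 2) (s₁ ^ 2) (s₃ ^ 2) N b *
        pentWy (r ^ 2) ((r ^ 2) ^ (N + 1) * s₁ ^ 2 * s₀ ^ 2) (s₁ ^ 2) (s₃ ^ 2) b (N - b) =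
      (r * s₄) ^ N * (xi r b s₁ s₃ * (s₂ / s₀) ^ b) := by
  have hq := h.nr.1
  have hr : r ≠ 0 := fun e => h.nr.1 (by simp [e])
  have h0 : s₀ ≠ 0 := fun e => h.n4.1 (by simp [e])
  have h1 : s₁ ≠ 0 := fun e => h.n1.1 (by simp [e])
  have h4 : s₄ ≠ 0 := fun e => h.n3.1 (by simp [e])
  have h15 : Nz (r ^ 2) (s₁ ^ 2 * s₃ ^ 2) := by simpa [mul_comm] using h.n51
  have p : (s₃ / s₁) ^ b * (s₂ / s₀) ^ b *
      ((r * s₄) ^ b * ((r ^ 2) ^ (N + 1) * s₁ ^ 2 * s₀ ^ 2) ^ b) = 1 := by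
    rw [← mul_pow, ← mul_pow, ← mul_pow]
    convert one_pow b using 2
    rw [← hcon]
    field_simp
    ring
  have e : (r * s₄) ^ N = (r * s₄) ^ b * (r * s₄) ^ (N - b) := by
    rw [← pow_add]; congr 1; omega
  rw [pentKb, pentWy, xi, e, show 2 * b + (N - b) + 1 = N + b + 1 by omega]
  have n1 := h.nr.qPoch_ne_zero (N - b)
  have n2 := (h15.mul_left hq).qPoch_ne_zero (N + b + 1)
  have n3 := (h.n5.mul_left hq).qPoch_ne_zero b
  have n4 : ((r ^ 2) ^ (N + 1) * s₁ ^ 2 * s₀ ^ 2) ^ b ≠ 0 :=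
    right_ne_zero_of_mul (right_ne_zero_of_mul_eq_one p)
  generalize qPoch (r ^ 2) (r ^ 2) (N - b) = u1 at *
  generalize qPoch (r ^ 2 * (s₁ ^ 2 * s₃ ^ 2)) (r ^ 2) (N + b + 1) = u2 at *
  generalize qPoch (r ^ 2 * s₃ ^ 2) (r ^ 2) b = u3 at *
  generalize qPoch (r ^ 2 * s₁ ^ 2) (r ^ 2) b = u4 at *
  generalize ((r ^ 2) ^ (N + 1) * s₁ ^ 2 * s₀ ^ 2) ^ b = v1 at *
  generalize (r * s₄) ^ (N - b) = v2 at *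
  generalize (r * s₄) ^ b = v3 at *
  generalize (s₃ / s₁) ^ b = v4 at *
  generalize (s₂ / s₀) ^ b = v5 at *
  field_simp
  linear_combination (exp := 1) -(v2 * u4) * p

theorem pentagon_factor (h : Gen5 (r ^ 2) (s₁ ^ 2) (s₂ ^ 2) (s₄ ^ 2) (s₀ ^ 2) (s₃ ^ 2) N)
    (hcon : r ^ (2 * N + 3) * s₀ * s₁ * s₂ * s₃ * s₄ = 1) {a l y : ℕ} (ha : a + y ≤ N)
    (hl : a + l ≤ N) :
    (r * s₂) ^ (N - y) * (r * s₃) ^ N * (r * s₄) ^ N *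
        racahWeight (r ^ 2) (s₁ ^ 2) (s₂ ^ 2) (s₄ ^ 2) a (N - y - a) *
        pentKy (r ^ 2) (s₂ ^ 2 * s₄ ^ 2) (s₀ ^ 2) (s₃ ^ 2) N y *
        pentWa (r ^ 2) (s₁ ^ 2) (s₂ ^ 2) (s₄ ^ 2) (s₀ ^ 2) (s₃ ^ 2) N a l (N - a - l) *
        pentWy (r ^ 2) ((r ^ 2) ^ (N + 1) * s₁ ^ 2 * s₀ ^ 2) (s₀ ^ 2) (s₃ ^ 2) y (N - y) =
      (s₁ / s₄) ^ y / xi r y s₀ s₃ * (xi r a s₂ s₁ * (s₄ / s₃) ^ a) *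
        (xi r l s₀ s₄ * (s₃ / s₂) ^ l) * ((r * s₀) ^ (N - a) * (r * s₁) ^ (N - l)) *
        racahWeight (r ^ 2) (s₃ ^ 2) (s₀ ^ 2) (s₄ ^ 2) y (N - a - y) *
        racahWeight (r ^ 2) (s₂ ^ 2) (s₁ ^ 2) (s₃ ^ 2) a (N - l - a) := by
  have hq := h.nr.1
  have hr : r ≠ 0 := fun e => h.nr.1 (by simp [e])
  have h0 : s₀ ≠ 0 := fun e => h.n4.1 (by simp [e])
  have h1 : s₁ ≠ 0 := fun e => h.n1.1 (by simp [e])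
  have h2 : s₂ ≠ 0 := fun e => h.n2.1 (by simp [e])
  have h3 : s₃ ≠ 0 := fun e => h.n5.1 (by simp [e])
  have h4 : s₄ ≠ 0 := fun e => h.n3.1 (by simp [e])
  have hQ : (r ^ 2) ^ (N + 1) ≠ 0 := pow_ne_zero _ hq
  have key := racahWeight_mul_pentKy h (a := a) (y := y) (n := N - a - y) (l := l)
    (m := N - a - l) (by omega) (by omega)
  have hcon' : (r ^ 2) ^ (N + 1) * r * s₀ * s₁ * s₂ * s₃ * s₄ = 1 := by
    rw [← hcon]
    ring
  set Q := (r ^ 2) ^ (N + 1) with hQdef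
  -- The monomials are matched separately in the exponents N, y, a and l. Each comparison of bases
  -- is an instance of the constraint on the square roots.
  have pN : (r * s₂) ^ N * (r * s₃) ^ N * (r * s₄) ^ N * (Q * s₁ ^ 2 * s₀ ^ 2) ^ N =
      (r * s₀) ^ N * (r * s₁) ^ N := by
    rw [← mul_pow, ← mul_pow, ← mul_pow, ← mul_pow]
    congr 1
    linear_combination r ^ 2 * s₀ * s₁ * hcon'
  have py : (r ^ 2 * s₀ ^ 2) ^ y * (-(s₁ ^ 2 * s₂ ^ 2 * Q)) ^ y =
      (s₁ / s₄) ^ y * ((s₀ / s₃) ^ y * (r * s₂) ^ y) * ((r ^ 2 * s₃ ^ 2) ^ y *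
        (-(s₂ ^ 2 * s₄ ^ 2 * Q)) ^ y * (Q * s₁ ^ 2 * s₀ ^ 2) ^ y) := by
    simp only [← mul_pow]
    congr 1
    field_simp
    linear_combination hcon'
  have pa : (Q * s₂ ^ 2 * s₃ ^ 2) ^ a * (r ^ 2 * s₁ ^ 2) ^ a * (-(s₄ ^ 2 * s₀ ^ 2 * Q)) ^ a *
      (r * s₀) ^ a = (s₁ / s₂) ^ a * (s₄ / s₃) ^ a *
        ((-(s₀ ^ 2 * s₃ ^ 2 * Q)) ^ a * (r ^ 2 * s₂ ^ 2) ^ a) := by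
    simp only [← mul_pow]
    congr 1
    field_simp
    linear_combination -hcon'
  have pl : (Q * s₄ ^ 2 * s₃ ^ 2) ^ l * (r * s₁) ^ l = (s₄ / s₀) ^ l * (s₃ / s₂) ^ l := by
    simp only [← mul_pow]
    congr 1
    field_simp
    linear_combination hcon'
  have f1 : (r * s₂) ^ N = (r * s₂) ^ y * (r * s₂) ^ (N - y) := by
    rw [← pow_add]; congr 1; omega
  have f2 : (r * s₀) ^ N = (r * s₀) ^ a * (r * s₀) ^ (N - a) := by
    rw [← pow_add]; congr 1; omega
  have f3 : (r * s₁) ^ N = (r * s₁) ^ l * (r * s₁) ^ (N - l) := by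
    rw [← pow_add]; congr 1; omega
  have ex : (s₁ / s₄) ^ y / xi r y s₀ s₃ = (s₁ / s₄) ^ y * (s₀ / s₃) ^ y *
      (qPoch (r ^ 2 * s₃ ^ 2) (r ^ 2) y / qPoch (r ^ 2 * s₀ ^ 2) (r ^ 2) y) := by
    rw [xi, ← inv_div s₃ s₀, inv_pow, div_eq_mul_inv _ (_ * _), mul_inv, inv_div]
    ring
  have n1 : (r * s₂) ^ y ≠ 0 := pow_ne_zero _ (mul_ne_zero hr h2)
  have n2 : (r * s₀) ^ a ≠ 0 := pow_ne_zero _ (mul_ne_zero hr h0)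
  have n3 : (r * s₁) ^ l ≠ 0 := pow_ne_zero _ (mul_ne_zero hr h1)
  have n4 : (r ^ 2 * s₂ ^ 2) ^ a ≠ 0 := pow_ne_zero _ (mul_ne_zero hq h.n2.1)
  have n5 : (r ^ 2 * s₃ ^ 2) ^ y ≠ 0 := pow_ne_zero _ (mul_ne_zero hq h.n5.1)
  have n6 : (-(s₀ ^ 2 * s₃ ^ 2 * Q)) ^ a ≠ 0 :=
    pow_ne_zero _ (neg_ne_zero.2 (mul_ne_zero h.n45.1 hQ))
  have n7 : (-(s₂ ^ 2 * s₄ ^ 2 * Q)) ^ y ≠ 0 :=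
    pow_ne_zero _ (neg_ne_zero.2 (mul_ne_zero h.n23.1 hQ))
  have n8 : (Q * s₁ ^ 2 * s₀ ^ 2) ^ y ≠ 0 :=
    pow_ne_zero _ (mul_ne_zero (mul_ne_zero hQ h.n1.1) h.n4.1)
  rw [f1, f2, f3] at pN
  rw [ex, xi, xi, show N - y - a = N - a - y by omega, show N - l - a = N - a - l by omega]
  clear f1 f2 f3 ex h hcon hcon'
  clear_value Q
  generalize (r * s₂) ^ y = e2 at *
  generalize (r * s₀) ^ a = e0 at *
  generalize (r * s₁) ^ l = e1 at *
  generalize (r * s₂) ^ (N - y) = t2 at *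
  generalize (r * s₀) ^ (N - a) = t0 at *
  generalize (r * s₁) ^ (N - l) = t1 at *
  generalize (r * s₃) ^ N = t3 at *
  generalize (r * s₄) ^ N = t4 at *
  generalize (-(s₀ ^ 2 * s₃ ^ 2 * Q)) ^ a = x1 at *
  generalize (r ^ 2 * s₂ ^ 2) ^ a = x2 at *
  generalize (r ^ 2 * s₃ ^ 2) ^ y = x3 at *
  generalize (-(s₂ ^ 2 * s₄ ^ 2 * Q)) ^ y = x4 at *
  generalize (Q * s₁ ^ 2 * s₀ ^ 2) ^ y = x5 at *
  generalize (Q * s₁ ^ 2 * s₀ ^ 2) ^ N = PN at *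
  generalize (s₁ / s₄) ^ y = g1 at *
  generalize (s₀ / s₃) ^ y = g2 at *
  generalize (s₁ / s₂) ^ a = g3 at *
  generalize (s₄ / s₃) ^ a = g4 at *
  generalize (s₄ / s₀) ^ l = g5 at *
  generalize (s₃ / s₂) ^ l = g6 at *
  generalize (r ^ 2 * s₀ ^ 2) ^ y * (-(s₁ ^ 2 * s₂ ^ 2 * Q)) ^ y = x8 at *
  generalize (Q * s₂ ^ 2 * s₃ ^ 2) ^ a * (r ^ 2 * s₁ ^ 2) ^ a * (-(s₄ ^ 2 * s₀ ^ 2 * Q)) ^ a =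
    x6 at *
  generalize (Q * s₄ ^ 2 * s₃ ^ 2) ^ l = x7 at *
  generalize qPoch (r ^ 2 * s₃ ^ 2) (r ^ 2) y / qPoch (r ^ 2 * s₀ ^ 2) (r ^ 2) y = R1 at *
  generalize qPoch (r ^ 2 * s₂ ^ 2) (r ^ 2) a / qPoch (r ^ 2 * s₁ ^ 2) (r ^ 2) a = R2 at *
  generalize qPoch (r ^ 2 * s₀ ^ 2) (r ^ 2) l / qPoch (r ^ 2 * s₄ ^ 2) (r ^ 2) l = R3 at *
  generalize racahWeight (r ^ 2) (s₃ ^ 2) (s₀ ^ 2) (s₄ ^ 2) y (N - a - y) = w1 at *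
  generalize racahWeight (r ^ 2) (s₂ ^ 2) (s₁ ^ 2) (s₃ ^ 2) a (N - a - l) = w2 at *
  have nX : x1 * x2 * (x3 * x4 * x5) * e2 * e0 * e1 ≠ 0 := by
    simp only [mul_ne_zero_iff]
    tauto
  refine mul_right_cancel₀ nX ?_
  linear_combination (exp := 1) t3 * t4 * e2 * t2 * e0 * e1 * key +
    e0 * e1 * x6 * x7 * x8 * R1 * R2 * R3 * w1 * w2 * pN +
    e0 * t0 * e1 * t1 * R1 * R2 * R3 * w1 * w2 * (x7 * e1 * x8 * pa +
      g3 * g4 * x1 * x2 * x8 * pl + g3 * g4 * x1 * x2 * g5 * g6 * py)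

/-- The pentagon relation for the `q`-Racah functions. -/
theorem racah_pentagon (h : Gen5 (r ^ 2) (s₁ ^ 2) (s₂ ^ 2) (s₄ ^ 2) (s₀ ^ 2) (s₃ ^ 2) N)
    (hcon : r ^ (2 * N + 3) * s₀ * s₁ * s₂ * s₃ * s₄ = 1) {a b l y : ℕ} (ha : a + y ≤ N)
    (hb : b + l ≤ N) :
    ∑ x ∈ range (N + 1), (s₁ / s₀) ^ x * xi r x s₂ s₄ * racah r a x s₄ s₂ s₁ (N - y) *
        racah r y b s₁ s₃ s₀ (N - x) * racah r x l s₀ s₄ s₂ (N - b) =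
      (s₁ / s₄) ^ y / xi r y s₀ s₃ * (xi r a s₂ s₁ * (s₄ / s₃) ^ a) *
        (xi r l s₀ s₄ * (s₃ / s₂) ^ l) * (xi r b s₁ s₃ * (s₂ / s₀) ^ b) *
        racah r y l s₄ s₀ s₃ (N - a) * racah r a b s₃ s₁ s₂ (N - l) := by
  rw [sum_congr rfl fun x hx => racah_pentagon_term h hcon ha hb
    (Nat.lt_succ_iff.1 (mem_range.1 hx)), ← mul_sum, ← pentS, pentagon h ha hb, pentT, pentU]
  split_ifs with hl
  · have e1 := pentKb_mul_pentWy h hcon (b := b) (by omega)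
    have e2 := pentagon_factor h hcon ha hl
    rw [racah_eq h.gen3₃₄₅ (by omega) (by omega), racah_eq h.gen3₂₁₅.symm (by omega) (by omega)]
    linear_combination (exp := 1)
      racahPhi (r ^ 2) y l (s₄ ^ 2) (s₀ ^ 2) (s₃ ^ 2) (N - a) *
        racahPhi (r ^ 2) a b (s₃ ^ 2) (s₁ ^ 2) (s₂ ^ 2) (N - l) *
        (xi r b s₁ s₃ * (s₂ / s₀) ^ b * e2 + (r * s₂) ^ (N - y) * (r * s₃) ^ N *
        racahWeight (r ^ 2) (s₁ ^ 2) (s₂ ^ 2) (s₄ ^ 2) a (N - y - a) *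
        pentKy (r ^ 2) (s₂ ^ 2 * s₄ ^ 2) (s₀ ^ 2) (s₃ ^ 2) N y *
        pentWa (r ^ 2) (s₁ ^ 2) (s₂ ^ 2) (s₄ ^ 2) (s₀ ^ 2) (s₃ ^ 2) N a l (N - a - l) *
        pentWy (r ^ 2) ((r ^ 2) ^ (N + 1) * s₁ ^ 2 * s₀ ^ 2) (s₀ ^ 2) (s₃ ^ 2) y (N - y) * e1)
  -- For a + l > N the product side is zero by definition of `pentU`, and here because l exceeds the
  -- size N - a.
  · rw [racah_eq_zero_right r s₄ s₀ s₃ y (by omega)]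
    ring

end

/-! ### The Griffiths sum for generic parameters -/

section

variable {r s₀ s₁ s₂ s₃ s₄ : ℂ} {N : ℕ}

theorem xi_mul_xi {s t : ℂ} {n : ℕ} (hs : s ≠ 0) (ht : t ≠ 0)
    (h : qPoch (r ^ 2 * s ^ 2) (r ^ 2) n ≠ 0) (h' : qPoch (r ^ 2 * t ^ 2) (r ^ 2) n ≠ 0) :
    xi r n s t * xi r n t s = 1 := by
  rw [xi, xi, mul_mul_mul_comm, div_mul_div_cancel₀ h', div_self h, ← mul_pow, one_mul,
    div_mul_div_cancel₀ hs, div_self ht, one_pow]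

theorem xi_ne_zero {s t : ℂ} {n : ℕ} (hs : s ≠ 0) (ht : t ≠ 0)
    (h : qPoch (r ^ 2 * s ^ 2) (r ^ 2) n ≠ 0) (h' : qPoch (r ^ 2 * t ^ 2) (r ^ 2) n ≠ 0) :
    xi r n s t ≠ 0 :=
  left_ne_zero_of_mul_eq_one (xi_mul_xi hs ht h h')

theorem omega_mul_pow (r s t : ℂ) (n : ℕ) : omega r n s * t ^ n = omega r n (s * t) := by
  rw [omega, omega, mul_pow s t]
  ring

theorem omega_ne_zero {s : ℂ} (hr : r ≠ 0) (hs : s ≠ 0) (n : ℕ) : omega r n s ≠ 0 :=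
  mul_ne_zero (mul_ne_zero (pow_ne_zero _ (by norm_num)) (pow_ne_zero _ hs))
    (pow_ne_zero _ (pow_ne_zero _ hr))

theorem two_mul_choose_succ_two (n : ℕ) : 2 * (n + 1).choose 2 = n * (n + 1) := by
  induction n with
  | zero => rfl
  | succ n ih =>
    rw [choose_succ_two, mul_add, ih]
    ring

/-- The quadratic exponents of q combine because C(j+m+1,2) + C(j+1,2) = C(m+1,2) + (j+m+1)j. At the
end this converts ω_{N-j} times a j-th power into ω_N ω_j. -/
theorem omega_add_mul_omega (r u v : ℂ) (j m : ℕ) :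
    omega r (j + m) u * omega r j v = omega r m u * ((r ^ 2) ^ (j + m + 1) * u * v) ^ j := by
  have e : (j + m + 1).choose 2 + (j + 1).choose 2 = (m + 1).choose 2 + (j + m + 1) * j := by
    have := two_mul_choose_succ_two (j + m)
    have := two_mul_choose_succ_two j
    have := two_mul_choose_succ_two m
    nlinarith
  have h1 : (-1 : ℂ) ^ j * (-1) ^ j = 1 := by rw [← mul_pow]; simp
  rw [omega, omega, omega, mul_pow, mul_pow, ← pow_mul (r ^ 2)]
  have e' : (r ^ 2) ^ (j + m + 1).choose 2 * (r ^ 2) ^ (j + 1).choose 2 =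
    (r ^ 2) ^ (m + 1).choose 2 * (r ^ 2) ^ ((j + m + 1) * j) := by rw [← pow_add, ← pow_add, e]
  rw [pow_add (-1 : ℂ), pow_add u]
  linear_combination (exp := 1) (-1) ^ m * u ^ j * u ^ m * v ^ j * ((-1) ^ j * (-1) ^ j * e' +
    (r ^ 2) ^ (m + 1).choose 2 * (r ^ 2) ^ ((j + m + 1) * j) * h1)

/-- Summands beyond the stated bound vanish, so a range independent of the indices can be used. The
later exchange of summations relies on this. -/
theorem griffiths_eq (r : ℂ) (i j x y : ℕ) (s₁ s₂ s₃ s₄ : ℂ) (N : ℕ) :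
    griffiths r i j x y s₁ s₂ s₃ s₄ N =
      ∑ a ∈ range (N + 1), omega r a (s₁ * s₂ * s₃ / s₄) * racah r i a s₁ s₂ s₃ (N - j) *
        racah r j y s₃ (fifthRoot r s₁ s₂ s₃ s₄ N) s₄ (N - a) * racah r a x s₄ s₂ s₁ (N - y) := by
  rw [griffiths]
  refine (sum_range_of_support (by omega) fun a ha => ?_).symm
  rcases min_lt_iff.1 ha with h | h
  · rw [racah_eq_zero_right _ _ _ _ _ h]
    ring
  · rw [racah_eq_zero_left _ _ _ _ _ h]
    ring

theorem griffiths_eq_zero (r : ℂ) {i j : ℕ} (x y : ℕ) (s₁ s₂ s₃ s₄ : ℂ) {N : ℕ} (h : N - j < i) :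
    griffiths r i j x y s₁ s₂ s₃ s₄ N = 0 :=
  sum_eq_zero fun a _ => by
    rw [racah_eq_zero_left _ _ _ _ _ h]
    ring

theorem Gen5.gen3₁₂₅ (h : Gen5 (r ^ 2) (s₁ ^ 2) (s₂ ^ 2) (s₄ ^ 2) (s₀ ^ 2) (s₃ ^ 2) N)
    (h23 : Nz (r ^ 2) (s₂ ^ 2 * s₃ ^ 2)) : Gen3 (r ^ 2) (s₁ ^ 2) (s₂ ^ 2) (s₃ ^ 2) :=
  ⟨h.nr, h.n1, h.n2, h.n5, h.n12, h23, by
    have := h.gen3₂₁₅.n123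
    rwa [mul_comm (s₂ ^ 2)] at this⟩

theorem Gen3.swap₁₂ {q b₁ b₂ b₃ : ℂ} (h : Gen3 q b₁ b₂ b₃) (h13 : Nz q (b₁ * b₃)) :
    Gen3 q b₂ b₁ b₃ :=
  ⟨h.nr, h.n2, h.n1, h.n3, by simpa [mul_comm] using h.n12, h13, by
    have := h.n123
    rwa [mul_comm b₁] at this⟩

/-- The sum over x is the pentagon relation. Its powers of s₄/s₃ and s₂/s₀ change the arguments of
ω_a and ω_b into s₁s₂ and s₁s₃, which is the form required by the Racah relation. Out-of-range
indices make a factor vanish on each side. -/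
theorem griffiths_sum_inner (h : Gen5 (r ^ 2) (s₁ ^ 2) (s₂ ^ 2) (s₄ ^ 2) (s₀ ^ 2) (s₃ ^ 2) N)
    (hcon : r ^ (2 * N + 3) * s₀ * s₁ * s₂ * s₃ * s₄ = 1) (i j k : ℕ)
    {l : ℕ} (hl : l ≤ N) (a b y : ℕ) :
    ∑ x ∈ range (N + 1), (s₁ / s₀) ^ x * (s₄ / s₁) ^ y * xi r x s₂ s₄ * xi r y s₀ s₃ *
        (omega r a (s₁ * s₂ * s₃ / s₄) * racah r i a s₁ s₂ s₃ (N - j) *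
          racah r j y s₃ s₀ s₄ (N - a) * racah r a x s₄ s₂ s₁ (N - y)) *
        (omega r b (s₁ * s₃ * s₀ / s₂) * racah r y b s₁ s₃ s₀ (N - x) *
          racah r x l s₀ s₄ s₂ (N - b) * racah r b k s₂ s₃ s₁ (N - l)) =
      xi r l s₀ s₄ * (s₃ / s₂) ^ l * (omega r b (s₁ * s₃) * xi r b s₁ s₃) *
        racah r b k s₂ s₃ s₁ (N - l) *
        (omega r a (s₁ * s₂) * xi r a s₂ s₁ * racah r i a s₁ s₂ s₃ (N - j) *
          racah r a b s₃ s₁ s₂ (N - l)) *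
        (racah r j y s₃ s₀ s₄ (N - a) * racah r y l s₄ s₀ s₃ (N - a)) := by
  by_cases ha : N - a < y
  · rw [racah_eq_zero_right r s₃ s₀ s₄ j ha]
    simp
  by_cases hb : N - l < b
  · rw [racah_eq_zero_left r s₂ s₃ s₁ k hb]
    simp
  by_cases ha' : N < a
  · rw [racah_eq_zero_right r s₁ s₂ s₃ i (show N - j < a by omega)]
    simp
  have hq := h.nr.1
  have hr : r ≠ 0 := fun e => h.nr.1 (by simp [e])
  have h0 : s₀ ≠ 0 := fun e => h.n4.1 (by simp [e])
  have h1 : s₁ ≠ 0 := fun e => h.n1.1 (by simp [e])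
  have h2 : s₂ ≠ 0 := fun e => h.n2.1 (by simp [e])
  have h3 : s₃ ≠ 0 := fun e => h.n5.1 (by simp [e])
  have h4 : s₄ ≠ 0 := fun e => h.n3.1 (by simp [e])
  have e := racah_pentagon h hcon (a := a) (b := b) (l := l) (y := y) (by omega) (by omega)
  have ea := omega_mul_pow r (s₁ * s₂ * s₃ / s₄) (s₄ / s₃) a
  have eb := omega_mul_pow r (s₁ * s₃ * s₀ / s₂) (s₂ / s₀) b
  rw [show s₁ * s₂ * s₃ / s₄ * (s₄ / s₃) = s₁ * s₂ by field_simp] at ea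
  rw [show s₁ * s₃ * s₀ / s₂ * (s₂ / s₀) = s₁ * s₃ by field_simp] at eb
  have ey : (s₄ / s₁) ^ y * xi r y s₀ s₃ * ((s₁ / s₄) ^ y / xi r y s₀ s₃) = 1 := by
    have := xi_ne_zero (r := r) h0 h3 ((h.n4.mul_left hq).qPoch_ne_zero y)
      ((h.n5.mul_left hq).qPoch_ne_zero y)
    rw [← mul_div_assoc, div_eq_one_iff_eq this, mul_right_comm, ← mul_pow,
      div_mul_div_cancel₀ h1, div_self h4, one_pow, one_mul]
  rw [← ea, ← eb]
  rw [sum_congr rfl fun x _ => show _ = (s₄ / s₁) ^ y * xi r y s₀ s₃ *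
    (omega r a (s₁ * s₂ * s₃ / s₄) * racah r i a s₁ s₂ s₃ (N - j) *
      racah r j y s₃ s₀ s₄ (N - a)) *
    (omega r b (s₁ * s₃ * s₀ / s₂) * racah r b k s₂ s₃ s₁ (N - l)) *
    ((s₁ / s₀) ^ x * xi r x s₂ s₄ * racah r a x s₄ s₂ s₁ (N - y) *
        racah r y b s₁ s₃ s₀ (N - x) * racah r x l s₀ s₄ s₂ (N - b)) by ring, ← mul_sum, e]
  generalize (s₁ / s₄) ^ y / xi r y s₀ s₃ = w at *
  generalize (s₄ / s₁) ^ y * xi r y s₀ s₃ = w' at *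
  linear_combination (exp := 1) (omega r a (s₁ * s₂ * s₃ / s₄) * racah r i a s₁ s₂ s₃ (N - j) *
      racah r j y s₃ s₀ s₄ (N - a)) *
    (omega r b (s₁ * s₃ * s₀ / s₂) * racah r b k s₂ s₃ s₁ (N - l)) *
    (xi r a s₂ s₁ * (s₄ / s₃) ^ a) *
        (xi r l s₀ s₄ * (s₃ / s₂) ^ l) * (xi r b s₁ s₃ * (s₂ / s₀) ^ b) *
        racah r y l s₄ s₀ s₃ (N - a) * racah r a b s₃ s₁ s₂ (N - l) * ey

/-- Orthogonality in y gives a delta independent of a, whereupon the sum over a is the Racah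
relation. The factors ω_b and ξ_b left by the two relations cancel. -/
theorem griffiths_sum_middle (h : Gen5 (r ^ 2) (s₁ ^ 2) (s₂ ^ 2) (s₄ ^ 2) (s₀ ^ 2) (s₃ ^ 2) N)
    (h23 : Nz (r ^ 2) (s₂ ^ 2 * s₃ ^ 2)) {i j : ℕ} (hij : i + j ≤ N) (k : ℕ)
    {l : ℕ} (hl : l ≤ N) (b : ℕ) :
    ∑ a ∈ range (N + 1), ∑ y ∈ range (N + 1),
        xi r l s₀ s₄ * (s₃ / s₂) ^ l * (omega r b (s₁ * s₃) * xi r b s₁ s₃) *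
        racah r b k s₂ s₃ s₁ (N - l) *
        (omega r a (s₁ * s₂) * xi r a s₂ s₁ * racah r i a s₁ s₂ s₃ (N - j) *
          racah r a b s₃ s₁ s₂ (N - l)) *
        (racah r j y s₃ s₀ s₄ (N - a) * racah r y l s₄ s₀ s₃ (N - a)) =
      (if j = l then 1 else 0) * (xi r l s₀ s₄ * (s₃ / s₂) ^ l) *
        omega r (N - j) (r * s₁ * s₂ * s₃) * (xi r i s₂ s₃ / omega r i (s₂ * s₃)) *
        (racah r i b s₁ s₃ s₂ (N - j) * racah r b k s₂ s₃ s₁ (N - l)) := by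
  have hq := h.nr.1
  have hr : r ≠ 0 := fun e => h.nr.1 (by simp [e])
  have h1 : s₁ ≠ 0 := fun e => h.n1.1 (by simp [e])
  have h3 : s₃ ≠ 0 := fun e => h.n5.1 (by simp [e])
  by_cases hb : N - l < b
  · rw [racah_eq_zero_left r s₂ s₃ s₁ k hb]
    simp
  have e : ∀ a ∈ range (N + 1), ∑ y ∈ range (N + 1),
        xi r l s₀ s₄ * (s₃ / s₂) ^ l * (omega r b (s₁ * s₃) * xi r b s₁ s₃) *
        racah r b k s₂ s₃ s₁ (N - l) *
        (omega r a (s₁ * s₂) * xi r a s₂ s₁ * racah r i a s₁ s₂ s₃ (N - j) *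
          racah r a b s₃ s₁ s₂ (N - l)) *
        (racah r j y s₃ s₀ s₄ (N - a) * racah r y l s₄ s₀ s₃ (N - a)) =
      (if j = l then 1 else 0) * (xi r l s₀ s₄ * (s₃ / s₂) ^ l *
        (omega r b (s₁ * s₃) * xi r b s₁ s₃) * racah r b k s₂ s₃ s₁ (N - l)) *
        (omega r a (s₁ * s₂) * xi r a s₂ s₁ * racah r i a s₁ s₂ s₃ (N - j) *
          racah r a b s₃ s₁ s₂ (N - l)) := fun a ha => by
    have ha := mem_range.1 ha
    rw [← mul_sum]
    by_cases h5 : N - j < a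
    · rw [racah_eq_zero_right r s₁ s₂ s₃ i h5]
      ring
    by_cases h6 : N - l < a
    · rw [racah_eq_zero_left r s₃ s₁ s₂ b h6]
      ring
    rw [sum_racah_mul_racah h.gen3₃₄₅.symm (by omega) (by omega) (by omega)]
    ring
  rw [sum_congr rfl e, ← mul_sum]
  split_ifs with hjl
  · subst hjl
    have g := h.gen3₁₂₅ h23
    have h13 : Nz (r ^ 2) (s₁ ^ 2 * s₃ ^ 2) := by simpa [mul_comm] using h.n51
    have g' := g.swap₁₂ h13
    have ex := xi_mul_xi (r := r) h1 h3 ((h.n1.mul_left hq).qPoch_ne_zero b)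
      ((h.n5.mul_left hq).qPoch_ne_zero b)
    have eo := div_self (omega_ne_zero hr (mul_ne_zero h1 h3) b)
    rw [sum_omega_mul_racah_mul_racah g g' (g'.symm.swap₁₂ (by simpa [mul_comm] using h23))
      (Nat.sub_le N j) (by omega) (by omega)]
    linear_combination (exp := 1) xi r j s₀ s₄ * (s₃ / s₂) ^ j *
        omega r (N - j) (r * s₁ * s₂ * s₃) * (xi r i s₂ s₃ / omega r i (s₂ * s₃)) *
        (racah r i b s₁ s₃ s₂ (N - j) * racah r b k s₂ s₃ s₁ (N - j)) *
        (xi r b s₁ s₃ * xi r b s₃ s₁ * eo + ex)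
  · ring

theorem sum_reorder (s : Finset ℕ) (f : ℕ → ℕ → ℕ → ℕ → ℂ) :
    ∑ x ∈ s, ∑ y ∈ s, ∑ b ∈ s, ∑ a ∈ s, f x y b a =
      ∑ b ∈ s, ∑ a ∈ s, ∑ y ∈ s, ∑ x ∈ s, f x y b a := by
  have e : ∀ g : ℕ → ℕ → ℕ → ℂ, ∑ x ∈ s, ∑ b ∈ s, ∑ a ∈ s, g x b a =
      ∑ b ∈ s, ∑ a ∈ s, ∑ x ∈ s, g x b a := fun g => by
    rw [sum_comm]
    exact sum_congr rfl fun b _ => sum_comm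
  rw [sum_comm, sum_congr rfl fun y _ => e _, e]

theorem griffiths_sum_generic (h : Gen5 (r ^ 2) (s₁ ^ 2) (s₂ ^ 2) (s₄ ^ 2) (s₀ ^ 2) (s₃ ^ 2) N)
    (h23 : Nz (r ^ 2) (s₂ ^ 2 * s₃ ^ 2)) (hcon : r ^ (2 * N + 3) * s₀ * s₁ * s₂ * s₃ * s₄ = 1)
    {i j k l : ℕ} (hij : i + j ≤ N) (hkl : k + l ≤ N) :
    ∑ x ∈ range (N + 1), ∑ y ∈ range (N - x + 1),
        (s₁ / s₀) ^ x * (s₄ / s₁) ^ y * xi r x s₂ s₄ * xi r y s₀ s₃ *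
          griffiths r i j x y s₁ s₂ s₃ s₄ N * griffiths r y x k l s₁ s₃ s₀ s₂ N =
      (if i = k then 1 else 0) * (if j = l then 1 else 0) *
        omega r N (r * s₁ * s₂ * s₃) *
        (omega r j (s₃ * s₀ * s₄ / s₂) / omega r i (s₂ * s₃)) *
        xi r i s₂ s₃ * xi r j s₀ s₄ := by
  have h2 : s₂ ≠ 0 := fun e => h.n2.1 (by simp [e])
  have g := h.gen3₁₂₅ h23
  have g' := g.swap₁₂ (by simpa [mul_comm] using h.n51)
  have f1 : fifthRoot r s₁ s₂ s₃ s₄ N = s₀ :=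
    inv_eq_of_mul_eq_one_right (by rw [← hcon]; ring)
  have f2 : fifthRoot r s₁ s₃ s₀ s₂ N = s₄ :=
    inv_eq_of_mul_eq_one_right (by rw [← hcon]; ring)
  have e1 : ∀ x ∈ range (N + 1), ∑ y ∈ range (N - x + 1),
        (s₁ / s₀) ^ x * (s₄ / s₁) ^ y * xi r x s₂ s₄ * xi r y s₀ s₃ *
          griffiths r i j x y s₁ s₂ s₃ s₄ N * griffiths r y x k l s₁ s₃ s₀ s₂ N =
      ∑ y ∈ range (N + 1), (∑ b ∈ range (N + 1), ∑ a ∈ range (N + 1),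
        (s₁ / s₀) ^ x * (s₄ / s₁) ^ y * xi r x s₂ s₄ * xi r y s₀ s₃ *
        (omega r a (s₁ * s₂ * s₃ / s₄) * racah r i a s₁ s₂ s₃ (N - j) *
          racah r j y s₃ s₀ s₄ (N - a) * racah r a x s₄ s₂ s₁ (N - y)) *
        (omega r b (s₁ * s₃ * s₀ / s₂) * racah r y b s₁ s₃ s₀ (N - x) *
          racah r x l s₀ s₄ s₂ (N - b) * racah r b k s₂ s₃ s₁ (N - l))) := fun x hx => by
    -- The triangle x + y ≤ N is enlarged to a square, because the second Griffiths function has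
    -- degree index y and vanishes for y > N - x.
    rw [← sum_range_of_support (Nat.sub_le N x) fun y hy => by
      rw [griffiths_eq_zero r (i := y) k l s₁ s₃ s₀ s₂ hy, mul_zero]]
    refine sum_congr rfl fun y _ => ?_
    rw [griffiths_eq, griffiths_eq, f1, f2, mul_sum, mul_sum]
    refine sum_congr rfl fun b _ => ?_
    rw [← sum_mul]
  rw [sum_congr rfl e1, sum_reorder]
  rw [sum_congr rfl fun b _ => (sum_congr rfl fun a _ => sum_congr rfl fun y _ =>
    griffiths_sum_inner h hcon i j k (by omega) a b y).trans
      (griffiths_sum_middle h h23 hij k (by omega) b)]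
  rw [← mul_sum]
  by_cases hjl : j = l
  · subst hjl
    rw [sum_racah_mul_racah (g'.symm.swap₁₂ (by simpa [mul_comm] using h23))
      (Nat.sub_le N j) (by omega) (by omega)]
    -- With both deltas present, only the constant remains. The constraint reduces the base of the
    -- j-th power in `omega_add_mul_omega` to s₃/s₂.
    obtain ⟨m, rfl⟩ := Nat.exists_eq_add_of_le (show j ≤ N by omega)
    have e := omega_add_mul_omega r (r * s₁ * s₂ * s₃) (s₃ * s₀ * s₄ / s₂) j m
    have e' : (r ^ 2) ^ (j + m + 1) * (r * s₁ * s₂ * s₃) * (s₃ * s₀ * s₄ / s₂) = s₃ / s₂ := by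
      field_simp
      linear_combination s₃ * hcon
    rw [e'] at e
    rw [if_pos rfl, show j + m - j = m by omega]
    rw [div_eq_mul_inv, div_eq_mul_inv]
    linear_combination (exp := 1) -((if i = k then 1 else 0) * xi r i s₂ s₃ * xi r j s₀ s₄ *
      (omega r i (s₂ * s₃))⁻¹) * e
  · rw [if_neg hjl]
    ring

end

/-! ### Continuity at admissible parameters -/

section

/-- The conditions under which a `q`-Racah function is continuous in its parameters. -/
structure Adm3 (q b₁ b₂ b₃ : ℂ) (K : ℕ) : Prop where
  q0 : q ≠ 0
  b0 : b₂ ≠ 0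
  hq : ∀ m, 1 ≤ m → m ≤ K → 1 - q ^ m ≠ 0
  n2 : ∀ m, 1 ≤ m → m ≤ K → 1 - b₂ * q ^ m ≠ 0
  n3 : ∀ m, 1 ≤ m → m ≤ K → 1 - b₃ * q ^ m ≠ 0
  n23 : ∀ m, 2 ≤ m → m ≤ 2 * K → 1 - b₂ * b₃ * q ^ m ≠ 0
  n123 : ∀ m, 3 ≤ m → m ≤ 2 * K + 1 → 1 - b₁ * b₂ * b₃ * q ^ m ≠ 0

theorem Adm3.mono {q b₁ b₂ b₃ : ℂ} {K M : ℕ} (h : Adm3 q b₁ b₂ b₃ M) (hK : K ≤ M) :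
    Adm3 q b₁ b₂ b₃ K :=
  ⟨h.q0, h.b0, fun m h1 h2 => h.hq m h1 (by omega), fun m h1 h2 => h.n2 m h1 (by omega),
    fun m h1 h2 => h.n3 m h1 (by omega), fun m h1 h2 => h.n23 m h1 (by omega),
    fun m h1 h2 => h.n123 m h1 (by omega)⟩

variable {z : ℂ}

@[fun_prop]
theorem continuousAt_qPoch {a q : ℂ → ℂ} (ha : ContinuousAt a z) (hq : ContinuousAt q z) (n : ℕ) :
    ContinuousAt (fun w => qPoch (a w) (q w) n) z := by
  unfold qPoch
  fun_prop

theorem continuousAt_phi43 {q b₁ b₂ b₃ : ℂ → ℂ} (hq : ContinuousAt q z) (h1 : ContinuousAt b₁ z)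
    (h2 : ContinuousAt b₂ z) (h3 : ContinuousAt b₃ z) {n K : ℕ} (hn : n ≤ K) (x : ℕ)
    (h : Adm3 (q z) (b₁ z) (b₂ z) (b₃ z) K) :
    ContinuousAt (fun w => phi43 (q w) n (b₂ w * b₃ w * q w ^ (n + 1)) (q w ^ (-(x : ℤ)))
      (b₁ w * b₂ w * q w ^ (x + 1)) (q w * b₂ w) (b₁ w * b₂ w * b₃ w * q w ^ (K + 2))
      (q w ^ (-(K : ℤ)))) z := by
  have hz : ∀ m : ℤ, ContinuousAt (fun w => q w ^ m) z := fun m => hq.zpow₀ m (Or.inl h.q0)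
  have hx := hz (-(x : ℤ))
  have hK := hz (-(K : ℤ))
  have hn' := hz (-(n : ℤ))
  unfold phi43
  refine tendsto_finsetSum _ fun k hk => ?_
  have hk := Nat.lt_succ_iff.1 (mem_range.1 hk)
  refine ContinuousAt.mul (ContinuousAt.div (by fun_prop) (by fun_prop) ?_)
    (ContinuousAt.div (by fun_prop) (by fun_prop) ?_)
  · refine mul_ne_zero (mul_ne_zero ?_ ?_) ?_
    · refine qPoch_ne_zero fun l hl => ?_
      have := h.n2 (l + 1) (by omega) (by omega)
      rwa [pow_succ', mul_left_comm, ← mul_assoc] at this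
    · refine qPoch_ne_zero fun l hl => ?_
      have := h.n123 (K + 2 + l) (by omega) (by omega)
      rwa [pow_add, ← mul_assoc] at this
    · refine qPoch_ne_zero fun l hl e => h.hq (K - l) (by omega) (by omega) ?_
      rw [zpow_neg, zpow_natCast] at e
      have hl' : q z ^ K = q z ^ (K - l) * q z ^ l := by rw [← pow_add]; congr 1; omega
      have := pow_ne_zero K h.q0
      have h6 := pow_ne_zero l h.q0
      rw [sub_eq_zero, eq_comm, inv_mul_eq_iff_eq_mul₀ this, mul_one, hl'] at e
      rw [sub_eq_zero]
      exact mul_right_cancel₀ h6 (by rw [one_mul]; exact e)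
  · refine qPoch_ne_zero fun l hl => ?_
    have := h.hq (l + 1) (by omega) (by omega)
    rwa [pow_succ'] at this

theorem continuousAt_racah {r s₁ s₂ s₃ : ℂ → ℂ} (hr : ContinuousAt r z) (h1 : ContinuousAt s₁ z)
    (h2 : ContinuousAt s₂ z) (h3 : ContinuousAt s₃ z) (n x : ℕ) {K : ℕ}
    (h : Adm3 (r z ^ 2) (s₁ z ^ 2) (s₂ z ^ 2) (s₃ z ^ 2) K) :
    ContinuousAt (fun w => racah (r w) n x (s₁ w) (s₂ w) (s₃ w) K) z := by
  unfold racah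
  dsimp only
  split_ifs with hnx
  · refine ContinuousAt.mul ?_ (continuousAt_phi43 (q := fun w => r w ^ 2)
      (b₁ := fun w => s₁ w ^ 2) (b₂ := fun w => s₂ w ^ 2) (b₃ := fun w => s₃ w ^ 2)
      (by fun_prop) (by fun_prop) (by fun_prop) (by fun_prop) hnx.1 x h)
    have hr0 : r z ≠ 0 := fun e => h.q0 (by simp [e])
    have hs0 : s₂ z ≠ 0 := fun e => h.b0 (by simp [e])
    have hq : ∀ k ≤ K, qPoch (r z ^ 2) (r z ^ 2) k ≠ 0 := fun k hk => by
      refine qPoch_ne_zero fun l hl => ?_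
      have := h.hq (l + 1) (by omega) (by omega)
      rwa [pow_succ'] at this
    have hpow : ContinuousAt (fun w => (r w * s₂ w) ^ (2 * (n : ℤ) - K)) z :=
      (hr.mul h2).zpow₀ _ (Or.inl (mul_ne_zero hr0 hs0))
    unfold Omega qBinom reducedPoch
    dsimp only
    simp only [if_pos hnx.1]
    refine ContinuousAt.div (ContinuousAt.mul (ContinuousAt.div (by fun_prop) (by fun_prop)
      (mul_ne_zero (hq _ hnx.1) (hq _ (by omega)))) (by fun_prop)) (by fun_prop) ?_
    refine mul_ne_zero (mul_ne_zero (zpow_ne_zero _ (mul_ne_zero hr0 hs0)) ?_) ?_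
    -- The exponents n + 1 + l could take the values 1 and 2K + 1 only at the removed index l = n.
    -- The others lie between 2 and 2K, exactly where the hypothesis applies.
    · refine prod_ne_zero_iff.2 fun l hl => ?_
      have hl := mem_erase.1 hl
      have hl' := mem_range.1 hl.2
      have hl1 := hl.1
      rw [mul_assoc, ← pow_add]
      exact h.n23 _ (by omega) (by omega)
    · refine qPoch_ne_zero fun l hl => ?_
      have := h.n3 (l + 1) (by omega) (by omega)
      convert this using 2
      ring
  · exact continuousAt_const

theorem continuousAt_omega {r s : ℂ → ℂ} (hr : ContinuousAt r z) (hs : ContinuousAt s z) (n : ℕ) :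
    ContinuousAt (fun w => omega (r w) n (s w)) z := by
  unfold omega
  fun_prop

theorem continuousAt_xi {r s t : ℂ → ℂ} (hr : ContinuousAt r z) (hs : ContinuousAt s z)
    (ht : ContinuousAt t z) {n N : ℕ} (hn : n ≤ N) (h0 : s z ≠ 0)
    (h : ∀ m, 1 ≤ m → m ≤ N → 1 - t z ^ 2 * (r z ^ 2) ^ m ≠ 0) :
    ContinuousAt (fun w => xi (r w) n (s w) (t w)) z := by
  unfold xi
  refine ContinuousAt.mul (ContinuousAt.div (by fun_prop) (by fun_prop)
    (qPoch_ne_zero fun l hl => ?_)) ((ht.div hs h0).pow n)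
  have := h (l + 1) (by omega) (by omega)
  convert this using 2
  ring

theorem one_sub_mul_pow_ne_zero {q c : ℂ} {m : ℕ} (h : c ≠ q ^ (-(m : ℤ))) :
    1 - c * q ^ m ≠ 0 := fun e => h (by
  rw [zpow_neg, zpow_natCast]
  exact eq_inv_of_mul_eq_one_left (sub_eq_zero.1 e).symm)

section

variable {q c₀ c₁ c₂ c₃ c₄ : ℂ} {N : ℕ}

theorem Admissible.one_sub_q (h : Admissible q c₀ c₁ c₂ c₃ c₄ N) (m : ℕ) (h1 : 1 ≤ m) (h2 : m ≤ N) :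
    1 - q ^ m ≠ 0 := fun e =>
  h.q_pow_ne_one m (mem_Icc.2 ⟨h1, h2⟩) (sub_eq_zero.1 e).symm

theorem Admissible.one_sub (h : Admissible q c₀ c₁ c₂ c₃ c₄ N) {c : ℂ}
    (hc : c ∈ ({c₀, c₁, c₂, c₃, c₄} : Set ℂ)) (m : ℕ) (h1 : 1 ≤ m) (h2 : m ≤ N) :
    1 - c * q ^ m ≠ 0 :=
  one_sub_mul_pow_ne_zero (h.c_ne c hc m (mem_Icc.2 ⟨h1, h2⟩))

theorem Admissible.adm3 (h : Admissible q c₀ c₁ c₂ c₃ c₄ N) {b₁ b₂ b₃ : ℂ}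
    (h2 : b₂ ∈ ({c₀, c₁, c₂, c₃, c₄} : Set ℂ)) (h3 : b₃ ∈ ({c₀, c₁, c₂, c₃, c₄} : Set ℂ))
    (h23 : b₂ * b₃ ∈ ({c₁ * c₂, c₂ * c₃, c₀ * c₃, c₀ * c₄, c₂ * c₄,
      q * c₁ * c₂ * c₃, q * c₀ * c₃ * c₄, q * c₁ * c₂ * c₄} : Set ℂ))
    (h123 : q * (b₁ * b₂ * b₃) ∈ ({c₁ * c₂, c₂ * c₃, c₀ * c₃, c₀ * c₄, c₂ * c₄,
      q * c₁ * c₂ * c₃, q * c₀ * c₃ * c₄, q * c₁ * c₂ * c₄} : Set ℂ)) {K : ℕ} (hK : K ≤ N) :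
    Adm3 q b₁ b₂ b₃ K :=
  Adm3.mono ⟨h.q_ne_zero, h.c_ne_zero _ h2, h.one_sub_q, h.one_sub h2, h.one_sub h3,
    fun m hm hm' => one_sub_mul_pow_ne_zero (h.prod_ne _ h23 m (mem_Icc.2 ⟨hm, hm'⟩)),
    fun m hm hm' => by
      -- The admissibility condition is stated for q times the triple product, so the exponent is
      -- lowered by one.
      obtain ⟨m, rfl⟩ := Nat.exists_eq_add_of_le' (show 1 ≤ m by omega)
      have := one_sub_mul_pow_ne_zero
        (h.prod_ne _ h123 m (mem_Icc.2 ⟨by omega, by omega⟩))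
      rwa [pow_succ', mul_left_comm, ← mul_assoc]⟩ hK

end

theorem continuousAt_griffiths {r s₁ s₂ s₃ s₄ : ℂ → ℂ} {N : ℕ} (hr : ContinuousAt r z)
    (h1 : ContinuousAt s₁ z) (h2 : ContinuousAt s₂ z) (h3 : ContinuousAt s₃ z)
    (h4 : ContinuousAt s₄ z)
    (h : Admissible (r z ^ 2) (fifthRoot (r z) (s₁ z) (s₂ z) (s₃ z) (s₄ z) N ^ 2) (s₁ z ^ 2)
      (s₂ z ^ 2) (s₃ z ^ 2) (s₄ z ^ 2) N) (i j x y : ℕ) :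
    ContinuousAt (fun w => griffiths (r w) i j x y (s₁ w) (s₂ w) (s₃ w) (s₄ w) N) z := by
  have hr0 : r z ≠ 0 := fun e => h.q_ne_zero (by simp [e])
  have n1 : s₁ z ≠ 0 := fun e => h.c_ne_zero (s₁ z ^ 2) (by simp) (by simp [e])
  have n2 : s₂ z ≠ 0 := fun e => h.c_ne_zero (s₂ z ^ 2) (by simp) (by simp [e])
  have n3 : s₃ z ≠ 0 := fun e => h.c_ne_zero (s₃ z ^ 2) (by simp) (by simp [e])
  have n4 : s₄ z ≠ 0 := fun e => h.c_ne_zero (s₄ z ^ 2) (by simp) (by simp [e])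
  have h0 : ContinuousAt (fun w => fifthRoot (r w) (s₁ w) (s₂ w) (s₃ w) (s₄ w) N) z := by
    unfold fifthRoot
    refine ContinuousAt.inv₀ (by fun_prop) ?_
    simp [hr0, n1, n2, n3, n4]
  unfold griffiths
  refine tendsto_finsetSum _ fun a _ => ?_
  refine (((continuousAt_omega hr (((h1.mul h2).mul h3).div h4 n4) a).mul
    (continuousAt_racah hr h1 h2 h3 i a (h.adm3 (by simp) (by simp) (by simp) ?_
      (Nat.sub_le _ _)))).mul
    (continuousAt_racah hr h3 h0 h4 j y (h.adm3 (by simp) (by simp) (by simp) ?_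
      (Nat.sub_le _ _)))).mul
    (continuousAt_racah hr h4 h2 h1 a x (h.adm3 (by simp) (by simp) (by simp [mul_comm]) ?_
      (Nat.sub_le _ _)))
  · simp [mul_assoc]
  · simp only [Set.mem_insert_iff, Set.mem_singleton_iff]
    iterate 6 right
    left
    ring
  · simp only [Set.mem_insert_iff, Set.mem_singleton_iff]
    iterate 7 right
    ring

end

/-! ### The perturbing curve -/

theorem finite_zpow_eq (C : ℂ) {k : ℤ} (hk : k ≠ 0) : {w : ℂ | w ≠ 0 ∧ C * w ^ k = 1}.Finite := by
  obtain ⟨n, hn⟩ : ∃ n : ℕ, n = k.natAbs := ⟨_, rfl⟩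
  have hn0 : 0 < n := by omega
  refine ((Polynomial.nthRootsFinset n C).finite_toSet.union
    (Polynomial.nthRootsFinset n C⁻¹).finite_toSet).subset ?_
  rintro w ⟨hw, e⟩
  have hC : C ≠ 0 := by
    rintro rfl
    simp at e
  rcases Int.natAbs_eq k with hk' | hk'
  · right
    rw [hk', ← hn, zpow_natCast] at e
    rw [mem_coe, Polynomial.mem_nthRootsFinset hn0]
    exact eq_inv_of_mul_eq_one_right e
  · left
    rw [hk', ← hn, zpow_neg, zpow_natCast] at e
    rw [mem_coe, Polynomial.mem_nthRootsFinset hn0]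
    exact (mul_inv_eq_one₀ (pow_ne_zero _ hw)).1 e |>.symm

/-- The equation c w^(2k) (q w^10)^m = 1 has exponent 2k + 10m in w, which is never zero when 5 does
not divide k. Each m then contributes finitely many exceptional w. -/
theorem countable_not_Nz {q c : ℂ} (hc : c ≠ 0) {k : ℤ} (hk : ¬ (5 : ℤ) ∣ k) :
    {w : ℂ | w ≠ 0 ∧ ¬ Nz (q * w ^ 10) (c * w ^ (2 * k))}.Countable := by
  refine (Set.countable_iUnion fun m : ℤ =>
    (finite_zpow_eq (c * q ^ m) (k := 2 * k + 10 * m) (by omega)).countable).mono ?_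
  rintro w ⟨hw, h⟩
  rw [Nz, not_and] at h
  have h := h (mul_ne_zero hc (zpow_ne_zero _ hw))
  push Not at h
  obtain ⟨m, hm⟩ := h
  refine Set.mem_iUnion.2 ⟨m, hw, ?_⟩
  rw [← hm, mul_zpow, zpow_add₀ hw, zpow_mul w 10 m]
  norm_cast
  ring

theorem countable_not_Nr {q : ℂ} :
    {w : ℂ | w ≠ 0 ∧ ∃ m : ℕ, (q * w ^ 10) ^ (m + 1) = 1}.Countable := by
  refine (Set.countable_iUnion fun m : ℕ =>
    (finite_zpow_eq (q ^ (m + 1)) (k := (10 * (m + 1) : ℕ)) (by omega)).countable).mono ?_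
  rintro w ⟨hw, m, hm⟩
  refine Set.mem_iUnion.2 ⟨m, hw, ?_⟩
  rw [← hm, zpow_natCast, mul_pow, pow_mul]

theorem fifthRoot_eq {r s₀ s₁ s₂ s₃ s₄ : ℂ} {N : ℕ}
    (hcon : r ^ (2 * N + 3) * s₀ * s₁ * s₂ * s₃ * s₄ = 1) : fifthRoot r s₁ s₂ s₃ s₄ N = s₀ :=
  inv_eq_of_mul_eq_one_right (by rw [← hcon]; ring)

/-- The exponents add up to 5(2N+3) + 4 = 10N + 19, which the power attached to s₀ compensates. -/
theorem curve_con {r s₀ s₁ s₂ s₃ s₄ w : ℂ} {N : ℕ} (hw : w ≠ 0)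
    (hcon : r ^ (2 * N + 3) * s₀ * s₁ * s₂ * s₃ * s₄ = 1) :
    (r * w ^ 5) ^ (2 * N + 3) * (s₀ * (w⁻¹) ^ (10 * N + 19)) * (s₁ * w) * (s₂ * w) * (s₃ * w) *
      (s₄ * w) = 1 := by
  have : w ^ (10 * N + 19) * (w⁻¹) ^ (10 * N + 19) = 1 := by
    rw [← mul_pow, mul_inv_cancel₀ hw, one_pow]
  rw [mul_pow, ← pow_mul]
  rw [← hcon]
  linear_combination (exp := 1) r ^ (2 * N + 3) * s₀ * s₁ * s₂ * s₃ * s₄ * this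

/-- Along a suitable curve the parameters are generic at all but countably many points. -/
theorem countable_not_generic {r s₀ s₁ s₂ s₃ s₄ : ℂ} {N : ℕ} (hr : r ≠ 0)
    (hcon : r ^ (2 * N + 3) * s₀ * s₁ * s₂ * s₃ * s₄ = 1) :
    {w : ℂ | ¬ (w ≠ 0 ∧ Gen5 ((r * w ^ 5) ^ 2) ((s₁ * w) ^ 2) ((s₂ * w) ^ 2) ((s₄ * w) ^ 2)
      ((s₀ * (w⁻¹) ^ (10 * N + 19)) ^ 2) ((s₃ * w) ^ 2) N ∧
      Nz ((r * w ^ 5) ^ 2) ((s₂ * w) ^ 2 * (s₃ * w) ^ 2))}.Countable := by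
  have hq : r ^ 2 ≠ 0 := pow_ne_zero _ hr
  have hprod : s₀ * s₁ * s₂ * s₃ * s₄ ≠ 0 := fun e => one_ne_zero (α := ℂ) (by
    rw [← hcon]
    linear_combination r ^ (2 * N + 3) * e)
  simp only [mul_ne_zero_iff] at hprod
  obtain ⟨⟨⟨⟨h0, h1⟩, h2⟩, h3⟩, h4⟩ := hprod
  have p : ∀ {s : ℂ}, s ≠ 0 → s ^ 2 ≠ 0 := fun h => pow_ne_zero _ h
  -- The roots and products to be tested scale with exponents 1, 2, -(10N+19) and -(10N+18), none
  -- divisible by 5. This is why r is scaled by the fifth power of w.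
  have one : ∀ {s : ℂ}, s ≠ 0 →
      {w : ℂ | w ≠ 0 ∧ ¬ Nz (r ^ 2 * w ^ 10) (s ^ 2 * w ^ (2 * (1 : ℤ)))}.Countable :=
    fun h => countable_not_Nz (p h) (by norm_num)
  have two : ∀ {s t : ℂ}, s ≠ 0 → t ≠ 0 →
      {w : ℂ | w ≠ 0 ∧ ¬ Nz (r ^ 2 * w ^ 10) (s ^ 2 * t ^ 2 * w ^ (2 * (2 : ℤ)))}.Countable :=
    fun h h' => countable_not_Nz (mul_ne_zero (p h) (p h')) (by norm_num)
  have zero : {w : ℂ | w ≠ 0 ∧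
      ¬ Nz (r ^ 2 * w ^ 10) (s₀ ^ 2 * w ^ (2 * (-(10 * N + 19) : ℤ)))}.Countable :=
    countable_not_Nz (p h0) (by omega)
  have zero' : ∀ {s : ℂ}, s ≠ 0 → {w : ℂ | w ≠ 0 ∧
      ¬ Nz (r ^ 2 * w ^ 10) (s₀ ^ 2 * s ^ 2 * w ^ (2 * (-(10 * N + 18) : ℤ)))}.Countable :=
    fun h => countable_not_Nz (mul_ne_zero (p h0) (p h)) (by omega)
  refine ((Set.countable_singleton (0 : ℂ)).union <| (countable_not_Nr (q := r ^ 2)).union <|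
    (one h1).union <| (one h2).union <| (one h3).union <| (one h4).union <| zero.union <|
    (two h1 h2).union <| (two h2 h4).union <| (two h3 h1).union <| (two h2 h3).union <|
    (zero' h4).union <| (zero' h3)).mono ?_
  intro w hw
  by_contra hn
  simp only [Set.mem_union, Set.mem_ofPred_eq, Set.mem_singleton_iff, not_or, not_and, not_not,
    not_exists] at hn
  obtain ⟨hw0, a, a1, a2, a3, a4, a0, a12, a24, a31, a23, a04, a03⟩ := hn
  have eq : (r * w ^ 5) ^ 2 = r ^ 2 * w ^ 10 := by ring
  have e1 : ∀ s : ℂ, (s * w) ^ 2 = s ^ 2 * w ^ (2 * (1 : ℤ)) := fun s => by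
    rw [mul_pow]
    norm_cast
  have e2 : ∀ s t : ℂ, (s * w) ^ 2 * (t * w) ^ 2 = s ^ 2 * t ^ 2 * w ^ (2 * (2 : ℤ)) :=
    fun s t => by
      norm_cast
      ring
  have e0 : (s₀ * (w⁻¹) ^ (10 * N + 19)) ^ 2 = s₀ ^ 2 * w ^ (2 * (-(10 * N + 19) : ℤ)) := by
    rw [mul_pow, ← pow_mul, mul_comm _ 2, inv_pow, mul_neg, zpow_neg]
    norm_cast
  have e0' : ∀ s : ℂ, (s₀ * (w⁻¹) ^ (10 * N + 19)) ^ 2 * (s * w) ^ 2 =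
      s₀ ^ 2 * s ^ 2 * w ^ (2 * (-(10 * N + 18) : ℤ)) := fun s => by
    rw [e0, e1, mul_mul_mul_comm, ← zpow_add₀ hw0]
    congr 2
  refine hw ⟨hw0, ⟨?_, ?_, ?_, ?_, ?_, ?_, ?_, ?_, ?_, ?_, ?_, ?_⟩, ?_⟩
  · rw [eq]
    exact ⟨mul_ne_zero hq (pow_ne_zero _ hw0), a hw0⟩
  · have e := curve_con hw0 hcon
    generalize s₀ * (w⁻¹) ^ (10 * N + 19) = t at *
    have e' := congrArg (· ^ 2) e
    simp only [one_pow] at e'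
    rw [← e']
    ring
  · rw [eq, e1]; exact a1 hw0
  · rw [eq, e1]; exact a2 hw0
  · rw [eq, e1]; exact a4 hw0
  · rw [eq, e0]; exact a0 hw0
  · rw [eq, e1]; exact a3 hw0
  · rw [eq, e2]; exact a12 hw0
  · rw [eq, e2]; exact a24 hw0
  · rw [eq, mul_comm ((s₄ * w) ^ 2), e0']; exact a04 hw0
  · rw [eq, e0']; exact a03 hw0
  · rw [eq, e2]; exact a31 hw0
  · rw [eq, e2]; exact a23 hw0

/-- The complement of a countable set is dense in ℂ, so equality off that set passes to the limit at
1, even if 1 itself is exceptional. -/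
theorem eq_of_generic_curve {f : ℂ → ℂ} {g : ℂ → ℂ} {B : Set ℂ} (hB : B.Countable)
    (hf : ContinuousAt f 1) (hg : ContinuousAt g 1) (h : ∀ w, w ∉ B → f w = g w) : f 1 = g 1 := by
  have hd := hB.dense_compl ℂ 1
  rw [mem_closure_iff_frequently] at hd
  refine sub_eq_zero.1 (isClosed_singleton.mem_of_frequently_of_tendsto
    (hd.mono fun w hw => ?_) (hf.sub hg) : f 1 - g 1 ∈ ({0} : Set ℂ))
  exact sub_eq_zero.2 (h w hw)

end

end GriffithsQRacah

/-! ### The theorem for admissible parameters -/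

open GriffithsQRacah in
theorem mainTheorem12 (N : ℕ) (r s₀ s₁ s₂ s₃ s₄ : ℂ)
    (hcon : r ^ (2 * N + 3) * s₀ * s₁ * s₂ * s₃ * s₄ = 1)
    (hG : Admissible (r ^ 2) (s₀ ^ 2) (s₁ ^ 2) (s₂ ^ 2) (s₃ ^ 2) (s₄ ^ 2) N)
    (hG' : Admissible (r ^ 2) (s₄ ^ 2) (s₁ ^ 2) (s₃ ^ 2) (s₀ ^ 2) (s₂ ^ 2) N)
    (i j k l : ℕ) (hij : i + j ≤ N) (hkl : k + l ≤ N) :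
    ∑ x ∈ Finset.range (N + 1), ∑ y ∈ Finset.range (N - x + 1),
        (s₁ / s₀) ^ x * (s₄ / s₁) ^ y * xi r x s₂ s₄ * xi r y s₀ s₃ *
          griffiths r i j x y s₁ s₂ s₃ s₄ N * griffiths r y x k l s₁ s₃ s₀ s₂ N =
      (if i = k then 1 else 0) * (if j = l then 1 else 0) *
        omega r N (r * s₁ * s₂ * s₃) *
        (omega r j (s₃ * s₀ * s₄ / s₂) / omega r i (s₂ * s₃)) *
        xi r i s₂ s₃ * xi r j s₀ s₄ := by
  have hr : r ≠ 0 := fun e => hG.q_ne_zero (by simp [e])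
  have h0 : s₀ ≠ 0 := fun e => hG.c_ne_zero (s₀ ^ 2) (by simp) (by simp [e])
  have h1 : s₁ ≠ 0 := fun e => hG.c_ne_zero (s₁ ^ 2) (by simp) (by simp [e])
  have h2 : s₂ ≠ 0 := fun e => hG.c_ne_zero (s₂ ^ 2) (by simp) (by simp [e])
  have h3 : s₃ ≠ 0 := fun e => hG.c_ne_zero (s₃ ^ 2) (by simp) (by simp [e])
  have h4 : s₄ ≠ 0 := fun e => hG.c_ne_zero (s₄ ^ 2) (by simp) (by simp [e])
  obtain ⟨R, hR⟩ : ∃ R : ℂ → ℂ, R = fun w => r * w ^ 5 := ⟨_, rfl⟩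
  obtain ⟨S₀, hS₀⟩ : ∃ S : ℂ → ℂ, S = fun w => s₀ * (w⁻¹) ^ (10 * N + 19) := ⟨_, rfl⟩
  obtain ⟨S₁, hS₁⟩ : ∃ S : ℂ → ℂ, S = fun w => s₁ * w := ⟨_, rfl⟩
  obtain ⟨S₂, hS₂⟩ : ∃ S : ℂ → ℂ, S = fun w => s₂ * w := ⟨_, rfl⟩
  obtain ⟨S₃, hS₃⟩ : ∃ S : ℂ → ℂ, S = fun w => s₃ * w := ⟨_, rfl⟩
  obtain ⟨S₄, hS₄⟩ : ∃ S : ℂ → ℂ, S = fun w => s₄ * w := ⟨_, rfl⟩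
  have cR : ContinuousAt R 1 := by rw [hR]; fun_prop
  have c₀ : ContinuousAt S₀ 1 := by
    rw [hS₀]
    exact continuousAt_const.mul ((continuousAt_id.inv₀ one_ne_zero).pow _)
  have c₁ : ContinuousAt S₁ 1 := by rw [hS₁]; fun_prop
  have c₂ : ContinuousAt S₂ 1 := by rw [hS₂]; fun_prop
  have c₃ : ContinuousAt S₃ 1 := by rw [hS₃]; fun_prop
  have c₄ : ContinuousAt S₄ 1 := by rw [hS₄]; fun_prop
  have eR : R 1 = r := by simp [hR]
  have e₀ : S₀ 1 = s₀ := by simp [hS₀]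
  have e₁ : S₁ 1 = s₁ := by simp [hS₁]
  have e₂ : S₂ 1 = s₂ := by simp [hS₂]
  have e₃ : S₃ 1 = s₃ := by simp [hS₃]
  have e₄ : S₄ 1 = s₄ := by simp [hS₄]
  have f₁ := fifthRoot_eq hcon
  -- For the second Griffiths function s₄ is the root determined by the constraint, so its
  -- continuity uses the second admissibility hypothesis.
  have f₂ : fifthRoot r s₁ s₃ s₀ s₂ N = s₄ := fifthRoot_eq (by rw [← hcon]; ring)
  have key := eq_of_generic_curve (f := fun w => ∑ x ∈ Finset.range (N + 1),
      ∑ y ∈ Finset.range (N - x + 1),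
        (S₁ w / S₀ w) ^ x * (S₄ w / S₁ w) ^ y * xi (R w) x (S₂ w) (S₄ w) *
          xi (R w) y (S₀ w) (S₃ w) * griffiths (R w) i j x y (S₁ w) (S₂ w) (S₃ w) (S₄ w) N *
          griffiths (R w) y x k l (S₁ w) (S₃ w) (S₀ w) (S₂ w) N)
    (g := fun w => (if i = k then 1 else 0) * (if j = l then 1 else 0) *
        omega (R w) N (R w * S₁ w * S₂ w * S₃ w) *
        (omega (R w) j (S₃ w * S₀ w * S₄ w / S₂ w) / omega (R w) i (S₂ w * S₃ w)) *
        xi (R w) i (S₂ w) (S₃ w) * xi (R w) j (S₀ w) (S₄ w))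
    (countable_not_generic hr hcon) ?_ ?_ ?_
  · simpa only [eR, e₀, e₁, e₂, e₃, e₄] using key
  -- Continuity is needed only at w = 1, where the given parameters are admissible and all
  -- denominators are nonzero.
  · refine tendsto_finsetSum _ fun x hx => tendsto_finsetSum _ fun y hy => ?_
    have hx := Finset.mem_range.1 hx
    have hy := Finset.mem_range.1 hy
    refine (((((((c₁.div c₀ (e₀ ▸ h0)).pow x).mul ((c₄.div c₁ (e₁ ▸ h1)).pow y)).mul
      (continuousAt_xi cR c₂ c₄ (N := N) (by omega) (e₂ ▸ h2) ?_)).mul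
      (continuousAt_xi cR c₀ c₃ (N := N) (by omega) (e₀ ▸ h0) ?_)).mul
      (continuousAt_griffiths cR c₁ c₂ c₃ c₄ ?_ i j x y)).mul
      (continuousAt_griffiths cR c₁ c₃ c₀ c₂ ?_ y x k l))
    · rw [eR, e₄]
      exact hG.one_sub (by simp)
    · rw [eR, e₃]
      exact hG.one_sub (by simp)
    · rwa [eR, e₁, e₂, e₃, e₄, f₁]
    · rwa [eR, e₁, e₂, e₃, e₀, f₂]
  · refine (((continuousAt_const.mul (continuousAt_omega cR (((cR.mul c₁).mul c₂).mul c₃) N)).mul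
      ((continuousAt_omega cR (((c₃.mul c₀).mul c₄).div c₂ (e₂ ▸ h2)) j).div
        (continuousAt_omega cR (c₂.mul c₃) i) ?_)).mul
      (continuousAt_xi cR c₂ c₃ (N := N) (by omega) (e₂ ▸ h2) ?_)).mul
      (continuousAt_xi cR c₀ c₄ (N := N) (by omega) (e₀ ▸ h0) ?_)
    · rw [Pi.mul_apply, eR, e₂, e₃]
      exact omega_ne_zero hr (mul_ne_zero h2 h3) i
    · rw [eR, e₃]
      exact hG.one_sub (by simp)
    · rw [eR, e₄]
      exact hG.one_sub (by simp)
  · intro w hw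
    obtain ⟨hw0, h, h23⟩ := not_not.1 hw
    subst hR hS₀ hS₁ hS₂ hS₃ hS₄
    exact griffiths_sum_generic h h23 (curve_con hw0 hcon) hij hkl
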